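/- Let $\mathcal{M}\subseteq\mathcal{B}(H)$ be a von Neumann algebra with a normal, semifinite, faithful trace $\tau$. For $f\in\mathcal{M}$ put $\|f\|_p=\tau(|f|^p)^{1/p}$ for $1\le p<\infty$, and let $\|f\|_\infty$ be the operator norm; $L_p(\mathcal{M})$ are the associated noncommutative $L_p$-spaces. Let $\mathcal{T}=(T_t)_{t\ge 0}$ be a Markovian semigroup on $(\mathcal{M},\tau)$, i.e. a weak-$*$ continuous semigroup of unital, completely positive, $\tau$-preserving, weak-$*$ continuous operators that are symmetric, $\tau(f^*\,T_tg)=\tau((T_tf)^*g)$ for $f,g\in\mathcal{M}\cap L_2(\mathcal{M})$. Let $A\ge 0$ be its generator, $T_t=e^{-tA}$, and let $$P_sf=e^{-sA^{1/2}}f=\frac{1}{2\sqrt{\pi}}\int_0^\infty s\,e^{-s^2/(4v)}\,v^{-3/2}\,T_vf\,dv\qquad(s>0)$$ be its Poisson semigroup, whose generator is $A^{1/2}$. For $0<\alpha<1$ and $f\in\mathcal{M}$ put $$\|f\|_{\Lambda^\circ_\alpha}=\sup_{s>0}\,s^{1-\alpha}\Big\|\frac{d}{ds}P_sf\Big\|_\infty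 .$$ **Theorem B.** Let $n>0$ be a real number. The following are equivalent. (i) $\mathcal{T}$ is ultracontractive with exponent $n$, property $(R_n)$: for all $1\le p<q\le\infty$ there is a constant $C$ such that, for every $t>0$, $$\|T_t:L_p(\mathcal{M})\to L_q(\mathcal{M})\|\le C\,t^{-\frac n2\left(\frac1p-\frac1q\right)}.$$ (ii) $A$ is injective on $L_2(\mathcal{M})$, and the Morrey inequality holds for some exponent: there are $p$ with $1\le p<\infty$ and $p>n$, and a constant $C$, such that $$\|f\|_{\Lambda^\circ_{1-n/p}}\le C\,\|A^{1/2}f\|_p$$ for every $f\in\mathcal{M}$ with $A^{1/2}f\in L_p(\mathcal{M})$, that is, for which $A^{1/2}f=\lim_{s\to0^+}(f-P_sf)/s$ exists in $L_p(\mathcal{M})$. In particular, for every Markovian semigroup whose generator is injective on $L_2(\mathcal{M})$, $(R_n)$ is equivalent to the Morrey inequality for some $p>n$; and $(R_n)$ implies the Morrey inequality for some $p>n$ without further assumptions. -/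

import Mathlib

open MeasureTheory Filter Set
open scoped NNReal ENNReal InnerProductSpace ComplexOrder Topology

noncomputable section

namespace MarkovMorrey

universe u

variable {H : Type u} [NormedAddCommGroup H] [InnerProductSpace ℂ H] [CompleteSpace H]

/-! ### Elements, positive cone and weak-* topology of a von Neumann algebra -/

/-- The elements of a von Neumann algebra `M ⊆ B(H)`. -/
abbrev Elt (M : VonNeumannAlgebra H) : Type u := M.toStarSubalgebra

/-- The positive cone `M₊`, with the order of `B(H)`. -/
abbrev PosElt (M : VonNeumannAlgebra H) : Type u := {x : H →L[ℂ] H // x ∈ M ∧ 0 ≤ x}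

/-- The weak-* (ultraweak) topology of `M`: the coarsest topology for which all the normal
functionals `x ↦ ∑ₖ ⟪ξₖ, x ηₖ⟫`, with `ξ, η ∈ ℓ²(ℕ; H)`, are continuous. -/
@[reducible] def weakStar (M : VonNeumannAlgebra H) : TopologicalSpace (Elt M) :=
  ⨅ (ξ : lp (fun _ : ℕ => H) 2) (η : lp (fun _ : ℕ => H) 2),
    TopologicalSpace.induced (fun x : Elt M => ∑' k, ⟪ξ k, (x : H →L[ℂ] H) (η k)⟫_ℂ)
      inferInstance

/-! ### Normal semifinite faithful traces -/

/-- A normal, semifinite, faithful trace `τ : M₊ → [0, ∞]`. -/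
structure NSFTrace (M : VonNeumannAlgebra H) where
  /-- the values of the trace -/
  toFun : PosElt M → ℝ≥0∞
  map_add : ∀ x y z : PosElt M, (z : H →L[ℂ] H) = x + y → toFun z = toFun x + toFun y
  map_smul : ∀ (c : ℝ≥0) (x z : PosElt M),
    (z : H →L[ℂ] H) = ((c : ℝ) : ℂ) • (x : H →L[ℂ] H) → toFun z = c * toFun x
  tracial : ∀ u ∈ M, u ∈ unitary (H →L[ℂ] H) → ∀ x z : PosElt M,
    (z : H →L[ℂ] H) = u * x * star u → toFun z = toFun x
  normal : ∀ (S : Set (PosElt M)) (x : PosElt M), S.Nonempty → DirectedOn (· ≤ ·) S →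
    IsLUB S x → toFun x = ⨆ y ∈ S, toFun y
  semifinite : ∀ x : PosElt M, toFun x = ∞ →
    ∃ y : PosElt M, y ≤ x ∧ (y : H →L[ℂ] H) ≠ 0 ∧ toFun y < ∞
  faithful : ∀ x : PosElt M, toFun x = 0 → (x : H →L[ℂ] H) = 0

/-- Real powers of `x* x` stay in `M`. -/
theorem rpow_star_mul_mem (M : VonNeumannAlgebra H) (x : Elt M) (r : ℝ) :
    (star (x : H →L[ℂ] H) * (x : H →L[ℂ] H)) ^ r ∈ M := by
  have hx : (star (x : H →L[ℂ] H) * (x : H →L[ℂ] H)) ∈ M := mul_mem (star_mem x.2) x.2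
  generalize star (x : H →L[ℂ] H) * (x : H →L[ℂ] H) = a at hx ⊢
  rw [← M.commutant_commutant, VonNeumannAlgebra.mem_commutant_iff]
  intro g hg
  rw [VonNeumannAlgebra.mem_commutant_iff] at hg
  have hc : Commute a g := hg _ hx
  rw [CFC.rpow_def]
  exact (hc.cfc_nnreal _).symm.eq

/-- `|x| ^ r = (x* x) ^ (r / 2)`, as an element of `M₊`. -/
def absPow {M : VonNeumannAlgebra H} (x : Elt M) (r : ℝ) : PosElt M :=
  ⟨(star (x : H →L[ℂ] H) * (x : H →L[ℂ] H)) ^ (r / 2), rpow_star_mul_mem M x (r / 2),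
    CFC.rpow_nonneg⟩

/-- `‖x‖_p = τ(|x|^p)^{1/p} ∈ [0, ∞]` for `x ∈ M` and `p < ∞`, and the operator norm for
`p = ∞`. The elements of `M` with finite `‖x‖_p` are `M ∩ L_p(M)`; they are dense in `L_p(M)`
for `p < ∞`. -/
def lpNorm {M : VonNeumannAlgebra H} (τ : NSFTrace M) (p : ℝ≥0∞) (x : Elt M) : ℝ≥0∞ :=
  if p = ∞ then ‖(x : H →L[ℂ] H)‖ₑ else τ.toFun (absPow x p.toReal) ^ (1 / p.toReal)

/-- `τ(f* g)` for `f, g ∈ M ∩ L_2(M)`, where `τ` is extended linearly from the positive elements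
of finite trace through `f* g = (1/4) ∑_{k < 4} i^{-k} |f + i^k g|²`. -/
def l2Inner {M : VonNeumannAlgebra H} (τ : NSFTrace M) (f g : Elt M) : ℂ :=
  (1 / 4 : ℂ) * ∑ k : Fin 4, (-Complex.I) ^ (k : ℕ) *
    ((τ.toFun (absPow (f + Complex.I ^ (k : ℕ) • g) 2)).toReal : ℂ)

/-- The norm of `S : L_p(M) → L_q(M)` (`p < ∞`), computed on the dense subspace `M ∩ L_p(M)`;
it is finite exactly when `S` extends to a bounded operator `L_p(M) → L_q(M)`. -/
def opNorm {M : VonNeumannAlgebra H} (τ : NSFTrace M) (p q : ℝ≥0∞) (S : Elt M → Elt M) : ℝ≥0∞ :=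
  ⨆ (x : Elt M) (_ : lpNorm τ p x ≤ 1), lpNorm τ q (S x)

/-! ### Markovian operators and semigroups -/

/-- Positivity of the matrix `a ∈ M_m[M] ⊆ B(H ⊕ ⋯ ⊕ H)`. -/
def MatrixPos {M : VonNeumannAlgebra H} {m : ℕ} (a : Fin m → Fin m → Elt M) : Prop :=
  ∀ ξ : Fin m → H, 0 ≤ ∑ i, ∑ j, ⟪ξ i, (a i j : H →L[ℂ] H) (ξ j)⟫_ℂ

/-- Markovian operators: unital, completely positive, trace preserving, weak-* continuous and
symmetric. -/
structure IsMarkovian {M : VonNeumannAlgebra H} (τ : NSFTrace M) (T : Elt M →ₗ[ℂ] Elt M) :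
    Prop where
  map_one : T 1 = 1
  completelyPositive : ∀ (m : ℕ) (a : Fin m → Fin m → Elt M), MatrixPos a →
    MatrixPos (fun i j => T (a i j))
  trace_preserving : ∀ (x : Elt M) (y z : PosElt M), (y : H →L[ℂ] H) = x →
    (z : H →L[ℂ] H) = T x → τ.toFun z = τ.toFun y
  weakStar_continuous : @Continuous _ _ (weakStar M) (weakStar M) T
  symmetric : ∀ f g : Elt M, lpNorm τ 2 f < ∞ → lpNorm τ 2 g < ∞ →
    l2Inner τ f (T g) = l2Inner τ (T f) g

/-- Markovian semigroups `(T_t)_{t ≥ 0}` on `(M, τ)`. -/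
structure MarkovSemigroup {M : VonNeumannAlgebra H} (τ : NSFTrace M) where
  /-- the operators `T_t` -/
  toFun : ℝ≥0 → Elt M →ₗ[ℂ] Elt M
  markovian : ∀ t, IsMarkovian τ (toFun t)
  map_zero : toFun 0 = LinearMap.id
  map_add : ∀ s t, toFun (s + t) = toFun s ∘ₗ toFun t
  weakStar_continuous : ∀ f : Elt M,
    @Continuous _ _ inferInstance (weakStar M) (fun t => toFun t f)

/-- `T_t` for a real time `t` (used for `t ≥ 0` only). -/
def MarkovSemigroup.at {M : VonNeumannAlgebra H} {τ : NSFTrace M} (T : MarkovSemigroup τ)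
    (t : ℝ) (f : Elt M) : Elt M := T.toFun t.toNNReal f

/-! ### Auxiliary facts for the construction of the Poisson semigroup -/

/-- Unital completely positive maps are contractive, in weak form. -/
theorem IsMarkovian.norm_inner_le {M : VonNeumannAlgebra H} {τ : NSFTrace M}
    {T : Elt M →ₗ[ℂ] Elt M} (hT : IsMarkovian τ T) (f : Elt M) (x y : H) :
    ‖⟪x, (T f : H →L[ℂ] H) y⟫_ℂ‖ ≤ ‖(f : H →L[ℂ] H)‖ * ‖x‖ * ‖y‖ := by
  set c : ℝ := ‖(f : H →L[ℂ] H)‖ with hc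
  have hc0 : 0 ≤ c := norm_nonneg _
  have hf : ∀ u v : H, ‖⟪u, (f : H →L[ℂ] H) v⟫_ℂ‖ ≤ c * ‖u‖ * ‖v‖ := fun u v =>
    (norm_inner_le_norm _ _).trans (by
      have := (f : H →L[ℂ] H).le_opNorm v
      nlinarith [norm_nonneg u, norm_nonneg v])
  -- the positive matrix with diagonal entries `c` and off-diagonal entries `f`, `f*`
  let a : Fin 2 → Fin 2 → Elt M := ![![(c : ℂ) • 1, f], ![star f, (c : ℂ) • 1]]
  have ha : MatrixPos a := by
    intro ξ
    have h1 : ⟪ξ 1, (star f : Elt M).1 (ξ 0)⟫_ℂ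
        = starRingEnd ℂ ⟪ξ 0, (f : H →L[ℂ] H) (ξ 1)⟫_ℂ := by
      change ⟪ξ 1, (ContinuousLinearMap.adjoint (f : H →L[ℂ] H)) (ξ 0)⟫_ℂ = _
      rw [ContinuousLinearMap.adjoint_inner_right, inner_conj_symm]
    have h2 := hf (ξ 0) (ξ 1)
    have h3 := (abs_le.1 (Complex.abs_re_le_norm ⟪ξ 0, (f : H →L[ℂ] H) (ξ 1)⟫_ℂ)).1
    have key : ∑ i, ∑ j, ⟪ξ i, (a i j : H →L[ℂ] H) (ξ j)⟫_ℂ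
        = ((c * ‖ξ 0‖ ^ 2 + c * ‖ξ 1‖ ^ 2
            + 2 * (⟪ξ 0, (f : H →L[ℂ] H) (ξ 1)⟫_ℂ).re : ℝ) : ℂ) := by
      have e0 : ⟪ξ 0, (((c : ℂ) • 1 : Elt M) : H →L[ℂ] H) (ξ 0)⟫_ℂ
          = ((c * ‖ξ 0‖ ^ 2 : ℝ) : ℂ) := by
        simp
      have e1 : ⟪ξ 1, (((c : ℂ) • 1 : Elt M) : H →L[ℂ] H) (ξ 1)⟫_ℂ
          = ((c * ‖ξ 1‖ ^ 2 : ℝ) : ℂ) := by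
        simp
      simp only [Fin.sum_univ_two, a, Matrix.cons_val_zero, Matrix.cons_val_one]
      rw [e0, e1, h1]
      have := Complex.add_conj ⟪ξ 0, (f : H →L[ℂ] H) (ξ 1)⟫_ℂ
      push_cast at this ⊢
      linear_combination this
    rw [key]
    rw [Complex.zero_le_real]
    nlinarith [sq_nonneg (‖ξ 0‖ - ‖ξ 1‖)]
  have hTa := hT.completelyPositive 2 a ha
  have hT1 : T ((c : ℂ) • 1) = (c : ℂ) • 1 := by rw [T.map_smul, hT.map_one]
  have main : ∀ u v : H, 0 ≤ ((c * ‖u‖ ^ 2 + c * ‖v‖ ^ 2 : ℝ) : ℂ)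
      + ⟪u, (T f : H →L[ℂ] H) v⟫_ℂ + ⟪v, (T (star f) : H →L[ℂ] H) u⟫_ℂ := by
    intro u v
    have h := hTa ![u, v]
    have e0 : ⟪u, (((c : ℂ) • 1 : Elt M) : H →L[ℂ] H) u⟫_ℂ = ((c * ‖u‖ ^ 2 : ℝ) : ℂ) := by
      simp
    have e1 : ⟪v, (((c : ℂ) • 1 : Elt M) : H →L[ℂ] H) v⟫_ℂ = ((c * ‖v‖ ^ 2 : ℝ) : ℂ) := by
      simp
    simp only [Fin.sum_univ_two, a, Matrix.cons_val_zero, Matrix.cons_val_one, hT1] at h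
    rw [e0, e1] at h
    convert h using 1
    push_cast
    ring
  have im0 : ∀ u v : H, (⟪u, (T f : H →L[ℂ] H) v⟫_ℂ).im
      + (⟪v, (T (star f) : H →L[ℂ] H) u⟫_ℂ).im = 0 := by
    intro u v
    have h := (Complex.le_def.1 (main u v)).2
    simp only [Complex.add_im, Complex.ofReal_im, Complex.zero_im] at h
    linarith
  have re0 : ∀ u v : H, (⟪u, (T f : H →L[ℂ] H) v⟫_ℂ).re
      = (⟪v, (T (star f) : H →L[ℂ] H) u⟫_ℂ).re := by
    intro u v
    have h := im0 u (Complex.I • v)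
    rw [ContinuousLinearMap.map_smul, inner_smul_right, inner_smul_left] at h
    simp at h
    linarith
  have re1 : ∀ u v : H, -(c * ‖u‖ ^ 2 + c * ‖v‖ ^ 2) ≤ 2 * (⟪u, (T f : H →L[ℂ] H) v⟫_ℂ).re := by
    intro u v
    have h := (Complex.le_def.1 (main u v)).1
    simp only [Complex.add_re, Complex.ofReal_re, Complex.zero_re] at h
    linarith [re0 u v]
  have re2 : ∀ u v : H, ‖⟪u, (T f : H →L[ℂ] H) v⟫_ℂ‖ * 2 ≤ c * ‖u‖ ^ 2 + c * ‖v‖ ^ 2 := by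
    intro u v
    set z := ⟪u, (T f : H →L[ℂ] H) v⟫_ℂ with hz
    by_cases hz0 : z = 0
    · rw [hz0]; simp; positivity
    have hzn : (‖z‖ : ℂ) ≠ 0 := by simpa using hz0
    let w : ℂ := -(starRingEnd ℂ z) / ‖z‖
    have hw : ‖w‖ = 1 := by
      simp only [w, norm_div, norm_neg, RCLike.norm_conj, Complex.norm_real, norm_norm]
      exact div_self (by simpa using hz0)
    have h := re1 u (w • v)
    rw [ContinuousLinearMap.map_smul, inner_smul_right, ← hz, norm_smul, hw, one_mul] at h
    have e : w * z = ((-‖z‖ : ℝ) : ℂ) := by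
      simp only [w]
      rw [div_mul_eq_mul_div, div_eq_iff hzn, neg_mul, Complex.conj_mul']
      push_cast
      ring
    rw [e, Complex.ofReal_re] at h
    linarith
  -- optimise over the scaling `(r x, r⁻¹ y)`
  by_cases hx : x = 0
  · simp [hx]
  by_cases hy : y = 0
  · simp [hy]
  have hx' : 0 < ‖x‖ := norm_pos_iff.2 hx
  have hy' : 0 < ‖y‖ := norm_pos_iff.2 hy
  have h := re2 (((‖y‖ : ℝ) : ℂ) • x) (((‖x‖ : ℝ) : ℂ) • y)
  rw [ContinuousLinearMap.map_smul, inner_smul_right, inner_smul_left] at h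
  simp only [norm_mul, norm_smul, Complex.norm_real, norm_norm, RCLike.norm_conj] at h
  have hxy : 0 < ‖x‖ * ‖y‖ := mul_pos hx' hy'
  refine le_of_mul_le_mul_left ?_ hxy
  nlinarith

/-- The weak integral against an integrable density. -/
theorem exists_weakIntegral (φ : ℝ → ℝ) (hφ : IntegrableOn φ (Ioi 0)) (F : ℝ → H →L[ℂ] H)
    (hF : ∀ x y : H, Continuous fun v => ⟪x, F v y⟫_ℂ) (C : ℝ)
    (hC : ∀ v (x y : H), ‖⟪x, F v y⟫_ℂ‖ ≤ C * ‖x‖ * ‖y‖) :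
    ∃ g : H →L[ℂ] H, ∀ x y : H, ⟪x, g y⟫_ℂ = ∫ v in Ioi (0 : ℝ), (φ v : ℂ) * ⟪x, F v y⟫_ℂ := by
  have hint : ∀ x y : H, IntegrableOn (fun v => (φ v : ℂ) * ⟪x, F v y⟫_ℂ) (Ioi 0) := by
    intro x y
    refine Integrable.mul_bdd (c := C * ‖x‖ * ‖y‖) hφ.ofReal
      (hF x y).aestronglyMeasurable (ae_of_all _ fun v => hC v x y)
  let B₀ : H →ₗ⋆[ℂ] H →ₗ[ℂ] ℂ := LinearMap.mk₂'ₛₗ (starRingEnd ℂ) (RingHom.id ℂ)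
    (fun x y => ∫ v in Ioi (0 : ℝ), (φ v : ℂ) * ⟪x, F v y⟫_ℂ)
    (by
      intro x x' y
      rw [← integral_add (hint x y) (hint x' y)]
      simp only [inner_add_left, mul_add])
    (by
      intro c x y
      rw [smul_eq_mul, ← integral_const_mul]
      congr 1; ext v; rw [inner_smul_left]; ring)
    (by
      intro x y y'
      rw [← integral_add (hint x y) (hint x y')]
      simp only [map_add, inner_add_right, mul_add])
    (by
      intro c x y
      rw [RingHom.id_apply, smul_eq_mul, ← integral_const_mul]
      congr 1; ext v; rw [map_smul, inner_smul_right]; ring)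
  let B : H →L⋆[ℂ] H →L[ℂ] ℂ := B₀.mkContinuous₂ ((∫ v in Ioi (0 : ℝ), |φ v|) * C) (by
    intro x y
    change ‖∫ v in Ioi (0 : ℝ), (φ v : ℂ) * ⟪x, F v y⟫_ℂ‖ ≤ _
    refine (norm_integral_le_of_norm_le (g := fun v => |φ v| * (C * ‖x‖ * ‖y‖))
      (hφ.abs.mul_const _) (ae_of_all _ fun v => ?_)).trans ?_
    · rw [norm_mul, Complex.norm_real, Real.norm_eq_abs]
      exact mul_le_mul_of_nonneg_left (hC v x y) (abs_nonneg _)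
    · rw [integral_mul_const]
      exact le_of_eq (by ring))
  refine ⟨ContinuousLinearMap.adjoint (InnerProductSpace.continuousLinearMapOfBilin B), ?_⟩
  intro x y
  rw [ContinuousLinearMap.adjoint_inner_right, InnerProductSpace.continuousLinearMapOfBilin_apply]
  rfl

/-- The subordination density
`φ_s(v) = s e^{-s²/(4v)} v^{-3/2} / (2 √π)`, for which
`e^{-s √λ} = ∫_0^∞ φ_s(v) e^{-v λ} dv`. -/
def subordinator (s v : ℝ) : ℝ :=
  1 / (2 * Real.sqrt Real.pi) * (s * Real.exp (-s ^ 2 / (4 * v)) * v ^ (-(3 / 2) : ℝ))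

theorem integrableOn_subordinator {s : ℝ} (hs : 0 < s) :
    IntegrableOn (subordinator s) (Ioi 0) := by
  have hmeas : Measurable (subordinator s) := by
    unfold subordinator
    fun_prop
  rw [← Ioc_union_Ioi_eq_Ioi (zero_le_one' ℝ)]
  refine IntegrableOn.union ?_ ?_
  · refine IntegrableOn.of_bound (C := 1 / (2 * Real.sqrt Real.pi) * (s * (32 / s ^ 4))) (by simp)
      hmeas.aestronglyMeasurable ?_
    refine (ae_restrict_iff' measurableSet_Ioc).2 (ae_of_all _ fun v hv => ?_)
    have hv0 : 0 < v := hv.1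
    have hpos : 0 ≤ subordinator s v := by unfold subordinator; positivity
    rw [Real.norm_of_nonneg hpos]
    unfold subordinator
    rw [mul_assoc s]
    have h1 : Real.exp (-s ^ 2 / (4 * v)) ≤ 32 / s ^ 4 * v ^ (2 : ℝ) := by
      have h := Real.quadratic_le_exp_of_nonneg (x := s ^ 2 / (4 * v)) (by positivity)
      have h2 : (s ^ 2 / (4 * v)) ^ 2 / 2 ≤ Real.exp (s ^ 2 / (4 * v)) := by
        have : 0 ≤ s ^ 2 / (4 * v) := by positivity
        linarith
      rw [neg_div, Real.exp_neg, Real.rpow_two]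
      refine (inv_anti₀ (by positivity) h2).trans (le_of_eq ?_)
      field_simp
      norm_num
    have h3 : v ^ (2 : ℝ) * v ^ (-(3 / 2) : ℝ) ≤ 1 := by
      rw [← Real.rpow_add hv0]
      exact Real.rpow_le_one hv0.le hv.2 (by norm_num)
    have h4 : Real.exp (-s ^ 2 / (4 * v)) * v ^ (-(3 / 2) : ℝ) ≤ 32 / s ^ 4 := by
      calc _ ≤ 32 / s ^ 4 * v ^ (2 : ℝ) * v ^ (-(3 / 2) : ℝ) := by gcongr
        _ = 32 / s ^ 4 * (v ^ (2 : ℝ) * v ^ (-(3 / 2) : ℝ)) := by ring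
        _ ≤ 32 / s ^ 4 * 1 := by gcongr
        _ = _ := mul_one _
    gcongr
  · have h0 : IntegrableOn (fun v : ℝ => 1 / (2 * Real.sqrt Real.pi) * (s * v ^ (-(3 / 2) : ℝ)))
        (Ioi 1) :=
      ((integrableOn_Ioi_rpow_of_lt (by norm_num) one_pos).const_mul s).const_mul _
    refine Integrable.mono' h0 hmeas.aestronglyMeasurable ?_
    refine (ae_restrict_iff' measurableSet_Ioi).2 (ae_of_all _ fun v hv => ?_)
    have hv0 : 0 < v := one_pos.trans hv
    have hpos : 0 ≤ subordinator s v := by unfold subordinator; positivity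
    rw [Real.norm_of_nonneg hpos]
    unfold subordinator
    have h1 : Real.exp (-s ^ 2 / (4 * v)) ≤ 1 := by
      rw [Real.exp_le_one_iff, neg_div]
      have : 0 ≤ s ^ 2 / (4 * v) := by positivity
      linarith
    have h2 : s * Real.exp (-s ^ 2 / (4 * v)) ≤ s := mul_le_of_le_one_right hs.le h1
    gcongr

theorem continuous_inner_at {M : VonNeumannAlgebra H} {τ : NSFTrace M} (T : MarkovSemigroup τ)
    (f : Elt M) (x y : H) : Continuous fun v => ⟪x, (T.at v f : H →L[ℂ] H) y⟫_ℂ := by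
  have h1 := T.weakStar_continuous f
  let ξ : lp (fun _ : ℕ => H) 2 := lp.single 2 0 x
  let η : lp (fun _ : ℕ => H) 2 := lp.single 2 0 y
  have h2 : @Continuous _ _ (weakStar M) inferInstance
      (fun a : Elt M => ∑' k, ⟪ξ k, (a : H →L[ℂ] H) (η k)⟫_ℂ) :=
    continuous_iInf_dom (continuous_iInf_dom continuous_induced_dom)
  have h3 : (fun a : Elt M => ∑' k, ⟪ξ k, (a : H →L[ℂ] H) (η k)⟫_ℂ)
      = fun a : Elt M => ⟪x, (a : H →L[ℂ] H) y⟫_ℂ := by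
    funext a
    rw [tsum_eq_single 0]
    · simp [ξ, η]
    · intro k hk
      simp [ξ, η, hk]
  rw [h3] at h2
  have h4 := @Continuous.comp _ _ _ _ (weakStar M) _ _ _ h2 h1
  exact h4.comp continuous_real_toNNReal

theorem exists_poisson {M : VonNeumannAlgebra H} {τ : NSFTrace M} (T : MarkovSemigroup τ)
    {s : ℝ} (hs : 0 < s) (f : Elt M) :
    ∃ g : Elt M, ∀ x y : H, ⟪x, (g : H →L[ℂ] H) y⟫_ℂ =
      ∫ v in Ioi (0 : ℝ), (subordinator s v : ℂ) * ⟪x, (T.at v f : H →L[ℂ] H) y⟫_ℂ := by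
  have hb : ∀ v (x y : H), ‖⟪x, (T.at v f : H →L[ℂ] H) y⟫_ℂ‖ ≤ ‖(f : H →L[ℂ] H)‖ * ‖x‖ * ‖y‖ :=
    fun v x y => (T.markovian _).norm_inner_le f x y
  obtain ⟨g, hg⟩ := exists_weakIntegral (subordinator s) (integrableOn_subordinator hs)
    (fun v => (T.at v f : H →L[ℂ] H)) (fun x y => continuous_inner_at T f x y) _ hb
  refine ⟨⟨g, ?_⟩, hg⟩
  change g ∈ M
  rw [← M.commutant_commutant, VonNeumannAlgebra.mem_commutant_iff]
  intro u hu
  rw [VonNeumannAlgebra.mem_commutant_iff] at hu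
  ext y
  refine ext_inner_left ℂ fun x => ?_
  change ⟪x, u (g y)⟫_ℂ = ⟪x, g (u y)⟫_ℂ
  rw [← ContinuousLinearMap.adjoint_inner_left, hg, hg]
  congr 1
  ext v
  have h : (T.at v f : H →L[ℂ] H) * u = u * (T.at v f : H →L[ℂ] H) := hu _ (T.at v f).2
  have h' : (T.at v f : H →L[ℂ] H) (u y) = u ((T.at v f : H →L[ℂ] H) y) :=
    congrArg (fun w : H →L[ℂ] H => w y) h
  rw [ContinuousLinearMap.adjoint_inner_left, h']

/-! ### The Poisson semigroup, `A^{1/2}` and the Hölder seminorm -/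

/-- The Poisson semigroup `P_s = e^{-s A^{1/2}}` on `M` of the Markovian semigroup
`T_t = e^{-t A}`: the weak-* integral `P_s f = ∫_0^∞ φ_s(v) T_v f dv` for `s > 0`, and
`P_0 f = f`. -/
def poisson {M : VonNeumannAlgebra H} {τ : NSFTrace M} (T : MarkovSemigroup τ)
    (s : ℝ) (f : Elt M) : Elt M :=
  if hs : 0 < s then Classical.choose (exists_poisson T hs f) else f

/-- The difference quotient `(f - S_s f) / s`. -/
def diffQuot {M : VonNeumannAlgebra H} (S : ℝ → Elt M → Elt M) (s : ℝ) (f : Elt M) : Elt M :=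
  ((s⁻¹ : ℝ) : ℂ) • (f - S s f)

/-- `f ∈ M` belongs to the `L_p`-domain of the generator `B` of `S_s = e^{-s B}`: the difference
quotients `(f - S_s f) / s` converge in `L_p(M)` as `s → 0⁺`, that is, they eventually lie in
`L_p(M)` and are Cauchy there. The limit is `B f ∈ L_p(M)`. -/
def InLpDomain {M : VonNeumannAlgebra H} (τ : NSFTrace M) (S : ℝ → Elt M → Elt M) (p : ℝ≥0∞)
    (f : Elt M) : Prop :=
  (∀ᶠ s in 𝓝[>] (0 : ℝ), lpNorm τ p (diffQuot S s f) < ∞) ∧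
  Tendsto (fun sr : ℝ × ℝ => lpNorm τ p (diffQuot S sr.1 f - diffQuot S sr.2 f))
    (𝓝[>] (0 : ℝ) ×ˢ 𝓝[>] (0 : ℝ)) (𝓝 0)

/-- `‖B f‖_p = lim_{s → 0⁺} ‖(f - S_s f) / s‖_p` for `f` in the `L_p`-domain of the generator `B`
of `S_s = e^{-s B}` (there the upper limit is a limit). -/
def genLpNorm {M : VonNeumannAlgebra H} (τ : NSFTrace M) (S : ℝ → Elt M → Elt M) (p : ℝ≥0∞)
    (f : Elt M) : ℝ≥0∞ :=
  limsup (fun s => lpNorm τ p (diffQuot S s f)) (𝓝[>] (0 : ℝ))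

/-- The homogeneous Hölder seminorm `sup_{s > 0} s^{1 - α} ‖(d/ds) P_s f‖_∞`; the map
`s ↦ P_s f` is differentiable in norm on `(0, ∞)`. -/
def holderSeminorm {M : VonNeumannAlgebra H} {τ : NSFTrace M} (T : MarkovSemigroup τ) (α : ℝ)
    (f : Elt M) : ℝ≥0∞ :=
  ⨆ (s : ℝ) (_ : 0 < s), ENNReal.ofReal (s ^ (1 - α)) *
    ‖deriv (fun r : ℝ => (poisson T r f : H →L[ℂ] H)) s‖ₑ

/-! ### The two properties -/

/-- Ultracontractivity `(R_n)`: `‖T_t : L_p(M) → L_q(M)‖ ≲ t^{-(n/2)(1/p - 1/q)}` for all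
`1 ≤ p < q ≤ ∞`. -/
def Ultracontractive {M : VonNeumannAlgebra H} {τ : NSFTrace M} (T : MarkovSemigroup τ)
    (n : ℝ) : Prop :=
  ∀ p q : ℝ≥0∞, 1 ≤ p → p < q → ∃ C : ℝ≥0, ∀ t : ℝ, 0 < t →
    opNorm τ p q (T.at t) ≤ C * ENNReal.ofReal (t ^ (-(n / 2 * (p⁻¹.toReal - q⁻¹.toReal))))

/-- The Morrey inequality `‖f‖_{Λ°_{1 - n/p}} ≲ ‖A^{1/2} f‖_p`, for all `f ∈ M` with
`A^{1/2} f ∈ L_p(M)`; `A^{1/2}` is the generator of the Poisson semigroup. -/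
def MorreyInequality {M : VonNeumannAlgebra H} {τ : NSFTrace M} (T : MarkovSemigroup τ)
    (n p : ℝ) : Prop :=
  ∃ C : ℝ≥0, ∀ f : Elt M, InLpDomain τ (poisson T) (ENNReal.ofReal p) f →
    holderSeminorm T (1 - n / p) f ≤ C * genLpNorm τ (poisson T) (ENNReal.ofReal p) f

/-- The generator `A` of `T` is injective on `L_2(M)`. It is enough to test it on `M ∩ L_2(M)`:
the orthogonal projection of `L_2(M)` onto `ker A`, which is the strong limit of `T_t` as
`t → ∞`, maps `M ∩ L_2(M)` onto a dense subspace of `ker A` that is contained in `M`. -/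
def GeneratorInjective {M : VonNeumannAlgebra H} {τ : NSFTrace M} (T : MarkovSemigroup τ) :
    Prop :=
  ∀ f : Elt M, lpNorm τ 2 f < ∞ → InLpDomain τ T.at 2 f → genLpNorm τ T.at 2 f = 0 → f = 0

end MarkovMorrey

end

/-!
Both implications compare `T` with its Poisson semigroup `P_s = ∫ φ_s(v) T_v dv`, where `φ_s` is the
subordination density.

*From ultracontractivity to Morrey.* For `q = ∞` ultracontractivity reads
`‖T_v x‖ ≤ C v^{-n/(2p)} ‖x‖_p`. Since `φ_s(v) v^{-β} ≤ C s^{-2β} φ_{s/2}(v)`, subordination gives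
`‖P_s x‖ ≤ C s^{-n/p} ‖x‖_p`. The derivative of `P_s f` in `s` is the norm limit of `-P_s` applied to
the difference quotients `(f - P_h f) / h`, whose `L_p`-norms tend to `‖A^{1/2} f‖_p`; this is the
Morrey inequality (`Ultracontractive.morreyInequality`), for every `p ≥ 1`. A vector in the kernel of
`A` is fixed by every `T_t`, and `‖T_t‖_{2 → ∞} → 0` (`Ultracontractive.generatorInjective`).

*From Morrey to ultracontractivity.* Let `f ≥ 0` with `τ(f) < ∞` and `N(s) = ‖P_s f‖`. The difference
quotients of `P_s f` lie between multiples of `± s⁻¹ P_{s/2} f`, as `|∂_s φ_s| ≤ C s⁻¹ φ_{s/2}`. Their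
`L_p`-norms are therefore at most `C s⁻¹ (N(s/2)^{p-1} τ(f))^{1/p}`, by interpolation between the trace
and the operator norm, and a second order bound shows that they converge in `L_p`. So the Morrey
inequality may be applied to `P_s f`, and it bounds the speed of `σ ↦ P_σ f` by
`C σ^{-n/p - 1} (N(u)^{p-1} τ(f))^{1/p}` for `σ ≥ 4 u`. Hence `P_σ f` converges in norm as `σ → ∞`; the
limit is a fixed point of the Poisson semigroup, then of `T`, and vanishes as `A` is injective. This
leaves `N(4u) ≤ C u^{-n/p} (N(u)^{p-1} τ(f))^{1/p}`, which iterates to `N(s) ≤ C s^{-n} τ(f)`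
(`MorreyInequality.exists_norm_poisson_le`). The spectral subordination formula
`⟪P_s f, f⟫ = ∫ φ_s(v) ‖T_{v/2} f‖₂² dv`, restricted to `t ≤ v ≤ 2t` and `s = √(2t)`, turns this into
`‖T_t f‖₂ ≤ C t^{-n/4} τ(f)`, and duality into `‖T_t f‖ ≤ C t^{-n/2} τ(f)`. All the other exponents
follow by interpolation on the positive cone (`ultracontractive_of_norm_at_le`).

*The noncommutative tools.* As constants do not matter, no sharp `L_p`-theory is needed: the `p`-th
powers `τ(|x|^p)` are compared with the traces `τ((|x| - λ)₊)` over dyadic levels `λ`, which gives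
quasi-triangle inequalities and the bounds `τ((T x)^p) ≤ C τ(x^p)`. The space `M ∩ L₂(M)` is made a
pre-Hilbert space `L2 τ`. Normality of `τ` enters in `isNormalVector`: pairings `⟪w', a w⟫` with
`w, w' ∈ M ∩ L₂(M)` commute with weak integrals. Moreover `τ(h)` is the supremum of `τ(√c h √c)` over
`0 ≤ c ≤ 1` of finite trace (`tr_le_of_forall_conj`), so that inequalities for `τ` can be tested on
such pairings.
-/

set_option linter.unusedSectionVars false

noncomputable section

namespace MarkovMorrey

variable {H : Type*} [NormedAddCommGroup H] [InnerProductSpace ℂ H] [CompleteSpace H]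

/-! ### Operators in a von Neumann algebra -/

section Operators

theorem nonneg_iff_inner (a : H →L[ℂ] H) : 0 ≤ a ↔ ∀ x : H, 0 ≤ ⟪x, a x⟫_ℂ := by
  rw [ContinuousLinearMap.nonneg_iff_isPositive]
  refine ⟨fun h x => h.inner_nonneg_right x, fun h => ?_⟩
  rw [ContinuousLinearMap.isPositive_iff_complex]
  intro x
  have h1 : ⟪a x, x⟫_ℂ = starRingEnd ℂ ⟪x, a x⟫_ℂ := (inner_conj_symm _ _).symm
  have h2 := Complex.le_def.1 (h x)
  rw [Complex.zero_re, Complex.zero_im] at h2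
  have h3 : (⟪a x, x⟫_ℂ).re = (⟪x, a x⟫_ℂ).re := by rw [h1, Complex.conj_re]
  have h4 : (⟪a x, x⟫_ℂ).im = 0 := by rw [h1, Complex.conj_im, ← h2.2, neg_zero]
  exact ⟨Complex.ext (by simp) (by simp [h4]), by rw [RCLike.re_eq_complex_re, h3]; exact h2.1⟩

theorem le_iff_inner (a b : H →L[ℂ] H) : a ≤ b ↔ ∀ x : H, ⟪x, a x⟫_ℂ ≤ ⟪x, b x⟫_ℂ := by
  rw [← sub_nonneg, nonneg_iff_inner]
  simp

/-- Conjugation `a ↦ e* a e` is monotone. -/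
theorem star_mul_mul_mono {a b : H →L[ℂ] H} (h : a ≤ b) (e : H →L[ℂ] H) :
    star e * a * e ≤ star e * b * e := star_left_conjugate_le_conjugate h e

theorem mul_mul_star_mono {a b : H →L[ℂ] H} (h : a ≤ b) (e : H →L[ℂ] H) :
    e * a * star e ≤ e * b * star e := star_right_conjugate_le_conjugate h e

theorem star_mul_mul_nonneg {a : H →L[ℂ] H} (h : 0 ≤ a) (e : H →L[ℂ] H) :
    0 ≤ star e * a * e := star_left_conjugate_nonneg h e

theorem mul_mul_star_nonneg {a : H →L[ℂ] H} (h : 0 ≤ a) (e : H →L[ℂ] H) :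
    0 ≤ e * a * star e := star_right_conjugate_nonneg h e

theorem smul_le_smul_ofReal {a b : H →L[ℂ] H} (h : a ≤ b) {c : ℝ} (hc : 0 ≤ c) :
    (c : ℂ) • a ≤ (c : ℂ) • b := by
  rw [le_iff_inner] at h ⊢
  intro x
  have h0 : (0 : ℂ) ≤ c := by exact_mod_cast hc
  simpa [inner_smul_right] using mul_le_mul_of_nonneg_left (h x) h0

theorem smul_ofReal_nonneg {a : H →L[ℂ] H} (h : 0 ≤ a) {c : ℝ} (hc : 0 ≤ c) :
    0 ≤ (c : ℂ) • a := by simpa using smul_le_smul_ofReal h hc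

theorem le_norm_smul_one {a : H →L[ℂ] H} (h : IsSelfAdjoint a) : a ≤ ((‖a‖ : ℝ) : ℂ) • 1 := by
  have := h.le_algebraMap_norm_self
  rwa [Algebra.algebraMap_eq_smul_one, ← Complex.coe_smul] at this

theorem norm_le_of_nonneg_of_le_smul {a : H →L[ℂ] H} (ha : 0 ≤ a) {c : ℝ} (hc : 0 ≤ c)
    (h : a ≤ (c : ℂ) • 1) : ‖a‖ ≤ c := by
  rw [CStarAlgebra.norm_le_iff_le_algebraMap a hc ha, Algebra.algebraMap_eq_smul_one,
    ← Complex.coe_smul]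
  exact h

theorem star_mul_mul_le {a : H →L[ℂ] H} (ha : 0 ≤ a) (e : H →L[ℂ] H) :
    star e * a * e ≤ ((‖a‖ : ℝ) : ℂ) • (star e * e) := by
  have := star_mul_mul_mono (le_norm_smul_one ha.isSelfAdjoint) e
  simpa using this

theorem mul_mul_star_le {a : H →L[ℂ] H} (ha : 0 ≤ a) (e : H →L[ℂ] H) :
    e * a * star e ≤ ((‖a‖ : ℝ) : ℂ) • (e * star e) := by
  have := mul_mul_star_mono (le_norm_smul_one ha.isSelfAdjoint) e
  simpa using this

variable {M : VonNeumannAlgebra H}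

theorem mem_iff_commute (x : H →L[ℂ] H) : x ∈ M ↔ ∀ g ∈ M.commutant, Commute g x := by
  conv_lhs => rw [← M.commutant_commutant, VonNeumannAlgebra.mem_commutant_iff]
  rfl

theorem cfc_mem {a : H →L[ℂ] H} (ha : a ∈ M) (f : ℝ → ℝ) : cfc f a ∈ M := by
  rw [mem_iff_commute] at ha ⊢
  intro g hg
  exact ((ha g hg).symm.cfc_real f).symm

theorem smul_mem' {a : H →L[ℂ] H} (ha : a ∈ M) (c : ℂ) : c • a ∈ M :=
  M.toStarSubalgebra.toSubalgebra.smul_mem ha c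

theorem star_mem' {a : H →L[ℂ] H} (ha : a ∈ M) : star a ∈ M := star_mem ha

theorem isClosed_coe : IsClosed {x : H →L[ℂ] H | x ∈ M} := by
  have : {x : H →L[ℂ] H | x ∈ M} = ⋂ g ∈ M.commutant, {x | g * x = x * g} := by
    ext x
    simp only [mem_ofPred_eq, mem_iInter]
    exact mem_iff_commute x
  rw [this]
  exact isClosed_biInter fun g _ => isClosed_eq (by fun_prop) (by fun_prop)

theorem sqrt_eq_cfc_real {a : H →L[ℂ] H} (ha : 0 ≤ a) : CFC.sqrt a = cfc Real.sqrt a := by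
  rw [CFC.sqrt_eq_real_sqrt a ha, cfcₙ_eq_cfc]

theorem sqrt_mem {a : H →L[ℂ] H} (ha : a ∈ M) (h0 : 0 ≤ a) : CFC.sqrt a ∈ M := by
  rw [sqrt_eq_cfc_real h0]
  exact cfc_mem ha _

theorem star_sqrt (a : H →L[ℂ] H) : star (CFC.sqrt a) = CFC.sqrt a :=
  (CFC.sqrt_nonneg a).isSelfAdjoint.star_eq

end Operators

/-! ### Elementary properties of the trace -/

section Trace

variable {M : VonNeumannAlgebra H}

/-- The trace as a function on all of `B(H)`, extended by `0` off the positive cone of `M`. -/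
def tr (τ : NSFTrace M) (a : H →L[ℂ] H) : ℝ≥0∞ := by
  classical exact if h : a ∈ M ∧ 0 ≤ a then τ.toFun ⟨a, h⟩ else 0

variable {τ : NSFTrace M}

theorem tr_eq {a : H →L[ℂ] H} (h : a ∈ M ∧ 0 ≤ a) : tr τ a = τ.toFun ⟨a, h⟩ := by
  simp [tr, h]

theorem tr_coe (a : PosElt M) : tr τ a = τ.toFun a := tr_eq a.2

theorem tr_add {a b : H →L[ℂ] H} (ha : a ∈ M) (ha0 : 0 ≤ a) (hb : b ∈ M) (hb0 : 0 ≤ b) :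
    tr τ (a + b) = tr τ a + tr τ b := by
  rw [tr_eq ⟨ha, ha0⟩, tr_eq ⟨hb, hb0⟩, tr_eq ⟨add_mem ha hb, add_nonneg ha0 hb0⟩]
  exact τ.map_add _ _ _ rfl

theorem tr_mono {a b : H →L[ℂ] H} (ha : a ∈ M) (ha0 : 0 ≤ a) (hb : b ∈ M) (hab : a ≤ b) :
    tr τ a ≤ tr τ b := by
  have := tr_add (τ := τ) ha ha0 (sub_mem hb ha) (sub_nonneg.2 hab)
  rw [add_sub_cancel] at this
  rw [this]
  exact le_self_add

theorem tr_smul {a : H →L[ℂ] H} (ha : a ∈ M) (ha0 : 0 ≤ a) {c : ℝ} (hc : 0 ≤ c) :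
    tr τ ((c : ℂ) • a) = ENNReal.ofReal c * tr τ a := by
  rw [tr_eq ⟨ha, ha0⟩, tr_eq ⟨smul_mem' ha _, smul_ofReal_nonneg ha0 hc⟩,
    τ.map_smul c.toNNReal ⟨a, ha, ha0⟩]
  · rfl
  · simp [hc]

@[simp] theorem tr_zero : tr τ (0 : H →L[ℂ] H) = 0 := by
  have := tr_smul (τ := τ) (zero_mem M) le_rfl (c := 0) le_rfl
  simpa using this

theorem tr_sum {ι : Type*} (s : Finset ι) {a : ι → H →L[ℂ] H} (ha : ∀ i ∈ s, a i ∈ M)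
    (ha0 : ∀ i ∈ s, 0 ≤ a i) : tr τ (∑ i ∈ s, a i) = ∑ i ∈ s, tr τ (a i) := by
  classical
  induction s using Finset.induction_on with
  | empty => simp
  | insert i s hi ih =>
    rw [Finset.sum_insert hi, Finset.sum_insert hi, tr_add, ih]
    · exact fun j hj => ha j (Finset.mem_insert_of_mem hj)
    · exact fun j hj => ha0 j (Finset.mem_insert_of_mem hj)
    · exact ha i (Finset.mem_insert_self i s)
    · exact ha0 i (Finset.mem_insert_self i s)
    · exact sum_mem fun j hj => ha j (Finset.mem_insert_of_mem hj)
    · exact Finset.sum_nonneg fun j hj => ha0 j (Finset.mem_insert_of_mem hj)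

theorem tr_unitary {u a : H →L[ℂ] H} (hu : u ∈ M) (hu' : u ∈ unitary (H →L[ℂ] H))
    (ha : a ∈ M) (ha0 : 0 ≤ a) : tr τ (u * a * star u) = tr τ a := by
  rw [tr_eq ⟨ha, ha0⟩, tr_eq ⟨mul_mem (mul_mem hu ha) (star_mem hu), mul_mul_star_nonneg ha0 u⟩]
  exact τ.tracial u hu hu' _ _ rfl

theorem eq_zero_of_tr_eq_zero {a : H →L[ℂ] H} (ha : a ∈ M) (ha0 : 0 ≤ a) (h : tr τ a = 0) :
    a = 0 := by
  rw [tr_eq ⟨ha, ha0⟩] at h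
  exact τ.faithful _ h

/-- Normality along norm convergent increasing sequences. -/
theorem tr_le_of_monotone_tendsto {a : ℕ → H →L[ℂ] H} {b : H →L[ℂ] H} {K : ℝ≥0∞}
    (ha : ∀ n, a n ∈ M) (ha0 : ∀ n, 0 ≤ a n) (hmono : Monotone a)
    (hlim : Tendsto a atTop (𝓝 b)) (hK : ∀ n, tr τ (a n) ≤ K) : tr τ b ≤ K := by
  have hb : b ∈ M := isClosed_coe.mem_of_tendsto hlim (Eventually.of_forall ha)
  have hle : ∀ n, a n ≤ b := fun n => hmono.ge_of_tendsto hlim n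
  have hb0 : 0 ≤ b := (ha0 0).trans (hle 0)
  let S : Set (PosElt M) := range fun n => ⟨a n, ha n, ha0 n⟩
  have hlub : IsLUB S ⟨b, hb, hb0⟩ := by
    constructor
    · rintro _ ⟨n, rfl⟩
      exact hle n
    · intro z hz
      change b ≤ z
      exact le_of_tendsto hlim (Eventually.of_forall fun n => hz ⟨n, rfl⟩)
  have hdir : DirectedOn (· ≤ ·) S := by
    rintro _ ⟨n, rfl⟩ _ ⟨m, rfl⟩
    exact ⟨_, ⟨max n m, rfl⟩, hmono (le_max_left n m), hmono (le_max_right n m)⟩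
  rw [tr_eq ⟨hb, hb0⟩, τ.normal S _ (range_nonempty _) hdir hlub]
  refine iSup₂_le ?_
  rintro _ ⟨n, rfl⟩
  rw [← tr_coe]
  exact hK n

end Trace

/-! ### The pre-Hilbert space `M ∩ L₂(M)` -/

section HilbertStructure

theorem star_add_mul_add_le (x y : H →L[ℂ] H) {s : ℝ} (hs : 0 < s) :
    star (x + y) * (x + y) ≤
      ((1 + s ^ 2 : ℝ) : ℂ) • (star x * x) + ((1 + (s⁻¹) ^ 2 : ℝ) : ℂ) • (star y * y) := by
  have h : 0 ≤ star ((s : ℂ) • x - (s⁻¹ : ℂ) • y) * ((s : ℂ) • x - (s⁻¹ : ℂ) • y) :=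
    star_mul_self_nonneg _
  rw [← sub_nonneg]
  convert h using 1
  have hs' : (s : ℂ) ≠ 0 := by exact_mod_cast hs.ne'
  simp only [star_add, star_sub, star_smul, add_mul, mul_add, sub_mul, mul_sub, smul_mul_assoc,
    mul_smul_comm, smul_sub, smul_smul, RCLike.star_def, Complex.conj_ofReal, map_inv₀]
  rw [inv_mul_cancel₀ hs', mul_inv_cancel₀ hs']
  push_cast
  module

theorem parallelogram_op (x y : H →L[ℂ] H) :
    star (x + y) * (x + y) + star (x - y) * (x - y)
      = ((2 : ℝ) : ℂ) • (star x * x) + ((2 : ℝ) : ℂ) • (star y * y) := by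
  simp only [star_add, star_sub, add_mul, mul_add, sub_mul, mul_sub]
  push_cast
  module

variable {M : VonNeumannAlgebra H}

theorem star_mul_mem {x : H →L[ℂ] H} (hx : x ∈ M) : star x * x ∈ M := mul_mem (star_mem' hx) hx

theorem tr_star_add_le (τ : NSFTrace M) {x y : H →L[ℂ] H} (hx : x ∈ M) (hy : y ∈ M) {s : ℝ}
    (hs : 0 < s) : tr τ (star (x + y) * (x + y)) ≤
      ENNReal.ofReal (1 + s ^ 2) * tr τ (star x * x)
        + ENNReal.ofReal (1 + (s⁻¹) ^ 2) * tr τ (star y * y) := by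
  have h1 : (0 : ℝ) ≤ 1 + s ^ 2 := by positivity
  have h2 : (0 : ℝ) ≤ 1 + (s⁻¹) ^ 2 := by positivity
  rw [← tr_smul (star_mul_mem hx) (star_mul_self_nonneg x) h1,
    ← tr_smul (star_mul_mem hy) (star_mul_self_nonneg y) h2,
    ← tr_add (smul_mem' (star_mul_mem hx) _) (smul_ofReal_nonneg (star_mul_self_nonneg x) h1)
      (smul_mem' (star_mul_mem hy) _) (smul_ofReal_nonneg (star_mul_self_nonneg y) h2)]
  exact tr_mono (star_mul_mem (add_mem hx hy)) (star_mul_self_nonneg _)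
    (add_mem (smul_mem' (star_mul_mem hx) _) (smul_mem' (star_mul_mem hy) _))
    (star_add_mul_add_le x y hs)

theorem tr_star_smul (τ : NSFTrace M) {x : H →L[ℂ] H} (hx : x ∈ M) (c : ℂ) :
    tr τ (star (c • x) * (c • x)) = ENNReal.ofReal (‖c‖ ^ 2) * tr τ (star x * x) := by
  rw [← tr_smul (star_mul_mem hx) (star_mul_self_nonneg x) (by positivity)]
  congr 1
  rw [star_smul, smul_mul_smul_comm, RCLike.star_def, Complex.conj_mul']
  push_cast
  rfl

/-- The square integrable elements `{x ∈ M : τ(x* x) < ∞}` of `M`. -/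
def l2Submodule (τ : NSFTrace M) : Submodule ℂ (H →L[ℂ] H) where
  carrier := {x | x ∈ M ∧ tr τ (star x * x) < ∞}
  zero_mem' := ⟨zero_mem M, by simp⟩
  add_mem' := by
    rintro x y ⟨hx, hx'⟩ ⟨hy, hy'⟩
    refine ⟨add_mem hx hy, (tr_star_add_le τ hx hy one_pos).trans_lt ?_⟩
    exact ENNReal.add_lt_top.2 ⟨ENNReal.mul_lt_top ENNReal.ofReal_lt_top hx',
      ENNReal.mul_lt_top ENNReal.ofReal_lt_top hy'⟩
  smul_mem' := by
    rintro c x ⟨hx, hx'⟩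
    refine ⟨smul_mem' hx c, ?_⟩
    rw [tr_star_smul τ hx]
    exact ENNReal.mul_lt_top ENNReal.ofReal_lt_top hx'

/-- The space `M ∩ L₂(M)`. It is a type of its own because it carries the norm
`‖x‖₂ = τ(x* x)^{1/2}` and not the operator norm. -/
def L2 (τ : NSFTrace M) : Type _ := ↥(l2Submodule τ)

variable {τ : NSFTrace M}

instance : AddCommGroup (L2 τ) := inferInstanceAs (AddCommGroup ↥(l2Submodule τ))
instance : Module ℂ (L2 τ) := inferInstanceAs (Module ℂ ↥(l2Submodule τ))

/-- The operator underlying an element of `M ∩ L₂(M)`. -/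
def L2.op : L2 τ →ₗ[ℂ] H →L[ℂ] H := (l2Submodule τ).subtype

/-- The element of `M ∩ L₂(M)` with a given underlying operator. -/
def L2.mk (x : H →L[ℂ] H) (hx : x ∈ M) (h : tr τ (star x * x) < ∞) : L2 τ := ⟨x, hx, h⟩

@[simp] theorem L2.op_mk (x : H →L[ℂ] H) (hx : x ∈ M) (h : tr τ (star x * x) < ∞) :
    (L2.mk x hx h).op = x := rfl

theorem L2.op_injective : Function.Injective (L2.op (τ := τ)) := Subtype.val_injective

theorem L2.op_mem (x : L2 τ) : x.op ∈ l2Submodule τ := x.2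

theorem L2.mem (x : L2 τ) : x.op ∈ M := x.2.1

theorem L2.tr_lt_top (x : L2 τ) : tr τ (star x.op * x.op) < ∞ := x.2.2

instance : Norm (L2 τ) := ⟨fun x => Real.sqrt (tr τ (star x.op * x.op)).toReal⟩

theorem L2.norm_def (x : L2 τ) : ‖x‖ = Real.sqrt (tr τ (star x.op * x.op)).toReal := rfl

theorem L2.norm_sq (x : L2 τ) : ‖x‖ ^ 2 = (tr τ (star x.op * x.op)).toReal :=
  Real.sq_sqrt ENNReal.toReal_nonneg

theorem L2.tr_eq_ofReal (x : L2 τ) : tr τ (star x.op * x.op) = ENNReal.ofReal (‖x‖ ^ 2) := by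
  rw [L2.norm_sq, ENNReal.ofReal_toReal x.tr_lt_top.ne]

theorem L2.norm_smul_aux (c : ℂ) (x : L2 τ) : ‖c • x‖ = ‖c‖ * ‖x‖ := by
  have h : ‖c • x‖ ^ 2 = (‖c‖ * ‖x‖) ^ 2 := by
    rw [L2.norm_sq, map_smul, tr_star_smul τ x.mem, ENNReal.toReal_mul, ← L2.norm_sq,
      ENNReal.toReal_ofReal (by positivity), mul_pow]
  exact (pow_left_inj₀ (Real.sqrt_nonneg _)
    (mul_nonneg (norm_nonneg _) (Real.sqrt_nonneg _)) two_ne_zero).1 h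

theorem L2.eq_zero_of_norm {x : L2 τ} (h : ‖x‖ = 0) : x = 0 := by
  have h1 : tr τ (star x.op * x.op) = 0 := by rw [x.tr_eq_ofReal, h]; simp
  have h2 := eq_zero_of_tr_eq_zero (star_mul_mem x.mem) (star_mul_self_nonneg _) h1
  apply L2.op_injective
  rw [map_zero]
  exact CStarRing.star_mul_self_eq_zero_iff _ |>.1 h2

theorem L2.norm_add_aux (x y : L2 τ) : ‖x + y‖ ≤ ‖x‖ + ‖y‖ := by
  rcases (Real.sqrt_nonneg _ : 0 ≤ ‖x‖).eq_or_lt' with hx | hx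
  · rw [L2.eq_zero_of_norm hx, zero_add]
    exact le_add_of_nonneg_left (Real.sqrt_nonneg _)
  rcases (Real.sqrt_nonneg _ : 0 ≤ ‖y‖).eq_or_lt' with hy | hy
  · rw [L2.eq_zero_of_norm hy, add_zero]
    exact le_add_of_nonneg_right (Real.sqrt_nonneg _)
  -- the optimal weight in `|x + y|² ≤ (1 + s²) |x|² + (1 + s⁻²) |y|²`
  set s := Real.sqrt (‖y‖ / ‖x‖) with hs
  have hs0 : 0 < s := Real.sqrt_pos.2 (div_pos hy hx)
  have hs2 : s ^ 2 = ‖y‖ / ‖x‖ := Real.sq_sqrt (div_pos hy hx).le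
  have h := tr_star_add_le τ x.mem y.mem hs0
  rw [← map_add, (x + y).tr_eq_ofReal, x.tr_eq_ofReal, y.tr_eq_ofReal,
    ← ENNReal.ofReal_mul (by positivity), ← ENNReal.ofReal_mul (by positivity),
    ← ENNReal.ofReal_add (by positivity) (by positivity),
    ENNReal.ofReal_le_ofReal_iff (by positivity), inv_pow, hs2] at h
  refine le_of_sq_le_sq ?_ (by positivity)
  have hx' : ‖x‖ ≠ 0 := hx.ne'
  have hy' : ‖y‖ ≠ 0 := hy.ne'
  refine h.trans (le_of_eq ?_)
  field_simp
  ring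

instance : NormedAddCommGroup (L2 τ) := fast_instance%
  { toFun := norm
    map_zero' := by simp [L2.norm_def]
    add_le' := L2.norm_add_aux
    neg' := fun x => by rw [← neg_one_smul ℂ x, L2.norm_smul_aux]; simp
    eq_zero_of_map_eq_zero' := fun _ => L2.eq_zero_of_norm : AddGroupNorm (L2 τ) }.toNormedAddCommGroup

instance : NormedSpace ℂ (L2 τ) where
  norm_smul_le c x := (L2.norm_smul_aux c x).le

theorem L2.parallelogram (x y : L2 τ) :
    ‖x + y‖ * ‖x + y‖ + ‖x - y‖ * ‖x - y‖ = 2 * (‖x‖ * ‖x‖ + ‖y‖ * ‖y‖) := by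
  have h := congrArg (tr τ) (parallelogram_op x.op y.op)
  have hx := star_mul_self_nonneg x.op
  have hy := star_mul_self_nonneg y.op
  rw [tr_add (star_mul_mem (add_mem x.mem y.mem)) (star_mul_self_nonneg _)
      (star_mul_mem (sub_mem x.mem y.mem)) (star_mul_self_nonneg _),
    tr_add (smul_mem' (star_mul_mem x.mem) _) (smul_ofReal_nonneg hx two_pos.le)
      (smul_mem' (star_mul_mem y.mem) _) (smul_ofReal_nonneg hy two_pos.le),
    tr_smul (star_mul_mem x.mem) hx two_pos.le, tr_smul (star_mul_mem y.mem) hy two_pos.le,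
    x.tr_eq_ofReal, y.tr_eq_ofReal] at h
  have e1 : tr τ (star (x.op + y.op) * (x.op + y.op)) = ENNReal.ofReal (‖x + y‖ ^ 2) :=
    (x + y).tr_eq_ofReal
  have e2 : tr τ (star (x.op - y.op) * (x.op - y.op)) = ENNReal.ofReal (‖x - y‖ ^ 2) :=
    (x - y).tr_eq_ofReal
  rw [e1, e2, ← ENNReal.ofReal_mul two_pos.le, ← ENNReal.ofReal_mul two_pos.le,
    ← ENNReal.ofReal_add (sq_nonneg _) (sq_nonneg _),
    ← ENNReal.ofReal_add (by positivity) (by positivity),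
    ENNReal.ofReal_eq_ofReal_iff (by positivity) (by positivity)] at h
  linarith

/-- The inner product of `M ∩ L₂(M)` comes from the parallelogram law, so that
`⟪x, y⟫ = τ(x* y)` without a linear extension of `τ`. -/
instance : InnerProductSpace ℂ (L2 τ) := InnerProductSpace.ofNorm (𝕜 := ℂ) L2.parallelogram

theorem L2.norm_le_of_tr_le {x y : L2 τ} {c : ℝ} (hc : 0 ≤ c)
    (h : tr τ (star x.op * x.op) ≤ ENNReal.ofReal (c ^ 2) * tr τ (star y.op * y.op)) :
    ‖x‖ ≤ c * ‖y‖ := by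
  rw [x.tr_eq_ofReal, y.tr_eq_ofReal, ← ENNReal.ofReal_mul (by positivity),
    ENNReal.ofReal_le_ofReal_iff (by positivity)] at h
  refine le_of_sq_le_sq ?_ (by positivity)
  rw [mul_pow]
  exact h

/-! #### Left and right multiplication -/

theorem tr_star_mul_left_le {x a : H →L[ℂ] H} (hx : x ∈ M) (ha : a ∈ M) :
    tr τ (star (a * x) * (a * x)) ≤ ENNReal.ofReal (‖a‖ ^ 2) * tr τ (star x * x) := by
  rw [← tr_smul (star_mul_mem hx) (star_mul_self_nonneg x) (by positivity)]
  refine tr_mono (star_mul_mem (mul_mem ha hx)) (star_mul_self_nonneg _)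
    (smul_mem' (star_mul_mem hx) _) ?_
  have := star_mul_mul_le (star_mul_self_nonneg a) x
  rw [CStarRing.norm_star_mul_self, ← sq] at this
  rw [star_mul, mul_assoc, ← mul_assoc (star a), ← mul_assoc]
  exact this

/-- Left multiplication by `a ∈ M` on `M ∩ L₂(M)`. -/
def L2.lmul {a : H →L[ℂ] H} (ha : a ∈ M) : L2 τ →ₗ[ℂ] L2 τ where
  toFun x := L2.mk (a * x.op) (mul_mem ha x.mem)
    ((tr_star_mul_left_le x.mem ha).trans_lt
      (ENNReal.mul_lt_top ENNReal.ofReal_lt_top x.tr_lt_top))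
  map_add' x y := L2.op_injective (by simp [mul_add])
  map_smul' c x := L2.op_injective (by simp)

@[simp] theorem L2.op_lmul {a : H →L[ℂ] H} (ha : a ∈ M) (x : L2 τ) :
    (L2.lmul ha x).op = a * x.op := rfl

theorem L2.norm_lmul_le {a : H →L[ℂ] H} (ha : a ∈ M) (x : L2 τ) :
    ‖L2.lmul ha x‖ ≤ ‖a‖ * ‖x‖ :=
  L2.norm_le_of_tr_le (norm_nonneg _) (tr_star_mul_left_le x.mem ha)

/-- The von Neumann algebra as a C*-algebra in its own right is spanned by its unitaries. -/
theorem induction_unitary {P : (H →L[ℂ] H) → Prop}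
    (unit : ∀ u ∈ M, u ∈ unitary (H →L[ℂ] H) → P u)
    (zero : P 0) (add : ∀ a ∈ M, ∀ b ∈ M, P a → P b → P (a + b))
    (smul : ∀ (c : ℂ), ∀ a ∈ M, P a → P (c • a)) {a : H →L[ℂ] H} (ha : a ∈ M) : P a := by
  have : IsClosed (M.toStarSubalgebra : Set (H →L[ℂ] H)) := isClosed_coe (M := M)
  let _ : CStarAlgebra M.toStarSubalgebra := StarSubalgebra.cstarAlgebra _
  have h : (⟨a, ha⟩ : M.toStarSubalgebra) ∈ Submodule.span ℂ
      (unitary M.toStarSubalgebra : Set M.toStarSubalgebra) := by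
    rw [CStarAlgebra.span_unitary]; trivial
  have key : ∀ b : M.toStarSubalgebra, b ∈ Submodule.span ℂ
      (unitary M.toStarSubalgebra : Set M.toStarSubalgebra) → P b := by
    intro b hb
    induction hb using Submodule.span_induction with
    | mem u hu =>
      refine unit u u.2 ?_
      have h1 := Unitary.mem_iff.1 hu
      exact Unitary.mem_iff.2 ⟨congrArg Subtype.val h1.1, congrArg Subtype.val h1.2⟩
    | zero => exact zero
    | add x y _ _ hx hy => exact add x x.2 y y.2 hx hy
    | smul c x _ hx => exact smul c x x.2 hx
  exact key _ h

theorem tr_star_mul_unitary {x u : H →L[ℂ] H} (hx : x ∈ M) (hu : u ∈ M)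
    (hu' : u ∈ unitary (H →L[ℂ] H)) :
    tr τ (star (x * u) * (x * u)) = tr τ (star x * x) := by
  have := tr_unitary (τ := τ) (star_mem' hu) (Unitary.star_mem hu') (star_mul_mem hx)
    (star_mul_self_nonneg x)
  rw [← this, star_star, star_mul]
  simp only [mul_assoc]

theorem mul_mem_l2Submodule {x a : H →L[ℂ] H} (hx : x ∈ l2Submodule τ) (ha : a ∈ M) :
    x * a ∈ l2Submodule τ := by
  refine induction_unitary (P := fun a => x * a ∈ l2Submodule τ) ?_ ?_ ?_ ?_ ha
  · intro u hu hu'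
    exact ⟨mul_mem hx.1 hu, by rw [tr_star_mul_unitary hx.1 hu hu']; exact hx.2⟩
  · rw [mul_zero]; exact zero_mem _
  · intro a _ b _ h1 h2
    rw [mul_add]; exact add_mem h1 h2
  · intro c a _ h
    rw [mul_smul_comm]; exact Submodule.smul_mem _ c h

/-- Right multiplication by `a ∈ M` on `M ∩ L₂(M)`. -/
def L2.rmul {a : H →L[ℂ] H} (ha : a ∈ M) : L2 τ →ₗ[ℂ] L2 τ where
  toFun x := L2.mk (x.op * a) (mul_mem x.mem ha) (mul_mem_l2Submodule x.op_mem ha).2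
  map_add' x y := L2.op_injective (by simp [add_mul])
  map_smul' c x := L2.op_injective (by simp)

@[simp] theorem L2.op_rmul {a : H →L[ℂ] H} (ha : a ∈ M) (x : L2 τ) :
    (L2.rmul ha x).op = x.op * a := rfl

theorem L2.inner_map_of_norm (f : L2 τ →ₗ[ℂ] L2 τ) (h : ∀ x, ‖f x‖ = ‖x‖) (x y : L2 τ) :
    ⟪f x, f y⟫_ℂ = ⟪x, y⟫_ℂ :=
  LinearIsometry.inner_map_map (𝕜 := ℂ) (⟨f, h⟩ : L2 τ →ₗᵢ[ℂ] L2 τ) x y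

theorem L2.inner_lmul {a : H →L[ℂ] H} (ha : a ∈ M) (x y : L2 τ) :
    ⟪L2.lmul ha x, y⟫_ℂ = ⟪x, L2.lmul (star_mem' ha) y⟫_ℂ := by
  have key : ∀ (h : a ∈ M), ⟪L2.lmul h x, y⟫_ℂ = ⟪x, L2.lmul (star_mem' h) y⟫_ℂ := by
    refine induction_unitary (P := fun a => ∀ (h : a ∈ M),
      ⟪L2.lmul h x, y⟫_ℂ = ⟪x, L2.lmul (star_mem' h) y⟫_ℂ) ?_ ?_ ?_ ?_ ha
    · intro u hu hu' h
      have e := Unitary.mem_iff.1 hu'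
      rw [← L2.inner_map_of_norm (L2.lmul h) _ x]
      · congr 1
        apply L2.op_injective
        simp [← mul_assoc, e.2]
      · intro z
        rw [L2.norm_def, L2.norm_def, L2.op_lmul, star_mul, mul_assoc, ← mul_assoc (star u), e.1,
          one_mul]
    · intro h
      have e1 : L2.lmul h x = 0 := L2.op_injective (by simp)
      have e2 : L2.lmul (star_mem' h) y = 0 := L2.op_injective (by simp)
      rw [e1, e2, inner_zero_left, inner_zero_right]
    · intro a ha b hb h1 h2 h
      have e1 : L2.lmul h x = L2.lmul ha x + L2.lmul hb x := L2.op_injective (by simp [add_mul])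
      have e2 : L2.lmul (star_mem' h) y = L2.lmul (star_mem' ha) y + L2.lmul (star_mem' hb) y :=
        L2.op_injective (by simp [add_mul])
      rw [e1, e2, inner_add_left, inner_add_right, h1 ha, h2 hb]
    · intro c a ha h1 h
      have e1 : L2.lmul h x = c • L2.lmul ha x := L2.op_injective (by simp)
      have e2 : L2.lmul (star_mem' h) y = starRingEnd ℂ c • L2.lmul (star_mem' ha) y :=
        L2.op_injective (by simp)
      rw [e1, e2, inner_smul_left, inner_smul_right, h1 ha]
  exact key ha

theorem L2.inner_rmul {a : H →L[ℂ] H} (ha : a ∈ M) (x y : L2 τ) :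
    ⟪L2.rmul ha x, y⟫_ℂ = ⟪x, L2.rmul (star_mem' ha) y⟫_ℂ := by
  have key : ∀ (h : a ∈ M), ⟪L2.rmul h x, y⟫_ℂ = ⟪x, L2.rmul (star_mem' h) y⟫_ℂ := by
    refine induction_unitary (P := fun a => ∀ (h : a ∈ M),
      ⟪L2.rmul h x, y⟫_ℂ = ⟪x, L2.rmul (star_mem' h) y⟫_ℂ) ?_ ?_ ?_ ?_ ha
    · intro u hu hu' h
      have e := Unitary.mem_iff.1 hu'
      rw [← L2.inner_map_of_norm (L2.rmul h) _ x]
      · congr 1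
        apply L2.op_injective
        simp [mul_assoc, e.1]
      · intro z
        rw [L2.norm_def, L2.norm_def, L2.op_rmul, tr_star_mul_unitary z.mem hu hu']
    · intro h
      have e1 : L2.rmul h x = 0 := L2.op_injective (by simp)
      have e2 : L2.rmul (star_mem' h) y = 0 := L2.op_injective (by simp)
      rw [e1, e2, inner_zero_left, inner_zero_right]
    · intro a ha b hb h1 h2 h
      have e1 : L2.rmul h x = L2.rmul ha x + L2.rmul hb x := L2.op_injective (by simp [mul_add])
      have e2 : L2.rmul (star_mem' h) y = L2.rmul (star_mem' ha) y + L2.rmul (star_mem' hb) y :=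
        L2.op_injective (by simp [mul_add])
      rw [e1, e2, inner_add_left, inner_add_right, h1 ha, h2 hb]
    · intro c a ha h1 h
      have e1 : L2.rmul h x = c • L2.rmul ha x := L2.op_injective (by simp)
      have e2 : L2.rmul (star_mem' h) y = starRingEnd ℂ c • L2.rmul (star_mem' ha) y :=
        L2.op_injective (by simp)
      rw [e1, e2, inner_smul_left, inner_smul_right, h1 ha]
  exact key ha

theorem L2.inner_self (x : L2 τ) : ⟪x, x⟫_ℂ = ((tr τ (star x.op * x.op)).toReal : ℂ) := by
  rw [inner_self_eq_norm_sq_to_K, ← L2.norm_sq]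
  simp

theorem L2.norm_rmul_le {a : H →L[ℂ] H} (ha : a ∈ M) (x : L2 τ) :
    ‖L2.rmul ha x‖ ≤ ‖a‖ * ‖x‖ := by
  -- `‖a‖² - a a* = b²`, and so `‖a‖² ‖x‖² - ‖x a‖² = ‖x b‖² ≥ 0`
  set d : H →L[ℂ] H := ((‖a‖ ^ 2 : ℝ) : ℂ) • 1 - a * star a with hd
  have hd0 : 0 ≤ d := by
    have h := le_norm_smul_one (IsSelfAdjoint.mul_star_self a)
    rw [CStarRing.norm_self_mul_star, ← sq] at h
    exact sub_nonneg.2 h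
  have hdM : d ∈ M := sub_mem (smul_mem' (one_mem M) _) (mul_mem ha (star_mem' ha))
  have hb := sqrt_mem hdM hd0
  have e1 : ⟪L2.rmul ha x, L2.rmul ha x⟫_ℂ + ⟪L2.rmul hb x, L2.rmul hb x⟫_ℂ
      = ((‖a‖ ^ 2 : ℝ) : ℂ) * ⟪x, x⟫_ℂ := by
    rw [L2.inner_rmul, L2.inner_rmul, ← inner_add_right, ← inner_smul_right]
    congr 1
    apply L2.op_injective
    simp only [map_add, L2.op_rmul, map_smul, star_sqrt, mul_assoc]
    rw [CFC.sqrt_mul_sqrt_self d hd0, hd, mul_sub, mul_smul_comm, mul_one, add_sub_cancel]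
  simp only [inner_self_eq_norm_sq_to_K, Complex.coe_algebraMap] at e1
  have e2 : ‖L2.rmul ha x‖ ^ 2 + ‖L2.rmul hb x‖ ^ 2 = ‖a‖ ^ 2 * ‖x‖ ^ 2 := by
    exact_mod_cast e1
  refine le_of_sq_le_sq ?_ (by positivity)
  rw [mul_pow]
  nlinarith [sq_nonneg ‖L2.rmul hb x‖]

end HilbertStructure

/-! ### Traciality -/

section Traciality

variable {M : VonNeumannAlgebra H} {τ : NSFTrace M}

theorem tr_conj_le {a e : H →L[ℂ] H} (ha : a ∈ M) (ha0 : 0 ≤ a) (he : e ∈ M) (he1 : ‖e‖ ≤ 1) :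
    tr τ (e * a * star e) ≤ tr τ a := by
  rcases eq_or_ne (tr τ a) ∞ with h | h
  · rw [h]; exact le_top
  have hs := CFC.sqrt_mul_sqrt_self a ha0
  have hw : star (CFC.sqrt a) * CFC.sqrt a = a := by rw [star_sqrt, hs]
  let w : L2 τ := L2.mk (CFC.sqrt a) (sqrt_mem ha ha0) (by rw [hw]; exact h.lt_top)
  have h1 := L2.norm_rmul_le (star_mem' he) w
  rw [norm_star] at h1
  have h2 : ‖L2.rmul (star_mem' he) w‖ ≤ ‖w‖ :=
    h1.trans (mul_le_of_le_one_left (norm_nonneg _) he1)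
  have e1 : tr τ (e * a * star e) = ENNReal.ofReal (‖L2.rmul (star_mem' he) w‖ ^ 2) := by
    rw [← L2.tr_eq_ofReal]
    simp only [L2.op_rmul, w, L2.op_mk, star_mul, star_star, star_sqrt]
    simp only [mul_assoc]
    rw [← mul_assoc (CFC.sqrt a) (CFC.sqrt a), hs]
  have e2 : tr τ a = ENNReal.ofReal (‖w‖ ^ 2) := by
    rw [← L2.tr_eq_ofReal]
    simp only [w, L2.op_mk, hw]
  rw [e1, e2]
  gcongr

theorem spectrum_nonneg {a : H →L[ℂ] H} (ha : 0 ≤ a) {t : ℝ} (ht : t ∈ spectrum ℝ a) : 0 ≤ t :=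
  spectrum_nonneg_of_nonneg ha ht

/-- The resolvent type cut-off `t ↦ t₊ / (t₊ + ε)`, an approximation of the indicator function of
`(0, ∞)`. -/
def cutoff (ε t : ℝ) : ℝ := max t 0 / (max t 0 + ε)

theorem continuous_cutoff {ε : ℝ} (hε : 0 < ε) : Continuous (cutoff ε) := by
  unfold cutoff
  refine Continuous.div (by fun_prop) (by fun_prop) fun t => ?_
  have := le_max_right t 0
  positivity

theorem cutoff_nonneg {ε : ℝ} (hε : 0 < ε) (t : ℝ) : 0 ≤ cutoff ε t := by
  have := le_max_right t 0
  unfold cutoff; positivity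

theorem cutoff_le_one {ε : ℝ} (hε : 0 < ε) (t : ℝ) : cutoff ε t ≤ 1 := by
  have := le_max_right t 0
  unfold cutoff
  rw [div_le_one (by positivity)]
  linarith

theorem one_sub_cutoff {ε : ℝ} (hε : 0 < ε) (t : ℝ) : 1 - cutoff ε t = ε / (max t 0 + ε) := by
  have := le_max_right t 0
  have h : max t 0 + ε ≠ 0 := by positivity
  unfold cutoff
  field_simp
  ring

theorem max_mul_one_sub_cutoff_le {ε : ℝ} (hε : 0 < ε) (t : ℝ) :
    max t 0 * (1 - cutoff ε t) ≤ ε := by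
  have h0 := le_max_right t 0
  rw [one_sub_cutoff hε, mul_div_assoc', div_le_iff₀ (by positivity)]
  nlinarith

theorem cutoff_anti {ε δ : ℝ} (hε : 0 < ε) (h : ε ≤ δ) (t : ℝ) : cutoff δ t ≤ cutoff ε t := by
  have h0 := le_max_right t 0
  unfold cutoff
  gcongr

theorem cfc_mul_self_mul_cfc {h : H →L[ℂ] H} (hh : IsSelfAdjoint h) {f : ℝ → ℝ}
    (hf : Continuous f) : cfc f h * h * cfc f h = cfc (fun t => f t * t * f t) h := by
  rw [cfc_mul (fun t => f t * t) f h (by fun_prop) hf.continuousOn,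
    cfc_mul f (fun t => t) h hf.continuousOn (by fun_prop), cfc_id' ℝ h]

theorem star_cfc (f : ℝ → ℝ) (h : H →L[ℂ] H) : star (cfc f h) = cfc f h :=
  (cfc_predicate f h : IsSelfAdjoint _).star_eq

/-- The null sequence `1 / (k + 1)`. -/
def epsSeq (k : ℕ) : ℝ := 1 / ((k : ℝ) + 1)

theorem epsSeq_pos (k : ℕ) : 0 < epsSeq k := Nat.one_div_pos_of_nat

theorem epsSeq_anti {k l : ℕ} (h : k ≤ l) : epsSeq l ≤ epsSeq k :=
  Nat.one_div_le_one_div h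

theorem tendsto_epsSeq : Tendsto epsSeq atTop (𝓝 0) := tendsto_one_div_add_atTop_nhds_zero_nat

/-- `x f(x* x) x*` is close to `x x*` for a cut-off `f`: the difference `z z*`,
`z = x (1 - f)^{1/2}(x* x)`, has the norm of `z* z = x* x (1 - f)(x* x)`. -/
theorem norm_conj_cutoff_sub_le {x h : H →L[ℂ] H} (hh : h = star x * x) {ε : ℝ} (hε : 0 < ε) :
    ‖x * cfc (cutoff ε) h * star x - x * star x‖ ≤ ε := by
  have h0 : 0 ≤ h := hh ▸ star_mul_self_nonneg x
  have hsa : IsSelfAdjoint h := h0.isSelfAdjoint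
  have hc := continuous_cutoff hε
  set r : ℝ → ℝ := fun t => Real.sqrt (1 - cutoff ε t) with hr
  have hrc : Continuous r := by fun_prop
  have hr2 : ∀ t, r t * r t = 1 - cutoff ε t := fun t =>
    Real.mul_self_sqrt (sub_nonneg.2 (cutoff_le_one hε t))
  have hrs := star_cfc r h
  have e1 : x * cfc (cutoff ε) h * star x - x * star x
      = -((x * cfc r h) * star (x * cfc r h)) := by
    rw [star_mul, hrs, mul_assoc x (cfc r h), ← mul_assoc (cfc r h),
      ← cfc_mul r r h hrc.continuousOn hrc.continuousOn]
    simp only [hr2]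
    rw [cfc_sub (fun _ => (1 : ℝ)) (cutoff ε) h continuousOn_const hc.continuousOn,
      cfc_const_one ℝ h]
    noncomm_ring
  have e2 : star (x * cfc r h) * (x * cfc r h) = cfc (fun t => r t * t * r t) h := by
    rw [← cfc_mul_self_mul_cfc hsa hrc, star_mul, hrs, hh]
    simp only [mul_assoc]
  rw [e1, norm_neg, CStarRing.norm_self_mul_star, ← CStarRing.norm_star_mul_self, e2]
  refine norm_cfc_le hε.le fun t ht => ?_
  have ht0 := spectrum_nonneg h0 ht
  have h1 := max_mul_one_sub_cutoff_le hε t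
  rw [max_eq_left ht0] at h1
  have e3 : r t * t * r t = t * (1 - cutoff ε t) := by rw [← hr2]; ring
  rw [e3, Real.norm_of_nonneg (mul_nonneg ht0 (sub_nonneg.2 (cutoff_le_one hε t)))]
  exact h1

/-- `x f(x* x) x* = u (x* x) u*` for a cut-off `f` and the contraction
`u = x (x* x + ε)^{-1/2}`. -/
theorem tr_conj_cutoff_le {x h : H →L[ℂ] H} (hx : x ∈ M) (hh : h = star x * x) {ε : ℝ}
    (hε : 0 < ε) : tr τ (x * cfc (cutoff ε) h * star x) ≤ tr τ h := by
  have hM : h ∈ M := hh ▸ star_mul_mem hx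
  have h0 : 0 ≤ h := hh ▸ star_mul_self_nonneg x
  have hsa : IsSelfAdjoint h := h0.isSelfAdjoint
  have hpos : ∀ t : ℝ, 0 < max t 0 + ε := fun t => by
    have := le_max_right t 0
    positivity
  obtain ⟨g, hgc, hg2⟩ : ∃ g : ℝ → ℝ, Continuous g ∧
      ∀ t ∈ spectrum ℝ h, g t * t * g t = cutoff ε t := by
    refine ⟨fun t => Real.sqrt (1 / (max t 0 + ε)), Real.continuous_sqrt.comp
      (Continuous.div (by fun_prop) (by fun_prop) fun t => (hpos t).ne'), fun t ht => ?_⟩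
    have ht0 := spectrum_nonneg h0 ht
    rw [mul_right_comm, Real.mul_self_sqrt (by have := hpos t; positivity), cutoff,
      max_eq_left ht0]
    ring
  have hgs := star_cfc g h
  have e1 : cfc (cutoff ε) h = cfc g h * h * cfc g h := by
    rw [cfc_mul_self_mul_cfc hsa hgc]
    exact (cfc_congr hg2).symm
  have e2 : star (x * cfc g h) * (x * cfc g h) = cfc (cutoff ε) h := by
    rw [e1, star_mul, hgs, mul_assoc, ← mul_assoc (star x), ← hh, ← mul_assoc]
  have hu : ‖x * cfc g h‖ ≤ 1 := by
    have h3 : ‖x * cfc g h‖ * ‖x * cfc g h‖ ≤ 1 := by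
      rw [← CStarRing.norm_star_mul_self, e2]
      refine norm_cfc_le zero_le_one fun t _ => ?_
      rw [Real.norm_of_nonneg (cutoff_nonneg hε t)]
      exact cutoff_le_one hε t
    nlinarith [norm_nonneg (x * cfc g h)]
  refine le_of_eq_of_le ?_ (tr_conj_le (τ := τ) hM h0 (mul_mem hx (cfc_mem hM g)) hu)
  congr 1
  rw [e1, star_mul, hgs]
  simp only [mul_assoc]

theorem tr_mul_star_le {x : H →L[ℂ] H} (hx : x ∈ M) :
    tr τ (x * star x) ≤ tr τ (star x * x) := by
  obtain ⟨h, hh⟩ : ∃ h, h = star x * x := ⟨_, rfl⟩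
  rw [← hh]
  have hM : h ∈ M := hh ▸ star_mul_mem hx
  have hc : ∀ k, Continuous (cutoff (epsSeq k)) := fun k => continuous_cutoff (epsSeq_pos k)
  refine tr_le_of_monotone_tendsto (a := fun k => x * cfc (cutoff (epsSeq k)) h * star x)
    (fun k => mul_mem (mul_mem hx (cfc_mem hM _)) (star_mem' hx))
    (fun k => mul_mul_star_nonneg (cfc_nonneg fun t _ => cutoff_nonneg (epsSeq_pos k) t) x)
    (fun k l hkl => mul_mul_star_mono (cfc_mono
      (fun t _ => cutoff_anti (epsSeq_pos l) (epsSeq_anti hkl) t)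
      (hc k).continuousOn (hc l).continuousOn) x) ?_
    fun k => tr_conj_cutoff_le hx hh (epsSeq_pos k)
  rw [tendsto_iff_norm_sub_tendsto_zero]
  exact squeeze_zero (fun _ => norm_nonneg _)
    (fun k => norm_conj_cutoff_sub_le hh (epsSeq_pos k)) tendsto_epsSeq

/-- The trace property `τ(x x*) = τ(x* x)`. -/
theorem tr_mul_star {x : H →L[ℂ] H} (hx : x ∈ M) :
    tr τ (x * star x) = tr τ (star x * x) := by
  refine le_antisymm (tr_mul_star_le hx) ?_
  have := tr_mul_star_le (τ := τ) (star_mem' hx)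
  rwa [star_star] at this

/-- `τ(√a b √a) = τ(√b a √b)`. -/
theorem tr_sqrt_mul_mul_sqrt {a b : H →L[ℂ] H} (ha : a ∈ M) (ha0 : 0 ≤ a) (hb : b ∈ M)
    (hb0 : 0 ≤ b) :
    tr τ (CFC.sqrt a * b * CFC.sqrt a) = tr τ (CFC.sqrt b * a * CFC.sqrt b) := by
  have h := tr_mul_star (τ := τ) (mul_mem (sqrt_mem ha ha0) (sqrt_mem hb hb0))
  rw [star_mul, star_sqrt, star_sqrt] at h
  have e1 := CFC.sqrt_mul_sqrt_self a ha0
  have e2 := CFC.sqrt_mul_sqrt_self b hb0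
  rw [mul_assoc, ← mul_assoc (CFC.sqrt b), e2, ← mul_assoc] at h
  rw [h, mul_assoc, ← mul_assoc (CFC.sqrt a), e1, ← mul_assoc]

/-- If `h ≤ a` and `a ≥ 0`, then `τ(h₊) ≤ τ(a)`. The cut-offs `e` of `h` are contractions that
commute with `h`, and `e h e ≤ e a e`, where `e h e` increases to `h₊`. -/
theorem tr_posPart_le {h a : H →L[ℂ] H} (hM : h ∈ M) (hsa : IsSelfAdjoint h) (ha : a ∈ M)
    (ha0 : 0 ≤ a) (hle : h ≤ a) : tr τ (cfc (fun t : ℝ => max t 0) h) ≤ tr τ a := by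
  have hc : ∀ k, Continuous (cutoff (epsSeq k)) := fun k => continuous_cutoff (epsSeq_pos k)
  have hfc : ∀ k, Continuous fun t => cutoff (epsSeq k) t * max t 0 * cutoff (epsSeq k) t :=
    fun k => by have := hc k; fun_prop
  refine tr_le_of_monotone_tendsto
    (a := fun k => cfc (fun t => cutoff (epsSeq k) t * max t 0 * cutoff (epsSeq k) t) h)
    (fun k => cfc_mem hM _) (fun k => cfc_nonneg fun t _ => ?_) ?_ ?_ fun k => ?_
  · have := cutoff_nonneg (epsSeq_pos k) t
    have := le_max_right t 0
    positivity
  · intro k l hkl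
    refine cfc_mono (fun t _ => ?_) (hfc k).continuousOn (hfc l).continuousOn
    have h1 := cutoff_anti (epsSeq_pos l) (epsSeq_anti hkl) t
    have h2 := cutoff_nonneg (epsSeq_pos k) t
    have h3 := le_max_right t 0
    have h4 := h2.trans h1
    gcongr
  · rw [tendsto_iff_norm_sub_tendsto_zero]
    refine squeeze_zero (g := fun k => 2 * epsSeq k) (fun _ => norm_nonneg _) (fun k => ?_)
      (by simpa using tendsto_epsSeq.const_mul 2)
    have hε := epsSeq_pos k
    rw [← cfc_sub _ _ h (hfc k).continuousOn (by fun_prop)]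
    refine norm_cfc_le (by positivity) fun t _ => ?_
    have h1 := max_mul_one_sub_cutoff_le hε t
    have h2 := cutoff_nonneg hε t
    have h3 := cutoff_le_one hε t
    have h4 := le_max_right t 0
    have e : cutoff (epsSeq k) t * max t 0 * cutoff (epsSeq k) t - max t 0
      = -((max t 0 * (1 - cutoff (epsSeq k) t)) * (1 + cutoff (epsSeq k) t)) := by ring
    have h5 : 0 ≤ max t 0 * (1 - cutoff (epsSeq k) t) := mul_nonneg h4 (by linarith)
    rw [e, norm_neg, Real.norm_of_nonneg (mul_nonneg h5 (by linarith))]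
    nlinarith
  · have hε := epsSeq_pos k
    set e := cfc (cutoff (epsSeq k)) h with he
    have hes : star e = e := star_cfc _ h
    have heM : e ∈ M := cfc_mem hM _
    have e1 : cfc (fun t => cutoff (epsSeq k) t * max t 0 * cutoff (epsSeq k) t) h
        = e * h * star e := by
      rw [hes, he, cfc_mul_self_mul_cfc hsa (hc k)]
      refine cfc_congr fun t _ => ?_
      rcases le_total t 0 with ht | ht
      · simp [cutoff, ht]
      · simp [ht]
    have hne : ‖e‖ ≤ 1 := norm_cfc_le zero_le_one fun t _ => by
      rw [Real.norm_of_nonneg (cutoff_nonneg hε t)]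
      exact cutoff_le_one hε t
    calc _ ≤ tr τ (e * a * star e) := by
          refine tr_mono (cfc_mem hM _) (cfc_nonneg fun t _ => ?_)
            (mul_mem (mul_mem heM ha) (star_mem' heM)) ?_
          · have := cutoff_nonneg hε t
            have := le_max_right t 0
            positivity
          · rw [e1]
            exact mul_mul_star_mono hle e
      _ ≤ tr τ a := tr_conj_le ha ha0 heM hne

end Traciality

/-! ### Monotone nets and exhaustion -/

section Exhaustion

/-- Bounded increasing nets of operators converge weakly. -/
theorem exists_weak_limit {ι : Type*} [Preorder ι] [IsDirectedOrder ι] [Nonempty ι]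
    (F : ι → H →L[ℂ] H) (hmono : Monotone F) (h0 : ∀ i, 0 ≤ F i) (k : H →L[ℂ] H)
    (hk : ∀ i, F i ≤ k) :
    ∃ b : H →L[ℂ] H, ∀ x z : H, Tendsto (fun i => ⟪x, F i z⟫_ℂ) atTop (𝓝 ⟪x, b z⟫_ℂ) := by
  have hquad : ∀ x : H, ∃ l : ℂ, Tendsto (fun i => ⟪F i x, x⟫_ℂ) atTop (𝓝 l) := by
    intro x
    have hre : ∀ i, ⟪F i x, x⟫_ℂ = ((⟪x, F i x⟫_ℂ).re : ℂ) := fun i => by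
      have h := (nonneg_iff_inner _).1 (h0 i) x
      rw [← inner_conj_symm, ← Complex.conj_ofReal]
      congr 1
      exact Complex.ext rfl (Complex.le_def.1 h).2.symm
    have hm : Monotone fun i => (⟪x, F i x⟫_ℂ).re := fun i j hij =>
      (Complex.le_def.1 ((le_iff_inner _ _).1 (hmono hij) x)).1
    have hb : BddAbove (range fun i => (⟪x, F i x⟫_ℂ).re) := by
      refine ⟨(⟪x, k x⟫_ℂ).re, ?_⟩
      rintro _ ⟨i, rfl⟩
      exact (Complex.le_def.1 ((le_iff_inner _ _).1 (hk i) x)).1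
    refine ⟨((⨆ i, (⟪x, F i x⟫_ℂ).re : ℝ) : ℂ), ?_⟩
    simp only [hre]
    exact (Complex.continuous_ofReal.tendsto _).comp (tendsto_atTop_ciSup hm hb)
  choose l hl using hquad
  have hpol : ∀ x z : H, ∃ c : ℂ, Tendsto (fun i => ⟪x, F i z⟫_ℂ) atTop (𝓝 c) := by
    intro x z
    have h1 : ∀ i, ⟪x, F i z⟫_ℂ = ⟪F i x, z⟫_ℂ := fun i => by
      have : ContinuousLinearMap.adjoint (F i) = F i := (h0 i).isSelfAdjoint.star_eq
      rw [← ContinuousLinearMap.adjoint_inner_left, this]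
    refine ⟨(l (z + x) - l (z - x) + Complex.I * l (z + Complex.I • x) -
      Complex.I * l (z - Complex.I • x)) / 4, ?_⟩
    have h2 : ∀ i, ⟪x, F i z⟫_ℂ = (⟪F i (z + x), z + x⟫_ℂ - ⟪F i (z - x), z - x⟫_ℂ +
        Complex.I * ⟪F i (z + Complex.I • x), z + Complex.I • x⟫_ℂ -
        Complex.I * ⟪F i (z - Complex.I • x), z - Complex.I • x⟫_ℂ) / 4 := fun i => by
      rw [h1]
      exact inner_map_polarization (F i : H →ₗ[ℂ] H) z x
    simp only [h2]
    exact ((((hl _).sub (hl _)).add ((hl _).const_mul _)).sub ((hl _).const_mul _)).div_const _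
  choose B hB using hpol
  have hbound : ∀ x z, ‖B x z‖ ≤ ‖k‖ * ‖x‖ * ‖z‖ := by
    intro x z
    refine le_of_tendsto (hB x z).norm (Eventually.of_forall fun i => ?_)
    have h1 : ‖F i‖ ≤ ‖k‖ := CStarAlgebra.norm_le_norm_of_nonneg_of_le (h0 i) (hk i)
    calc ‖⟪x, F i z⟫_ℂ‖ ≤ ‖x‖ * ‖F i z‖ := norm_inner_le_norm _ _
      _ ≤ ‖x‖ * (‖k‖ * ‖z‖) := by
          gcongr
          exact ((F i).le_opNorm z).trans (by gcongr)
      _ = _ := by ring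
  let B₀ : H →ₗ⋆[ℂ] H →ₗ[ℂ] ℂ := LinearMap.mk₂'ₛₗ (starRingEnd ℂ) (RingHom.id ℂ) B
    (fun x x' z => tendsto_nhds_unique (hB (x + x') z)
      (by simpa [inner_add_left] using (hB x z).add (hB x' z)))
    (fun c x z => tendsto_nhds_unique (hB (c • x) z)
      (by simpa [inner_smul_left, mul_comm] using (hB x z).const_mul (starRingEnd ℂ c)))
    (fun x z z' => tendsto_nhds_unique (hB x (z + z'))
      (by simpa [inner_add_right] using (hB x z).add (hB x z')))
    (fun c x z => tendsto_nhds_unique (hB x (c • z))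
      (by simpa [inner_smul_right] using (hB x z).const_mul c))
  let B₁ : H →L⋆[ℂ] H →L[ℂ] ℂ := B₀.mkContinuous₂ ‖k‖ hbound
  refine ⟨ContinuousLinearMap.adjoint (InnerProductSpace.continuousLinearMapOfBilin B₁), ?_⟩
  intro x z
  rw [ContinuousLinearMap.adjoint_inner_right, InnerProductSpace.continuousLinearMapOfBilin_apply]
  exact hB x z

variable {M : VonNeumannAlgebra H} {τ : NSFTrace M}

/-- `b` is the supremum of `S ⊆ M₊` in the sense of quadratic forms. -/
def IsWeakSup (S : Set (PosElt M)) (b : PosElt M) : Prop :=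
  ∀ x : H, IsLUB ((fun y : PosElt M => (⟪x, (y : H →L[ℂ] H) x⟫_ℂ).re) '' S)
    (⟪x, (b : H →L[ℂ] H) x⟫_ℂ).re

theorem inner_eq_re (y : PosElt M) (x : H) :
    ⟪x, (y : H →L[ℂ] H) x⟫_ℂ = ((⟪x, (y : H →L[ℂ] H) x⟫_ℂ).re : ℂ) :=
  Complex.ext rfl (Complex.le_def.1 ((nonneg_iff_inner _).1 y.2.2 x)).2.symm

theorem posElt_le_iff (y z : PosElt M) :
    y ≤ z ↔ ∀ x : H, (⟪x, (y : H →L[ℂ] H) x⟫_ℂ).re ≤ (⟪x, (z : H →L[ℂ] H) x⟫_ℂ).re := by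
  refine (le_iff_inner _ _).trans (forall_congr' fun x => ?_)
  rw [inner_eq_re y, inner_eq_re z]
  simp

theorem IsWeakSup.isLUB {S : Set (PosElt M)} {b : PosElt M} (h : IsWeakSup S b) : IsLUB S b := by
  constructor
  · intro y hy
    rw [posElt_le_iff]
    exact fun x => (h x).1 ⟨y, hy, rfl⟩
  · intro z hz
    rw [posElt_le_iff]
    intro x
    refine (h x).2 ?_
    rintro _ ⟨y, hy, rfl⟩
    exact (posElt_le_iff _ _).1 (hz hy) x

theorem exists_isWeakSup {S : Set (PosElt M)} (hne : S.Nonempty) (hdir : DirectedOn (· ≤ ·) S)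
    (k : PosElt M) (hk : ∀ y ∈ S, y ≤ k) : ∃ b : PosElt M, IsWeakSup S b := by
  have : Nonempty S := hne.to_subtype
  have : IsDirectedOrder S := ⟨directedOn_iff_directed.1 hdir⟩
  obtain ⟨b, hb⟩ := exists_weak_limit (fun y : S => (y.1 : H →L[ℂ] H)) (fun _ _ h => h)
    (fun y => y.1.2.2) k (fun y => hk y y.2)
  have hbM : b ∈ M := by
    rw [mem_iff_commute]
    intro g hg
    ext z
    refine ext_inner_left ℂ fun x => ?_
    change ⟪x, g (b z)⟫_ℂ = ⟪x, b (g z)⟫_ℂ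
    rw [← ContinuousLinearMap.adjoint_inner_left]
    refine tendsto_nhds_unique (hb _ _) ?_
    refine (hb x (g z)).congr fun y => ?_
    rw [ContinuousLinearMap.adjoint_inner_left]
    have h1 : g * (y.1 : H →L[ℂ] H) = (y.1 : H →L[ℂ] H) * g :=
      (mem_iff_commute _).1 y.1.2.1 g hg
    exact congrArg (fun a : H →L[ℂ] H => ⟪x, a z⟫_ℂ) h1.symm
  have hb0 : 0 ≤ b := by
    rw [nonneg_iff_inner]
    exact fun x => ge_of_tendsto (hb x x)
      (Eventually.of_forall fun y => (nonneg_iff_inner _).1 y.1.2.2 x)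
  refine ⟨⟨b, hbM, hb0⟩, fun x => ?_⟩
  have h1 := (Complex.continuous_re.tendsto _).comp (hb x x)
  have h2 : Monotone fun y : S => (⟪x, (y.1 : H →L[ℂ] H) x⟫_ℂ).re := fun y z hyz =>
    (posElt_le_iff _ _).1 hyz x
  have h3 := isLUB_of_tendsto_atTop h2 h1
  rw [image_eq_range]
  exact h3

/-- Normality of `x ↦ τ(w* x w)`. -/
theorem IsWeakSup.tr_conj_le {S : Set (PosElt M)} {b : PosElt M} (h : IsWeakSup S b)
    (hne : S.Nonempty) (hdir : DirectedOn (· ≤ ·) S) {w : H →L[ℂ] H} (hw : w ∈ M) {K : ℝ≥0∞}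
    (hK : ∀ y ∈ S, tr τ (star w * (y : H →L[ℂ] H) * w) ≤ K) :
    tr τ (star w * (b : H →L[ℂ] H) * w) ≤ K := by
  let f : PosElt M → PosElt M := fun y => ⟨star w * y * w,
    mul_mem (mul_mem (star_mem' hw) y.2.1) hw, star_mul_mul_nonneg y.2.2 w⟩
  have hf : ∀ y (x : H), ⟪x, (f y : H →L[ℂ] H) x⟫_ℂ = ⟪w x, (y : H →L[ℂ] H) (w x)⟫_ℂ := by
    intro y x
    change ⟪x, (ContinuousLinearMap.adjoint w) ((y : H →L[ℂ] H) (w x))⟫_ℂ = _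
    rw [ContinuousLinearMap.adjoint_inner_right]
  have hsup : IsWeakSup (f '' S) (f b) := by
    intro x
    have := h (w x)
    rw [image_image]
    simpa only [hf] using this
  have hdir' : DirectedOn (· ≤ ·) (f '' S) := by
    rintro _ ⟨y, hy, rfl⟩ _ ⟨z, hz, rfl⟩
    obtain ⟨u, hu, h1, h2⟩ := hdir y hy z hz
    exact ⟨f u, ⟨u, hu, rfl⟩, star_mul_mul_mono h1 w, star_mul_mul_mono h2 w⟩
  have := τ.normal _ _ (hne.image f) hdir' hsup.isLUB
  rw [show star w * (b : H →L[ℂ] H) * w = (f b : H →L[ℂ] H) from rfl, tr_coe, this]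
  refine iSup₂_le ?_
  rintro _ ⟨y, hy, rfl⟩
  rw [← tr_coe]
  exact hK y hy

/-- Exhaustion: a property of positive elements that is stable under directed suprema holds for a
maximal element below a given `k`. -/
theorem exists_maximal_le (P : PosElt M → Prop) (hP0 : P ⟨0, zero_mem M, le_rfl⟩)
    (hsup : ∀ (S : Set (PosElt M)) (b : PosElt M), S.Nonempty → DirectedOn (· ≤ ·) S →
      (∀ y ∈ S, P y) → IsWeakSup S b → P b) (k : PosElt M) :
    ∃ e : PosElt M, P e ∧ e ≤ k ∧ ∀ f : PosElt M, e ≤ f → f ≤ k → P f → f = e := by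
  obtain ⟨e, -, he⟩ := zorn_le_nonempty₀ {y : PosElt M | P y ∧ y ≤ k} (fun c hc hchain y hy => by
    have hdir := hchain.directedOn
    obtain ⟨b, hb⟩ := exists_isWeakSup ⟨y, hy⟩ hdir k fun z hz => (hc hz).2
    exact ⟨b, ⟨hsup c b ⟨y, hy⟩ hdir (fun z hz => (hc hz).1) hb,
      hb.isLUB.2 fun z hz => (hc hz).2⟩, fun z hz => hb.isLUB.1 hz⟩)
    ⟨0, zero_mem M, le_rfl⟩ ⟨hP0, k.2.2⟩
  exact ⟨e, he.prop.1, he.prop.2, fun f hef hfk hf => he.eq_of_ge ⟨hf, hfk⟩ hef⟩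

theorem exists_tr_lt_top_le (τ : NSFTrace M) {k : H →L[ℂ] H} (hk : k ∈ M) (hk0 : 0 ≤ k)
    (hne : k ≠ 0) : ∃ c ∈ M, 0 ≤ c ∧ c ≤ k ∧ c ≠ 0 ∧ tr τ c < ∞ := by
  by_cases h : tr τ k = ∞
  · rw [tr_eq ⟨hk, hk0⟩] at h
    obtain ⟨y, hy, hy0, hyt⟩ := τ.semifinite _ h
    exact ⟨y, y.2.1, y.2.2, hy, hy0, by rwa [tr_coe]⟩
  · exact ⟨k, hk, hk0, le_rfl, hne, lt_top_iff_ne_top.2 h⟩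

/-- A normal semifinite trace is determined by its finite part: `τ(h)` is the supremum of the
values `τ(√c h √c)` with `0 ≤ c ≤ 1` and `τ(c) < ∞`. -/
theorem tr_le_of_forall_conj {h : H →L[ℂ] H} (hM : h ∈ M) (h0 : 0 ≤ h) {K : ℝ≥0∞}
    (hK : ∀ c ∈ M, 0 ≤ c → c ≤ 1 → tr τ c < ∞ → tr τ (CFC.sqrt c * h * CFC.sqrt c) ≤ K) :
    tr τ h ≤ K := by
  have hs := sqrt_mem hM h0
  have hss := CFC.sqrt_mul_sqrt_self h h0
  let s : (H →L[ℂ] H) → ℝ≥0∞ := fun e => ⨆ (c : H →L[ℂ] H) (_ : c ∈ M ∧ 0 ≤ c ∧ c ≤ e ∧ tr τ c < ∞),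
    tr τ (CFC.sqrt h * c * CFC.sqrt h)
  have hcM : ∀ c ∈ M, CFC.sqrt h * c * CFC.sqrt h ∈ M := fun c hc =>
    mul_mem (mul_mem hs hc) hs
  have hc0 : ∀ c : H →L[ℂ] H, 0 ≤ c → 0 ≤ CFC.sqrt h * c * CFC.sqrt h := fun c hc => by
    have := star_mul_mul_nonneg hc (CFC.sqrt h)
    rwa [star_sqrt] at this
  obtain ⟨e, he, he1, hmax⟩ := exists_maximal_le (M := M)
    (fun e => tr τ (CFC.sqrt h * (e : H →L[ℂ] H) * CFC.sqrt h) ≤ s e) (by simp)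
    (by
      intro S b hne hdir hS hb
      have := hb.tr_conj_le (τ := τ) hne hdir hs (K := s b) fun y hy => by
        rw [star_sqrt]
        refine (hS y hy).trans ?_
        refine iSup₂_le fun c hc => ?_
        exact le_iSup₂_of_le c ⟨hc.1, hc.2.1, hc.2.2.1.trans (hb.isLUB.1 hy), hc.2.2.2⟩ le_rfl
      rwa [star_sqrt] at this) ⟨1, one_mem M, zero_le_one⟩
  have he1' : (e : H →L[ℂ] H) ≤ 1 := he1
  have key : (e : H →L[ℂ] H) = 1 := by
    by_contra hne
    obtain ⟨c, hcM', hc0', hc1, hcne, hct⟩ := exists_tr_lt_top_le τ (sub_mem (one_mem M) e.2.1)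
      (sub_nonneg.2 he1') (sub_ne_zero.2 (Ne.symm hne))
    let f : PosElt M := ⟨e + c, add_mem e.2.1 hcM', add_nonneg e.2.2 hc0'⟩
    have hf : f = e := by
      refine hmax f (le_add_of_nonneg_right hc0') ?_ ?_
      · change (e : H →L[ℂ] H) + c ≤ 1
        have := add_le_add_right hc1 (e : H →L[ℂ] H)
        rwa [add_sub_cancel] at this
      · change tr τ (CFC.sqrt h * ((e : H →L[ℂ] H) + c) * CFC.sqrt h) ≤ s (e + c)
        rw [mul_add, add_mul, tr_add (hcM _ e.2.1) (hc0 _ e.2.2) (hcM _ hcM') (hc0 _ hc0')]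
        refine (add_le_add_left he _).trans ?_
        have hne' : ∃ c : H →L[ℂ] H, c ∈ M ∧ 0 ≤ c ∧ c ≤ (e : H →L[ℂ] H) ∧ tr τ c < ∞ :=
          ⟨0, zero_mem M, le_rfl, e.2.2, by simp⟩
        simp only [s]
        rw [ENNReal.biSup_add' hne']
        refine iSup₂_le fun d hd => ?_
        rw [← tr_add (hcM _ hd.1) (hc0 _ hd.2.1) (hcM _ hcM') (hc0 _ hc0'), ← add_mul, ← mul_add]
        refine le_iSup₂_of_le (d + c) ⟨add_mem hd.1 hcM', add_nonneg hd.2.1 hc0',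
          add_le_add_left hd.2.2.1 c, ?_⟩ le_rfl
        rw [tr_add hd.1 hd.2.1 hcM' hc0']
        exact ENNReal.add_lt_top.2 ⟨hd.2.2.2, hct⟩
    have : (e : H →L[ℂ] H) + c = e := congrArg Subtype.val hf
    exact hcne (by simpa using this)
  simp only [key, mul_one, hss] at he
  refine he.trans (iSup₂_le fun c hc => ?_)
  rw [tr_sqrt_mul_mul_sqrt hM h0 hc.1 hc.2.1]
  exact hK c hc.1 hc.2.1 hc.2.2.1 hc.2.2.2

end Exhaustion

/-! ### Normality of the trace and weak integrals -/

section Normality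

variable {M : VonNeumannAlgebra H} {τ : NSFTrace M}

theorem exists_re_inner_pos {k : H →L[ℂ] H} (hk0 : 0 ≤ k) (hne : k ≠ 0) :
    ∃ ξ : H, 0 < (⟪ξ, k ξ⟫_ℂ).re := by
  by_contra! h
  refine hne (le_antisymm ?_ hk0)
  rw [le_iff_inner]
  intro x
  have h1 := Complex.le_def.1 ((nonneg_iff_inner _).1 hk0 x)
  rw [Complex.le_def]
  simpa using ⟨h x, h1.2.symm⟩

/-- Below every nonzero positive element there is a nonzero element on which `τ` is dominated by
a vector functional. It is the complement of a maximal `p` with `τ(p) ≥ ⟪ξ, p ξ⟫`. -/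
theorem exists_le_forall_tr_le (τ : NSFTrace M) {k : H →L[ℂ] H} (hk : k ∈ M) (hk0 : 0 ≤ k)
    (hne : k ≠ 0) : ∃ c ∈ M, 0 ≤ c ∧ c ≤ k ∧ c ≠ 0 ∧
      ∃ ξ : H, ∀ y ∈ M, 0 ≤ y → y ≤ c → tr τ y ≤ ENNReal.ofReal (⟪ξ, y ξ⟫_ℂ).re := by
  obtain ⟨k', hk'M, hk'0, hk'k, hk'ne, hk't⟩ := exists_tr_lt_top_le τ hk hk0 hne
  obtain ⟨ξ₀, hξ₀⟩ := exists_re_inner_pos hk'0 hk'ne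
  -- scale the vector so that the vector functional exceeds `τ` at `k'`
  obtain ⟨ξ, hξ⟩ : ∃ ξ : H, tr τ k' < ENNReal.ofReal (⟪ξ, k' ξ⟫_ℂ).re := by
    set r := (⟪ξ₀, k' ξ₀⟫_ℂ).re
    obtain ⟨t, ht⟩ : ∃ t : ℝ, (tr τ k').toReal < t ^ 2 * r := by
      refine ⟨Real.sqrt (((tr τ k').toReal + 1) / r), ?_⟩
      rw [Real.sq_sqrt (by positivity), div_mul_cancel₀ _ hξ₀.ne']
      linarith
    refine ⟨(t : ℂ) • ξ₀, ?_⟩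
    have e : (⟪(t : ℂ) • ξ₀, k' ((t : ℂ) • ξ₀)⟫_ℂ).re = t ^ 2 * r := by
      rw [map_smul, inner_smul_left, inner_smul_right, Complex.conj_ofReal, ← mul_assoc,
        ← Complex.ofReal_mul, Complex.re_ofReal_mul]
      ring
    rw [e]
    exact (ENNReal.lt_ofReal_iff_toReal_lt hk't.ne).2 ht
  obtain ⟨p, hp, hpk, hmax⟩ := exists_maximal_le (M := M)
    (fun y => ENNReal.ofReal (⟪ξ, (y : H →L[ℂ] H) ξ⟫_ℂ).re ≤ tr τ y) (by simp)
    (by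
      intro S b hne hdir hS hb
      by_cases hbt : tr τ (b : H →L[ℂ] H) = ∞
      · rw [hbt]; exact le_top
      refine ENNReal.ofReal_le_of_le_toReal ((hb ξ).2 ?_)
      rintro _ ⟨y, hy, rfl⟩
      have h1 := (hS y hy).trans (tr_mono y.2.1 y.2.2 b.2.1 (hb.isLUB.1 hy))
      exact (ENNReal.ofReal_le_iff_le_toReal hbt).1 h1) ⟨k', hk'M, hk'0⟩
  have hpk' : (p : H →L[ℂ] H) ≤ k' := hpk
  refine ⟨k' - p, sub_mem hk'M p.2.1, sub_nonneg.2 hpk', (sub_le_self _ p.2.2).trans hk'k, ?_, ξ,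
    ?_⟩
  · intro h
    rw [sub_eq_zero.1 h] at hξ
    exact (hξ.trans_le hp).ne rfl
  · intro y hy hy0 hyc
    by_contra! hlt
    let f : PosElt M := ⟨p + y, add_mem p.2.1 hy, add_nonneg p.2.2 hy0⟩
    have hf : f = p := by
      refine hmax f (le_add_of_nonneg_right hy0) ?_ ?_
      · change (p : H →L[ℂ] H) + y ≤ k'
        have := add_le_add_right hyc (p : H →L[ℂ] H)
        rwa [add_sub_cancel] at this
      · change ENNReal.ofReal (⟪ξ, ((p : H →L[ℂ] H) + y) ξ⟫_ℂ).re ≤ tr τ ((p : H →L[ℂ] H) + y)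
        rw [tr_add p.2.1 p.2.2 hy hy0, add_apply, inner_add_right,
          Complex.add_re]
        exact ENNReal.ofReal_add_le.trans (add_le_add hp hlt.le)
    have h1 : (p : H →L[ℂ] H) + y = p := congrArg Subtype.val hf
    have h2 : y = 0 := by simpa using h1
    simp [h2] at hlt

theorem exists_dominated (τ : NSFTrace M) {k : H →L[ℂ] H} (hk : k ∈ M) (hk0 : 0 ≤ k)
    (hne : k ≠ 0) : ∃ c ∈ M, 0 ≤ c ∧ c ≤ k ∧ c ≠ 0 ∧
      ∃ ζ : H, ∀ x ∈ M, tr τ (x * c * star x) ≤ ENNReal.ofReal (‖x ζ‖ ^ 2) := by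
  obtain ⟨c, hcM, hc0, hck, hcne, ξ, hξ⟩ := exists_le_forall_tr_le τ hk hk0 hne
  refine ⟨c, hcM, hc0, hck, hcne, CFC.sqrt c ξ, fun x hx => ?_⟩
  have hs := sqrt_mem hcM hc0
  have hss := CFC.sqrt_mul_sqrt_self c hc0
  have e1 : tr τ (x * c * star x) = tr τ (star (x * CFC.sqrt c) * (x * CFC.sqrt c)) := by
    rw [← tr_mul_star (mul_mem hx hs), star_mul, star_sqrt, mul_assoc x (CFC.sqrt c),
      ← mul_assoc (CFC.sqrt c), hss, mul_assoc]
  set y := star (x * CFC.sqrt c) * (x * CFC.sqrt c) with hy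
  have hyM : y ∈ M := star_mul_mem (mul_mem hx hs)
  have hy0 : 0 ≤ y := star_mul_self_nonneg _
  set m : ℝ := ‖star x * x‖ + 1 with hm
  have hm0 : 0 < m := by positivity
  have hyc : ((m⁻¹ : ℝ) : ℂ) • y ≤ c := by
    have h1 : y ≤ ((‖star x * x‖ : ℝ) : ℂ) • c := by
      have := star_mul_mul_le (star_mul_self_nonneg x) (CFC.sqrt c)
      rw [star_sqrt, hss] at this
      refine le_trans (le_of_eq ?_) this
      rw [hy, star_mul, star_sqrt]
      simp only [mul_assoc]
    have h2 : y ≤ (m : ℂ) • c := by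
      refine h1.trans ?_
      rw [hm, Complex.ofReal_add, add_smul, Complex.ofReal_one, one_smul]
      exact le_add_of_nonneg_right hc0
    have h3 := smul_le_smul_ofReal h2 (inv_nonneg.2 hm0.le)
    rwa [smul_smul, ← Complex.ofReal_mul, inv_mul_cancel₀ hm0.ne', Complex.ofReal_one,
      one_smul] at h3
  have h4 := hξ _ (smul_mem' hyM _) (smul_ofReal_nonneg hy0 (inv_nonneg.2 hm0.le)) hyc
  have e2 : y = (m : ℂ) • ((m⁻¹ : ℝ) : ℂ) • y := by
    rw [smul_smul, ← Complex.ofReal_mul, mul_inv_cancel₀ hm0.ne', Complex.ofReal_one, one_smul]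
  have e3 : (⟪ξ, y ξ⟫_ℂ).re = ‖x (CFC.sqrt c ξ)‖ ^ 2 := by
    have : ⟪ξ, y ξ⟫_ℂ = ⟪x (CFC.sqrt c ξ), x (CFC.sqrt c ξ)⟫_ℂ := by
      change ⟪ξ, ContinuousLinearMap.adjoint (x * CFC.sqrt c) ((x * CFC.sqrt c) ξ)⟫_ℂ = _
      rw [ContinuousLinearMap.adjoint_inner_right]
      rfl
    rw [this, inner_self_eq_norm_sq_to_K]
    norm_cast
  rw [e1, e2, tr_smul (smul_mem' hyM _) (smul_ofReal_nonneg hy0 (inv_nonneg.2 hm0.le)) hm0.le]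
  refine (mul_le_mul_right h4 _).trans (le_of_eq ?_)
  rw [← ENNReal.ofReal_mul hm0.le, smul_apply, inner_smul_right,
    Complex.re_ofReal_mul, mul_inv_cancel_left₀ hm0.ne', e3]

/-- Riesz representation of the functionals `x ↦ ⟪w', x w⟫` when `‖x w‖₂ ≤ ‖x ζ‖`. -/
theorem exists_inner_lmul_eq (w w' : L2 τ) (ζ : H)
    (h : ∀ x (hx : x ∈ M), ‖L2.lmul hx w‖ ≤ ‖x ζ‖) :
    ∃ η : H, ∀ x (hx : x ∈ M), ⟪w', L2.lmul hx w⟫_ℂ = ⟪η, x ζ⟫_ℂ := by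
  let J : Elt M →ₗ[ℂ] H :=
    { toFun := fun x => (x : H →L[ℂ] H) ζ
      map_add' := fun _ _ => rfl
      map_smul' := fun _ _ => rfl }
  let Λ : Elt M →ₗ[ℂ] ℂ :=
    { toFun := fun x => ⟪w', L2.lmul x.2 w⟫_ℂ
      map_add' := fun x y => by
        have e : L2.lmul (x + y).2 w = L2.lmul x.2 w + L2.lmul y.2 w :=
          L2.op_injective (by simp [add_mul])
        rw [e, inner_add_right]
      map_smul' := fun c x => by
        have e : L2.lmul (c • x).2 w = c • L2.lmul x.2 w := L2.op_injective (by simp)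
        rw [e, inner_smul_right]
        rfl }
  have hΛ : ∀ x, ‖Λ x‖ ≤ ‖w'‖ * ‖J x‖ := fun x =>
    (norm_inner_le_norm _ _).trans (mul_le_mul_of_nonneg_left (h x x.2) (norm_nonneg _))
  have hker : J.ker ≤ Λ.ker := by
    intro x hx
    have h1 := hΛ x
    rw [LinearMap.mem_ker.1 hx, norm_zero, mul_zero] at h1
    exact LinearMap.mem_ker.2 (norm_le_zero_iff.1 h1)
  let ℓ : J.range →ₗ[ℂ] ℂ := (J.ker.liftQ Λ hker) ∘ₗ J.quotKerEquivRange.symm.toLinearMap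
  have hℓ : ∀ x, ℓ ⟨J x, LinearMap.mem_range_self J x⟩ = Λ x := by
    intro x
    have h1 := LinearMap.quotKerEquivRange_symm_apply_image J x (LinearMap.mem_range_self J x)
    change (J.ker.liftQ Λ hker) (J.quotKerEquivRange.symm ⟨J x, _⟩) = _
    rw [h1]
    simp
  let ℓc : StrongDual ℂ J.range := ℓ.mkContinuous ‖w'‖ (by
    rintro ⟨_, x, rfl⟩
    rw [hℓ]
    exact hΛ x)
  obtain ⟨g, hg, -⟩ := exists_extension_norm_eq J.range ℓc
  refine ⟨(InnerProductSpace.toDual ℂ H).symm g, fun x hx => ?_⟩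
  rw [InnerProductSpace.toDual_symm_apply]
  exact ((hg ⟨J ⟨x, hx⟩, ⟨x, hx⟩, rfl⟩).trans (hℓ ⟨x, hx⟩)).symm

/-- `g = ∫_0^∞ ψ(v) F(v) dv` in the weak sense. -/
def IsWeakIntegral (ψ : ℝ → ℝ) (F : ℝ → H →L[ℂ] H) (g : H →L[ℂ] H) : Prop :=
  ∀ x y : H, ⟪x, g y⟫_ℂ = ∫ v in Ioi (0 : ℝ), (ψ v : ℂ) * ⟪x, F v y⟫_ℂ

/-- The vectors `w` for which `F(v) w` is weakly continuous in `M ∩ L₂(M)` and integrates to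
`g w`, where `g` is the weak integral of `ψ F`. -/
structure IsNormalVector (ψ : ℝ → ℝ) {F : ℝ → H →L[ℂ] H} (hF : ∀ v, F v ∈ M) {g : H →L[ℂ] H}
    (hg : g ∈ M) (w : L2 τ) : Prop where
  continuous : ∀ w' : L2 τ, Continuous fun v => ⟪w', L2.lmul (hF v) w⟫_ℂ
  integral : ∀ w' : L2 τ, ⟪w', L2.lmul hg w⟫_ℂ
    = ∫ v in Ioi (0 : ℝ), (ψ v : ℂ) * ⟪w', L2.lmul (hF v) w⟫_ℂ

section

variable {ψ : ℝ → ℝ} {F : ℝ → H →L[ℂ] H} (hF : ∀ v, F v ∈ M) {g : H →L[ℂ] H} (hg : g ∈ M)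

theorem norm_inner_lmul_le {a : H →L[ℂ] H} (ha : a ∈ M) {C : ℝ} (hC : ‖a‖ ≤ C) (w w' : L2 τ) :
    ‖⟪w', L2.lmul ha w⟫_ℂ‖ ≤ C * (‖w'‖ * ‖w‖) := by
  refine (norm_inner_le_norm _ _).trans ?_
  have h1 := (L2.norm_lmul_le ha w).trans (mul_le_mul_of_nonneg_right hC (norm_nonneg _))
  calc _ ≤ ‖w'‖ * (C * ‖w‖) := by gcongr
    _ = _ := by ring

theorem integrable_inner_lmul {C : ℝ} (hC : ∀ v, ‖F v‖ ≤ C)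
    (hψ : IntegrableOn ψ (Ioi 0)) {w w' : L2 τ}
    (hc : Continuous fun v => ⟪w', L2.lmul (hF v) w⟫_ℂ) :
    IntegrableOn (fun v => (ψ v : ℂ) * ⟪w', L2.lmul (hF v) w⟫_ℂ) (Ioi 0) :=
  Integrable.mul_bdd (c := C * (‖w'‖ * ‖w‖)) hψ.ofReal hc.aestronglyMeasurable
    (ae_of_all _ fun v => norm_inner_lmul_le (hF v) (hC v) w w')

theorem IsNormalVector.add {C : ℝ} (hC : ∀ v, ‖F v‖ ≤ C) (hψ : IntegrableOn ψ (Ioi 0))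
    {w₁ w₂ : L2 τ} (h₁ : IsNormalVector ψ hF hg w₁) (h₂ : IsNormalVector ψ hF hg w₂) :
    IsNormalVector ψ hF hg (w₁ + w₂) where
  continuous w' := by
    simp only [map_add, inner_add_right]
    exact (h₁.continuous w').add (h₂.continuous w')
  integral w' := by
    simp only [map_add, inner_add_right, mul_add]
    rw [h₁.integral, h₂.integral, integral_add
      (integrable_inner_lmul hF hC hψ (h₁.continuous w'))
      (integrable_inner_lmul hF hC hψ (h₂.continuous w'))]

theorem IsNormalVector.of_approx {C : ℝ} (hC : ∀ v, ‖F v‖ ≤ C) (hψ : IntegrableOn ψ (Ioi 0))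
    {w : L2 τ} (h : ∀ ε > 0, ∃ w₁, ‖w - w₁‖ < ε ∧ IsNormalVector ψ hF hg w₁) :
    IsNormalVector ψ hF hg w := by
  have hC0 : 0 ≤ C := (norm_nonneg _).trans (hC 0)
  choose u hu hun using fun k : ℕ => h (epsSeq k) (epsSeq_pos k)
  have hlim : Tendsto (fun k => ‖w - u k‖) atTop (𝓝 0) :=
    squeeze_zero (fun _ => norm_nonneg _) (fun k => (hu k).le) tendsto_epsSeq
  have hdiff : ∀ (w' : L2 τ) {a : H →L[ℂ] H} (ha : a ∈ M) (D : ℝ), ‖a‖ ≤ D → ∀ k,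
      ‖⟪w', L2.lmul ha (u k)⟫_ℂ - ⟪w', L2.lmul ha w⟫_ℂ‖ ≤ D * (‖w'‖ * ‖w - u k‖) := by
    intro w' a ha D hD k
    rw [← inner_sub_right, ← map_sub, norm_sub_rev w]
    exact norm_inner_lmul_le ha hD _ w'
  have htend : ∀ (w' : L2 τ) {a : H →L[ℂ] H} (ha : a ∈ M),
      Tendsto (fun k => ⟪w', L2.lmul ha (u k)⟫_ℂ) atTop (𝓝 ⟪w', L2.lmul ha w⟫_ℂ) := by
    intro w' a ha
    rw [tendsto_iff_norm_sub_tendsto_zero]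
    refine squeeze_zero (fun _ => norm_nonneg _) (hdiff w' ha ‖a‖ le_rfl) ?_
    simpa using (hlim.const_mul ‖w'‖).const_mul ‖a‖
  have hcont : ∀ w' : L2 τ, Continuous fun v => ⟪w', L2.lmul (hF v) w⟫_ℂ := by
    intro w'
    refine TendstoUniformly.continuous (p := atTop)
      (F := fun k v => ⟪w', L2.lmul (hF v) (u k)⟫_ℂ) ?_
      (Frequently.of_forall fun k => (hun k).continuous w')
    rw [Metric.tendstoUniformly_iff]
    intro ε hε
    have h1 : Tendsto (fun k => C * (‖w'‖ * ‖w - u k‖)) atTop (𝓝 0) := by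
      simpa using (hlim.const_mul ‖w'‖).const_mul C
    filter_upwards [h1.eventually (gt_mem_nhds hε)] with k hk v
    rw [dist_comm, dist_eq_norm]
    exact (hdiff w' (hF v) C (hC v) k).trans_lt hk
  refine ⟨hcont, fun w' => ?_⟩
  refine tendsto_nhds_unique (htend w' hg) ?_
  simp only [(hun _).integral w']
  have hub : ∀ k, ‖u k‖ ≤ ‖w‖ + 1 := fun k => by
    have h1 : epsSeq k ≤ 1 := by
      have := epsSeq_anti (Nat.zero_le k)
      simpa [epsSeq] using this
    have h2 : ‖u k‖ ≤ ‖w‖ + ‖w - u k‖ := by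
      rw [norm_sub_rev]
      exact norm_le_norm_add_norm_sub' _ _
    linarith [hu k]
  refine tendsto_integral_of_dominated_convergence
    (fun v => ‖ψ v‖ * (C * (‖w'‖ * (‖w‖ + 1))))
    (fun k => (integrable_inner_lmul hF hC hψ ((hun k).continuous w')).aestronglyMeasurable)
    (hψ.norm.mul_const _) (fun k => ae_of_all _ fun v => ?_)
    (ae_of_all _ fun v => (htend w' (hF v)).const_mul _)
  rw [norm_mul, Complex.norm_real]
  have := norm_inner_lmul_le (hF v) (hC v) (u k) w'
  gcongr
  refine this.trans ?_
  gcongr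
  exact hub k

theorem isNormalVector_of_dominated (hFc : ∀ x y : H, Continuous fun v => ⟪x, F v y⟫_ℂ)
    (hint : IsWeakIntegral ψ F g) {w : L2 τ} {ζ : H}
    (h : ∀ x (hx : x ∈ M), ‖L2.lmul hx w‖ ≤ ‖x ζ‖) : IsNormalVector ψ hF hg w where
  continuous w' := by
    obtain ⟨η, hη⟩ := exists_inner_lmul_eq w w' ζ h
    simpa only [hη] using hFc η ζ
  integral w' := by
    obtain ⟨η, hη⟩ := exists_inner_lmul_eq w w' ζ h
    simp only [hη]
    exact hint η ζ

theorem exists_norm_lmul_le {c : H →L[ℂ] H} (hcM : c ∈ M) (hc0 : 0 ≤ c) {ζ : H}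
    (hζ : ∀ x ∈ M, tr τ (x * c * star x) ≤ ENNReal.ofReal (‖x ζ‖ ^ 2)) (w : L2 τ) :
    ∃ ζ' : H, ∀ x (hx : x ∈ M), ‖L2.lmul hx (L2.lmul hcM w)‖ ≤ ‖x ζ'‖ := by
  set D : ℝ := ‖w.op * star w.op‖ with hD
  have hD0 : 0 ≤ D := norm_nonneg _
  refine ⟨((Real.sqrt (D * ‖c‖) : ℝ) : ℂ) • ζ, fun x hx => ?_⟩
  refine le_of_sq_le_sq ?_ (norm_nonneg _)
  have hz : x * (c * w.op) ∈ M := mul_mem hx (mul_mem hcM w.mem)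
  have hcc : c * c ≤ ((‖c‖ : ℝ) : ℂ) • c := by
    have h1 := mul_mul_star_le hc0 (CFC.sqrt c)
    have hss := CFC.sqrt_mul_sqrt_self c hc0
    rw [star_sqrt, hss] at h1
    refine le_trans (le_of_eq ?_) h1
    have h2 : ∀ s d : H →L[ℂ] H, s * s = d → d * d = s * d * s := by
      rintro s _ rfl
      simp only [mul_assoc]
    exact h2 _ _ hss
  have h1 : (x * (c * w.op)) * star (x * (c * w.op))
      ≤ ((D * ‖c‖ : ℝ) : ℂ) • (x * c * star x) := by
    have e1 : (x * (c * w.op)) * star (x * (c * w.op))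
        = (x * c) * (w.op * star w.op) * star (x * c) := by
      simp only [star_mul, mul_assoc]
    have e2 : (x * c) * star (x * c) = x * (c * c) * star x := by
      simp only [star_mul, mul_assoc, hc0.isSelfAdjoint.star_eq]
    have h2 := mul_mul_star_le (mul_star_self_nonneg w.op) (x * c)
    have h3 := smul_le_smul_ofReal (mul_mul_star_mono hcc x) hD0
    rw [e2] at h2
    rw [e1]
    refine h2.trans (h3.trans (le_of_eq ?_))
    rw [mul_smul_comm, smul_mul_assoc, smul_smul, ← Complex.ofReal_mul]
  have hM2 : x * c * star x ∈ M := mul_mem (mul_mem hx hcM) (star_mem' hx)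
  have h4 : tr τ (star (x * (c * w.op)) * (x * (c * w.op)))
      ≤ ENNReal.ofReal (D * ‖c‖ * ‖x ζ‖ ^ 2) := by
    rw [← tr_mul_star hz]
    refine (tr_mono (mul_mem hz (star_mem' hz)) (mul_star_self_nonneg _)
      (smul_mem' hM2 _) h1).trans ?_
    rw [tr_smul hM2 (mul_mul_star_nonneg hc0 x) (by positivity),
      ENNReal.ofReal_mul (p := D * ‖c‖) (by positivity)]
    gcongr
    exact hζ x hx
  have h5 := (L2.lmul hx (L2.lmul hcM w)).tr_eq_ofReal
  rw [L2.op_lmul, L2.op_lmul] at h5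
  rw [h5, ENNReal.ofReal_le_ofReal_iff (by positivity)] at h4
  rw [map_smul, norm_smul, mul_pow, Complex.norm_real, Real.norm_eq_abs, sq_abs,
    Real.sq_sqrt (by positivity)]
  exact h4

/-- Along a directed supremum `b` of `S`, the vectors `y w`, `y ∈ S`, approximate `b w` in
`M ∩ L₂(M)`. -/
theorem IsWeakSup.exists_norm_lmul_sub_lt {S : Set (PosElt M)} {b : PosElt M}
    (h : IsWeakSup S b) (hne : S.Nonempty) (hdir : DirectedOn (· ≤ ·) S) (w : L2 τ) {ε : ℝ}
    (hε : 0 < ε) : ∃ y ∈ S, ‖L2.lmul b.2.1 w - L2.lmul y.2.1 w‖ < ε := by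
  set δ : ℝ := ε ^ 2 / (‖(b : H →L[ℂ] H)‖ + 1) with hδ
  have hδ0 : 0 < δ := by positivity
  have hcM : ∀ y : PosElt M, star w.op * (y : H →L[ℂ] H) * w.op ∈ M := fun y =>
    mul_mem (mul_mem (star_mem' w.mem) y.2.1) w.mem
  -- by normality some `y ∈ S` has `τ(w* (b - y) w) < δ`
  obtain ⟨y, hy, hyδ⟩ : ∃ y ∈ S,
      tr τ (star w.op * ((b : H →L[ℂ] H) - y) * w.op) < ENNReal.ofReal δ := by
    by_contra! hcon
    set t := tr τ (star w.op * (b : H →L[ℂ] H) * w.op) with ht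
    have htfin : t < ∞ := by
      have h1 := star_mul_mul_le b.2.2 w.op
      refine (tr_mono (hcM b) (star_mul_mul_nonneg b.2.2 _)
        (smul_mem' (star_mul_mem w.mem) _) h1).trans_lt ?_
      rw [tr_smul (star_mul_mem w.mem) (star_mul_self_nonneg _) (norm_nonneg _)]
      exact ENNReal.mul_lt_top ENNReal.ofReal_lt_top w.tr_lt_top
    have hle : ∀ y ∈ S, tr τ (star w.op * (y : H →L[ℂ] H) * w.op) + ENNReal.ofReal δ ≤ t := by
      intro y hy
      have hyb : (y : H →L[ℂ] H) ≤ b := h.isLUB.1 hy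
      have hd0 := sub_nonneg.2 hyb
      have e : star w.op * (b : H →L[ℂ] H) * w.op = star w.op * (y : H →L[ℂ] H) * w.op
          + star w.op * ((b : H →L[ℂ] H) - y) * w.op := by noncomm_ring
      rw [ht, e, tr_add (hcM y) (star_mul_mul_nonneg y.2.2 _)
        (mul_mem (mul_mem (star_mem' w.mem) (sub_mem b.2.1 y.2.1)) w.mem)
        (star_mul_mul_nonneg hd0 _)]
      gcongr
      exact hcon y hy
    have h2 : t ≤ t - ENNReal.ofReal δ := h.tr_conj_le hne hdir w.mem fun y hy =>
      ENNReal.le_sub_of_add_le_right ENNReal.ofReal_ne_top (hle y hy)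
    obtain ⟨y, hy⟩ := hne
    have h3 : ENNReal.ofReal δ ≤ t := le_add_self.trans (hle y hy)
    have hδ' : ENNReal.ofReal δ ≠ 0 := by simpa using hδ0
    have h4 : t ≠ 0 := fun h0 => hδ' (by simpa [h0] using h3)
    exact (ENNReal.sub_lt_self htfin.ne h4 hδ').not_ge h2
  refine ⟨y, hy, ?_⟩
  have hyb : (y : H →L[ℂ] H) ≤ b := h.isLUB.1 hy
  have hd0 : 0 ≤ (b : H →L[ℂ] H) - y := sub_nonneg.2 hyb
  have hdM : (b : H →L[ℂ] H) - y ∈ M := sub_mem b.2.1 y.2.1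
  obtain ⟨d, hd⟩ : ∃ d, d = (b : H →L[ℂ] H) - y := ⟨_, rfl⟩
  rw [← hd] at hd0 hdM hyδ
  have e1 : L2.lmul b.2.1 w - L2.lmul y.2.1 w = L2.lmul (sqrt_mem hdM hd0)
      (L2.lmul (sqrt_mem hdM hd0) w) := by
    apply L2.op_injective
    simp only [map_sub, L2.op_lmul]
    rw [← mul_assoc, CFC.sqrt_mul_sqrt_self d hd0, hd, sub_mul]
  have e2 : ENNReal.ofReal (‖L2.lmul (sqrt_mem hdM hd0) w‖ ^ 2) = tr τ (star w.op * d * w.op) := by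
    rw [← L2.tr_eq_ofReal, L2.op_lmul, star_mul, star_sqrt, mul_assoc, ← mul_assoc (CFC.sqrt d),
      CFC.sqrt_mul_sqrt_self d hd0, mul_assoc]
  rw [← e2, ENNReal.ofReal_lt_ofReal_iff hδ0] at hyδ
  have h3 := L2.norm_lmul_le (sqrt_mem hdM hd0) (L2.lmul (sqrt_mem hdM hd0) w)
  have h4 : ‖CFC.sqrt d‖ ^ 2 ≤ ‖(b : H →L[ℂ] H)‖ := by
    rw [sq, ← CStarRing.norm_star_mul_self, star_sqrt, CFC.sqrt_mul_sqrt_self d hd0]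
    exact CStarAlgebra.norm_le_norm_of_nonneg_of_le hd0 (hd ▸ sub_le_self _ y.2.2)
  rw [e1]
  refine lt_of_pow_lt_pow_left₀ 2 hε.le ?_
  calc _ ≤ (‖CFC.sqrt d‖ * ‖L2.lmul (sqrt_mem hdM hd0) w‖) ^ 2 := by gcongr
    _ = ‖CFC.sqrt d‖ ^ 2 * ‖L2.lmul (sqrt_mem hdM hd0) w‖ ^ 2 := mul_pow _ _ _
    _ ≤ (‖(b : H →L[ℂ] H)‖ + 1) * ‖L2.lmul (sqrt_mem hdM hd0) w‖ ^ 2 := by gcongr; linarith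
    _ < (‖(b : H →L[ℂ] H)‖ + 1) * δ := by gcongr
    _ = ε ^ 2 := by rw [hδ]; field_simp

/-- Normality of the trace: the functionals `x ↦ ⟪w', x w⟫` of `M ∩ L₂(M)` commute with weak
integrals. -/
theorem isNormalVector {C : ℝ} (hC : ∀ v, ‖F v‖ ≤ C) (hψ : IntegrableOn ψ (Ioi 0))
    (hFc : ∀ x y : H, Continuous fun v => ⟪x, F v y⟫_ℂ) (hint : IsWeakIntegral ψ F g)
    (w : L2 τ) : IsNormalVector ψ hF hg w := by
  have h0 : IsNormalVector ψ hF hg (0 : L2 τ) :=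
    isNormalVector_of_dominated hF hg hFc hint (ζ := 0) fun x hx => by simp
  obtain ⟨e, he, he1, hmax⟩ := exists_maximal_le (M := M)
    (fun e => ∀ w : L2 τ, IsNormalVector ψ hF hg (L2.lmul e.2.1 w))
    (by
      intro w
      have : L2.lmul (zero_mem M) w = 0 := L2.op_injective (by simp)
      rw [this]
      exact h0)
    (by
      intro S b hne hdir hS hb w
      refine IsNormalVector.of_approx hF hg hC hψ fun ε hε => ?_
      obtain ⟨y, hy, hlt⟩ := hb.exists_norm_lmul_sub_lt hne hdir w hε
      exact ⟨_, hlt, hS y hy w⟩) ⟨1, one_mem M, zero_le_one⟩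
  have he1' : (e : H →L[ℂ] H) ≤ 1 := he1
  have key : (e : H →L[ℂ] H) = 1 := by
    by_contra hne
    obtain ⟨c, hcM, hc0, hc1, hcne, ζ, hζ⟩ := exists_dominated τ (sub_mem (one_mem M) e.2.1)
      (sub_nonneg.2 he1') (sub_ne_zero.2 (Ne.symm hne))
    let f : PosElt M := ⟨e + c, add_mem e.2.1 hcM, add_nonneg e.2.2 hc0⟩
    have hf : f = e := by
      refine hmax f (le_add_of_nonneg_right hc0) ?_ fun w => ?_
      · change (e : H →L[ℂ] H) + c ≤ 1
        have := add_le_add_right hc1 (e : H →L[ℂ] H)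
        rwa [add_sub_cancel] at this
      · obtain ⟨ζ', hζ'⟩ := exists_norm_lmul_le hcM hc0 hζ w
        have e1 : L2.lmul f.2.1 w = L2.lmul e.2.1 w + L2.lmul hcM w :=
          L2.op_injective (by simp [f, add_mul])
        rw [e1]
        exact (he w).add hF hg hC hψ (isNormalVector_of_dominated hF hg hFc hint hζ')
    have : (e : H →L[ℂ] H) + c = e := congrArg Subtype.val hf
    exact hcne (by simpa using this)
  have e1 : L2.lmul e.2.1 w = w := L2.op_injective (by simp [key])
  rw [← e1]
  exact he w

end

end Normality

/-! ### Traces of powers -/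

section Powers

variable {M : VonNeumannAlgebra H} {τ : NSFTrace M}

/-- The power `a₊ ^ r` of the positive part of `a`. -/
def pw (r : ℝ) (a : H →L[ℂ] H) : H →L[ℂ] H := cfc (fun t : ℝ => max t 0 ^ r) a

/-- The positive part `(a - lam)₊`. -/
def excess (lam : ℝ) (a : H →L[ℂ] H) : H →L[ℂ] H := cfc (fun t : ℝ => max (t - lam) 0) a

theorem pw_mem {a : H →L[ℂ] H} (ha : a ∈ M) (r : ℝ) : pw r a ∈ M := cfc_mem ha _

theorem pw_nonneg (r : ℝ) (a : H →L[ℂ] H) : 0 ≤ pw r a :=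
  cfc_nonneg fun t _ => Real.rpow_nonneg (le_max_right t 0) r

theorem excess_mem {a : H →L[ℂ] H} (ha : a ∈ M) (lam : ℝ) : excess lam a ∈ M := cfc_mem ha _

theorem excess_nonneg (lam : ℝ) (a : H →L[ℂ] H) : 0 ≤ excess lam a :=
  cfc_nonneg fun _ _ => le_max_right _ _

theorem continuous_max_rpow {r : ℝ} (hr : 0 ≤ r) : Continuous fun t : ℝ => max t 0 ^ r :=
  (continuous_id.max continuous_const).rpow_const fun _ => Or.inr hr

theorem cfc_shift {f : ℝ → ℝ} (hf : Continuous f) {a : H →L[ℂ] H} (ha : IsSelfAdjoint a)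
    (lam : ℝ) : cfc f (a - (lam : ℂ) • 1) = cfc (fun t => f (t - lam)) a := by
  have e : a - (lam : ℂ) • 1 = cfc (fun t : ℝ => t - lam) a := by
    rw [cfc_sub (fun t : ℝ => t) (fun _ => lam) a (by fun_prop) (by fun_prop), cfc_id' ℝ a,
      cfc_const lam a, Algebra.algebraMap_eq_smul_one, ← Complex.coe_smul]
  rw [e, ← cfc_comp' f (fun t : ℝ => t - lam) a (hf.continuousOn) (by fun_prop)]

theorem isSelfAdjoint_smul_one (lam : ℝ) : IsSelfAdjoint ((lam : ℂ) • (1 : H →L[ℂ] H)) := by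
  rw [isSelfAdjoint_iff, star_smul, star_one]
  simp

theorem sub_smul_one_le_excess {a : H →L[ℂ] H} (ha : IsSelfAdjoint a) (lam : ℝ) :
    a - (lam : ℂ) • 1 ≤ excess lam a := by
  have h := cfc_shift continuous_id ha lam
  rw [cfc_id ℝ _ (ha.sub (isSelfAdjoint_smul_one lam))] at h
  rw [h]
  exact cfc_mono (fun t _ => le_max_left _ _) (by fun_prop) (by fun_prop)

/-- If `h - lam ≤ a` with `a ≥ 0`, then `τ((h - lam)₊) ≤ τ(a)`. -/
theorem tr_excess_le {h a : H →L[ℂ] H} (hM : h ∈ M) (hsa : IsSelfAdjoint h) (ha : a ∈ M)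
    (ha0 : 0 ≤ a) {lam : ℝ} (hle : h - (lam : ℂ) • 1 ≤ a) : tr τ (excess lam h) ≤ tr τ a := by
  have := tr_posPart_le (τ := τ) (sub_mem hM (smul_mem' (one_mem M) (lam : ℂ)))
    (hsa.sub (isSelfAdjoint_smul_one lam)) ha ha0 hle
  rwa [cfc_shift (f := fun t => max t 0) (by fun_prop) hsa] at this

/-- Functional calculi of `a` in the left translates of a monotone function `f` increase to
`f(a)`. -/
theorem tr_cfc_le_of_shift {f : ℝ → ℝ} (hf : Continuous f) (hmono : Monotone f)
    (h0 : ∀ t, 0 ≤ f t) {a : H →L[ℂ] H} (ha : a ∈ M) {K : ℝ≥0∞}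
    (hK : ∀ δ > 0, tr τ (cfc (fun t => f (t - δ)) a) ≤ K) : tr τ (cfc f a) ≤ K := by
  refine tr_le_of_monotone_tendsto (a := fun k => cfc (fun t => f (t - epsSeq k)) a)
    (fun k => cfc_mem ha _) (fun k => cfc_nonneg fun t _ => h0 _) ?_ ?_
    (fun k => hK _ (epsSeq_pos k))
  · intro k l hkl
    exact cfc_mono (fun t _ => hmono (by linarith [epsSeq_anti hkl]))
      (by fun_prop) (by fun_prop)
  · refine tendsto_cfc_fun ?_ (Eventually.of_forall fun k => by fun_prop)
    intro u hu
    have hc : ContinuousOn (Function.uncurry fun δ t : ℝ => f (t - δ))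
        (univ ×ˢ spectrum ℝ a) := by
      apply Continuous.continuousOn
      fun_prop
    obtain ⟨v, hv, hvu⟩ := (ContinuousFunctionalCalculus.isCompact_spectrum (R := ℝ) a).mem_uniformity_of_prod
      hc (mem_univ (0 : ℝ)) (symm_le_uniformity hu)
    rw [nhdsWithin_univ] at hv
    filter_upwards [tendsto_epsSeq hv] with k hk t ht
    have := hvu _ hk t ht
    simpa using this

/-- Upper dyadic estimate: `∑ᵢ λᵢ^{r-1} (t - λᵢ)₊ ≤ C t^r` over `λᵢ = 2^i δ`, by comparison with
the telescoping sum of `min(t, λᵢ/2)^{r-1} t`. -/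
theorem sum_dyadic_le {r : ℝ} (hr : 1 < r) {δ : ℝ} (hδ : 0 < δ) (L : ℕ) (t : ℝ) :
    ∑ i ∈ Finset.range L, (2 ^ i * δ) ^ (r - 1) * max (t - 2 ^ i * δ) 0
      ≤ (1 - (1 / 2 : ℝ) ^ (r - 1))⁻¹ * max t 0 ^ r := by
  have hr' : 0 < r - 1 := by linarith
  have hq1 : (1 / 2 : ℝ) ^ (r - 1) < 1 := Real.rpow_lt_one (by norm_num) (by norm_num) hr'
  have hC : 0 < (1 - (1 / 2 : ℝ) ^ (r - 1))⁻¹ := inv_pos.2 (by linarith)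
  rcases le_or_gt t 0 with ht | ht
  · have h0 : ∀ i ∈ Finset.range L,
        (2 ^ i * δ) ^ (r - 1) * max (t - 2 ^ i * δ) 0 = 0 := fun i _ => by
      have : 0 < 2 ^ i * δ := by positivity
      rw [max_eq_right (by linarith), mul_zero]
    rw [Finset.sum_eq_zero h0]
    have := le_max_right t 0
    positivity
  let m : ℕ → ℝ := fun i => min t (2 ^ i * δ / 2) ^ (r - 1) * t
  have hm : ∀ i, (2 ^ i * δ) ^ (r - 1) * max (t - 2 ^ i * δ) 0
      ≤ (1 - (1 / 2 : ℝ) ^ (r - 1))⁻¹ * (m (i + 1) - m i) := by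
    intro i
    have hl : 0 < 2 ^ i * δ := by positivity
    have e : (2 : ℝ) ^ (i + 1) * δ / 2 = 2 ^ i * δ := by ring
    simp only [m, e]
    rcases le_or_gt t (2 ^ i * δ) with h | h
    · rw [max_eq_right (by linarith), mul_zero]
      refine mul_nonneg hC.le (sub_nonneg.2 ?_)
      gcongr
      linarith
    · rw [max_eq_left (by linarith), min_eq_right h.le, min_eq_right (by linarith)]
      have e2 : (2 ^ i * δ / 2) ^ (r - 1) = (2 ^ i * δ) ^ (r - 1) * (1 / 2 : ℝ) ^ (r - 1) := by
        rw [← Real.mul_rpow hl.le (by norm_num)]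
        ring_nf
      have hl' : 0 ≤ (2 ^ i * δ) ^ (r - 1) := by positivity
      have hne : 1 - (1 / 2 : ℝ) ^ (r - 1) ≠ 0 := by linarith
      rw [e2]
      have e3 : (1 - (1 / 2 : ℝ) ^ (r - 1))⁻¹ * ((2 ^ i * δ) ^ (r - 1) * t
          - (2 ^ i * δ) ^ (r - 1) * (1 / 2 : ℝ) ^ (r - 1) * t) = (2 ^ i * δ) ^ (r - 1) * t := by
        field_simp
      rw [e3]
      gcongr
      linarith
  calc _ ≤ ∑ i ∈ Finset.range L, (1 - (1 / 2 : ℝ) ^ (r - 1))⁻¹ * (m (i + 1) - m i) :=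
        Finset.sum_le_sum fun i _ => hm i
    _ = (1 - (1 / 2 : ℝ) ^ (r - 1))⁻¹ * (m L - m 0) := by
        rw [← Finset.mul_sum, Finset.sum_range_sub]
    _ ≤ _ := by
        have h0 : 0 ≤ m 0 := by simp only [m]; positivity
        have hL : m L ≤ max t 0 ^ r := by
          have e : max t 0 ^ r = t ^ (r - 1) * t := by
            rw [max_eq_left ht.le, Real.rpow_sub_one ht.ne']
            field_simp
          rw [e]
          simp only [m]
          gcongr
          exact min_le_left _ _
        gcongr
        linarith

/-- Lower dyadic estimate. -/
theorem le_sum_dyadic {r : ℝ} (hr : 1 < r) {δ : ℝ} (hδ : 0 < δ) (L : ℕ) {t : ℝ}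
    (ht : t < 8 * (2 ^ L * δ)) : max (t - 4 * δ) 0 ^ r ≤
      2 * 8 ^ (r - 1) *
        ∑ i ∈ Finset.range (L + 1), (2 ^ i * δ) ^ (r - 1) * max (t - 2 * (2 ^ i * δ)) 0 := by
  have h0 : ∀ i ∈ Finset.range (L + 1),
      0 ≤ (2 ^ i * δ) ^ (r - 1) * max (t - 2 * (2 ^ i * δ)) 0 := fun i _ => by
    have := le_max_right (t - 2 * (2 ^ i * δ)) 0
    positivity
  rcases lt_or_ge t (4 * δ) with h | h
  · rw [max_eq_right (by linarith), Real.zero_rpow (by linarith)]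
    have := Finset.sum_nonneg h0
    positivity
  have h1 : 1 ≤ t / (4 * δ) := by rwa [le_div_iff₀ (by positivity), one_mul]
  obtain ⟨i, hi, hi'⟩ := exists_nat_pow_near h1 one_lt_two
  rw [le_div_iff₀ (by positivity)] at hi
  rw [div_lt_iff₀ (by positivity)] at hi'
  have ht0 : 0 < t := by nlinarith
  have hiL : i ∈ Finset.range (L + 1) := by
    rw [Finset.mem_range, Nat.lt_succ_iff]
    by_contra! hlt
    have : (2 : ℝ) ^ (L + 1) ≤ 2 ^ i := pow_le_pow_right₀ one_le_two hlt
    rw [pow_succ] at this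
    nlinarith
  have hl : 0 < 2 ^ i * δ := by positivity
  have h2 : max (t - 4 * δ) 0 ^ r ≤ t ^ r := by
    have h3 : max (t - 4 * δ) 0 ≤ t := max_le (by linarith) ht0.le
    exact Real.rpow_le_rpow (le_max_right _ _) h3 (by linarith)
  have h3 : t ^ r = t ^ (r - 1) * t := by
    rw [Real.rpow_sub_one ht0.ne']
    field_simp
  have h4 : t ^ (r - 1) ≤ 8 ^ (r - 1) * (2 ^ i * δ) ^ (r - 1) := by
    rw [← Real.mul_rpow (by norm_num) hl.le]
    refine Real.rpow_le_rpow ht0.le ?_ (by linarith)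
    rw [pow_succ] at hi'
    linarith
  have h5 : t ≤ 2 * max (t - 2 * (2 ^ i * δ)) 0 := by
    have := le_max_left (t - 2 * (2 ^ i * δ)) 0
    linarith
  calc _ ≤ t ^ (r - 1) * t := h2.trans h3.le
    _ ≤ (8 ^ (r - 1) * (2 ^ i * δ) ^ (r - 1)) * (2 * max (t - 2 * (2 ^ i * δ)) 0) := by gcongr
    _ = 2 * 8 ^ (r - 1) * ((2 ^ i * δ) ^ (r - 1) * max (t - 2 * (2 ^ i * δ)) 0) := by ring
    _ ≤ _ := by
      gcongr
      exact Finset.single_le_sum h0 hiL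

/-- The constant of the weak type comparison `tr_pw_le_of_tr_excess_le`. -/
def dyadicConst (r : ℝ) : ℝ≥0 :=
  Real.toNNReal (2 * 8 ^ (r - 1)) * Real.toNNReal ((1 - (1 / 2 : ℝ) ^ (r - 1))⁻¹)

theorem continuous_finset_sum_fun {ι : Type*} {s : Finset ι} {f : ι → ℝ → ℝ}
    (hf : ∀ i, Continuous (f i)) : Continuous (∑ i ∈ s, f i) := by
  have := continuous_finsetSum s fun i _ => hf i
  convert this using 1
  ext t
  simp

theorem abs_le_norm_of_mem_spectrum {a : H →L[ℂ] H} {t : ℝ} (ht : t ∈ spectrum ℝ a) :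
    |t| ≤ ‖a‖ := by
  refine (spectrum.norm_le_norm_mul_of_mem ht).trans ?_
  exact mul_le_of_le_one_right (norm_nonneg a) ContinuousLinearMap.norm_id_le

theorem sum_tr_excess_le {r : ℝ} (hr : 1 < r) {δ : ℝ} (hδ : 0 < δ) (L : ℕ) {a : H →L[ℂ] H}
    (ha : a ∈ M) : ∑ i ∈ Finset.range L,
      ENNReal.ofReal ((2 ^ i * δ) ^ (r - 1)) * tr τ (excess (2 ^ i * δ) a)
      ≤ Real.toNNReal ((1 - (1 / 2 : ℝ) ^ (r - 1))⁻¹) * tr τ (pw r a) := by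
  have hr' : 0 < r - 1 := by linarith
  have hq1 : (1 / 2 : ℝ) ^ (r - 1) < 1 := Real.rpow_lt_one (by norm_num) (by norm_num) hr'
  have hC : 0 < (1 - (1 / 2 : ℝ) ^ (r - 1))⁻¹ := inv_pos.2 (by linarith)
  have hc : ∀ i : ℕ, (0 : ℝ) ≤ (2 ^ i * δ) ^ (r - 1) := fun i => by positivity
  have e1 : ∀ i : ℕ, ((((2 : ℝ) ^ i * δ) ^ (r - 1) : ℝ) : ℂ) • excess (2 ^ i * δ) a
      = cfc (fun t : ℝ => (2 ^ i * δ) ^ (r - 1) * max (t - 2 ^ i * δ) 0) a := fun i => by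
    rw [excess, Complex.coe_smul, cfc_const_mul _ _ a (by fun_prop)]
  have e2 : ((((1 - (1 / 2 : ℝ) ^ (r - 1))⁻¹ : ℝ)) : ℂ) • pw r a
      = cfc (fun t : ℝ => (1 - (1 / 2 : ℝ) ^ (r - 1))⁻¹ * max t 0 ^ r) a := by
    rw [pw, Complex.coe_smul,
      cfc_const_mul _ _ a (continuous_max_rpow (by linarith)).continuousOn]
  simp only [← tr_smul (excess_mem ha _) (excess_nonneg _ a) (hc _)]
  rw [← tr_sum _ (fun i _ => smul_mem' (excess_mem ha _) _)
    (fun i _ => smul_ofReal_nonneg (excess_nonneg _ a) (hc _))]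
  change _ ≤ ENNReal.ofReal _ * _
  rw [← tr_smul (pw_mem ha r) (pw_nonneg r a) hC.le, e2]
  simp only [e1]
  rw [← cfc_sum _ a _ (fun i _ => by fun_prop)]
  refine tr_mono (cfc_mem ha _) (cfc_nonneg fun t _ => ?_) (cfc_mem ha _)
    (cfc_mono (fun t _ => ?_) ?_ ?_)
  · rw [Finset.sum_apply]
    refine Finset.sum_nonneg fun i _ => mul_nonneg (hc i) (le_max_right _ _)
  · rw [Finset.sum_apply]
    exact sum_dyadic_le hr hδ L t
  · exact (continuous_finset_sum_fun fun i => by fun_prop).continuousOn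
  · exact ((continuous_max_rpow (by linarith)).const_mul _).continuousOn

theorem tr_shift_pw_le_sum {r : ℝ} (hr : 1 < r) {δ : ℝ} (hδ : 0 < δ) {a : H →L[ℂ] H}
    (ha : a ∈ M) : ∃ L : ℕ,
    tr τ (cfc (fun t : ℝ => max (t - 4 * δ) 0 ^ r) a) ≤
      Real.toNNReal (2 * 8 ^ (r - 1)) * ∑ i ∈ Finset.range L,
        ENNReal.ofReal ((2 ^ i * δ) ^ (r - 1)) * tr τ (excess (2 * (2 ^ i * δ)) a) := by
  obtain ⟨L, hL⟩ := pow_unbounded_of_one_lt (‖a‖ / δ) one_lt_two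
  rw [div_lt_iff₀ hδ] at hL
  have hC : (0 : ℝ) ≤ 2 * 8 ^ (r - 1) := by positivity
  refine ⟨L + 1, ?_⟩
  have hc : ∀ i : ℕ, (0 : ℝ) ≤ (2 ^ i * δ) ^ (r - 1) := fun i => by positivity
  have e1 : ∀ i : ℕ, ((((2 : ℝ) ^ i * δ) ^ (r - 1) : ℝ) : ℂ) • excess (2 * (2 ^ i * δ)) a
      = cfc (fun t : ℝ => (2 ^ i * δ) ^ (r - 1) * max (t - 2 * (2 ^ i * δ)) 0) a := fun i => by
    rw [excess, Complex.coe_smul, cfc_const_mul _ _ a (by fun_prop)]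
  simp only [← tr_smul (excess_mem ha _) (excess_nonneg _ a) (hc _)]
  rw [← tr_sum _ (fun i _ => smul_mem' (excess_mem ha _) _)
    (fun i _ => smul_ofReal_nonneg (excess_nonneg _ a) (hc _))]
  change _ ≤ ENNReal.ofReal _ * _
  rw [← tr_smul (sum_mem fun i _ => smul_mem' (excess_mem ha _) _)
    (Finset.sum_nonneg fun i _ => smul_ofReal_nonneg (excess_nonneg _ a) (hc _)) hC]
  simp only [e1]
  rw [← cfc_sum _ a _ (fun i _ => by fun_prop), Complex.coe_smul, ← cfc_const_mul _ _ a
    (continuous_finset_sum_fun fun i => by fun_prop).continuousOn]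
  refine tr_mono (cfc_mem ha _) (cfc_nonneg fun t _ => ?_) (cfc_mem ha _)
    (cfc_mono (fun t ht => ?_) ?_ ?_)
  · exact Real.rpow_nonneg (le_max_right _ _) r
  · rw [Finset.sum_apply]
    refine le_sum_dyadic hr hδ L ?_
    have h1 : t ≤ ‖a‖ := (le_abs_self t).trans (abs_le_norm_of_mem_spectrum ht)
    have : 0 ≤ ‖a‖ := norm_nonneg a
    linarith
  · exact ((continuous_max_rpow (r := r) (by linarith)).comp
      (continuous_id.sub (continuous_const (y := 4 * δ)))).continuousOn
  · exact ((continuous_finset_sum_fun fun i => by fun_prop).const_mul _).continuousOn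

/-- If the distribution of `y` is controlled by those of `a` and `b`, then so are its moments of
order `r > 1`, since `t ^ r` is comparable with a sum of multiples of the functions
`(t - 2^i δ)₊`. -/
theorem tr_pw_le_of_tr_excess_le {r : ℝ} (hr : 1 < r) {y a b : H →L[ℂ] H} (hy : y ∈ M)
    (ha : a ∈ M) (hb : b ∈ M)
    (h : ∀ lam > 0, tr τ (excess (2 * lam) y) ≤ tr τ (excess lam a) + tr τ (excess lam b)) :
    tr τ (pw r y) ≤ dyadicConst r * (tr τ (pw r a) + tr τ (pw r b)) := by
  refine tr_cfc_le_of_shift (f := fun t => max t 0 ^ r) (continuous_max_rpow (by linarith))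
    (fun s t hst => ?_) (fun t => Real.rpow_nonneg (le_max_right t 0) r) hy fun δ hδ => ?_
  · exact Real.rpow_le_rpow (le_max_right _ _) (max_le_max_right _ hst) (by linarith)
  have hδ' : 0 < δ / 4 := by positivity
  obtain ⟨L, hL⟩ := tr_shift_pw_le_sum (τ := τ) hr hδ' hy
  rw [mul_div_cancel₀ δ (by norm_num)] at hL
  refine hL.trans ?_
  rw [dyadicConst, ENNReal.coe_mul, mul_assoc]
  gcongr
  rw [mul_add]
  refine le_trans ?_ (add_le_add (sum_tr_excess_le hr hδ' L ha) (sum_tr_excess_le hr hδ' L hb))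
  rw [← Finset.sum_add_distrib]
  refine Finset.sum_le_sum fun i _ => ?_
  rw [← mul_add]
  gcongr
  exact h _ (by positivity)

end Powers

/-! ### The quasi-triangle inequality -/

section Rotfeld

variable {M : VonNeumannAlgebra H} {τ : NSFTrace M}

/-- The function `t ↦ (t₊ + ε) ^ x`. -/
def regPow (ε x t : ℝ) : ℝ := (max t 0 + ε) ^ x

theorem regPow_nonneg {ε : ℝ} (hε : 0 < ε) (x t : ℝ) : 0 ≤ regPow ε x t := by
  have := le_max_right t 0
  unfold regPow; positivity

theorem continuous_regPow {ε : ℝ} (hε : 0 < ε) (x : ℝ) : Continuous (regPow ε x) := by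
  unfold regPow
  refine Continuous.rpow_const (by fun_prop) fun t => Or.inl ?_
  have := le_max_right t 0
  positivity

theorem isStrictlyPositive_add_smul {a : H →L[ℂ] H} (ha : 0 ≤ a) {ε : ℝ} (hε : 0 < ε) :
    IsStrictlyPositive (a + (ε : ℂ) • 1) := by
  refine IsStrictlyPositive.nonneg_add ha ?_
  rw [IsStrictlyPositive.iff_of_unital]
  refine ⟨smul_ofReal_nonneg zero_le_one hε.le, ?_⟩
  exact isUnit_one.smul (Units.mk0 (ε : ℂ) (by exact_mod_cast hε.ne'))

theorem cfc_regPow {a : H →L[ℂ] H} (ha : 0 ≤ a) {ε : ℝ} (hε : 0 < ε) (x : ℝ) :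
    cfc (regPow ε x) a = (a + (ε : ℂ) • 1) ^ x := by
  have e : a + (ε : ℂ) • 1 = cfc (fun t : ℝ => t + ε) a := by
    rw [cfc_add a (fun t : ℝ => t) (fun _ => ε) (by fun_prop) (by fun_prop), cfc_id' ℝ a,
      cfc_const ε a, Algebra.algebraMap_eq_smul_one, ← Complex.coe_smul]
  rw [CFC.rpow_eq_cfc_real (isStrictlyPositive_add_smul ha hε).nonneg, e,
    ← cfc_comp' (fun t : ℝ => t ^ x) (fun t : ℝ => t + ε) a ?_ (by fun_prop)]
  · refine cfc_congr fun t ht => ?_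
    rw [regPow, max_eq_left (spectrum_nonneg ha ht)]
  · rintro _ ⟨t, ht, rfl⟩
    have := spectrum_nonneg ha ht
    refine (Real.continuousAt_rpow_const _ _ (Or.inl ?_)).continuousWithinAt
    simp only
    positivity

/-- Operator antitonicity of `t ↦ (t + ε) ^ (-x)` for `0 ≤ x ≤ 1`. -/
theorem cfc_regPow_neg_anti {a b : H →L[ℂ] H} (ha : 0 ≤ a) (hab : a ≤ b) {ε : ℝ} (hε : 0 < ε)
    {x : ℝ} (hx0 : 0 ≤ x) (hx1 : x ≤ 1) : cfc (regPow ε (-x)) b ≤ cfc (regPow ε (-x)) a := by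
  have hb := ha.trans hab
  rcases hx0.eq_or_lt with rfl | hx0'
  · rw [cfc_regPow hb hε, cfc_regPow ha hε, neg_zero,
      CFC.rpow_zero _ (isStrictlyPositive_add_smul hb hε).nonneg,
      CFC.rpow_zero _ (isStrictlyPositive_add_smul ha hε).nonneg]
  have hA := isStrictlyPositive_add_smul ha hε
  have hB := isStrictlyPositive_add_smul hb hε
  rw [cfc_regPow hb hε, cfc_regPow ha hε]
  have h1 : (a + (ε : ℂ) • 1) ^ x ≤ (b + (ε : ℂ) • 1) ^ x :=
    CFC.rpow_le_rpow ⟨hx0, hx1⟩ (by gcongr)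
  have h2 := CStarAlgebra.rpow_neg_one_le_rpow_neg_one h1 (hA.rpow _ x)
  rw [CFC.rpow_rpow _ _ _ hx0'.ne' hA,
    CFC.rpow_rpow _ _ _ hx0'.ne' hB] at h2
  simpa using h2

theorem sqrt_mul_cfc_mul_sqrt {a : H →L[ℂ] H} (ha : 0 ≤ a) {g : ℝ → ℝ} (hg : Continuous g) :
    CFC.sqrt a * cfc g a * CFC.sqrt a = cfc (fun t => max t 0 * g t) a := by
  have hc : Continuous Real.sqrt := Real.continuous_sqrt
  rw [sqrt_eq_cfc_real ha, ← cfc_mul _ _ a hc.continuousOn hg.continuousOn,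
    ← cfc_mul (fun t => √t * g t) _ a (hc.mul hg).continuousOn hc.continuousOn]
  refine cfc_congr fun t ht => ?_
  have := spectrum_nonneg ha ht
  rw [max_eq_left this, mul_right_comm, Real.mul_self_sqrt this]

theorem sqrt_cfc (a : H →L[ℂ] H) {g : ℝ → ℝ} (hg : Continuous g) (hg0 : ∀ t, 0 ≤ g t) :
    CFC.sqrt (cfc g a) = cfc (fun t => √(g t)) a := by
  rw [CFC.sqrt_eq_iff _ _ (cfc_nonneg fun t _ => hg0 t) (cfc_nonneg fun t _ => Real.sqrt_nonneg _),
    ← cfc_mul _ _ a (by fun_prop) (by fun_prop)]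
  simp only [Real.mul_self_sqrt (hg0 _)]

theorem sqrt_cfc_mul_mul_sqrt_cfc {a : H →L[ℂ] H} (ha : 0 ≤ a) {g : ℝ → ℝ} (hg : Continuous g)
    (hg0 : ∀ t, 0 ≤ g t) :
    CFC.sqrt (cfc g a) * a * CFC.sqrt (cfc g a) = cfc (fun t => max t 0 * g t) a := by
  rw [sqrt_cfc a hg hg0,
    cfc_mul_self_mul_cfc (f := fun t => √(g t)) ha.isSelfAdjoint (by fun_prop)]
  refine cfc_congr fun t ht => ?_
  have := spectrum_nonneg ha ht
  rw [max_eq_left this, mul_right_comm, Real.mul_self_sqrt (hg0 t), mul_comm]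

/-- Rotfel'd's inequality in the form `τ((a + b) (a + b + ε)^{r-1}) ≤ τ(a^r) + τ(b^r)`: the two
terms on the left are `τ(√a (a + b + ε)^{r-1} √a)` and the same for `b`. -/
theorem tr_cfc_regPow_add_le {r : ℝ} (hr0 : 0 < r) (hr1 : r ≤ 1) {a b : H →L[ℂ] H} (ha : a ∈ M)
    (ha0 : 0 ≤ a) (hb : b ∈ M) (hb0 : 0 ≤ b) {ε : ℝ} (hε : 0 < ε) :
    tr τ (cfc (fun t => max t 0 * regPow ε (-(1 - r)) t) (a + b))
      ≤ tr τ (pw r a) + tr τ (pw r b) := by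
  have hg := continuous_regPow hε (-(1 - r))
  have hs0 := add_nonneg ha0 hb0
  obtain ⟨K, hK⟩ : ∃ K, K = cfc (regPow ε (-(1 - r))) (a + b) := ⟨_, rfl⟩
  have hK0 : 0 ≤ K := hK ▸ cfc_nonneg fun t _ => regPow_nonneg hε _ t
  have hKM : K ∈ M := hK ▸ cfc_mem (add_mem ha hb) _
  have hsK := sqrt_mem hKM hK0
  have key : ∀ c ∈ M, 0 ≤ c → c ≤ a + b → tr τ (CFC.sqrt K * c * CFC.sqrt K) ≤ tr τ (pw r c) := by
    intro c hc hc0 hcs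
    rw [tr_sqrt_mul_mul_sqrt hKM hK0 hc hc0]
    have hsc := sqrt_mem hc hc0
    refine tr_mono (mul_mem (mul_mem hsc hKM) hsc) ?_ (pw_mem hc r) ?_
    · have := star_mul_mul_nonneg hK0 (CFC.sqrt c)
      rwa [star_sqrt] at this
    · have h1 := star_mul_mul_mono (hK ▸ cfc_regPow_neg_anti hc0 hcs hε
        (x := 1 - r) (by linarith) (by linarith)) (CFC.sqrt c)
      rw [star_sqrt, sqrt_mul_cfc_mul_sqrt hc0 hg] at h1
      refine h1.trans (cfc_mono (fun t ht => ?_) (by fun_prop)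
        (continuous_max_rpow hr0.le).continuousOn)
      rcases (le_max_right t 0).eq_or_lt with h | h
      · rw [← h, zero_mul, Real.zero_rpow hr0.ne']
      · have e : max t 0 ^ r = max t 0 * max t 0 ^ (-(1 - r)) := by
          rw [← Real.rpow_one_add' h.le (by linarith)]
          ring_nf
        rw [e, regPow]
        refine mul_le_mul_of_nonneg_left ?_ h.le
        exact Real.rpow_le_rpow_of_nonpos h (by linarith) (by linarith)
  rw [← sqrt_cfc_mul_mul_sqrt_cfc hs0 hg (regPow_nonneg hε _), ← hK, mul_add, add_mul]
  have hpos : ∀ c, 0 ≤ c → 0 ≤ CFC.sqrt K * c * CFC.sqrt K := fun c hc => by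
    have := star_mul_mul_nonneg hc (CFC.sqrt K)
    rwa [star_sqrt] at this
  rw [tr_add (mul_mem (mul_mem hsK ha) hsK) (hpos a ha0) (mul_mem (mul_mem hsK hb) hsK)
    (hpos b hb0)]
  exact add_le_add (key a ha ha0 (le_add_of_nonneg_right hb0))
    (key b hb hb0 (le_add_of_nonneg_left ha0))

theorem rpow_sub_mul_regPow_le {r : ℝ} (hr0 : 0 < r) (hr1 : r ≤ 1) {ε : ℝ} (hε : 0 < ε) {t : ℝ}
    (ht : 0 ≤ t) : t ^ r - t * regPow ε (-(1 - r)) t ≤ ε ^ r := by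
  rw [regPow, max_eq_left ht]
  have h1 : t ^ r ≤ (t + ε) ^ r := Real.rpow_le_rpow ht (by linarith) hr0.le
  have h2 : (t + ε) ^ r = (t + ε) * (t + ε) ^ (-(1 - r)) := by
    rw [← Real.rpow_one_add' (by positivity) (by linarith)]
    ring_nf
  have h3 : (t + ε) ^ (-(1 - r)) ≤ ε ^ (-(1 - r)) :=
    Real.rpow_le_rpow_of_nonpos hε (by linarith) (by linarith)
  have h4 : ε ^ r = ε * ε ^ (-(1 - r)) := by
    rw [← Real.rpow_one_add' hε.le (by linarith)]
    ring_nf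
  nlinarith

/-- Rotfel'd's inequality `τ((a + b)^r) ≤ τ(a^r) + τ(b^r)` for `0 < r ≤ 1`. -/
theorem tr_pw_add_le_of_le_one {r : ℝ} (hr0 : 0 < r) (hr1 : r ≤ 1) {a b : H →L[ℂ] H}
    (ha : a ∈ M) (ha0 : 0 ≤ a) (hb : b ∈ M) (hb0 : 0 ≤ b) :
    tr τ (pw r (a + b)) ≤ tr τ (pw r a) + tr τ (pw r b) := by
  have hs0 := add_nonneg ha0 hb0
  have hc : ∀ k, Continuous fun t => max t 0 * regPow (epsSeq k) (-(1 - r)) t := fun k => by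
    have := continuous_regPow (epsSeq_pos k) (-(1 - r))
    fun_prop
  refine tr_le_of_monotone_tendsto
    (a := fun k => cfc (fun t => max t 0 * regPow (epsSeq k) (-(1 - r)) t) (a + b))
    (fun k => cfc_mem (add_mem ha hb) _)
    (fun k => cfc_nonneg fun t _ => mul_nonneg (le_max_right _ _)
      (regPow_nonneg (epsSeq_pos k) _ t)) ?_ ?_
    fun k => tr_cfc_regPow_add_le hr0 hr1 ha ha0 hb hb0 (epsSeq_pos k)
  · intro k l hkl
    refine cfc_mono (fun t _ => ?_) (hc k).continuousOn (hc l).continuousOn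
    have h0 := le_max_right t 0
    have := epsSeq_pos l
    have := epsSeq_anti hkl
    refine mul_le_mul_of_nonneg_left ?_ h0
    exact Real.rpow_le_rpow_of_nonpos (by positivity) (by linarith) (by linarith)
  · rw [tendsto_iff_norm_sub_tendsto_zero]
    have hlim : Tendsto (fun k => epsSeq k ^ r) atTop (𝓝 0) := by
      have := tendsto_epsSeq.rpow_const (p := r) (Or.inr hr0.le)
      rwa [Real.zero_rpow hr0.ne'] at this
    refine squeeze_zero (fun _ => norm_nonneg _) (fun k => ?_) hlim
    have hε := epsSeq_pos k
    rw [pw, ← cfc_sub _ _ _ (hc k).continuousOn (continuous_max_rpow hr0.le).continuousOn]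
    refine norm_cfc_le (by positivity) fun t ht => ?_
    have ht0 := spectrum_nonneg hs0 ht
    have h1 := rpow_sub_mul_regPow_le hr0 hr1 hε ht0
    rw [max_eq_left ht0, Real.norm_eq_abs, abs_sub_comm, abs_of_nonneg]
    · exact h1
    · rcases ht0.eq_or_lt with h | h
      · rw [← h, zero_mul, Real.zero_rpow hr0.ne', sub_zero]
      · have e : t ^ r = t * t ^ (-(1 - r)) := by
          rw [← Real.rpow_one_add' h.le (by linarith)]
          ring_nf
        rw [e, regPow, max_eq_left ht0, sub_nonneg]
        refine mul_le_mul_of_nonneg_left ?_ h.le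
        exact Real.rpow_le_rpow_of_nonpos h (by linarith) (by linarith)

theorem pw_eq_rpow {a : H →L[ℂ] H} (ha : 0 ≤ a) (r : ℝ) : pw r a = a ^ r := by
  rw [CFC.rpow_eq_cfc_real ha]
  refine cfc_congr fun t ht => ?_
  rw [max_eq_left (spectrum_nonneg ha ht)]

/-- The constant of `tr_pw_le_add`. -/
def quasiConst (r : ℝ) : ℝ≥0 := dyadicConst r + 1

/-- The quasi-triangle inequality `τ(c^r) ≤ C_r (τ(a^r) + τ(b^r))` for `0 ≤ c ≤ a + b` and all
`r > 0`. -/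
theorem tr_pw_le_add {r : ℝ} (hr : 0 < r) {a b c : H →L[ℂ] H} (ha : a ∈ M) (ha0 : 0 ≤ a)
    (hb : b ∈ M) (hb0 : 0 ≤ b) (hc : c ∈ M) (hc0 : 0 ≤ c) (h : c ≤ a + b) :
    tr τ (pw r c) ≤ quasiConst r * (tr τ (pw r a) + tr τ (pw r b)) := by
  rcases le_or_gt r 1 with hr1 | hr1
  · refine le_trans ?_ ((tr_pw_add_le_of_le_one (τ := τ) hr hr1 ha ha0 hb hb0).trans ?_)
    · refine tr_mono (pw_mem hc r) (pw_nonneg r c) (pw_mem (add_mem ha hb) r) ?_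
      rw [pw_eq_rpow hc0, pw_eq_rpow (add_nonneg ha0 hb0)]
      exact CFC.rpow_le_rpow ⟨hr.le, hr1⟩ h
    · rw [quasiConst, ENNReal.coe_add, ENNReal.coe_one, add_mul, one_mul]
      exact le_add_self
  · refine (tr_pw_le_of_tr_excess_le hr1 hc ha hb fun lam _ => ?_).trans ?_
    · rw [← tr_add (excess_mem ha _) (excess_nonneg _ _) (excess_mem hb _) (excess_nonneg _ _)]
      refine tr_excess_le hc hc0.isSelfAdjoint (add_mem (excess_mem ha _) (excess_mem hb _))
        (add_nonneg (excess_nonneg _ _) (excess_nonneg _ _)) ?_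
      have h1 := add_le_add (sub_smul_one_le_excess ha0.isSelfAdjoint lam)
        (sub_smul_one_le_excess hb0.isSelfAdjoint lam)
      refine le_trans ?_ h1
      have e : a - (lam : ℂ) • 1 + (b - (lam : ℂ) • 1) = a + b - ((2 * lam : ℝ) : ℂ) • 1 := by
        push_cast
        module
      rw [e]
      exact sub_le_sub_right h _
    · gcongr
      rw [quasiConst]
      exact le_self_add

end Rotfeld

/-! ### Moments of operators in `M` -/

section Moments

variable {M : VonNeumannAlgebra H} {τ : NSFTrace M}

/-- The moment `τ(|x| ^ r)`. -/
def moment (τ : NSFTrace M) (r : ℝ) (x : H →L[ℂ] H) : ℝ≥0∞ := tr τ (pw (r / 2) (star x * x))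

theorem lpNorm_of_ne_top {p : ℝ≥0∞} (hp : p ≠ ∞) (x : Elt M) :
    lpNorm τ p x = moment τ p.toReal (x : H →L[ℂ] H) ^ (1 / p.toReal) := by
  have h0 := star_mul_self_nonneg (x : H →L[ℂ] H)
  rw [lpNorm, if_neg hp, ← tr_coe, moment, pw_eq_rpow h0, absPow]

theorem lpNorm_ofReal {p : ℝ} (hp : 0 < p) (x : Elt M) :
    lpNorm τ (ENNReal.ofReal p) x = moment τ p (x : H →L[ℂ] H) ^ (1 / p) := by
  rw [lpNorm_of_ne_top ENNReal.ofReal_ne_top, ENNReal.toReal_ofReal hp.le]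

theorem lpNorm_top (x : Elt M) : lpNorm τ ∞ x = ‖(x : H →L[ℂ] H)‖ₑ := if_pos rfl

theorem star_mul_self_of_isSelfAdjoint {h : H →L[ℂ] H} (hh : IsSelfAdjoint h) :
    star h * h = cfc (fun t : ℝ => t * t) h := by
  rw [hh.star_eq, cfc_mul (fun t : ℝ => t) (fun t => t) h, cfc_id' ℝ h]

theorem moment_of_isSelfAdjoint {h : H →L[ℂ] H} (hh : IsSelfAdjoint h) {r : ℝ} (hr : 0 < r) :
    moment τ r h = tr τ (cfc (fun t : ℝ => |t| ^ r) h) := by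
  rw [moment, star_mul_self_of_isSelfAdjoint hh, pw,
    ← cfc_comp' (fun t : ℝ => max t 0 ^ (r / 2)) (fun t : ℝ => t * t) h
      (continuous_max_rpow (by linarith)).continuousOn (by fun_prop)]
  congr 2
  ext t
  rw [max_eq_left (mul_self_nonneg t), ← abs_mul_abs_self, ← Real.mul_rpow (abs_nonneg t)
    (abs_nonneg t) |>.symm, ← pow_two, ← Real.rpow_natCast, ← Real.rpow_mul (abs_nonneg t)]
  congr 1
  push_cast
  ring

theorem moment_of_nonneg {a : H →L[ℂ] H} (ha : 0 ≤ a) {r : ℝ} (hr : 0 < r) :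
    moment τ r a = tr τ (pw r a) := by
  rw [moment_of_isSelfAdjoint ha.isSelfAdjoint hr]
  congr 1
  refine cfc_congr fun t ht => ?_
  have := spectrum_nonneg ha ht
  rw [abs_of_nonneg this, max_eq_left this]

theorem moment_two (x : H →L[ℂ] H) : moment τ 2 x = tr τ (star x * x) := by
  rw [moment, div_self two_ne_zero, pw_eq_rpow (star_mul_self_nonneg x),
    CFC.rpow_one _ (star_mul_self_nonneg x)]

theorem pw_smul {r : ℝ} (hr : 0 < r) {c : ℝ} (hc : 0 ≤ c) {a : H →L[ℂ] H}
    (ha : IsSelfAdjoint a) : pw r ((c : ℂ) • a) = ((c ^ r : ℝ) : ℂ) • pw r a := by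
  have h1 := continuous_max_rpow hr.le
  rw [pw, pw, Complex.coe_smul, Complex.coe_smul, ← cfc_comp_smul c _ a h1.continuousOn ha,
    ← cfc_smul (c ^ r) _ a h1.continuousOn]
  congr 1
  ext t
  rw [smul_eq_mul, smul_eq_mul, ← Real.mul_rpow hc (le_max_right t 0), mul_max_of_nonneg _ _ hc,
    mul_zero]

theorem tr_pw_smul {r : ℝ} (hr : 0 < r) {c : ℝ} (hc : 0 ≤ c) {a : H →L[ℂ] H} (haM : a ∈ M)
    (ha : IsSelfAdjoint a) :
    tr τ (pw r ((c : ℂ) • a)) = ENNReal.ofReal (c ^ r) * tr τ (pw r a) := by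
  rw [pw_smul hr hc ha, tr_smul (pw_mem haM r) (pw_nonneg r a) (by positivity)]

theorem moment_smul {r : ℝ} (hr : 0 < r) (c : ℂ) {x : H →L[ℂ] H} (hx : x ∈ M) :
    moment τ r (c • x) = ENNReal.ofReal (‖c‖ ^ r) * moment τ r x := by
  have e : star (c • x) * (c • x) = ((‖c‖ ^ 2 : ℝ) : ℂ) • (star x * x) := by
    rw [star_smul, smul_mul_smul_comm, RCLike.star_def, Complex.conj_mul']
    push_cast
    rfl
  rw [moment, e, tr_pw_smul (by linarith) (by positivity) (star_mul_mem hx)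
    (star_mul_self_nonneg x).isSelfAdjoint, moment]
  congr 2
  rw [← Real.rpow_natCast, ← Real.rpow_mul (norm_nonneg c)]
  congr 1
  push_cast
  ring

/-- The constant of the quasi-triangle inequality for `moment`. -/
def momentConst (r : ℝ) : ℝ≥0 := quasiConst (r / 2) * Real.toNNReal (2 ^ (r / 2))

theorem tr_pw_two_smul_le {r : ℝ} (hr : 0 < r) {a b c : H →L[ℂ] H} (ha : a ∈ M) (ha0 : 0 ≤ a)
    (hb : b ∈ M) (hb0 : 0 ≤ b) (hc : c ∈ M) (hc0 : 0 ≤ c)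
    (h : c ≤ ((2 : ℝ) : ℂ) • a + ((2 : ℝ) : ℂ) • b) :
    tr τ (pw (r / 2) c) ≤ momentConst r * (tr τ (pw (r / 2) a) + tr τ (pw (r / 2) b)) := by
  have h2 : (0 : ℝ) ≤ 2 := by norm_num
  refine (tr_pw_le_add (by linarith) (smul_mem' ha _) (smul_ofReal_nonneg ha0 h2)
    (smul_mem' hb _) (smul_ofReal_nonneg hb0 h2) hc hc0 h).trans ?_
  rw [tr_pw_smul (by linarith) h2 ha ha0.isSelfAdjoint,
    tr_pw_smul (by linarith) h2 hb hb0.isSelfAdjoint, ← mul_add, ← mul_assoc, momentConst,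
    ENNReal.coe_mul]
  rfl

theorem moment_add_le {r : ℝ} (hr : 0 < r) {x y : H →L[ℂ] H} (hx : x ∈ M) (hy : y ∈ M) :
    moment τ r (x + y) ≤ momentConst r * (moment τ r x + moment τ r y) := by
  refine tr_pw_two_smul_le hr (star_mul_mem hx) (star_mul_self_nonneg x) (star_mul_mem hy)
    (star_mul_self_nonneg y) (star_mul_mem (add_mem hx hy)) (star_mul_self_nonneg _) ?_
  refine (star_add_mul_add_le x y one_pos).trans (le_of_eq ?_)
  norm_num

/-- `x p(x* x) = p(x x*) x` for continuous functions `p`, by polynomial approximation. -/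
theorem mul_cfc_star_mul (x : H →L[ℂ] H) {g : ℝ → ℝ} (hg : Continuous g) :
    x * cfc g (star x * x) = cfc g (x * star x) * x := by
  obtain ⟨a, ha⟩ : ∃ a, a = star x * x := ⟨_, rfl⟩
  obtain ⟨b, hb⟩ : ∃ b, b = x * star x := ⟨_, rfl⟩
  have ha0 : IsSelfAdjoint a := ha ▸ IsSelfAdjoint.star_mul_self x
  have hb0 : IsSelfAdjoint b := hb ▸ IsSelfAdjoint.mul_star_self x
  rw [← ha, ← hb]
  set R : ℝ := max ‖a‖ ‖b‖ with hR
  have hcomm : x * a = b * x := by rw [ha, hb, mul_assoc]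
  have hpow : ∀ n : ℕ, x * a ^ n = b ^ n * x := fun n =>
    ((show SemiconjBy x a b from hcomm).pow_right n)
  have hpoly : ∀ p : Polynomial ℝ, x * Polynomial.aeval a p = Polynomial.aeval b p * x := by
    intro p
    induction p using Polynomial.induction_on' with
    | add p q hp hq => rw [map_add, map_add, mul_add, add_mul, hp, hq]
    | monomial n c =>
      rw [Polynomial.aeval_monomial, Polynomial.aeval_monomial, ← Algebra.smul_def,
        ← Algebra.smul_def, mul_smul_comm, smul_mul_assoc, hpow]
  refine eq_of_forall_dist_le fun ε hε => ?_
  set δ : ℝ := ε / (2 * (‖x‖ + 1)) with hδ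
  have hx0 := norm_nonneg x
  have hδ0 : 0 < δ := by positivity
  obtain ⟨p, hp⟩ := exists_polynomial_near_of_continuousOn (-R) R g hg.continuousOn δ hδ0
  have hpc : ∀ c : H →L[ℂ] H, IsSelfAdjoint c → ‖c‖ ≤ R →
      ‖cfc g c - Polynomial.aeval c p‖ ≤ δ := by
    intro c hc hcR
    rw [← cfc_polynomial p c hc, ← cfc_sub _ _ c hg.continuousOn (by fun_prop)]
    refine norm_cfc_le hδ0.le fun t ht => ?_
    rw [Real.norm_eq_abs, abs_sub_comm]
    have h1 := abs_le.1 ((abs_le_norm_of_mem_spectrum ht).trans hcR)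
    exact (hp t h1).le
  have e : x * cfc g a - cfc g b * x
      = x * (cfc g a - Polynomial.aeval a p) - (cfc g b - Polynomial.aeval b p) * x := by
    rw [mul_sub, sub_mul, hpoly]
    abel
  rw [dist_eq_norm, e]
  refine (norm_sub_le _ _).trans ((add_le_add (norm_mul_le _ _) (norm_mul_le _ _)).trans ?_)
  have h1 := hpc a ha0 (le_max_left _ _)
  have h2 := hpc b hb0 (le_max_right _ _)
  calc _ ≤ ‖x‖ * δ + δ * ‖x‖ := by gcongr
    _ = ε * (‖x‖ / (‖x‖ + 1)) := by rw [hδ]; field_simp; ring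
    _ ≤ ε * 1 := by
      gcongr
      rw [div_le_one (by positivity)]
      linarith
    _ = ε := mul_one ε

/-- `τ(f(x x*)) = τ(f(x* x))` for `f(t) = t g(t)²`: with `y = x g(x* x)` one has
`y* y = f(x* x)` and `y y* = f(x x*)`. -/
theorem tr_cfc_mul_star_eq {x : H →L[ℂ] H} (hx : x ∈ M) {g : ℝ → ℝ} (hg : Continuous g) :
    tr τ (cfc (fun t => g t * t * g t) (x * star x))
      = tr τ (cfc (fun t => g t * t * g t) (star x * x)) := by
  have h := tr_mul_star (τ := τ) (mul_mem hx (cfc_mem (star_mul_mem hx) g))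
  rw [star_mul, star_cfc] at h
  have e1 : x * cfc g (star x * x) * (cfc g (star x * x) * star x)
      = cfc (fun t => g t * t * g t) (x * star x) := by
    have e2 : cfc g (star x * x) * star x = star x * cfc g (x * star x) := by
      have := mul_cfc_star_mul (star x) hg
      rw [star_star] at this
      exact this.symm
    rw [e2, mul_cfc_star_mul x hg, ← cfc_mul_self_mul_cfc (IsSelfAdjoint.mul_star_self x) hg]
    noncomm_ring
  have e2 : cfc g (star x * x) * star x * (x * cfc g (star x * x))
      = cfc (fun t => g t * t * g t) (star x * x) := by
    rw [← cfc_mul_self_mul_cfc (IsSelfAdjoint.star_mul_self x) hg]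
    noncomm_ring
  rwa [e1, e2] at h

theorem tr_pw_mul_star_le {r : ℝ} (hr : 0 < r) {x : H →L[ℂ] H} (hx : x ∈ M) :
    tr τ (pw r (x * star x)) ≤ tr τ (pw r (star x * x)) := by
  have hsM : star x * x ∈ M := star_mul_mem hx
  refine tr_cfc_le_of_shift (f := fun t => max t 0 ^ r) (continuous_max_rpow hr.le)
    (fun s t hst => Real.rpow_le_rpow (le_max_right _ _) (max_le_max_right _ hst) hr.le)
    (fun t => Real.rpow_nonneg (le_max_right t 0) r) (mul_mem hx (star_mem' hx)) fun δ hδ => ?_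
  set g : ℝ → ℝ := fun t => √(max (t - δ) 0 ^ r / max t δ) with hgdef
  have hpos : ∀ t, 0 < max t δ := fun t => hδ.trans_le (le_max_right _ _)
  have hfc : Continuous fun t => max (t - δ) 0 ^ r :=
    (continuous_max_rpow hr.le).comp (continuous_id.sub continuous_const)
  have hg : Continuous g := Real.continuous_sqrt.comp
    (hfc.div (by fun_prop) fun t => (hpos t).ne')
  have hgt : ∀ t, g t * t * g t = max (t - δ) 0 ^ r := by
    intro t
    have h0 : 0 ≤ max (t - δ) 0 ^ r := Real.rpow_nonneg (le_max_right _ _) r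
    rw [mul_right_comm, hgdef]
    simp only
    rw [Real.mul_self_sqrt (div_nonneg h0 (hpos t).le)]
    rcases le_or_gt t δ with h | h
    · rw [max_eq_right (by linarith : t - δ ≤ 0), Real.zero_rpow hr.ne']
      simp
    · rw [max_eq_left h.le, div_mul_cancel₀ _ (hδ.trans h).ne']
  have h1 := tr_cfc_mul_star_eq (τ := τ) hx hg
  simp only [hgt] at h1
  rw [h1]
  refine tr_mono (cfc_mem hsM _) (cfc_nonneg fun t _ => Real.rpow_nonneg (le_max_right _ _) r)
    (cfc_mem hsM _) (cfc_mono (fun t _ => ?_) hfc.continuousOn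
      (continuous_max_rpow hr.le).continuousOn)
  exact Real.rpow_le_rpow (le_max_right _ _) (max_le_max_right _ (by linarith)) hr.le

theorem moment_star_le {r : ℝ} (hr : 0 < r) {x : H →L[ℂ] H} (hx : x ∈ M) :
    moment τ r (star x) ≤ moment τ r x := by
  rw [moment, star_star]
  exact tr_pw_mul_star_le (by linarith) hx

theorem moment_mono_cfc {r : ℝ} (hr : 0 < r) {h : H →L[ℂ] H} (hM : h ∈ M)
    (hsa : IsSelfAdjoint h) {f : ℝ → ℝ} (hf : Continuous f) (hf0 : ∀ t, 0 ≤ f t)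
    (hle : ∀ t, f t ≤ |t|) : tr τ (pw r (cfc f h)) ≤ moment τ r h := by
  have h1 := continuous_max_rpow hr.le
  have h2 : Continuous fun t : ℝ => |t| ^ r := continuous_abs.rpow_const fun _ => Or.inr hr.le
  rw [moment_of_isSelfAdjoint hsa hr, pw, ← cfc_comp' _ f h h1.continuousOn hf.continuousOn]
  refine tr_mono (cfc_mem hM _) (cfc_nonneg fun t _ => Real.rpow_nonneg (le_max_right _ _) r)
    (cfc_mem hM _) (cfc_mono (fun t _ => ?_) (h1.comp hf).continuousOn h2.continuousOn)
  rw [max_eq_left (hf0 t)]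
  exact Real.rpow_le_rpow (hf0 t) (hle t) hr.le

/-- A self-adjoint element is the difference of two positive ones with smaller moments. -/
theorem exists_sub_of_isSelfAdjoint {r : ℝ} (hr : 0 < r) {h : H →L[ℂ] H} (hM : h ∈ M)
    (hsa : IsSelfAdjoint h) : ∃ a ∈ M, ∃ b ∈ M, 0 ≤ a ∧ 0 ≤ b ∧ h = a - b ∧
      tr τ (pw r a) ≤ moment τ r h ∧ tr τ (pw r b) ≤ moment τ r h := by
  refine ⟨cfc (fun t => max t 0) h, cfc_mem hM _, cfc (fun t => max (-t) 0) h, cfc_mem hM _,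
    cfc_nonneg fun t _ => le_max_right _ _, cfc_nonneg fun t _ => le_max_right _ _, ?_,
    moment_mono_cfc hr hM hsa (by fun_prop) (fun t => le_max_right _ _)
      fun t => max_le (le_abs_self t) (abs_nonneg t),
    moment_mono_cfc hr hM hsa (by fun_prop) (fun t => le_max_right _ _)
      fun t => max_le (neg_le_abs t) (abs_nonneg t)⟩
  rw [← cfc_sub _ _ h (by fun_prop) (by fun_prop)]
  conv_lhs => rw [← cfc_id' ℝ h]
  refine cfc_congr fun t _ => ?_
  rcases le_total t 0 with ht | ht
  · rw [max_eq_right ht, max_eq_left (by linarith)]; ring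
  · rw [max_eq_left ht, max_eq_right (by linarith)]; ring

/-- Every `x ∈ M` is a combination `(a₀ - a₁) + i (a₂ - a₃)` of positive elements whose moments
are controlled by those of `x`. -/
theorem exists_decomposition {r : ℝ} (hr : 0 < r) {x : H →L[ℂ] H} (hx : x ∈ M) :
    ∃ a : Fin 4 → H →L[ℂ] H, (∀ i, a i ∈ M) ∧ (∀ i, 0 ≤ a i) ∧
      x = (a 0 - a 1) + Complex.I • (a 2 - a 3) ∧
      ∀ i, tr τ (pw r (a i)) ≤ 2 * momentConst r * moment τ r x := by
  have hs := star_mem' hx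
  have bound : ∀ c d : ℂ, ‖c‖ ≤ 1 → ‖d‖ ≤ 1 →
      moment τ r (c • x + d • star x) ≤ 2 * momentConst r * moment τ r x := by
    intro c d hc hd
    have hc1 : ENNReal.ofReal (‖c‖ ^ r) ≤ 1 := by
      rw [ENNReal.ofReal_le_one]
      exact Real.rpow_le_one (norm_nonneg c) hc hr.le
    have hd1 : ENNReal.ofReal (‖d‖ ^ r) ≤ 1 := by
      rw [ENNReal.ofReal_le_one]
      exact Real.rpow_le_one (norm_nonneg d) hd hr.le
    refine (moment_add_le hr (smul_mem' hx c) (smul_mem' hs d)).trans ?_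
    rw [moment_smul hr c hx, moment_smul hr d hs]
    calc _ ≤ momentConst r * (1 * moment τ r x + 1 * moment τ r x) := by
          have := moment_star_le (τ := τ) hr hx
          gcongr
      _ = _ := by ring
  obtain ⟨u, hu⟩ : ∃ u, u = (1 / 2 : ℂ) • x + (1 / 2 : ℂ) • star x := ⟨_, rfl⟩
  obtain ⟨v, hv⟩ : ∃ v, v = (-Complex.I / 2) • x + (Complex.I / 2) • star x := ⟨_, rfl⟩
  have huM : u ∈ M := hu ▸ add_mem (smul_mem' hx _) (smul_mem' hs _)
  have hvM : v ∈ M := hv ▸ add_mem (smul_mem' hx _) (smul_mem' hs _)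
  have hus : IsSelfAdjoint u := by
    rw [isSelfAdjoint_iff, hu]
    simp [star_add, star_smul, add_comm]
  have hvs : IsSelfAdjoint v := by
    rw [isSelfAdjoint_iff, hv]
    simp [star_add, star_smul, add_comm, neg_div]
  have hxuv : x = u + Complex.I • v := by
    rw [hu, hv, smul_add, smul_smul, smul_smul]
    have e1 : Complex.I * (-Complex.I / 2) = 1 / 2 := by
      linear_combination (-1 / 2 : ℂ) * Complex.I_mul_I
    have e2 : Complex.I * (Complex.I / 2) = -(1 / 2) := by
      linear_combination (1 / 2 : ℂ) * Complex.I_mul_I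
    rw [e1, e2]
    module
  have hub : moment τ r u ≤ 2 * momentConst r * moment τ r x :=
    hu ▸ bound _ _ (by norm_num) (by norm_num)
  have hvb : moment τ r v ≤ 2 * momentConst r * moment τ r x :=
    hv ▸ bound _ _ (by norm_num) (by norm_num)
  obtain ⟨a, ha, b, hb, ha0, hb0, hab, hat, hbt⟩ :=
    exists_sub_of_isSelfAdjoint (τ := τ) hr huM hus
  obtain ⟨c, hc, d, hd, hc0, hd0, hcd, hct, hdt⟩ :=
    exists_sub_of_isSelfAdjoint (τ := τ) hr hvM hvs
  refine ⟨![a, b, c, d], ?_, ?_, ?_, ?_⟩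
  · intro i; fin_cases i <;> assumption
  · intro i; fin_cases i <;> assumption
  · rw [hxuv, hab, hcd]; rfl
  · intro i
    fin_cases i
    · exact hat.trans hub
    · exact hbt.trans hub
    · exact hct.trans hvb
    · exact hdt.trans hvb

/-- `τ(|h|^r) ≤ ‖h‖^{r-s} τ(|h|^s)`. -/
theorem moment_le_norm_rpow_mul {r s : ℝ} (hs : 0 < s) (hsr : s ≤ r) {h : H →L[ℂ] H}
    (hM : h ∈ M) (hsa : IsSelfAdjoint h) {K : ℝ} (hK : ‖h‖ ≤ K) :
    moment τ r h ≤ ENNReal.ofReal (K ^ (r - s)) * moment τ s h := by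
  have hK0 : 0 ≤ K := (norm_nonneg h).trans hK
  have hr := hs.trans_le hsr
  have h1 : ∀ q : ℝ, 0 < q → Continuous fun t : ℝ => |t| ^ q := fun q hq =>
    continuous_abs.rpow_const fun _ => Or.inr hq.le
  rw [moment_of_isSelfAdjoint hsa hr, moment_of_isSelfAdjoint hsa hs,
    ← tr_smul (cfc_mem hM _) (cfc_nonneg fun t _ => by positivity) (by positivity),
    Complex.coe_smul, ← cfc_const_mul _ _ h (h1 s hs).continuousOn]
  refine tr_mono (cfc_mem hM _) (cfc_nonneg fun t _ => by positivity)
    (cfc_mem hM _) (cfc_mono (fun t ht => ?_) (h1 r hr).continuousOn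
      ((h1 s hs).const_mul _).continuousOn)
  have h2 := (abs_le_norm_of_mem_spectrum ht).trans hK
  rcases (abs_nonneg t).eq_or_lt with h0 | h0
  · rw [← h0, Real.zero_rpow hr.ne', Real.zero_rpow hs.ne', mul_zero]
  · have e : |t| ^ r = |t| ^ (r - s) * |t| ^ s := by
      rw [← Real.rpow_add h0]
      ring_nf
    rw [e]
    gcongr

/-- If `-u ≤ h ≤ u`, then `τ(|h|) ≤ 2 τ(u)`. -/
theorem moment_one_le {h u : H →L[ℂ] H} (hM : h ∈ M) (hu : u ∈ M) (h1 : h ≤ u) (h2 : -u ≤ h) :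
    moment τ 1 h ≤ 2 * tr τ u := by
  have hu0 : 0 ≤ u := by
    have h3 : -u ≤ u := h2.trans h1
    rw [le_iff_inner] at h3
    rw [nonneg_iff_inner]
    intro x
    have := h3 x
    rw [neg_apply, inner_neg_right] at this
    have h4 := Complex.le_def.1 this
    rw [Complex.le_def]
    simp only [Complex.neg_re, Complex.neg_im, Complex.zero_re, Complex.zero_im] at h4 ⊢
    constructor <;> linarith [h4.1, h4.2]
  have hsa : IsSelfAdjoint h := by
    have := (sub_nonneg.2 h1).isSelfAdjoint
    have h3 := hu0.isSelfAdjoint.sub this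
    rwa [sub_sub_cancel] at h3
  have e : cfc (fun t : ℝ => |t| ^ (1 : ℝ)) h
      = cfc (fun t : ℝ => max t 0) h + cfc (fun t : ℝ => max t 0) (-h) := by
    have e1 : cfc (fun t : ℝ => max t 0) (-h) = cfc (fun t : ℝ => max (-t) 0) h := by
      rw [← cfc_comp_neg (fun t : ℝ => max t 0) h (by fun_prop)]
    rw [e1, ← cfc_add h _ _ (by fun_prop) (by fun_prop)]
    refine cfc_congr fun t _ => ?_
    simp only [Real.rpow_one]
    rcases le_total t 0 with ht | ht
    · rw [abs_of_nonpos ht, max_eq_right ht, max_eq_left (by linarith)]; ring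
    · rw [abs_of_nonneg ht, max_eq_left ht, max_eq_right (by linarith)]; ring
  rw [moment_of_isSelfAdjoint hsa one_pos, e, tr_add (cfc_mem hM _)
    (cfc_nonneg fun t _ => le_max_right _ _) (cfc_mem (neg_mem hM) _)
    (cfc_nonneg fun t _ => le_max_right _ _), two_mul]
  exact add_le_add (tr_posPart_le hM hsa hu hu0 h1)
    (tr_posPart_le (neg_mem hM) hsa.neg hu hu0 (neg_le.1 h2))

end Moments

/-! ### Markovian operators -/

section Markovian

variable {M : VonNeumannAlgebra H} {τ : NSFTrace M}

variable {Φ : Elt M →ₗ[ℂ] Elt M}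

theorem IsMarkovian.nonneg (hΦ : IsMarkovian τ Φ) {f : Elt M} (hf : 0 ≤ (f : H →L[ℂ] H)) :
    0 ≤ (Φ f : H →L[ℂ] H) := by
  have h := hΦ.completelyPositive 1 (fun _ _ => f) fun ξ => by
    simpa using (nonneg_iff_inner _).1 hf (ξ 0)
  rw [nonneg_iff_inner]
  intro x
  simpa using h fun _ => x

theorem IsMarkovian.mono (hΦ : IsMarkovian τ Φ) {f g : Elt M}
    (hfg : (f : H →L[ℂ] H) ≤ (g : H →L[ℂ] H)) : (Φ f : H →L[ℂ] H) ≤ (Φ g : H →L[ℂ] H) := by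
  have := hΦ.nonneg (f := g - f) (by
    change 0 ≤ (g : H →L[ℂ] H) - f
    exact sub_nonneg.2 hfg)
  rw [map_sub] at this
  exact sub_nonneg.1 this

theorem opNorm_le_of_norm_inner_le {a : H →L[ℂ] H} {K : ℝ} (hK : 0 ≤ K)
    (h : ∀ x y : H, ‖⟪x, a y⟫_ℂ‖ ≤ K * ‖x‖ * ‖y‖) : ‖a‖ ≤ K := by
  refine ContinuousLinearMap.opNorm_le_bound _ hK fun y => ?_
  rcases eq_or_ne (a y) 0 with h0 | h0
  · rw [h0, norm_zero]; positivity
  have h1 := h (a y) y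
  rw [← inner_self_re_eq_norm, inner_self_eq_norm_mul_norm] at h1
  have h2 := norm_pos_iff.2 h0
  refine le_of_mul_le_mul_left ?_ h2
  linarith

theorem IsMarkovian.norm_le (hΦ : IsMarkovian τ Φ) (f : Elt M) :
    ‖(Φ f : H →L[ℂ] H)‖ ≤ ‖(f : H →L[ℂ] H)‖ :=
  opNorm_le_of_norm_inner_le (norm_nonneg _) (hΦ.norm_inner_le f)

theorem IsMarkovian.isSelfAdjoint (hΦ : IsMarkovian τ Φ) {f : Elt M}
    (hf : IsSelfAdjoint (f : H →L[ℂ] H)) : IsSelfAdjoint (Φ f : H →L[ℂ] H) := by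
  set c : ℝ := ‖(f : H →L[ℂ] H)‖
  have h := hΦ.nonneg (f := (c : ℂ) • 1 - f) (by
    change 0 ≤ (c : ℂ) • (1 : H →L[ℂ] H) - f
    exact sub_nonneg.2 (le_norm_smul_one hf))
  rw [map_sub, map_smul, hΦ.map_one] at h
  have h1 : IsSelfAdjoint ((c : ℂ) • (1 : H →L[ℂ] H) - (Φ f : H →L[ℂ] H)) := h.isSelfAdjoint
  have := (isSelfAdjoint_smul_one c).sub h1
  rwa [sub_sub_cancel] at this

theorem IsMarkovian.map_star (hΦ : IsMarkovian τ Φ) (f : Elt M) : Φ (star f) = star (Φ f) := by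
  have hu : IsSelfAdjoint (((1 / 2 : ℂ) • (f + star f) : Elt M) : H →L[ℂ] H) := by
    change IsSelfAdjoint ((1 / 2 : ℂ) • ((f : H →L[ℂ] H) + star (f : H →L[ℂ] H)))
    rw [isSelfAdjoint_iff]
    simp [star_smul, add_comm]
  have hv : IsSelfAdjoint (((-Complex.I / 2) • (f - star f) : Elt M) : H →L[ℂ] H) := by
    change IsSelfAdjoint ((-Complex.I / 2) • ((f : H →L[ℂ] H) - star (f : H →L[ℂ] H)))
    rw [isSelfAdjoint_iff, star_smul, star_sub, star_star, ← neg_sub, smul_neg, ← neg_smul]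
    simp [neg_div]
  have h1 : star (Φ ((1 / 2 : ℂ) • (f + star f))) = Φ ((1 / 2 : ℂ) • (f + star f)) :=
    Subtype.ext (hΦ.isSelfAdjoint hu).star_eq
  have h2 : star (Φ ((-Complex.I / 2) • (f - star f))) = Φ ((-Complex.I / 2) • (f - star f)) :=
    Subtype.ext (hΦ.isSelfAdjoint hv).star_eq
  have e1 : Complex.I * (-Complex.I / 2) = 1 / 2 := by
    linear_combination (-1 / 2 : ℂ) * Complex.I_mul_I
  have ef : f = (1 / 2 : ℂ) • (f + star f) + Complex.I • ((-Complex.I / 2) • (f - star f)) := by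
    rw [smul_smul, e1]
    module
  have es : star f
      = (1 / 2 : ℂ) • (f + star f) - Complex.I • ((-Complex.I / 2) • (f - star f)) := by
    rw [smul_smul, e1]
    module
  have eT : Φ f = Φ ((1 / 2 : ℂ) • (f + star f))
      + Complex.I • Φ ((-Complex.I / 2) • (f - star f)) := by
    rw [← map_smul Φ Complex.I, ← map_add, ← ef]
  rw [eT, star_add, star_smul, h1, h2, RCLike.star_def, Complex.conj_I, neg_smul,
    ← sub_eq_add_neg, ← map_smul Φ Complex.I, ← map_sub, ← es]

/-- The Kadison–Schwarz inequality, from the positivity of `[[1, f], [f*, f* f]]`. -/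
theorem IsMarkovian.star_mul_le (hΦ : IsMarkovian τ Φ) (f : Elt M) :
    star (Φ f : H →L[ℂ] H) * (Φ f : H →L[ℂ] H) ≤ (Φ (star f * f) : H →L[ℂ] H) := by
  have hadj : ∀ (g : Elt M) (x y : H),
      ⟪x, ((star g : Elt M) : H →L[ℂ] H) y⟫_ℂ = ⟪(g : H →L[ℂ] H) x, y⟫_ℂ := fun g x y =>
    ContinuousLinearMap.adjoint_inner_right _ _ _
  have h := hΦ.completelyPositive 2 ![![1, f], ![star f, star f * f]] fun ξ => by
    have e : ∑ i, ∑ j, ⟪ξ i, (((![![1, f], ![star f, star f * f]] : Fin 2 → Fin 2 → Elt M) i j :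
          Elt M) : H →L[ℂ] H) (ξ j)⟫_ℂ
        = ⟪ξ 0 + (f : H →L[ℂ] H) (ξ 1), ξ 0 + (f : H →L[ℂ] H) (ξ 1)⟫_ℂ := by
      simp only [Fin.sum_univ_two, Matrix.cons_val_zero, Matrix.cons_val_one]
      have e1 : ⟪ξ 1, ((star f * f : Elt M) : H →L[ℂ] H) (ξ 1)⟫_ℂ
          = ⟪(f : H →L[ℂ] H) (ξ 1), (f : H →L[ℂ] H) (ξ 1)⟫_ℂ := hadj f (ξ 1) (f.1 (ξ 1))
      have e2 : ⟪ξ 0, ((1 : Elt M) : H →L[ℂ] H) (ξ 0)⟫_ℂ = ⟪ξ 0, ξ 0⟫_ℂ := rfl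
      rw [hadj, e1, e2, inner_add_left, inner_add_right, inner_add_right]
    rw [e]
    rw [inner_self_eq_norm_sq_to_K]
    have := Complex.zero_le_real.2 (sq_nonneg ‖ξ 0 + (f : H →L[ℂ] H) (ξ 1)‖)
    rwa [Complex.ofReal_pow] at this
  rw [le_iff_inner]
  intro x
  have h1 := h ![-((Φ f : H →L[ℂ] H) x), x]
  simp only [Fin.sum_univ_two, Matrix.cons_val_zero, Matrix.cons_val_one, hΦ.map_one,
    hΦ.map_star] at h1
  rw [hadj] at h1
  have e2 : ∀ y : H, ((1 : Elt M) : H →L[ℂ] H) y = y := fun y => rfl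
  simp only [e2, inner_neg_left, inner_neg_right] at h1
  have e3 : ⟪x, (star (Φ f : H →L[ℂ] H) * (Φ f : H →L[ℂ] H)) x⟫_ℂ
      = ⟪(Φ f : H →L[ℂ] H) x, (Φ f : H →L[ℂ] H) x⟫_ℂ := hadj (Φ f) x ((Φ f).1 x)
  rw [e3, ← sub_nonneg]
  refine h1.trans (le_of_eq ?_)
  ring

theorem IsMarkovian.tr_eq (hΦ : IsMarkovian τ Φ) {f : Elt M} (hf : 0 ≤ (f : H →L[ℂ] H)) :
    tr τ (Φ f : H →L[ℂ] H) = tr τ (f : H →L[ℂ] H) := by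
  rw [MarkovMorrey.tr_eq ⟨f.2, hf⟩, MarkovMorrey.tr_eq ⟨(Φ f).2, hΦ.nonneg hf⟩]
  exact hΦ.trace_preserving f ⟨f, f.2, hf⟩ ⟨Φ f, (Φ f).2, hΦ.nonneg hf⟩ rfl rfl

theorem IsMarkovian.tr_star_mul_le (hΦ : IsMarkovian τ Φ) (f : Elt M) :
    tr τ (star (Φ f : H →L[ℂ] H) * (Φ f : H →L[ℂ] H))
      ≤ tr τ (star (f : H →L[ℂ] H) * (f : H →L[ℂ] H)) := by
  have h0 : 0 ≤ ((star f * f : Elt M) : H →L[ℂ] H) := star_mul_self_nonneg (f : H →L[ℂ] H)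
  exact (tr_mono (star_mul_mem (Φ f).2) (star_mul_self_nonneg _) (Φ (star f * f)).2
    (hΦ.star_mul_le f)).trans (hΦ.tr_eq h0).le

/-- The inclusion of `M ∩ L₂(M)` into `M`. -/
def L2.elt : L2 τ →ₗ[ℂ] Elt M where
  toFun x := ⟨x.op, x.mem⟩
  map_add' x y := Subtype.ext (map_add L2.op x y)
  map_smul' c x := Subtype.ext (map_smul L2.op c x)

theorem L2.coe_elt (x : L2 τ) : (x.elt : H →L[ℂ] H) = x.op := rfl

/-- The action of a Markovian operator on `M ∩ L₂(M)`. -/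
def L2.map (hΦ : IsMarkovian τ Φ) : L2 τ →ₗ[ℂ] L2 τ where
  toFun x := L2.mk (Φ x.elt) (Φ x.elt).2 ((hΦ.tr_star_mul_le x.elt).trans_lt x.tr_lt_top)
  map_add' x y := L2.op_injective (by
    rw [map_add L2.op, L2.op_mk, L2.op_mk, L2.op_mk, map_add, map_add]
    rfl)
  map_smul' c x := L2.op_injective (by
    rw [RingHom.id_apply, map_smul L2.op, L2.op_mk, L2.op_mk, map_smul, map_smul]
    rfl)

theorem L2.norm_map_le (hΦ : IsMarkovian τ Φ) (x : L2 τ) : ‖L2.map hΦ x‖ ≤ ‖x‖ := by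
  have h := hΦ.tr_star_mul_le x.elt
  rw [← one_mul (tr τ (star (x.elt : H →L[ℂ] H) * (x.elt : H →L[ℂ] H))), ← ENNReal.ofReal_one,
    ← one_pow 2] at h
  exact (L2.norm_le_of_tr_le (x := L2.map hΦ x) (y := x) zero_le_one h).trans (one_mul _).le

theorem lpNorm_two_lt_top_iff (f : Elt M) :
    lpNorm τ 2 f < ∞ ↔ tr τ (star (f : H →L[ℂ] H) * (f : H →L[ℂ] H)) < ∞ := by
  rw [lpNorm_of_ne_top (by norm_num), ENNReal.toReal_ofNat, moment_two]
  simp [lt_top_iff_ne_top]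

theorem toFun_absPow_two (f : Elt M) :
    τ.toFun (absPow f 2) = tr τ (star (f : H →L[ℂ] H) * (f : H →L[ℂ] H)) := by
  have h0 := star_mul_self_nonneg (f : H →L[ℂ] H)
  rw [← moment_two, moment, pw_eq_rpow h0, ← tr_coe, absPow]

theorem l2Inner_eq_inner (x y : L2 τ) : l2Inner τ x.elt y.elt = ⟪x, y⟫_ℂ := by
  have h : ∀ c : ℂ, ((τ.toFun (absPow (x.elt + c • y.elt) 2)).toReal : ℂ)
      = ((‖x + c • y‖ : ℝ) : ℂ) ^ 2 := by
    intro c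
    rw [toFun_absPow_two, ← map_smul, ← map_add, L2.coe_elt, ← L2.norm_sq, Complex.ofReal_pow]
  have e3 : Complex.I ^ 3 = -Complex.I := Complex.I_pow_three
  have e5 : (-Complex.I) ^ 3 = Complex.I := by
    rw [neg_pow, e3]
    ring
  have e4 : ((3 : Fin 4) : ℕ) = 3 := rfl
  rw [l2Inner, inner_eq_sum_norm_sq_div_four (𝕜 := ℂ)]
  simp only [h, Fin.sum_univ_four, Fin.val_zero, Fin.val_one, Fin.val_two, pow_zero, pow_one,
    one_smul, one_mul, Complex.I_sq, neg_sq, RCLike.I_to_complex, e4, e5, e3, neg_smul,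
    ← sub_eq_add_neg, RCLike.ofReal_eq_complex_ofReal]
  ring

theorem L2.inner_map (hΦ : IsMarkovian τ Φ) (x y : L2 τ) :
    ⟪L2.map hΦ x, y⟫_ℂ = ⟪x, L2.map hΦ y⟫_ℂ := by
  have h := hΦ.symmetric x.elt y.elt
    ((lpNorm_two_lt_top_iff _).2 x.tr_lt_top) ((lpNorm_two_lt_top_iff _).2 y.tr_lt_top)
  have e := l2Inner_eq_inner x (L2.map hΦ y)
  have e' := l2Inner_eq_inner (L2.map hΦ x) y
  rw [← e, ← e']
  exact h.symm

/-- A Markovian operator decreases the distribution of positive elements: `Φ x - lam = Φ(x - lam)`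
is at most `Φ((x - lam)₊)`. -/
theorem IsMarkovian.tr_excess_le (hΦ : IsMarkovian τ Φ) {f : Elt M}
    (hf : IsSelfAdjoint (f : H →L[ℂ] H)) (lam : ℝ) :
    tr τ (excess lam (Φ f : H →L[ℂ] H)) ≤ tr τ (excess lam (f : H →L[ℂ] H)) := by
  let e : Elt M := ⟨excess lam (f : H →L[ℂ] H), excess_mem f.2 lam⟩
  rw [← hΦ.tr_eq (f := e) (excess_nonneg _ _)]
  refine MarkovMorrey.tr_excess_le (Φ f).2 (hΦ.isSelfAdjoint hf) (Φ e).2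
    (hΦ.nonneg (f := e) (excess_nonneg _ _)) ?_
  have h := hΦ.mono (f := f - (lam : ℂ) • 1) (g := e) (sub_smul_one_le_excess hf lam)
  rw [map_sub, map_smul, hΦ.map_one] at h
  exact h

theorem IsMarkovian.tr_pw_le (hΦ : IsMarkovian τ Φ) {r : ℝ} (hr : 1 ≤ r) {f : Elt M}
    (hf : 0 ≤ (f : H →L[ℂ] H)) :
    tr τ (pw r (Φ f : H →L[ℂ] H)) ≤ (2 * dyadicConst r + 1) * tr τ (pw r (f : H →L[ℂ] H)) := by
  rcases hr.eq_or_lt with rfl | hr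
  · rw [pw_eq_rpow hf, pw_eq_rpow (hΦ.nonneg hf), CFC.rpow_one _ hf,
      CFC.rpow_one _ (hΦ.nonneg hf), hΦ.tr_eq hf, add_mul, one_mul]
    exact le_add_self
  · refine (tr_pw_le_of_tr_excess_le hr (Φ f).2 f.2 f.2 fun lam hlam => ?_).trans ?_
    · refine le_trans ?_ ((hΦ.tr_excess_le hf.isSelfAdjoint lam).trans le_self_add)
      refine tr_mono (excess_mem (Φ f).2 _) (excess_nonneg _ _) (excess_mem (Φ f).2 _)
        (cfc_mono (fun t _ => max_le_max_right _ (by linarith)) (by fun_prop) (by fun_prop))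
    · rw [add_mul, one_mul, ← two_mul, mul_left_comm, mul_assoc]
      exact le_self_add

end Markovian

/-! ### Markovian semigroups -/

section Semigroup

variable {M : VonNeumannAlgebra H} {τ : NSFTrace M} (T : MarkovSemigroup τ)

theorem MarkovSemigroup.at_eq (t : ℝ) (f : Elt M) : T.at t f = T.toFun t.toNNReal f := rfl

theorem MarkovSemigroup.at_add {s t : ℝ} (hs : 0 ≤ s) (ht : 0 ≤ t) (f : Elt M) :
    T.at (s + t) f = T.at s (T.at t f) := by
  rw [MarkovSemigroup.at, Real.toNNReal_add hs ht, T.map_add]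
  rfl

theorem MarkovSemigroup.at_zero (f : Elt M) : T.at 0 f = f := by
  rw [MarkovSemigroup.at, Real.toNNReal_zero, T.map_zero]
  rfl

/-- The semigroup on `M ∩ L₂(M)`. -/
def MarkovSemigroup.l2 (t : ℝ) : L2 τ →ₗ[ℂ] L2 τ := L2.map (T.markovian t.toNNReal)

theorem MarkovSemigroup.op_l2 (t : ℝ) (x : L2 τ) :
    (T.l2 t x).op = (T.at t x.elt : H →L[ℂ] H) := rfl

theorem MarkovSemigroup.l2_add {s t : ℝ} (hs : 0 ≤ s) (ht : 0 ≤ t) (x : L2 τ) :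
    T.l2 (s + t) x = T.l2 s (T.l2 t x) := by
  apply L2.op_injective
  rw [T.op_l2, T.at_add hs ht]
  rfl

theorem MarkovSemigroup.norm_l2_le (t : ℝ) (x : L2 τ) : ‖T.l2 t x‖ ≤ ‖x‖ :=
  L2.norm_map_le _ x

theorem MarkovSemigroup.inner_l2 (t : ℝ) (x y : L2 τ) : ⟪T.l2 t x, y⟫_ℂ = ⟪x, T.l2 t y⟫_ℂ :=
  L2.inner_map _ x y

theorem MarkovSemigroup.inner_l2_add {s t : ℝ} (hs : 0 ≤ s) (ht : 0 ≤ t) (x y : L2 τ) :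
    ⟪x, T.l2 (s + t) y⟫_ℂ = ⟪T.l2 s x, T.l2 t y⟫_ℂ := by
  rw [T.l2_add hs ht, T.inner_l2]

theorem MarkovSemigroup.inner_l2_self {t : ℝ} (ht : 0 ≤ t) (x : L2 τ) :
    ⟪x, T.l2 t x⟫_ℂ = ((‖T.l2 (t / 2) x‖ ^ 2 : ℝ) : ℂ) := by
  have h2 : 0 ≤ t / 2 := by linarith
  conv_lhs => rw [← add_halves t, T.inner_l2_add h2 h2, inner_self_eq_norm_sq_to_K]
  push_cast
  rfl

theorem MarkovSemigroup.norm_l2_anti {s t : ℝ} (hs : 0 ≤ s) (hst : s ≤ t) (x : L2 τ) :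
    ‖T.l2 t x‖ ≤ ‖T.l2 s x‖ := by
  have h := T.l2_add (sub_nonneg.2 hst) hs x
  rw [sub_add_cancel] at h
  rw [h]
  exact T.norm_l2_le _ _

end Semigroup

/-! ### The subordination density -/

section Subordinator

/-- The primitive `∫₀ˣ e^{-t²} dt` of the Gaussian. -/
def gaussPrim (x : ℝ) : ℝ := ∫ t in (0 : ℝ)..x, Real.exp (-t ^ 2)

theorem hasDerivAt_gaussPrim (x : ℝ) : HasDerivAt gaussPrim (Real.exp (-x ^ 2)) x := by
  have hc : Continuous fun t : ℝ => Real.exp (-t ^ 2) := by fun_prop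
  exact intervalIntegral.integral_hasDerivAt_right (hc.intervalIntegrable _ _)
    hc.stronglyMeasurable.stronglyMeasurableAtFilter hc.continuousAt

theorem continuous_gaussPrim : Continuous gaussPrim :=
  continuous_iff_continuousAt.2 fun x => (hasDerivAt_gaussPrim x).continuousAt

theorem gaussPrim_zero : gaussPrim 0 = 0 := by simp [gaussPrim]

theorem gaussPrim_neg (x : ℝ) : gaussPrim (-x) = -gaussPrim x := by
  have h := intervalIntegral.integral_comp_neg (a := 0) (b := x) fun t : ℝ => Real.exp (-t ^ 2)
  simp only [neg_sq, neg_zero] at h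
  rw [gaussPrim, gaussPrim, h, intervalIntegral.integral_symm]

theorem tendsto_gaussPrim_atTop : Tendsto gaussPrim atTop (𝓝 (√Real.pi / 2)) := by
  have h1 : IntegrableOn (fun t : ℝ => Real.exp (-t ^ 2)) (Ioi 0) := by
    have := (integrable_exp_neg_mul_sq (b := 1) one_pos).integrableOn (s := Ioi 0)
    simpa using this
  have h2 := intervalIntegral_tendsto_integral_Ioi 0 h1 tendsto_id
  have h3 := integral_gaussian_Ioi 1
  simp only [div_one, neg_mul, one_mul] at h3
  rwa [h3] at h2

theorem tendsto_gaussPrim_atBot : Tendsto gaussPrim atBot (𝓝 (-(√Real.pi / 2))) := by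
  have h := (tendsto_gaussPrim_atTop.comp tendsto_neg_atBot_atTop).neg
  refine h.congr fun x => ?_
  simp [gaussPrim_neg]

theorem subordinator_nonneg {s : ℝ} (hs : 0 ≤ s) {v : ℝ} (hv : 0 ≤ v) : 0 ≤ subordinator s v := by
  unfold subordinator; positivity

theorem subordinator_eq (s : ℝ) {v : ℝ} (hv : 0 < v) :
    subordinator s v = s * Real.exp (-s ^ 2 / (4 * v)) / (2 * √Real.pi * (v * √v)) := by
  have h : v ^ (-(3 / 2) : ℝ) = (v * √v)⁻¹ := by
    rw [Real.rpow_neg hv.le, Real.sqrt_eq_rpow]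
    congr 1
    nth_rewrite 2 [← Real.rpow_one v]
    rw [← Real.rpow_add hv]
    norm_num
  rw [subordinator, h]
  field_simp

theorem hasDerivAt_gaussPrim_div_sqrt (s : ℝ) {v : ℝ} (hv : 0 < v) :
    HasDerivAt (fun v => -(2 / √Real.pi) * gaussPrim (s / (2 * √v))) (subordinator s v) v := by
  have hw : 0 < √v := Real.sqrt_pos.2 hv
  have hpi : 0 < √Real.pi := Real.sqrt_pos.2 Real.pi_pos
  have h1 : HasDerivAt (fun v => s / (2 * √v)) (-(s / (4 * (v * √v)))) v := by
    have h2 := ((hasDerivAt_const v s).div ((Real.hasDerivAt_sqrt hv.ne').const_mul 2)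
      (by positivity))
    refine h2.congr_deriv ?_
    rw [mul_pow, Real.sq_sqrt hv.le]
    field_simp
    ring
  have h3 := ((hasDerivAt_gaussPrim (s / (2 * √v))).comp v h1).const_mul (-(2 / √Real.pi))
  refine h3.congr_deriv ?_
  rw [subordinator_eq s hv, div_pow, mul_pow, Real.sq_sqrt hv.le, neg_div]
  norm_num
  field_simp
  ring

/-- The subordination density has mass `1`: its primitive in `v` is
`-erf(s / (2 √v))`. -/
theorem integral_subordinator {s : ℝ} (hs : 0 < s) :
    ∫ v in Ioi (0 : ℝ), subordinator s v = 1 := by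
  have hpi : 0 < √Real.pi := Real.sqrt_pos.2 Real.pi_pos
  let F : ℝ → ℝ := fun v => -(2 / √Real.pi) * gaussPrim (s / (2 * √v))
  have hsqrt : Tendsto (fun v : ℝ => √v) (𝓝[>] 0) (𝓝[>] 0) := by
    refine tendsto_nhdsWithin_iff.2 ⟨?_, ?_⟩
    · have := (Real.continuous_sqrt.tendsto 0).mono_left (nhdsWithin_le_nhds (s := Ioi 0))
      rwa [Real.sqrt_zero] at this
    · filter_upwards [self_mem_nhdsWithin] with v hv using Real.sqrt_pos.2 hv
  have h0 : Tendsto F (𝓝[>] 0) (𝓝 (-1)) := by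
    have h1 : Tendsto (fun v => s / (2 * √v)) (𝓝[>] 0) atTop := by
      have h2 := (tendsto_inv_nhdsGT_zero.comp hsqrt).const_mul_atTop (r := s / 2) (by positivity)
      refine h2.congr fun v => ?_
      simp only [Function.comp]
      rw [div_mul_eq_mul_div, mul_comm 2, ← div_div, div_eq_mul_inv s]
    have h3 := (tendsto_gaussPrim_atTop.comp h1).const_mul (-(2 / √Real.pi))
    have e : -(2 / √Real.pi) * (√Real.pi / 2) = -1 := by field_simp
    rwa [e] at h3
  have hinf : Tendsto F atTop (𝓝 0) := by
    have h1 : Tendsto (fun v => s / (2 * √v)) atTop (𝓝 0) :=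
      tendsto_const_nhds.div_atTop (Real.tendsto_sqrt_atTop.const_mul_atTop two_pos)
    have h3 := ((continuous_gaussPrim.tendsto 0).comp h1).const_mul (-(2 / √Real.pi))
    rwa [gaussPrim_zero, mul_zero] at h3
  have hev : ∀ v : ℝ, v ≠ 0 → Function.update F 0 (-1) v = F v := fun v hv =>
    Function.update_of_ne hv _ _
  have := integral_Ioi_of_hasDerivAt_of_tendsto (f := Function.update F 0 (-1)) (a := 0) (m := 0)
    (f' := subordinator s) ?_ (fun v hv => ?_) (integrableOn_subordinator hs) ?_
  · rw [this]; simp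
  · rw [continuousWithinAt_update_same]
    simpa using h0
  · refine (hasDerivAt_gaussPrim_div_sqrt s hv).congr_of_eventuallyEq ?_
    filter_upwards [Ioi_mem_nhds hv] with w hw using hev w (ne_of_gt hw)
  · refine hinf.congr' ?_
    filter_upwards [Ioi_mem_atTop 0] with w hw using (hev w (ne_of_gt hw)).symm

/-- The exponent in the convolution of two subordination densities, after completing the square. -/
def convExponent (r s v u : ℝ) : ℝ := (r * (v - u) - s * u) / (2 * √v * (√u * √(v - u)))

theorem hasDerivAt_convExponent (r s : ℝ) {v u : ℝ} (hu : 0 < u) (huv : u < v) :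
    HasDerivAt (convExponent r s v)
      (-(√v * (r * (v - u) + s * u)) / (4 * (u * √u * ((v - u) * √(v - u))))) u := by
  have hq' : 0 < v - u := sub_pos.2 huv
  obtain ⟨p, hp⟩ : ∃ p, p = √u := ⟨_, rfl⟩
  obtain ⟨q, hq⟩ : ∃ q, q = √(v - u) := ⟨_, rfl⟩
  obtain ⟨w, hw⟩ : ∃ w, w = √v := ⟨_, rfl⟩
  have hp0 : 0 < p := hp ▸ Real.sqrt_pos.2 hu
  have hq0 : 0 < q := hq ▸ Real.sqrt_pos.2 hq'
  have hw0 : 0 < w := hw ▸ Real.sqrt_pos.2 (hu.trans huv)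
  have hp2 : u = p ^ 2 := by rw [hp, Real.sq_sqrt hu.le]
  have hq2 : v - u = q ^ 2 := by rw [hq, Real.sq_sqrt hq'.le]
  have hw2 : w ^ 2 = p ^ 2 + q ^ 2 := by
    rw [hw, Real.sq_sqrt (hu.trans huv).le]; linarith
  have hsub : HasDerivAt (fun u => v - u) (-1) u := by
    simpa using (hasDerivAt_id u).const_sub v
  have h1 : HasDerivAt (fun u => r * (v - u) - s * u) (-(r + s)) u :=
    ((hsub.const_mul r).sub ((hasDerivAt_id u).const_mul s)).congr_deriv (by ring)
  have h2 : HasDerivAt (fun u => √u * √(v - u)) (1 / (2 * p) * q + p * (-1 / (2 * q))) u := by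
    rw [hp, hq]
    exact (Real.hasDerivAt_sqrt hu.ne').mul (hsub.sqrt hq'.ne')
  have h3 := h1.div (h2.const_mul (2 * √v)) (by
    rw [← hp, ← hq, ← hw]; positivity)
  refine h3.congr_deriv ?_
  rw [← hp, ← hq, ← hw, hq2, hp2]
  rw [div_eq_div_iff (by positivity) (by positivity)]
  field_simp
  linear_combination 4 * (r * q ^ 2 + s * p ^ 2) * hw2

theorem exp_convExponent (r s : ℝ) {v u : ℝ} (hu : 0 < u) (huv : u < v) :
    Real.exp (-(r + s) ^ 2 / (4 * v)) * Real.exp (-convExponent r s v u ^ 2)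
      = Real.exp (-r ^ 2 / (4 * u)) * Real.exp (-s ^ 2 / (4 * (v - u))) := by
  have hq' : 0 < v - u := sub_pos.2 huv
  have hv := hu.trans huv
  rw [← Real.exp_add, ← Real.exp_add, convExponent, div_pow, mul_pow, mul_pow, mul_pow,
    Real.sq_sqrt hu.le, Real.sq_sqrt hq'.le, Real.sq_sqrt hv.le]
  congr 1
  field_simp
  ring

theorem hasDerivAt_gaussPrim_convExponent (r s : ℝ) {v u : ℝ} (hu : 0 < u) (huv : u < v) :
    HasDerivAt (fun u => Real.exp (-(r + s) ^ 2 / (4 * v)) * gaussPrim (convExponent r s v u))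
      (-(√v * (r * (v - u) + s * u)) / (4 * (u * √u * ((v - u) * √(v - u))))
        * (Real.exp (-r ^ 2 / (4 * u)) * Real.exp (-s ^ 2 / (4 * (v - u))))) u := by
  have h := ((hasDerivAt_gaussPrim (convExponent r s v u)).comp u
    (hasDerivAt_convExponent r s hu huv)).const_mul (Real.exp (-(r + s) ^ 2 / (4 * v)))
  refine h.congr_deriv ?_
  rw [← mul_assoc, exp_convExponent r s hu huv, mul_comm]

theorem tendsto_inv_sqrt_mul_sqrt_zero {v : ℝ} (hv : 0 < v) :
    Tendsto (fun u => (2 * √v * (√u * √(v - u)))⁻¹) (𝓝[>] 0) atTop := by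
  refine tendsto_inv_nhdsGT_zero.comp (tendsto_nhdsWithin_iff.2 ⟨?_, ?_⟩)
  · have hc : Continuous fun u => 2 * √v * (√u * √(v - u)) := by fun_prop
    have := (hc.tendsto 0).mono_left (nhdsWithin_le_nhds (s := Ioi 0))
    simpa using this
  · filter_upwards [Ioo_mem_nhdsGT hv] with u hu
    have h1 : 0 < √v := Real.sqrt_pos.2 hv
    have h2 : 0 < √u := Real.sqrt_pos.2 hu.1
    have h3 : 0 < √(v - u) := Real.sqrt_pos.2 (sub_pos.2 hu.2)
    exact mem_Ioi.2 (by positivity)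

theorem tendsto_inv_sqrt_mul_sqrt_right {v : ℝ} (hv : 0 < v) :
    Tendsto (fun u => (2 * √v * (√u * √(v - u)))⁻¹) (𝓝[<] v) atTop := by
  refine tendsto_inv_nhdsGT_zero.comp (tendsto_nhdsWithin_iff.2 ⟨?_, ?_⟩)
  · have hc : Continuous fun u => 2 * √v * (√u * √(v - u)) := by fun_prop
    have := (hc.tendsto v).mono_left (nhdsWithin_le_nhds (s := Iio v))
    simpa using this
  · filter_upwards [Ioo_mem_nhdsLT hv] with u hu
    have h1 : 0 < √v := Real.sqrt_pos.2 hv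
    have h2 : 0 < √u := Real.sqrt_pos.2 hu.1
    have h3 : 0 < √(v - u) := Real.sqrt_pos.2 (sub_pos.2 hu.2)
    exact mem_Ioi.2 (by positivity)

theorem tendsto_convExponent_zero {r : ℝ} (hr : 0 < r) (s : ℝ) {v : ℝ} (hv : 0 < v) :
    Tendsto (convExponent r s v) (𝓝[>] 0) atTop := by
  have hc : Continuous fun u => r * (v - u) - s * u := by fun_prop
  have h1 := (hc.tendsto 0).mono_left (nhdsWithin_le_nhds (s := Ioi 0))
  exact h1.pos_mul_atTop (by simp; positivity) (tendsto_inv_sqrt_mul_sqrt_zero hv)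

theorem tendsto_convExponent_right (r : ℝ) {s : ℝ} (hs : 0 < s) {v : ℝ} (hv : 0 < v) :
    Tendsto (convExponent r s v) (𝓝[<] v) atBot := by
  have hc : Continuous fun u => r * (v - u) - s * u := by fun_prop
  have h1 := (hc.tendsto v).mono_left (nhdsWithin_le_nhds (s := Iio v))
  exact h1.neg_mul_atTop (by simp; positivity) (tendsto_inv_sqrt_mul_sqrt_right hv)

theorem tendsto_convExponent_right_neg (r : ℝ) {s : ℝ} (hs : s < 0) {v : ℝ} (hv : 0 < v) :
    Tendsto (convExponent r s v) (𝓝[<] v) atTop := by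
  have hc : Continuous fun u => r * (v - u) - s * u := by fun_prop
  have h1 := (hc.tendsto v).mono_left (nhdsWithin_le_nhds (s := Iio v))
  exact h1.pos_mul_atTop (by simp; exact mul_neg_of_neg_of_pos hs hv)
    (tendsto_inv_sqrt_mul_sqrt_right hv)

theorem measurable_subordinator (s : ℝ) : Measurable (subordinator s) := by
  unfold subordinator
  fun_prop

theorem exists_rpow_mul_exp_neg_le (β : ℝ) (hβ : 0 ≤ β) :
    ∃ C : ℝ, 0 < C ∧ ∀ w : ℝ, 0 ≤ w → w ^ β * Real.exp (-w) ≤ C := by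
  set k := ⌈β⌉₊
  refine ⟨1 + k.factorial, by positivity, fun w hw => ?_⟩
  rw [Real.exp_neg, mul_inv_le_iff₀ (Real.exp_pos w)]
  have h1 : w ^ β ≤ 1 + w ^ k := by
    rcases le_total w 1 with h | h
    · have := Real.rpow_le_one hw h hβ
      have := pow_nonneg hw k
      linarith
    · have : w ^ β ≤ w ^ (k : ℝ) := Real.rpow_le_rpow_of_exponent_le h (Nat.le_ceil β)
      rw [Real.rpow_natCast] at this
      linarith
  have h2 := Real.pow_div_factorial_le_exp w hw k
  rw [div_le_iff₀ (by positivity)] at h2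
  have h3 := Real.one_le_exp hw
  linarith

/-- `φ_s(v) v^{-β} ≤ C s^{-2β} φ_{s/2}(v)`. -/
theorem exists_subordinator_mul_rpow_le (β : ℝ) (hβ : 0 ≤ β) :
    ∃ C : ℝ, 0 < C ∧ ∀ s v : ℝ, 0 < s → 0 < v →
      subordinator s v * v ^ (-β) ≤ C * s ^ (-(2 * β)) * subordinator (s / 2) v := by
  obtain ⟨C, hC, h⟩ := exists_rpow_mul_exp_neg_le β hβ
  refine ⟨2 * (16 / 3) ^ β * C, by positivity, fun s v hs hv => ?_⟩
  have hpi : 0 < √Real.pi := Real.sqrt_pos.2 Real.pi_pos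
  have hv' : 0 < √v := Real.sqrt_pos.2 hv
  obtain ⟨w, hw⟩ : ∃ w, w = 3 * s ^ 2 / (16 * v) := ⟨_, rfl⟩
  have hw0 : 0 < w := by rw [hw]; positivity
  have e1 : v ^ (-β) = (16 / 3) ^ β * s ^ (-(2 * β)) * w ^ β := by
    have e2 : s ^ (-(2 * β)) = (s ^ 2)⁻¹ ^ β := by
      rw [Real.inv_rpow (by positivity), ← Real.rpow_natCast s 2, ← Real.rpow_mul hs.le,
        Real.rpow_neg hs.le]
      norm_num
    rw [e2, ← Real.mul_rpow (by norm_num) (by positivity),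
      ← Real.mul_rpow (by positivity) hw0.le, Real.rpow_neg hv.le, ← Real.inv_rpow hv.le, hw]
    congr 1
    field_simp
  have e2 : Real.exp (-s ^ 2 / (4 * v)) = Real.exp (-(s / 2) ^ 2 / (4 * v)) * Real.exp (-w) := by
    rw [← Real.exp_add, hw]
    congr 1
    field_simp
    ring
  rw [subordinator_eq s hv, subordinator_eq (s / 2) hv, e1, e2]
  have h1 := h w hw0.le
  have hE := Real.exp_pos (-(s / 2) ^ 2 / (4 * v))
  have hs' : 0 < s ^ (-(2 * β)) := Real.rpow_pos_of_pos hs _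
  have h16 : (0 : ℝ) < (16 / 3) ^ β := by positivity
  calc _ = s * Real.exp (-(s / 2) ^ 2 / (4 * v)) / (2 * √Real.pi * (v * √v))
        * ((16 / 3) ^ β * s ^ (-(2 * β))) * (w ^ β * Real.exp (-w)) := by ring
    _ ≤ s * Real.exp (-(s / 2) ^ 2 / (4 * v)) / (2 * √Real.pi * (v * √v))
        * ((16 / 3) ^ β * s ^ (-(2 * β))) * C := by gcongr
    _ = _ := by ring

theorem exists_subordinator_le {s : ℝ} (hs : 0 < s) : ∃ C : ℝ, ∀ v, 0 < v → subordinator s v ≤ C := by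
  obtain ⟨C, hC, h⟩ := exists_rpow_mul_exp_neg_le (3 / 2) (by norm_num)
  refine ⟨1 / (2 * √Real.pi) * (s * (C * (4 / s ^ 2) ^ (3 / 2 : ℝ))), fun v hv => ?_⟩
  have h1 := h (s ^ 2 / (4 * v)) (by positivity)
  unfold subordinator
  rw [mul_assoc s]
  have e : v ^ (-(3 / 2) : ℝ) = (s ^ 2 / (4 * v)) ^ (3 / 2 : ℝ) * (4 / s ^ 2) ^ (3 / 2 : ℝ) := by
    rw [← Real.mul_rpow (by positivity) (by positivity), Real.rpow_neg hv.le,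
      ← Real.inv_rpow hv.le]
    congr 1
    field_simp
  have h2 : Real.exp (-s ^ 2 / (4 * v)) * v ^ (-(3 / 2) : ℝ) ≤ C * (4 / s ^ 2) ^ (3 / 2 : ℝ) := by
    rw [e, mul_left_comm, ← mul_assoc, neg_div]
    gcongr
  gcongr

/-- The convolution of two subordination densities: with `z = convExponent r s v`, the function
`(r + s) e^{-(r+s)²/4v} G(z) + (s - r) e^{-(r-s)²/4v} G(z')`, `z' = convExponent r (-s) v`, is a
primitive of a multiple of `φ_r(u) φ_s(v - u)`. -/
theorem integral_subordinator_mul {r s : ℝ} (hr : 0 < r) (hs : 0 < s) {v : ℝ} (hv : 0 < v) :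
    ∫ u in (0 : ℝ)..v, subordinator r u * subordinator s (v - u) = subordinator (r + s) v := by
  have hpi : 0 < √Real.pi := Real.sqrt_pos.2 Real.pi_pos
  have hw : 0 < √v := Real.sqrt_pos.2 hv
  have hw2 : √v ^ 2 = v := Real.sq_sqrt hv.le
  set E := Real.exp (-(r + s) ^ 2 / (4 * v)) with hE
  set E' := Real.exp (-(r + -s) ^ 2 / (4 * v)) with hE'
  let c : ℝ := -(1 / (2 * √Real.pi ^ 2 * (v * √v)))
  let F : ℝ → ℝ := fun u => c * ((r + s) * (E * gaussPrim (convExponent r s v u))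
    + (s - r) * (E' * gaussPrim (convExponent r (-s) v u)))
  have hF : ∀ u ∈ Ioo 0 v, HasDerivAt F (subordinator r u * subordinator s (v - u)) u := by
    rintro u ⟨hu, huv⟩
    have hq : 0 < v - u := sub_pos.2 huv
    have hu' : 0 < √u := Real.sqrt_pos.2 hu
    have hq' : 0 < √(v - u) := Real.sqrt_pos.2 hq
    have h1 := hasDerivAt_gaussPrim_convExponent r s hu huv
    have h2 := hasDerivAt_gaussPrim_convExponent r (-s) hu huv
    refine (((h1.const_mul (r + s)).add (h2.const_mul (s - r))).const_mul c).congr_deriv ?_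
    rw [subordinator_eq r hu, subordinator_eq s hq, neg_sq]
    simp only [c]
    field_simp
    ring
  have h0 : Tendsto F (𝓝[>] 0) (𝓝 (c * ((r + s) * (E * (√Real.pi / 2))
      + (s - r) * (E' * (√Real.pi / 2))))) :=
    ((((tendsto_gaussPrim_atTop.comp (tendsto_convExponent_zero hr s hv)).const_mul E).const_mul
      (r + s)).add (((tendsto_gaussPrim_atTop.comp
        (tendsto_convExponent_zero hr (-s) hv)).const_mul E').const_mul (s - r))).const_mul c
  have h1 : Tendsto F (𝓝[<] v) (𝓝 (c * ((r + s) * (E * (-(√Real.pi / 2)))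
      + (s - r) * (E' * (√Real.pi / 2))))) :=
    ((((tendsto_gaussPrim_atBot.comp (tendsto_convExponent_right r hs hv)).const_mul E).const_mul
      (r + s)).add (((tendsto_gaussPrim_atTop.comp
        (tendsto_convExponent_right_neg r (neg_lt_zero.2 hs) hv)).const_mul E').const_mul
          (s - r))).const_mul c
  have hint : IntervalIntegrable (fun u => subordinator r u * subordinator s (v - u)) volume 0 v := by
    obtain ⟨C, hC⟩ := exists_subordinator_le hr
    obtain ⟨D, hD⟩ := exists_subordinator_le hs
    rw [intervalIntegrable_iff_integrableOn_Ioo_of_le hv.le]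
    refine IntegrableOn.of_bound (C := C * D) (by simp)
      ((measurable_subordinator r).mul ((measurable_subordinator s).comp
        (measurable_const.sub measurable_id))).aestronglyMeasurable ?_
    refine (ae_restrict_iff' measurableSet_Ioo).2 (ae_of_all _ fun u hu => ?_)
    have hq : 0 < v - u := sub_pos.2 hu.2
    have hn1 := subordinator_nonneg hr.le hu.1.le
    have hn2 := subordinator_nonneg hs.le hq.le
    rw [Real.norm_of_nonneg (mul_nonneg hn1 hn2)]
    exact mul_le_mul (hC u hu.1) (hD _ hq) hn2 (hn1.trans (hC u hu.1))
  rw [intervalIntegral.integral_eq_sub_of_hasDerivAt_of_tendsto hv hF hint h0 h1,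
    subordinator_eq _ hv, ← hE]
  simp only [c]
  field_simp
  ring

/-- The derivative of `s ↦ φ_s(v)`. -/
def subordinatorDeriv (s v : ℝ) : ℝ :=
  Real.exp (-s ^ 2 / (4 * v)) * (1 - s ^ 2 / (2 * v)) / (2 * √Real.pi * (v * √v))

/-- The second derivative of `s ↦ φ_s(v)`. -/
def subordinatorDeriv₂ (s v : ℝ) : ℝ :=
  Real.exp (-s ^ 2 / (4 * v)) * (s ^ 3 / (4 * v ^ 2) - 3 * s / (2 * v))
    / (2 * √Real.pi * (v * √v))

theorem hasDerivAt_exp_neg_sq_div (s v : ℝ) : HasDerivAt (fun s => Real.exp (-s ^ 2 / (4 * v)))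
    (Real.exp (-s ^ 2 / (4 * v)) * (-(2 * s) / (4 * v))) s := by
  have h := ((hasDerivAt_pow 2 s).neg.div_const (4 * v)).exp
  simpa using h

theorem hasDerivAt_subordinator (s : ℝ) {v : ℝ} (hv : 0 < v) :
    HasDerivAt (fun s => subordinator s v) (subordinatorDeriv s v) s := by
  have hw : 0 < √v := Real.sqrt_pos.2 hv
  have hpi : 0 < √Real.pi := Real.sqrt_pos.2 Real.pi_pos
  have e : (fun s => subordinator s v) = fun s =>
      s * Real.exp (-s ^ 2 / (4 * v)) / (2 * √Real.pi * (v * √v)) :=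
    funext fun s => subordinator_eq s hv
  rw [e]
  refine (((hasDerivAt_id s).mul (hasDerivAt_exp_neg_sq_div s v)).div_const
    (2 * √Real.pi * (v * √v))).congr_deriv ?_
  rw [subordinatorDeriv, id]
  field_simp
  ring

theorem hasDerivAt_subordinatorDeriv (s : ℝ) {v : ℝ} (hv : 0 < v) :
    HasDerivAt (fun s => subordinatorDeriv s v) (subordinatorDeriv₂ s v) s := by
  have hw : 0 < √v := Real.sqrt_pos.2 hv
  have hpi : 0 < √Real.pi := Real.sqrt_pos.2 Real.pi_pos
  have h2 : HasDerivAt (fun s => 1 - s ^ 2 / (2 * v)) (-(2 * s / (2 * v))) s := by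
    simpa using ((hasDerivAt_pow 2 s).div_const (2 * v)).const_sub 1
  have h := ((hasDerivAt_exp_neg_sq_div s v).mul h2).div_const (2 * √Real.pi * (v * √v))
  refine h.congr_deriv ?_
  rw [subordinatorDeriv₂]
  field_simp
  ring

theorem exp_neg_sq_div_le {s σ : ℝ} (hs : 0 < s) (h1 : s ≤ σ) {v : ℝ} (hv : 0 < v) :
    Real.exp (-σ ^ 2 / (4 * v))
      ≤ Real.exp (-(s / 2) ^ 2 / (4 * v)) * Real.exp (-(3 * (s ^ 2 / (16 * v)))) := by
  rw [← Real.exp_add, Real.exp_le_exp]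
  have e : -(s / 2) ^ 2 / (4 * v) + -(3 * (s ^ 2 / (16 * v))) = -(s ^ 2 / (4 * v)) := by
    field_simp
    ring
  rw [e, neg_div]
  gcongr

theorem abs_subordinatorDeriv_le {s σ : ℝ} (hs : 0 < s) (h1 : s ≤ σ) (h2 : σ ≤ 2 * s) {v : ℝ}
    (hv : 0 < v) : |subordinatorDeriv σ v| ≤ 22 / s * subordinator (s / 2) v := by
  have hw : 0 < √v := Real.sqrt_pos.2 hv
  have hpi : 0 < √Real.pi := Real.sqrt_pos.2 Real.pi_pos
  obtain ⟨w, hw'⟩ : ∃ w, w = s ^ 2 / (16 * v) := ⟨_, rfl⟩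
  have hw0 : 0 < w := by rw [hw']; positivity
  have hE := exp_neg_sq_div_le hs h1 hv
  rw [← hw'] at hE
  have hb : |1 - σ ^ 2 / (2 * v)| ≤ 11 * Real.exp (3 * w) := by
    have h3 : σ ^ 2 / (2 * v) ≤ 32 * w := by
      have : σ ^ 2 ≤ (2 * s) ^ 2 := pow_le_pow_left₀ (hs.le.trans h1) h2 2
      rw [hw', mul_div_assoc', div_le_div_iff₀ (by positivity) (by positivity)]
      nlinarith
    have h4 : 0 ≤ σ ^ 2 / (2 * v) := by positivity
    have h5 := Real.add_one_le_exp (3 * w)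
    rw [abs_le]
    constructor <;> linarith
  rw [subordinator_eq _ hv, subordinatorDeriv, abs_div, abs_mul, Real.abs_exp,
    abs_of_pos (by positivity : 0 < 2 * √Real.pi * (v * √v)), mul_div_assoc']
  refine div_le_div_of_nonneg_right ?_ (by positivity)
  calc _ ≤ (Real.exp (-(s / 2) ^ 2 / (4 * v)) * Real.exp (-(3 * w)))
        * (11 * Real.exp (3 * w)) := mul_le_mul hE hb (abs_nonneg _) (by positivity)
    _ = 11 * Real.exp (-(s / 2) ^ 2 / (4 * v)) * (Real.exp (-(3 * w)) * Real.exp (3 * w)) := by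
        ring
    _ = _ := by
        rw [← Real.exp_add, neg_add_cancel, Real.exp_zero]
        field_simp
        ring

theorem abs_subordinatorDeriv₂_le {s σ : ℝ} (hs : 0 < s) (h1 : s ≤ σ) (h2 : σ ≤ 2 * s) {v : ℝ}
    (hv : 0 < v) : |subordinatorDeriv₂ σ v| ≤ 228 / s ^ 2 * subordinator (s / 2) v := by
  have hw : 0 < √v := Real.sqrt_pos.2 hv
  have hpi : 0 < √Real.pi := Real.sqrt_pos.2 Real.pi_pos
  have hσ : 0 < σ := hs.trans_le h1
  obtain ⟨w, hw'⟩ : ∃ w, w = s ^ 2 / (16 * v) := ⟨_, rfl⟩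
  have hw0 : 0 < w := by rw [hw']; positivity
  have hE := exp_neg_sq_div_le hs h1 hv
  rw [← hw'] at hE
  have hb : |σ ^ 3 / (4 * v ^ 2) - 3 * σ / (2 * v)| ≤ 114 / s * Real.exp (3 * w) := by
    have h3 : σ ^ 3 / (4 * v ^ 2) ≤ 512 * w ^ 2 / s := by
      have : σ ^ 3 ≤ (2 * s) ^ 3 := pow_le_pow_left₀ hσ.le h2 3
      calc _ ≤ (2 * s) ^ 3 / (4 * v ^ 2) := by gcongr
        _ = _ := by rw [hw']; field_simp; ring
    have h3' : 3 * σ / (2 * v) ≤ 48 * w / s := by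
      calc _ ≤ 3 * (2 * s) / (2 * v) := by gcongr
        _ = _ := by rw [hw']; field_simp; ring
    have h4 : 0 ≤ σ ^ 3 / (4 * v ^ 2) := by positivity
    have h4' : 0 ≤ 3 * σ / (2 * v) := by positivity
    have h5 := Real.quadratic_le_exp_of_nonneg (x := 3 * w) (by positivity)
    have h6 : 512 * w ^ 2 / s + 48 * w / s ≤ 114 / s * Real.exp (3 * w) := by
      rw [← add_div, div_mul_eq_mul_div]
      gcongr
      nlinarith
    have h7 : 0 ≤ 512 * w ^ 2 / s := by positivity
    have h8 : 0 ≤ 48 * w / s := by positivity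
    rw [abs_le]
    constructor <;> linarith
  rw [subordinator_eq _ hv, subordinatorDeriv₂, abs_div, abs_mul, Real.abs_exp,
    abs_of_pos (by positivity : 0 < 2 * √Real.pi * (v * √v)), mul_div_assoc']
  refine div_le_div_of_nonneg_right ?_ (by positivity)
  calc _ ≤ (Real.exp (-(s / 2) ^ 2 / (4 * v)) * Real.exp (-(3 * w)))
        * (114 / s * Real.exp (3 * w)) := mul_le_mul hE hb (abs_nonneg _) (by positivity)
    _ = 114 / s * Real.exp (-(s / 2) ^ 2 / (4 * v)) * (Real.exp (-(3 * w)) * Real.exp (3 * w)) := by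
        ring
    _ = _ := by
        rw [← Real.exp_add, neg_add_cancel, Real.exp_zero]
        field_simp
        ring

/-- At the Poisson time `√t` the times in `[t/2, t]` carry a fixed part of the mass. -/
theorem subordinator_sqrt_ge {t v : ℝ} (ht : 0 < t) (h1 : t / 2 ≤ v) (h2 : v ≤ t) :
    Real.exp (-(1 / 2)) / (2 * √Real.pi) / t ≤ subordinator (√t) v := by
  have hv : 0 < v := by linarith
  have hpi : 0 < √Real.pi := Real.sqrt_pos.2 Real.pi_pos
  have ht' : 0 < √t := Real.sqrt_pos.2 ht
  have hw : 0 < √v := Real.sqrt_pos.2 hv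
  have hwt : √v ≤ √t := Real.sqrt_le_sqrt h2
  rw [subordinator_eq _ hv, Real.sq_sqrt ht.le]
  have hE : Real.exp (-(1 / 2)) ≤ Real.exp (-t / (4 * v)) := by
    rw [Real.exp_le_exp, neg_div, neg_le_neg_iff, div_le_div_iff₀ (by positivity) (by norm_num)]
    linarith
  calc _ = √t * Real.exp (-(1 / 2)) / (2 * √Real.pi * (t * √t)) := by field_simp
    _ ≤ _ := by gcongr

end Subordinator

/-! ### Weak integrals of the semigroup -/

section NormalFunctional

variable {M : VonNeumannAlgebra H}

theorem summable_norm_mul_norm (ξ η : lp (fun _ : ℕ => H) 2) :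
    Summable fun k => ‖ξ k‖ * ‖η k‖ := by
  have h : ∀ ζ : lp (fun _ : ℕ => H) 2, Summable fun k => ‖ζ k‖ ^ 2 := fun ζ => by
    have := (lp.memℓp ζ).summable (by norm_num)
    simpa using this
  refine Summable.of_nonneg_of_le (fun k => by positivity) (fun k => ?_) ((h ξ).add (h η))
  nlinarith [sq_nonneg (‖ξ k‖ - ‖η k‖), sq_nonneg ‖ξ k‖, sq_nonneg ‖η k‖]

theorem norm_inner_le_mul (a : H →L[ℂ] H) (x y : H) : ‖⟪x, a y⟫_ℂ‖ ≤ ‖a‖ * (‖x‖ * ‖y‖) := by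
  refine (norm_inner_le_norm _ _).trans ?_
  have := a.le_opNorm y
  calc _ ≤ ‖x‖ * (‖a‖ * ‖y‖) := by gcongr
    _ = _ := by ring

theorem summable_inner (ξ η : lp (fun _ : ℕ => H) 2) (a : H →L[ℂ] H) :
    Summable fun k => ⟪ξ k, a (η k)⟫_ℂ :=
  Summable.of_norm_bounded ((summable_norm_mul_norm ξ η).mul_left ‖a‖)
    fun k => norm_inner_le_mul a (ξ k) (η k)

/-- The normal functional `a ↦ ∑ₖ ⟪ξₖ, a ηₖ⟫`. -/
def normalFunctional (M : VonNeumannAlgebra H)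
    (p : lp (fun _ : ℕ => H) 2 × lp (fun _ : ℕ => H) 2) : Elt M →ₗ[ℂ] ℂ where
  toFun a := ∑' k, ⟪p.1 k, (a : H →L[ℂ] H) (p.2 k)⟫_ℂ
  map_add' a b := by
    rw [← (summable_inner p.1 p.2 a).tsum_add (summable_inner p.1 p.2 b)]
    refine tsum_congr fun k => ?_
    rw [← inner_add_right]
    rfl
  map_smul' c a := by
    rw [RingHom.id_apply, smul_eq_mul, ← tsum_mul_left]
    refine tsum_congr fun k => ?_
    rw [← inner_smul_right]
    rfl

/-- A functional that is continuous for the weak-* topology is a finite combination of the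
functionals defining that topology. -/
theorem mem_span_normalFunctional {φ : Elt M →ₗ[ℂ] ℂ}
    (hφ : @Continuous _ _ (weakStar M) inferInstance φ) :
    φ ∈ Submodule.span ℂ (range (normalFunctional M)) := by
  rw [LinearMap.mem_span_iff_continuous]
  have e : weakStar M = ⨅ p, TopologicalSpace.induced (normalFunctional M p) inferInstance :=
    (iInf_prod (f := fun p => TopologicalSpace.induced (normalFunctional M p) inferInstance)).symm
  rwa [e] at hφ

theorem continuous_inner_weakStar (x y : H) : @Continuous _ _ (weakStar M) inferInstance
    (fun a : Elt M => ⟪x, (a : H →L[ℂ] H) y⟫_ℂ) := by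
  let ξ : lp (fun _ : ℕ => H) 2 := lp.single 2 0 x
  let η : lp (fun _ : ℕ => H) 2 := lp.single 2 0 y
  have h2 : @Continuous _ _ (weakStar M) inferInstance
      (fun a : Elt M => ∑' k, ⟪ξ k, (a : H →L[ℂ] H) (η k)⟫_ℂ) :=
    continuous_iInf_dom (continuous_iInf_dom continuous_induced_dom)
  have h3 : (fun a : Elt M => ∑' k, ⟪ξ k, (a : H →L[ℂ] H) (η k)⟫_ℂ)
      = fun a : Elt M => ⟪x, (a : H →L[ℂ] H) y⟫_ℂ := by
    funext a
    rw [tsum_eq_single 0]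
    · simp [ξ, η]
    · intro k hk
      simp [ξ, η, hk]
  rwa [h3] at h2

/-- Weak-* continuous functionals commute with weak integrals of bounded families. -/
theorem integral_of_mem_span {ψ : ℝ → ℝ} (hψ : IntegrableOn ψ (Ioi 0)) {F : ℝ → Elt M} {g : Elt M}
    (hF : ∀ x y : H, Continuous fun v => ⟪x, (F v : H →L[ℂ] H) y⟫_ℂ) {C : ℝ}
    (hC : ∀ v, ‖(F v : H →L[ℂ] H)‖ ≤ C)
    (hg : IsWeakIntegral ψ (fun v => (F v : H →L[ℂ] H)) (g : H →L[ℂ] H))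
    {φ : Elt M →ₗ[ℂ] ℂ} (hφ : φ ∈ Submodule.span ℂ (range (normalFunctional M))) :
    IntegrableOn (fun v => (ψ v : ℂ) * φ (F v)) (Ioi 0) ∧
      φ g = ∫ v in Ioi (0 : ℝ), (ψ v : ℂ) * φ (F v) := by
  induction hφ using Submodule.span_induction with
  | mem φ hφ =>
    obtain ⟨p, rfl⟩ := hφ
    have hterm : ∀ k, IntegrableOn
        (fun v => (ψ v : ℂ) * ⟪p.1 k, (F v : H →L[ℂ] H) (p.2 k)⟫_ℂ) (Ioi 0) := fun k =>
      Integrable.mul_bdd (c := C * (‖p.1 k‖ * ‖p.2 k‖)) hψ.ofReal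
        (hF _ _).aestronglyMeasurable (ae_of_all _ fun v => (norm_inner_le_mul _ _ _).trans (by
          have := hC v
          gcongr))
    have hnorm : ∀ k v, ‖(ψ v : ℂ) * ⟪p.1 k, (F v : H →L[ℂ] H) (p.2 k)⟫_ℂ‖
        ≤ |ψ v| * (C * (‖p.1 k‖ * ‖p.2 k‖)) := by
      intro k v
      rw [norm_mul, Complex.norm_real, Real.norm_eq_abs]
      refine mul_le_mul_of_nonneg_left ((norm_inner_le_mul _ _ _).trans ?_) (abs_nonneg _)
      have := hC v
      gcongr
    have hsum : Summable fun k =>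
        ∫ v in Ioi (0 : ℝ), ‖(ψ v : ℂ) * ⟪p.1 k, (F v : H →L[ℂ] H) (p.2 k)⟫_ℂ‖ := by
      refine Summable.of_nonneg_of_le (fun k => integral_nonneg fun v => norm_nonneg _)
        (fun k => ?_) (((summable_norm_mul_norm p.1 p.2).mul_left C).mul_left
          (∫ v in Ioi (0 : ℝ), |ψ v|))
      rw [← integral_mul_const]
      exact integral_mono_of_nonneg (ae_of_all _ fun v => norm_nonneg _)
        (hψ.abs.mul_const _) (ae_of_all _ fun v => hnorm k v)
    have key := hasSum_integral_of_summable_integral_norm hterm hsum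
    have e : ∀ v, (ψ v : ℂ) * normalFunctional M p (F v)
        = ∑' k, (ψ v : ℂ) * ⟪p.1 k, (F v : H →L[ℂ] H) (p.2 k)⟫_ℂ := fun v => tsum_mul_left.symm
    refine ⟨?_, ?_⟩
    · have hmeas : AEStronglyMeasurable (fun v => normalFunctional M p (F v))
          (volume.restrict (Ioi 0)) := by
        have hm : Continuous fun v => normalFunctional M p (F v) := by
          refine continuous_tsum (fun k => hF (p.1 k) (p.2 k))
            ((summable_norm_mul_norm p.1 p.2).mul_left C) fun k v => ?_
          refine (norm_inner_le_mul _ _ _).trans ?_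
          have := hC v
          gcongr
        exact hm.aestronglyMeasurable
      refine Integrable.mul_bdd (c := ∑' k, C * (‖p.1 k‖ * ‖p.2 k‖)) hψ.ofReal hmeas
        (ae_of_all _ fun v => ?_)
      refine tsum_of_norm_bounded ((summable_norm_mul_norm p.1 p.2).mul_left C).hasSum fun k => ?_
      refine (norm_inner_le_mul _ _ _).trans ?_
      have := hC v
      gcongr
    · simp only [e]
      rw [← key.tsum_eq]
      exact tsum_congr fun k => hg _ _
  | zero => simp
  | add φ₁ φ₂ _ _ h₁ h₂ =>
    simp only [LinearMap.add_apply, mul_add]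
    exact ⟨h₁.1.add h₂.1, by rw [integral_add h₁.1 h₂.1, h₁.2, h₂.2]⟩
  | smul c φ _ h =>
    simp only [LinearMap.smul_apply, smul_eq_mul, mul_left_comm _ c]
    exact ⟨h.1.const_mul c, by rw [integral_const_mul, h.2]⟩

end NormalFunctional

section TimeIntegral

variable {M : VonNeumannAlgebra H} {τ : NSFTrace M} (T : MarkovSemigroup τ)

theorem MarkovSemigroup.norm_at_le (v : ℝ) (f : Elt M) :
    ‖(T.at v f : H →L[ℂ] H)‖ ≤ ‖(f : H →L[ℂ] H)‖ := (T.markovian _).norm_le f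

theorem exists_timeIntegral {ψ : ℝ → ℝ} (hψ : IntegrableOn ψ (Ioi 0)) (f : Elt M) :
    ∃ g : Elt M, IsWeakIntegral ψ (fun v => (T.at v f : H →L[ℂ] H)) (g : H →L[ℂ] H) := by
  obtain ⟨g, hg⟩ := exists_weakIntegral ψ hψ
    (fun v => (T.at v f : H →L[ℂ] H)) (fun x y => continuous_inner_at T f x y) _
    fun v x y => (T.markovian _).norm_inner_le f x y
  refine ⟨⟨g, ?_⟩, hg⟩
  change g ∈ M
  rw [mem_iff_commute]
  intro u hu
  ext y
  refine ext_inner_left ℂ fun x => ?_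
  change ⟪x, u (g y)⟫_ℂ = ⟪x, g (u y)⟫_ℂ
  rw [← ContinuousLinearMap.adjoint_inner_left, hg, hg]
  congr 1
  ext v
  have h : u * (T.at v f : H →L[ℂ] H) = (T.at v f : H →L[ℂ] H) * u :=
    (mem_iff_commute _).1 (T.at v f).2 u hu
  have h' : u ((T.at v f : H →L[ℂ] H) y) = (T.at v f : H →L[ℂ] H) (u y) :=
    congrArg (fun w : H →L[ℂ] H => w y) h
  rw [ContinuousLinearMap.adjoint_inner_left, h']

/-- The weak integral `∫_0^∞ ψ(v) T_v f dv`; it is `0` if `ψ` is not integrable. -/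
def timeIntegral (ψ : ℝ → ℝ) (f : Elt M) : Elt M := by
  classical exact
    if h : IntegrableOn ψ (Ioi 0) then Classical.choose (exists_timeIntegral T h f) else 0

theorem isWeakIntegral_timeIntegral {ψ : ℝ → ℝ} (hψ : IntegrableOn ψ (Ioi 0)) (f : Elt M) :
    IsWeakIntegral ψ (fun v => (T.at v f : H →L[ℂ] H)) (timeIntegral T ψ f : H →L[ℂ] H) := by
  rw [timeIntegral, dif_pos hψ]
  exact Classical.choose_spec (exists_timeIntegral T hψ f)

theorem IsWeakIntegral.unique {ψ : ℝ → ℝ} {F : ℝ → H →L[ℂ] H} {g g' : Elt M}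
    (h : IsWeakIntegral ψ F (g : H →L[ℂ] H)) (h' : IsWeakIntegral ψ F (g' : H →L[ℂ] H)) :
    g = g' := by
  refine Subtype.ext (ContinuousLinearMap.ext fun y => ext_inner_left ℂ fun x => ?_)
  rw [h x y, h' x y]

theorem poisson_eq_timeIntegral {s : ℝ} (hs : 0 < s) (f : Elt M) :
    poisson T s f = timeIntegral T (subordinator s) f := by
  refine IsWeakIntegral.unique (ψ := subordinator s) (F := fun v => (T.at v f : H →L[ℂ] H)) ?_
    (isWeakIntegral_timeIntegral T (integrableOn_subordinator hs) f)
  rw [poisson, dif_pos hs]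
  exact Classical.choose_spec (exists_poisson T hs f)

variable {T}

theorem integrableOn_inner {ψ : ℝ → ℝ} (hψ : IntegrableOn ψ (Ioi 0)) (f : Elt M) (x y : H) :
    IntegrableOn (fun v => (ψ v : ℂ) * ⟪x, (T.at v f : H →L[ℂ] H) y⟫_ℂ) (Ioi 0) :=
  Integrable.mul_bdd (c := ‖(f : H →L[ℂ] H)‖ * (‖x‖ * ‖y‖)) hψ.ofReal
    (continuous_inner_at T f x y).aestronglyMeasurable
    (ae_of_all _ fun v => (norm_inner_le_mul _ _ _).trans (by
      have := T.norm_at_le v f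
      gcongr))

theorem timeIntegral_sub {ψ₁ ψ₂ : ℝ → ℝ} (h₁ : IntegrableOn ψ₁ (Ioi 0))
    (h₂ : IntegrableOn ψ₂ (Ioi 0)) (f : Elt M) :
    timeIntegral T (fun v => ψ₁ v - ψ₂ v) f = timeIntegral T ψ₁ f - timeIntegral T ψ₂ f := by
  refine IsWeakIntegral.unique (isWeakIntegral_timeIntegral T (h₁.sub h₂) f) fun x y => ?_
  change ⟪x, (timeIntegral T ψ₁ f : H →L[ℂ] H) y - (timeIntegral T ψ₂ f : H →L[ℂ] H) y⟫_ℂ = _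
  rw [inner_sub_right, isWeakIntegral_timeIntegral T h₁ f, isWeakIntegral_timeIntegral T h₂ f,
    ← integral_sub (integrableOn_inner h₁ f x y) (integrableOn_inner h₂ f x y)]
  refine integral_congr_ae (ae_of_all _ fun v => ?_)
  simp only [Pi.sub_apply]
  push_cast
  ring

theorem timeIntegral_smul {ψ : ℝ → ℝ} (h : IntegrableOn ψ (Ioi 0)) (c : ℝ) (f : Elt M) :
    timeIntegral T (fun v => c * ψ v) f = (c : ℂ) • timeIntegral T ψ f := by
  refine IsWeakIntegral.unique (isWeakIntegral_timeIntegral T (h.const_mul c) f) fun x y => ?_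
  change ⟪x, (c : ℂ) • (timeIntegral T ψ f : H →L[ℂ] H) y⟫_ℂ = _
  rw [inner_smul_right, isWeakIntegral_timeIntegral T h f, ← integral_const_mul]
  refine integral_congr_ae (ae_of_all _ fun v => ?_)
  simp only
  push_cast
  ring

theorem MarkovSemigroup.at_linear (T : MarkovSemigroup τ) (v : ℝ) (c : ℂ) (f g : Elt M) :
    T.at v (f + c • g) = T.at v f + c • T.at v g := by
  simp [MarkovSemigroup.at]

theorem timeIntegral_linear {ψ : ℝ → ℝ} (h : IntegrableOn ψ (Ioi 0)) (c : ℂ) (f g : Elt M) :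
    timeIntegral T ψ (f + c • g) = timeIntegral T ψ f + c • timeIntegral T ψ g := by
  refine IsWeakIntegral.unique (isWeakIntegral_timeIntegral T h _) fun x y => ?_
  change ⟪x, (timeIntegral T ψ f : H →L[ℂ] H) y + c • (timeIntegral T ψ g : H →L[ℂ] H) y⟫_ℂ = _
  rw [inner_add_right, inner_smul_right, isWeakIntegral_timeIntegral T h f,
    isWeakIntegral_timeIntegral T h g, ← integral_const_mul,
    ← integral_add (integrableOn_inner h f x y) ((integrableOn_inner h g x y).const_mul c)]
  refine integral_congr_ae (ae_of_all _ fun v => ?_)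
  simp only [T.at_linear]
  change _ = _ * ⟪x, (T.at v f : H →L[ℂ] H) y + c • (T.at v g : H →L[ℂ] H) y⟫_ℂ
  rw [inner_add_right, inner_smul_right]
  ring

theorem timeIntegral_nonneg {ψ : ℝ → ℝ} (h : IntegrableOn ψ (Ioi 0)) (h0 : ∀ v, 0 < v → 0 ≤ ψ v)
    {f : Elt M} (hf : 0 ≤ (f : H →L[ℂ] H)) : 0 ≤ (timeIntegral T ψ f : H →L[ℂ] H) := by
  rw [nonneg_iff_inner]
  intro x
  have h1 : ∀ v, ⟪x, (T.at v f : H →L[ℂ] H) x⟫_ℂ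
      = ((⟪x, (T.at v f : H →L[ℂ] H) x⟫_ℂ).re : ℂ) := fun v =>
    inner_eq_re ⟨T.at v f, (T.at v f).2, (T.markovian _).nonneg hf⟩ x
  have h2 : ∀ v, 0 ≤ (⟪x, (T.at v f : H →L[ℂ] H) x⟫_ℂ).re := fun v =>
    (Complex.le_def.1 ((nonneg_iff_inner _).1 ((T.markovian _).nonneg hf) x)).1
  rw [isWeakIntegral_timeIntegral T h f x x]
  have e : ∫ v in Ioi (0 : ℝ), (ψ v : ℂ) * ⟪x, (T.at v f : H →L[ℂ] H) x⟫_ℂ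
      = ((∫ v in Ioi (0 : ℝ), ψ v * (⟪x, (T.at v f : H →L[ℂ] H) x⟫_ℂ).re : ℝ) : ℂ) := by
    rw [← integral_complex_ofReal]
    refine integral_congr_ae (ae_of_all _ fun v => ?_)
    simp only
    rw [h1 v]
    push_cast
    rfl
  rw [e, Complex.zero_le_real]
  exact setIntegral_nonneg measurableSet_Ioi fun v hv => mul_nonneg (h0 v hv) (h2 v)

theorem timeIntegral_mono {ψ₁ ψ₂ : ℝ → ℝ} (h₁ : IntegrableOn ψ₁ (Ioi 0))
    (h₂ : IntegrableOn ψ₂ (Ioi 0)) (hle : ∀ v, 0 < v → ψ₁ v ≤ ψ₂ v)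
    {f : Elt M} (hf : 0 ≤ (f : H →L[ℂ] H)) :
    (timeIntegral T ψ₁ f : H →L[ℂ] H) ≤ (timeIntegral T ψ₂ f : H →L[ℂ] H) := by
  have := timeIntegral_nonneg (T := T) (h₂.sub h₁) (fun v hv => sub_nonneg.2 (hle v hv)) hf
  have e := timeIntegral_sub (T := T) h₂ h₁ f
  rw [show (fun v => ψ₂ v - ψ₁ v) = ψ₂ - ψ₁ from rfl] at e
  rw [e] at this
  exact sub_nonneg.1 this

theorem norm_timeIntegral_le {ψ b : ℝ → ℝ} (h : IntegrableOn ψ (Ioi 0))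
    (hb : IntegrableOn b (Ioi 0)) {f : Elt M}
    (hle : ∀ v, 0 < v → |ψ v| * ‖(T.at v f : H →L[ℂ] H)‖ ≤ b v) :
    ‖(timeIntegral T ψ f : H →L[ℂ] H)‖ ≤ ∫ v in Ioi (0 : ℝ), b v := by
  have h0 : 0 ≤ ∫ v in Ioi (0 : ℝ), b v := setIntegral_nonneg measurableSet_Ioi fun v hv =>
    (by positivity : 0 ≤ |ψ v| * ‖(T.at v f : H →L[ℂ] H)‖).trans (hle v hv)
  refine opNorm_le_of_norm_inner_le h0 fun x y => ?_
  rw [isWeakIntegral_timeIntegral T h f x y, mul_assoc, ← integral_mul_const]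
  refine (norm_integral_le_of_norm_le (g := fun v => b v * (‖x‖ * ‖y‖)) (hb.mul_const _) ?_)
  refine (ae_restrict_iff' measurableSet_Ioi).2 (ae_of_all _ fun v hv => ?_)
  rw [norm_mul, Complex.norm_real, Real.norm_eq_abs]
  calc _ ≤ |ψ v| * (‖(T.at v f : H →L[ℂ] H)‖ * (‖x‖ * ‖y‖)) :=
        mul_le_mul_of_nonneg_left (norm_inner_le_mul _ _ _) (abs_nonneg _)
    _ = |ψ v| * ‖(T.at v f : H →L[ℂ] H)‖ * (‖x‖ * ‖y‖) := by ring
    _ ≤ _ := mul_le_mul_of_nonneg_right (hle v hv) (by positivity)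

theorem integrableOn_of_abs_le {ψ : ℝ → ℝ} (hm : Measurable ψ) {κ s : ℝ} (hs : 0 < s)
    (hle : ∀ v, 0 < v → |ψ v| ≤ κ * subordinator s v) : IntegrableOn ψ (Ioi 0) :=
  Integrable.mono' ((integrableOn_subordinator hs).const_mul κ) hm.aestronglyMeasurable
    ((ae_restrict_iff' measurableSet_Ioi).2 (ae_of_all _ fun v hv => hle v hv))

theorem norm_timeIntegral_le_of_abs_le {ψ : ℝ → ℝ} (h : IntegrableOn ψ (Ioi 0)) {κ s : ℝ}
    (hs : 0 < s) (hle : ∀ v, 0 < v → |ψ v| ≤ κ * subordinator s v) (f : Elt M) :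
    ‖(timeIntegral T ψ f : H →L[ℂ] H)‖ ≤ κ * ‖(f : H →L[ℂ] H)‖ := by
  have hi := ((integrableOn_subordinator hs).const_mul κ).mul_const ‖(f : H →L[ℂ] H)‖
  refine (norm_timeIntegral_le h hi fun v hv => ?_).trans (le_of_eq ?_)
  · have := T.norm_at_le v f
    have := hle v hv
    gcongr
    exact (abs_nonneg _).trans this
  · rw [integral_mul_const, integral_const_mul, integral_subordinator hs, mul_one]

theorem timeIntegral_le_of_abs_le {ψ : ℝ → ℝ} (h : IntegrableOn ψ (Ioi 0)) {κ s : ℝ}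
    (hs : 0 < s) (hle : ∀ v, 0 < v → |ψ v| ≤ κ * subordinator s v) {f : Elt M}
    (hf : 0 ≤ (f : H →L[ℂ] H)) :
    (timeIntegral T ψ f : H →L[ℂ] H) ≤ (κ : ℂ) • (poisson T s f : H →L[ℂ] H) ∧
      -((κ : ℂ) • (poisson T s f : H →L[ℂ] H)) ≤ (timeIntegral T ψ f : H →L[ℂ] H) := by
  have hi := integrableOn_subordinator hs
  have e : ∀ c : ℝ, (timeIntegral T (fun v => c * subordinator s v) f : H →L[ℂ] H)
      = (c : ℂ) • (poisson T s f : H →L[ℂ] H) := fun c => by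
    rw [timeIntegral_smul hi, poisson_eq_timeIntegral T hs]
    rfl
  constructor
  · rw [← e]
    exact timeIntegral_mono h (hi.const_mul κ) (fun v hv => (le_abs_self _).trans (hle v hv)) hf
  · rw [← neg_smul, ← Complex.ofReal_neg, ← e]
    refine timeIntegral_mono (hi.const_mul (-κ)) h (fun v hv => ?_) hf
    have := (abs_le.1 (hle v hv)).1
    linarith

/-- Weak integrals may be paired with vectors of `M ∩ L₂(M)`, not only with vectors of `H`. -/
theorem integral_inner_lmul {ψ : ℝ → ℝ} (h : IntegrableOn ψ (Ioi 0)) (f : Elt M) (w w' : L2 τ) :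
    (Continuous fun v => ⟪w', L2.lmul (T.at v f).2 w⟫_ℂ) ∧
    ⟪w', L2.lmul (timeIntegral T ψ f).2 w⟫_ℂ
      = ∫ v in Ioi (0 : ℝ), (ψ v : ℂ) * ⟪w', L2.lmul (T.at v f).2 w⟫_ℂ := by
  have := isNormalVector (M := M) (τ := τ) (fun v => (T.at v f).2) (timeIntegral T ψ f).2
    (fun v => T.norm_at_le v f) h (fun x y => continuous_inner_at T f x y)
    (isWeakIntegral_timeIntegral T h f) w
  exact ⟨this.continuous w', this.integral w'⟩

end TimeIntegral

/-! ### The Poisson semigroup -/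

section Poisson

variable {M : VonNeumannAlgebra H} {τ : NSFTrace M}

theorem L2.inner_lmul_self {a : H →L[ℂ] H} (ha : a ∈ M) (ha0 : 0 ≤ a) (w : L2 τ) :
    ⟪w, L2.lmul ha w⟫_ℂ = ((tr τ (star w.op * a * w.op)).toReal : ℂ) ∧
      tr τ (star w.op * a * w.op) < ∞ := by
  have hs := sqrt_mem ha ha0
  have e : star (L2.lmul hs w).op * (L2.lmul hs w).op = star w.op * a * w.op := by
    rw [L2.op_lmul, star_mul, star_sqrt]
    conv_rhs => rw [← CFC.sqrt_mul_sqrt_self a ha0]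
    simp only [mul_assoc]
  rw [← e]
  refine ⟨?_, L2.tr_lt_top _⟩
  rw [← L2.inner_self, L2.inner_lmul]
  congr 1
  apply L2.op_injective
  simp only [L2.op_lmul, star_sqrt]
  rw [← mul_assoc, CFC.sqrt_mul_sqrt_self a ha0]

theorem tr_star_mul_mul_le {w a : H →L[ℂ] H} (hw : w ∈ M) (hw1 : ‖w‖ ≤ 1) (ha : a ∈ M)
    (ha0 : 0 ≤ a) : tr τ (star w * a * w) ≤ tr τ a := by
  have := tr_conj_le (τ := τ) ha ha0 (star_mem' hw) (by rwa [norm_star])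
  rwa [star_star] at this

/-- Bounds of `τ(h)` can be tested on the weights `τ(w* h w) = ⟪w, h w⟫`, where `w` runs through the
contractions in `M ∩ L₂(M)`. -/
theorem tr_le_of_forall_inner_lmul {h : H →L[ℂ] H} (hM : h ∈ M) (h0 : 0 ≤ h) {K : ℝ}
    (hK : ∀ w : L2 τ, ‖w.op‖ ≤ 1 → ‖⟪w, L2.lmul hM w⟫_ℂ‖ ≤ K) : tr τ h ≤ ENNReal.ofReal K := by
  refine tr_le_of_forall_conj hM h0 fun c hc hc0 hc1 hct => ?_
  have hsc := sqrt_mem hc hc0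
  let w : L2 τ := L2.mk (CFC.sqrt c) hsc (by rwa [star_sqrt, CFC.sqrt_mul_sqrt_self c hc0])
  have hw : star w.op = CFC.sqrt c := star_sqrt c
  have hw1 : ‖w.op‖ ≤ 1 := by
    have h1 : ‖star w.op * w.op‖ ≤ 1 := by
      rw [hw, L2.op_mk, CFC.sqrt_mul_sqrt_self c hc0]
      exact (CStarAlgebra.norm_le_one_iff_of_nonneg c hc0).2 hc1
    rw [CStarRing.norm_star_mul_self] at h1
    nlinarith [norm_nonneg w.op]
  obtain ⟨e1, e2⟩ := L2.inner_lmul_self hM h0 w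
  have h2 := hK w hw1
  rw [e1, Complex.norm_real, Real.norm_of_nonneg ENNReal.toReal_nonneg] at h2
  rw [hw] at h2 e2
  change tr τ (CFC.sqrt c * _ * w.op) ≤ _
  rw [← ENNReal.ofReal_toReal e2.ne]
  exact ENNReal.ofReal_le_ofReal h2

variable (T : MarkovSemigroup τ)

theorem poisson_of_pos_eq {s : ℝ} (hs : 0 < s) :
    poisson T s = timeIntegral T (subordinator s) := funext (poisson_eq_timeIntegral T hs)

theorem poisson_linear {s : ℝ} (hs : 0 < s) (c : ℂ) (f g : Elt M) :
    poisson T s (f + c • g) = poisson T s f + c • poisson T s g := by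
  rw [poisson_of_pos_eq T hs, timeIntegral_linear (integrableOn_subordinator hs)]

theorem poisson_nonneg {s : ℝ} (hs : 0 < s) {f : Elt M} (hf : 0 ≤ (f : H →L[ℂ] H)) :
    0 ≤ (poisson T s f : H →L[ℂ] H) := by
  rw [poisson_of_pos_eq T hs]
  exact timeIntegral_nonneg (integrableOn_subordinator hs)
    (fun v hv => subordinator_nonneg hs.le hv.le) hf

theorem norm_poisson_le {s : ℝ} (hs : 0 < s) (f : Elt M) :
    ‖(poisson T s f : H →L[ℂ] H)‖ ≤ ‖(f : H →L[ℂ] H)‖ := by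
  rw [poisson_of_pos_eq T hs]
  refine (norm_timeIntegral_le_of_abs_le (integrableOn_subordinator hs) hs
    (fun v hv => ?_) f).trans (one_mul _).le
  rw [abs_of_nonneg (subordinator_nonneg hs.le hv.le), one_mul]

theorem tr_poisson_le {s : ℝ} (hs : 0 < s) {f : Elt M} (hf : 0 ≤ (f : H →L[ℂ] H)) :
    tr τ (poisson T s f : H →L[ℂ] H) ≤ tr τ (f : H →L[ℂ] H) := by
  rcases eq_or_ne (tr τ (f : H →L[ℂ] H)) ∞ with ht | ht
  · rw [ht]; exact le_top
  have hi := integrableOn_subordinator hs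
  rw [← ENNReal.ofReal_toReal ht]
  refine tr_le_of_forall_inner_lmul (poisson T s f).2 (poisson_nonneg T hs hf) fun w hw1 => ?_
  have hv : ∀ v, ‖⟪w, L2.lmul (T.at v f).2 w⟫_ℂ‖ ≤ (tr τ (f : H →L[ℂ] H)).toReal := by
    intro v
    have h0 := (T.markovian v.toNNReal).nonneg hf
    rw [(L2.inner_lmul_self (T.at v f).2 h0 w).1, Complex.norm_real,
      Real.norm_of_nonneg ENNReal.toReal_nonneg]
    refine ENNReal.toReal_mono ht ?_
    rw [← (T.markovian v.toNNReal).tr_eq hf]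
    exact tr_star_mul_mul_le w.mem hw1 (T.at v f).2 h0
  have e4 := (integral_inner_lmul (T := T) hi f w w).2
  simp only [← poisson_eq_timeIntegral T hs] at e4
  rw [e4]
  refine (norm_integral_le_of_norm_le
    (g := fun v => subordinator s v * (tr τ (f : H →L[ℂ] H)).toReal) (hi.mul_const _) ?_).trans ?_
  · refine (ae_restrict_iff' measurableSet_Ioi).2 (ae_of_all _ fun v hv' => ?_)
    have hp := subordinator_nonneg hs.le (le_of_lt hv')
    rw [norm_mul, Complex.norm_real, Real.norm_of_nonneg hp]
    exact mul_le_mul_of_nonneg_left (hv v) hp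
  · rw [integral_mul_const, integral_subordinator hs, one_mul]

/-- Each `T_u` commutes with the weak integrals, by weak-* continuity. -/
theorem inner_at_poisson {u s : ℝ} (hu : 0 ≤ u) (hs : 0 < s) (f : Elt M) (x y : H) :
    ⟪x, (T.at u (poisson T s f) : H →L[ℂ] H) y⟫_ℂ
      = ∫ v in Ioi (0 : ℝ), (subordinator s v : ℂ) * ⟪x, (T.at (u + v) f : H →L[ℂ] H) y⟫_ℂ := by
  let φ : Elt M →ₗ[ℂ] ℂ :=
    { toFun := fun a => ⟪x, (T.at u a : H →L[ℂ] H) y⟫_ℂ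
      map_add' := fun a b => by
        rw [← inner_add_right]
        simp only [MarkovSemigroup.at, map_add]
        rfl
      map_smul' := fun c a => by
        rw [RingHom.id_apply, smul_eq_mul, ← inner_smul_right]
        simp only [MarkovSemigroup.at, map_smul]
        rfl }
  have hφ : @Continuous _ _ (weakStar M) inferInstance φ :=
    @Continuous.comp (Elt M) (Elt M) ℂ (weakStar M) (weakStar M) _ (T.toFun u.toNNReal)
      (fun a : Elt M => ⟪x, (a : H →L[ℂ] H) y⟫_ℂ)
      (continuous_inner_weakStar x y) (T.markovian u.toNNReal).weakStar_continuous
  have := (integral_of_mem_span (F := fun v => T.at v f) (integrableOn_subordinator hs)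
    (fun x y => continuous_inner_at T f x y) (fun v => T.norm_at_le v f)
    (isWeakIntegral_timeIntegral T (integrableOn_subordinator hs) f)
    (mem_span_normalFunctional hφ)).2
  rw [← poisson_eq_timeIntegral T hs] at this
  refine this.trans (setIntegral_congr_fun measurableSet_Ioi fun v hv => ?_)
  simp only [φ, LinearMap.coe_mk, AddHom.coe_mk]
  rw [T.at_add hu (le_of_lt hv)]

theorem integral_indicator_subordinator_mul {r s : ℝ} (hr : 0 < r) (hs : 0 < s) (z : ℝ) :
    ∫ u, (Ioi 0).indicator (subordinator r) u * (Ioi 0).indicator (subordinator s) (z - u)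
      = (Ioi 0).indicator (subordinator (r + s)) z := by
  have e : (fun u => (Ioi 0).indicator (subordinator r) u
      * (Ioi 0).indicator (subordinator s) (z - u))
      = (Ioo 0 z).indicator fun u => subordinator r u * subordinator s (z - u) := by
    funext u
    by_cases h1 : 0 < u <;> by_cases h2 : u < z <;> simp [indicator, h1, h2]
  rw [e, integral_indicator measurableSet_Ioo]
  by_cases hz : 0 < z
  · rw [indicator_of_mem (mem_Ioi.2 hz), ← integral_subordinator_mul hr hs hz,
      intervalIntegral.integral_of_le hz.le, integral_Ioc_eq_integral_Ioo]
  · rw [indicator_of_notMem (by simpa using hz), Ioo_eq_empty (by simpa using hz)]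
    simp

/-- The convolution identity `φ_r * φ_s = φ_{r+s}`, tested against a bounded function. -/
theorem integral_integral_subordinator {r s : ℝ} (hr : 0 < r) (hs : 0 < s) {G : ℝ → ℂ}
    (hG : Continuous G) {C : ℝ} (hC : ∀ v, ‖G v‖ ≤ C) :
    ∫ u in Ioi (0 : ℝ), (subordinator r u : ℂ) *
        ∫ v in Ioi (0 : ℝ), (subordinator s v : ℂ) * G (u + v)
      = ∫ z in Ioi (0 : ℝ), (subordinator (r + s) z : ℂ) * G z := by
  let F : ℝ → ℝ → ℂ := fun s v => (((Ioi 0).indicator (subordinator s) v : ℝ) : ℂ)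
  have hF : ∀ s, 0 < s → Integrable (F s) := fun s hs =>
    ((integrable_indicator_iff measurableSet_Ioi).2 (integrableOn_subordinator hs)).ofReal
  have e : ∀ (s : ℝ) (K : ℝ → ℂ), ∫ v in Ioi (0 : ℝ), (subordinator s v : ℂ) * K v
      = ∫ v, F s v * K v := by
    intro s K
    rw [← integral_indicator measurableSet_Ioi]
    congr 1
    funext v
    by_cases hv : v ∈ Ioi (0 : ℝ) <;> simp [F, hv]
  simp only [e]
  have h1 : ∀ u, ∫ v, F s v * G (u + v) = ∫ z, F s (z - u) * G z := by
    intro u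
    rw [← integral_sub_right_eq_self (fun v => F s v * G (u + v)) u]
    congr 1
    funext z
    rw [add_sub_cancel]
  simp only [h1, ← integral_const_mul]
  have hint : Integrable (Function.uncurry fun u z => F r u * (F s (z - u) * G z))
      (volume.prod volume) := by
    have h2 : Integrable (fun p : ℝ × ℝ => F r p.2 * F s (p.1 - p.2)) (volume.prod volume) :=
      Integrable.convolution_integrand (ContinuousLinearMap.mul ℂ ℂ) (hF r hr) (hF s hs)
    have h3 := (h2.swap).mul_bdd (g := fun p : ℝ × ℝ => G p.2) (c := C)
      (hG.comp continuous_snd).aestronglyMeasurable (ae_of_all _ fun p => hC _)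
    refine h3.congr (ae_of_all _ fun p => ?_)
    simp only [Function.comp, Prod.fst_swap, Prod.snd_swap, Function.uncurry]
    ring
  rw [integral_integral_swap hint]
  congr 1
  funext z
  simp only [← mul_assoc]
  rw [integral_mul_const]
  congr 1
  have := congrArg (fun x : ℝ => (x : ℂ)) (integral_indicator_subordinator_mul hr hs z)
  rw [← integral_complex_ofReal] at this
  simpa [F] using this

theorem poisson_poisson {r s : ℝ} (hr : 0 < r) (hs : 0 < s) (f : Elt M) :
    poisson T r (poisson T s f) = poisson T (r + s) f := by
  rw [poisson_eq_timeIntegral T (add_pos hr hs)]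
  refine IsWeakIntegral.unique (ψ := subordinator (r + s))
    (F := fun v => (T.at v f : H →L[ℂ] H)) (fun x y => ?_)
    (isWeakIntegral_timeIntegral T (integrableOn_subordinator (add_pos hr hs)) f)
  rw [poisson_eq_timeIntegral T hr,
    isWeakIntegral_timeIntegral T (integrableOn_subordinator hr),
    ← integral_integral_subordinator hr hs (continuous_inner_at T f x y)
      (fun v => (T.markovian _).norm_inner_le f x y)]
  refine setIntegral_congr_fun measurableSet_Ioi fun u hu => ?_
  simp only
  rw [inner_at_poisson T (le_of_lt hu) hs]

end Poisson

/-! ### Differentiability in time -/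

section Derivative

/-- Taylor's formula with a second order remainder. -/
theorem abs_taylor_le {f f' f'' : ℝ → ℝ} {a b K : ℝ} (hf : ∀ x, HasDerivAt f (f' x) x)
    (hf' : ∀ x, HasDerivAt f' (f'' x) x) (hK : ∀ x ∈ Icc a b, |f'' x| ≤ K) {x y : ℝ}
    (hx : x ∈ Icc a b) (hy : y ∈ Icc a b) :
    |f y - f x - (y - x) * f' x| ≤ K * (y - x) ^ 2 := by
  have hsub : uIcc x y ⊆ Icc a b := (convex_Icc a b).ordConnected.uIcc_subset hx hy
  have hK0 : 0 ≤ K := (abs_nonneg _).trans (hK x hx)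
  have h1 : ∀ z ∈ uIcc x y, ‖f' z - f' x‖ ≤ K * |y - x| := by
    intro z hz
    refine ((convex_Icc a b).norm_image_sub_le_of_norm_hasDerivWithin_le
      (fun w _ => (hf' w).hasDerivWithinAt) hK hx (hsub hz)).trans ?_
    refine mul_le_mul_of_nonneg_left ?_ hK0
    rw [Real.norm_eq_abs]
    exact abs_sub_left_of_mem_uIcc hz
  have h2 := (convex_uIcc x y).norm_image_sub_le_of_norm_hasDerivWithin_le
    (f := fun z => f z - z * f' x) (f' := fun z => f' z - 1 * f' x)
    (fun w _ => ((hf w).sub ((hasDerivAt_id w).mul_const (f' x))).hasDerivWithinAt)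
    (fun z hz => by simpa using h1 z hz) left_mem_uIcc right_mem_uIcc
  rw [Real.norm_eq_abs, Real.norm_eq_abs] at h2
  calc |f y - f x - (y - x) * f' x| = |f y - y * f' x - (f x - x * f' x)| := by
        congr 1; ring
    _ ≤ _ := h2
    _ = K * |y - x| ^ 2 := by ring
    _ = _ := by rw [sq_abs]

variable {a s σ : ℝ}

theorem abs_subordinator_sub_le (ha : 0 < a) (hs : s ∈ Icc a (2 * a)) (hσ : σ ∈ Icc a (2 * a))
    {v : ℝ} (hv : 0 < v) :
    |subordinator σ v - subordinator s v| ≤ 22 / a * |σ - s| * subordinator (a / 2) v := by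
  have := (convex_Icc a (2 * a)).norm_image_sub_le_of_norm_hasDerivWithin_le
    (f := fun s => subordinator s v) (fun w _ => (hasDerivAt_subordinator w hv).hasDerivWithinAt)
    (fun w hw => abs_subordinatorDeriv_le ha hw.1 hw.2 hv) hs hσ
  rw [Real.norm_eq_abs, Real.norm_eq_abs] at this
  exact this.trans (le_of_eq (by ring))

theorem abs_subordinator_taylor_le (ha : 0 < a) (hs : s ∈ Icc a (2 * a))
    (hσ : σ ∈ Icc a (2 * a)) {v : ℝ} (hv : 0 < v) :
    |subordinator σ v - subordinator s v - (σ - s) * subordinatorDeriv s v|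
      ≤ 228 / a ^ 2 * (σ - s) ^ 2 * subordinator (a / 2) v := by
  have := abs_taylor_le (f := fun s => subordinator s v)
    (fun w => hasDerivAt_subordinator w hv) (fun w => hasDerivAt_subordinatorDeriv w hv)
    (fun w hw => abs_subordinatorDeriv₂_le ha hw.1 hw.2 hv) hs hσ
  exact this.trans (le_of_eq (by ring))

variable {M : VonNeumannAlgebra H} {τ : NSFTrace M} (T : MarkovSemigroup τ)

theorem integrableOn_subordinatorDeriv (hs : 0 < s) : IntegrableOn (subordinatorDeriv s) (Ioi 0) :=
  integrableOn_of_abs_le (by unfold subordinatorDeriv; fun_prop) (half_pos hs) fun v hv =>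
    abs_subordinatorDeriv_le hs le_rfl (by linarith) hv

theorem hasDerivAt_poisson (hs : 0 < s) (f : Elt M) :
    HasDerivAt (fun r => (poisson T r f : H →L[ℂ] H))
      (timeIntegral T (subordinatorDeriv s) f : H →L[ℂ] H) s := by
  rw [hasDerivAt_iff_isLittleO]
  obtain ⟨a, ha⟩ : ∃ a, a = 2 * s / 3 := ⟨_, rfl⟩
  have ha0 : 0 < a := by rw [ha]; positivity
  have hsa : s ∈ Icc a (2 * a) := ⟨by linarith, by linarith⟩
  have hO : (fun σ => (poisson T σ f : H →L[ℂ] H) - (poisson T s f : H →L[ℂ] H)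
      - (σ - s) • (timeIntegral T (subordinatorDeriv s) f : H →L[ℂ] H)) =O[𝓝 s]
      fun σ => (σ - s) ^ 2 := by
    refine Asymptotics.IsBigO.of_bound (228 / a ^ 2 * ‖(f : H →L[ℂ] H)‖) ?_
    filter_upwards [Icc_mem_nhds (show a < s by linarith) (show s < 2 * a by linarith)] with σ hσ
    have hσ0 : 0 < σ := ha0.trans_le hσ.1
    have h1 := integrableOn_subordinator hσ0
    have h2 := integrableOn_subordinator hs
    have h3 := integrableOn_subordinatorDeriv hs
    have e : (poisson T σ f : H →L[ℂ] H) - (poisson T s f : H →L[ℂ] H)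
        - (σ - s) • (timeIntegral T (subordinatorDeriv s) f : H →L[ℂ] H)
        = (timeIntegral T (fun v => subordinator σ v - subordinator s v
            - (σ - s) * subordinatorDeriv s v) f : H →L[ℂ] H) := by
      have h12 : IntegrableOn (fun v => subordinator σ v - subordinator s v) (Ioi 0) := h1.sub h2
      rw [timeIntegral_sub h12 (h3.const_mul _), timeIntegral_smul h3,
        timeIntegral_sub h1 h2, poisson_eq_timeIntegral T hσ0, poisson_eq_timeIntegral T hs]
      rfl
    rw [e]
    refine (norm_timeIntegral_le_of_abs_le ((h1.sub h2).sub (h3.const_mul _)) (half_pos ha0)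
      (fun v hv => abs_subordinator_taylor_le ha0 hsa hσ hv) f).trans (le_of_eq ?_)
    rw [norm_pow, Real.norm_eq_abs, sq_abs]
    ring
  refine hO.trans_isLittleO ?_
  have := Asymptotics.isLittleO_pow_sub_sub (E' := ℝ) s (m := 2) (by norm_num)
  simpa using this

theorem deriv_poisson (hs : 0 < s) (f : Elt M) :
    deriv (fun r => (poisson T r f : H →L[ℂ] H)) s
      = (timeIntegral T (subordinatorDeriv s) f : H →L[ℂ] H) := (hasDerivAt_poisson T hs f).deriv

end Derivative

/-! ### Ultracontractivity implies the Morrey inequality -/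

section Morrey

variable {M : VonNeumannAlgebra H} {τ : NSFTrace M}

theorem lpNorm_smul {p : ℝ} (hp : 0 < p) (c : ℂ) (x : Elt M) :
    lpNorm τ (ENNReal.ofReal p) (c • x)
      = ENNReal.ofReal ‖c‖ * lpNorm τ (ENNReal.ofReal p) x := by
  rw [lpNorm_ofReal hp, lpNorm_ofReal hp]
  change moment τ p (c • (x : H →L[ℂ] H)) ^ (1 / p) = _
  rw [moment_smul hp c x.2, ENNReal.mul_rpow_of_nonneg _ _ (by positivity),
    ENNReal.ofReal_rpow_of_nonneg (by positivity) (by positivity), ← Real.rpow_mul (norm_nonneg _),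
    mul_one_div_cancel hp.ne', Real.rpow_one]

theorem L2.lpNorm_elt (x : L2 τ) : lpNorm τ 2 x.elt = ENNReal.ofReal ‖x‖ := by
  rw [lpNorm_of_ne_top (by norm_num), ENNReal.toReal_ofNat, moment_two, L2.coe_elt,
    L2.tr_eq_ofReal, ENNReal.ofReal_rpow_of_nonneg (by positivity) (by norm_num),
    ← Real.sqrt_eq_rpow, Real.sqrt_sq (norm_nonneg _)]

/-- A bound of `‖S : L_p(M) → L_∞(M)‖` bounds the norm of `S x`. -/
theorem norm_le_of_opNorm_le {p : ℝ} (hp : 0 < p) {S : Elt M → Elt M}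
    (hS : ∀ (c : ℂ) x, S (c • x) = c • S x) {K : ℝ} (hK : 0 ≤ K)
    (h : opNorm τ (ENNReal.ofReal p) ∞ S ≤ ENNReal.ofReal K) {x : Elt M}
    (hx : lpNorm τ (ENNReal.ofReal p) x < ∞) :
    ‖(S x : H →L[ℂ] H)‖ ≤ K * (lpNorm τ (ENNReal.ofReal p) x).toReal := by
  obtain ⟨ν, hν⟩ : ∃ ν, ν = (lpNorm τ (ENNReal.ofReal p) x).toReal := ⟨_, rfl⟩
  have hν0 : 0 ≤ ν := hν ▸ ENNReal.toReal_nonneg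
  have hν' : lpNorm τ (ENNReal.ofReal p) x = ENNReal.ofReal ν := by
    rw [hν, ENNReal.ofReal_toReal hx.ne]
  rw [← hν]
  -- rescaling by a number slightly larger than the norm, which may be zero
  have key : ∀ c, ν < c → ‖(S x : H →L[ℂ] H)‖ ≤ K * c := by
    intro c hc
    have hc0 : 0 < c := hν0.trans_lt hc
    have hn : ‖((c⁻¹ : ℝ) : ℂ)‖ = c⁻¹ := by
      rw [Complex.norm_real, Real.norm_of_nonneg (by positivity)]
    have h1 : lpNorm τ (ENNReal.ofReal p) (((c⁻¹ : ℝ) : ℂ) • x) ≤ 1 := by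
      rw [lpNorm_smul hp, hν', hn, ← ENNReal.ofReal_mul (by positivity), ENNReal.ofReal_le_one,
        inv_mul_le_one₀ hc0]
      exact hc.le
    have h2 := (le_iSup₂ (f := fun (y : Elt M) (_ : lpNorm τ (ENNReal.ofReal p) y ≤ 1) =>
      lpNorm τ ∞ (S y)) _ h1).trans h
    rw [lpNorm_top, hS] at h2
    change ‖((c⁻¹ : ℝ) : ℂ) • (S x : H →L[ℂ] H)‖ₑ ≤ _ at h2
    rw [← ofReal_norm, norm_smul, hn, ENNReal.ofReal_le_ofReal_iff hK, inv_mul_le_iff₀ hc0] at h2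
    linarith
  have hlim : Tendsto (fun c => K * c) (𝓝[>] ν) (𝓝 (K * ν)) :=
    (tendsto_const_nhds.mul tendsto_id).mono_left nhdsWithin_le_nhds
  refine ge_of_tendsto hlim ?_
  filter_upwards [self_mem_nhdsWithin] with c hc using key c hc

variable {T : MarkovSemigroup τ} {n : ℝ}

theorem MarkovSemigroup.at_smul (T : MarkovSemigroup τ) (t : ℝ) (c : ℂ) (f : Elt M) :
    T.at t (c • f) = c • T.at t f := by
  simp [MarkovSemigroup.at]

theorem Ultracontractive.exists_norm_at_le (hT : Ultracontractive T n) {p : ℝ} (hp : 1 ≤ p) :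
    ∃ C : ℝ, 0 ≤ C ∧ ∀ (t : ℝ) (x : Elt M), 0 < t → lpNorm τ (ENNReal.ofReal p) x < ∞ →
      ‖(T.at t x : H →L[ℂ] H)‖
        ≤ C * t ^ (-(n / (2 * p))) * (lpNorm τ (ENNReal.ofReal p) x).toReal := by
  have hp0 : 0 < p := one_pos.trans_le hp
  obtain ⟨C, hC⟩ := hT (ENNReal.ofReal p) ∞ (by simpa using ENNReal.ofReal_le_ofReal hp)
    ENNReal.ofReal_lt_top
  refine ⟨C, C.2, fun t x ht hx => norm_le_of_opNorm_le hp0 (T.at_smul t) (by positivity) ?_ hx⟩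
  refine (hC t ht).trans (le_of_eq ?_)
  rw [ENNReal.ofReal_mul C.coe_nonneg, ENNReal.ofReal_coe_nnreal]
  congr 4
  rw [ENNReal.toReal_inv, ENNReal.toReal_ofReal hp0.le, ENNReal.inv_top, ENNReal.toReal_zero]
  field_simp
  ring

theorem Ultracontractive.exists_norm_poisson_le (hn : 0 < n) (hT : Ultracontractive T n) {p : ℝ}
    (hp : 1 ≤ p) :
    ∃ C : ℝ, 0 ≤ C ∧ ∀ (s : ℝ) (x : Elt M), 0 < s → lpNorm τ (ENNReal.ofReal p) x < ∞ →
      ‖(poisson T s x : H →L[ℂ] H)‖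
        ≤ C * s ^ (-(n / p)) * (lpNorm τ (ENNReal.ofReal p) x).toReal := by
  have hp0 : 0 < p := one_pos.trans_le hp
  obtain ⟨C, hC0, hC⟩ := hT.exists_norm_at_le hp
  obtain ⟨D, hD0, hD⟩ := exists_subordinator_mul_rpow_le (n / (2 * p)) (by positivity)
  refine ⟨C * D, by positivity, fun s x hs hx => ?_⟩
  obtain ⟨ν, hν⟩ : ∃ ν, ν = (lpNorm τ (ENNReal.ofReal p) x).toReal := ⟨_, rfl⟩
  have hν0 : 0 ≤ ν := hν ▸ ENNReal.toReal_nonneg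
  have hi := integrableOn_subordinator (half_pos hs)
  rw [poisson_eq_timeIntegral T hs, ← hν]
  refine (norm_timeIntegral_le (b := fun v => C * D * s ^ (-(n / p)) * ν * subordinator (s / 2) v)
    (integrableOn_subordinator hs) (hi.const_mul _) fun v hv => ?_).trans (le_of_eq ?_)
  · have hs0 := subordinator_nonneg hs.le hv.le
    rw [abs_of_nonneg hs0]
    have h1 := hC v x hv hx
    rw [← hν] at h1
    have h2 := hD s v hs hv
    rw [show 2 * (n / (2 * p)) = n / p by field_simp] at h2
    calc _ ≤ subordinator s v * (C * v ^ (-(n / (2 * p))) * ν) := by gcongr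
      _ = C * ν * (subordinator s v * v ^ (-(n / (2 * p)))) := by ring
      _ ≤ C * ν * (D * s ^ (-(n / p)) * subordinator (s / 2) v) := by gcongr
      _ = _ := by ring
  · rw [integral_const_mul, integral_subordinator (half_pos hs), mul_one]

theorem diffQuot_poisson_shift {s h : ℝ} (hs : 0 < s) (hh : 0 < h) (f : Elt M) :
    poisson T s (diffQuot (poisson T) h f)
      = ((h⁻¹ : ℝ) : ℂ) • (poisson T s f - poisson T (s + h) f) := by
  have e : diffQuot (poisson T) h f
      = 0 + ((h⁻¹ : ℝ) : ℂ) • (f + (-1 : ℂ) • poisson T h f) := by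
    rw [diffQuot, zero_add, neg_one_smul, sub_eq_add_neg]
  have h0 : poisson T s 0 = 0 := by
    have h1 := poisson_linear T hs (-1 : ℂ) (0 : Elt M) 0
    rw [neg_one_smul, neg_one_smul] at h1
    simpa using h1
  rw [e, poisson_linear T hs, poisson_linear T hs, poisson_poisson T hs hh, h0, zero_add,
    neg_one_smul, sub_eq_add_neg]

/-- The derivative of `P_s f` is the limit of `-P_s` of the difference quotients at `0`. -/
theorem tendsto_poisson_diffQuot {s : ℝ} (hs : 0 < s) (f : Elt M) :
    Tendsto (fun h => ‖(poisson T s (diffQuot (poisson T) h f) : H →L[ℂ] H)‖ₑ) (𝓝[>] 0)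
      (𝓝 ‖deriv (fun r : ℝ => (poisson T r f : H →L[ℂ] H)) s‖ₑ) := by
  have h1 := (hasDerivAt_poisson T hs f).hasDerivWithinAt (s := Ioi s)
  rw [hasDerivWithinAt_iff_tendsto_slope' (by simp)] at h1
  have h2 : Tendsto (fun h : ℝ => s + h) (𝓝[>] 0) (𝓝[>] s) := by
    refine tendsto_nhdsWithin_iff.2 ⟨?_, ?_⟩
    · have : Tendsto (fun h : ℝ => s + h) (𝓝 0) (𝓝 (s + 0)) := tendsto_const_nhds.add tendsto_id
      rw [add_zero] at this
      exact this.mono_left nhdsWithin_le_nhds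
    · filter_upwards [self_mem_nhdsWithin] with h hh
      exact lt_add_of_pos_right s hh
  rw [deriv_poisson T hs]
  refine ((h1.comp h2).enorm).congr' ?_
  filter_upwards [self_mem_nhdsWithin] with h hh
  rw [diffQuot_poisson_shift hs hh]
  simp only [Function.comp, slope_def_module, add_sub_cancel_left]
  change _ = ‖((h⁻¹ : ℝ) : ℂ) • ((poisson T s f : H →L[ℂ] H) - poisson T (s + h) f)‖ₑ
  rw [Complex.coe_smul, ← enorm_neg, ← smul_neg, neg_sub]

theorem Ultracontractive.morreyInequality (hn : 0 < n) (hT : Ultracontractive T n) {p : ℝ}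
    (hp : 1 ≤ p) : MorreyInequality T n p := by
  have hp0 : 0 < p := one_pos.trans_le hp
  obtain ⟨C, hC0, hC⟩ := hT.exists_norm_poisson_le hn hp
  refine ⟨⟨C, hC0⟩, fun f hf => iSup₂_le fun s hs => ?_⟩
  have hle : ‖deriv (fun r : ℝ => (poisson T r f : H →L[ℂ] H)) s‖ₑ
      ≤ ENNReal.ofReal (C * s ^ (-(n / p)))
        * genLpNorm τ (poisson T) (ENNReal.ofReal p) f := by
    rw [genLpNorm, ← ENNReal.limsup_const_mul_of_ne_top ENNReal.ofReal_ne_top,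
      ← (tendsto_poisson_diffQuot hs f).limsup_eq]
    refine limsup_le_limsup ?_
    filter_upwards [hf.1] with h hh
    rw [← ofReal_norm, ← ENNReal.ofReal_toReal hh.ne, ← ENNReal.ofReal_mul (by positivity)]
    exact ENNReal.ofReal_le_ofReal (hC s _ hs hh)
  refine (mul_le_mul_right hle _).trans (le_of_eq ?_)
  rw [← mul_assoc, ← ENNReal.ofReal_mul (by positivity)]
  congr 1
  rw [show s ^ (1 - (1 - n / p)) * (C * s ^ (-(n / p)))
      = C * (s ^ (n / p) * s ^ (-(n / p))) by rw [sub_sub_cancel]; ring,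
    ← Real.rpow_add hs, add_neg_cancel, Real.rpow_zero, mul_one]
  exact ENNReal.ofReal_eq_coe_nnreal hC0

theorem MarkovSemigroup.norm_sub_l2_mul_le (T : MarkovSemigroup τ) (x : L2 τ) {h : ℝ} (hh : 0 < h)
    (k : ℕ) : ‖x - T.l2 (k * h) x‖ ≤ k * ‖x - T.l2 h x‖ := by
  induction k with
  | zero =>
    have : T.l2 0 x = x := L2.op_injective (by rw [T.op_l2, T.at_zero]; rfl)
    simp [this]
  | succ k ih =>
    have e : x - T.l2 ((k + 1 : ℕ) * h) x
        = (x - T.l2 (k * h) x) + T.l2 (k * h) (x - T.l2 h x) := by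
      rw [map_sub, ← T.l2_add (by positivity) hh.le]
      push_cast
      rw [add_mul, one_mul]
      abel
    rw [e]
    refine (norm_add_le _ _).trans ?_
    have := T.norm_l2_le (k * h) (x - T.l2 h x)
    push_cast
    linarith

theorem L2.lpNorm_diffQuot (x : L2 τ) {h : ℝ} (hh : 0 < h) :
    lpNorm τ 2 (diffQuot T.at h x.elt) = ENNReal.ofReal (h⁻¹ * ‖x - T.l2 h x‖) := by
  have e : diffQuot T.at h x.elt = (((h⁻¹ : ℝ) : ℂ) • (x - T.l2 h x)).elt := by
    rw [map_smul, map_sub]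
    rfl
  rw [e, L2.lpNorm_elt, norm_smul, Complex.norm_real, Real.norm_of_nonneg (by positivity)]

/-- Vectors in the kernel of the `L₂`-generator are fixed by the semigroup. -/
theorem l2_eq_of_genLpNorm_eq_zero {x : L2 τ} (h : genLpNorm τ T.at 2 x.elt = 0) {t : ℝ}
    (ht : 0 < t) : T.l2 t x = x := by
  have hle : ∀ ε, 0 < ε → ‖x - T.l2 t x‖ ≤ t * ε := by
    intro ε hε
    have hlim : limsup (fun h => lpNorm τ 2 (diffQuot T.at h x.elt)) (𝓝[>] (0 : ℝ))
        < ENNReal.ofReal ε := by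
      rw [genLpNorm] at h
      rw [h]
      exact ENNReal.ofReal_pos.2 hε
    have h1 : ∀ᶠ h in 𝓝[>] (0 : ℝ), lpNorm τ 2 (diffQuot T.at h x.elt) < ENNReal.ofReal ε :=
      eventually_lt_of_limsup_lt hlim
    have h2 : Tendsto (fun k : ℕ => t / ((k : ℝ) + 1)) atTop (𝓝[>] 0) := by
      refine tendsto_nhdsWithin_iff.2 ⟨?_, Eventually.of_forall fun k => ?_⟩
      · exact tendsto_const_nhds.div_atTop
          (tendsto_atTop_add_const_right _ _ tendsto_natCast_atTop_atTop)
      · exact mem_Ioi.2 (by positivity)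
    obtain ⟨k, hk⟩ := (h2.eventually h1).exists
    have hh : 0 < t / ((k : ℝ) + 1) := by positivity
    rw [L2.lpNorm_diffQuot x hh, ENNReal.ofReal_lt_ofReal_iff hε, inv_mul_lt_iff₀ hh] at hk
    have h3 := T.norm_sub_l2_mul_le x hh (k + 1)
    have e : ((k + 1 : ℕ) : ℝ) * (t / ((k : ℝ) + 1)) = t := by
      push_cast
      field_simp
    rw [e] at h3
    refine h3.trans ?_
    push_cast
    calc ((k : ℝ) + 1) * ‖x - T.l2 (t / ((k : ℝ) + 1)) x‖
        ≤ ((k : ℝ) + 1) * (t / ((k : ℝ) + 1) * ε) := by gcongr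
      _ = t * ε := by field_simp
  have hz : ‖x - T.l2 t x‖ ≤ 0 := by
    refine le_of_forall_pos_le_add fun ε hε => ?_
    have := hle (ε / t) (by positivity)
    rw [mul_div_cancel₀ _ ht.ne'] at this
    linarith
  exact (sub_eq_zero.1 (norm_le_zero_iff.1 hz)).symm

theorem Ultracontractive.generatorInjective (hn : 0 < n) (hT : Ultracontractive T n) :
    GeneratorInjective T := by
  intro f hf _ h0
  obtain ⟨C, hC0, hC⟩ := hT.exists_norm_at_le (p := 2) one_le_two
  rw [show ENNReal.ofReal 2 = 2 by simp] at hC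
  let x : L2 τ := L2.mk f f.2 ((lpNorm_two_lt_top_iff f).1 hf)
  have hfix : ∀ t, 0 < t → T.at t f = f := fun t ht => by
    have := congrArg L2.elt (l2_eq_of_genLpNorm_eq_zero (x := x) (T := T) h0 ht)
    exact this
  have hlim : Tendsto (fun t : ℝ => C * t ^ (-(n / (2 * 2))) * (lpNorm τ 2 f).toReal) atTop
      (𝓝 (C * 0 * (lpNorm τ 2 f).toReal)) :=
    ((tendsto_rpow_neg_atTop (by positivity)).const_mul C).mul_const _
  have hle : ‖(f : H →L[ℂ] H)‖ ≤ C * 0 * (lpNorm τ 2 f).toReal := by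
    refine ge_of_tendsto hlim ?_
    filter_upwards [eventually_gt_atTop 0] with t ht
    have := hC t f ht hf
    rwa [hfix t ht] at this
  rw [mul_zero, zero_mul] at hle
  exact Subtype.ext (norm_le_zero_iff.1 hle)

end Morrey

/-! ### Smoothing by the Poisson semigroup -/

section Domain

variable {M : VonNeumannAlgebra H} {τ : NSFTrace M} {T : MarkovSemigroup τ}

theorem norm_le_of_neg_le_of_le {h u : H →L[ℂ] H} (h1 : h ≤ u) (h2 : -u ≤ h) :
    ‖h‖ ≤ 3 * ‖u‖ := by
  have h3 : 0 ≤ h + u := by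
    have := sub_nonneg.2 h2
    rwa [sub_neg_eq_add] at this
  have h4 : ‖h + u‖ ≤ ‖u + u‖ :=
    CStarAlgebra.norm_le_norm_of_nonneg_of_le h3 (add_le_add_left h1 u)
  have h5 := norm_sub_le (h + u) u
  have h6 := norm_add_le u u
  rw [add_sub_cancel_right] at h5
  linarith

/-- Weak integrals that are dominated by `P_σ f` in the order lie in `L_p(M)`, by interpolation
between the trace and the operator norm. -/
theorem lpNorm_timeIntegral_le {p : ℝ} (hp : 1 ≤ p) {ψ : ℝ → ℝ} (h : IntegrableOn ψ (Ioi 0))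
    {κ σ : ℝ} (hκ : 0 ≤ κ) (hσ : 0 < σ) (hle : ∀ v, 0 < v → |ψ v| ≤ κ * subordinator σ v)
    {f : Elt M} (hf : 0 ≤ (f : H →L[ℂ] H)) (ht : tr τ (f : H →L[ℂ] H) < ∞) :
    lpNorm τ (ENNReal.ofReal p) (timeIntegral T ψ f) ≤ ENNReal.ofReal (3 * κ *
      (2 * ‖(poisson T σ f : H →L[ℂ] H)‖ ^ (p - 1) * (tr τ (f : H →L[ℂ] H)).toReal) ^ (1 / p)) := by
  have hp0 : 0 < p := one_pos.trans_le hp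
  obtain ⟨N, hN⟩ : ∃ N, N = ‖(poisson T σ f : H →L[ℂ] H)‖ := ⟨_, rfl⟩
  have hN0 : 0 ≤ N := hN ▸ norm_nonneg _
  obtain ⟨θ, hθ⟩ : ∃ θ, θ = (tr τ (f : H →L[ℂ] H)).toReal := ⟨_, rfl⟩
  have hθ0 : 0 ≤ θ := hθ ▸ ENNReal.toReal_nonneg
  have hθ' : tr τ (f : H →L[ℂ] H) = ENNReal.ofReal θ := by rw [hθ, ENNReal.ofReal_toReal ht.ne]
  rw [← hN, ← hθ]
  obtain ⟨h1, h2⟩ := timeIntegral_le_of_abs_le (T := T) h hσ hle hf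
  have hP0 := poisson_nonneg T hσ hf
  have hu0 : 0 ≤ (κ : ℂ) • (poisson T σ f : H →L[ℂ] H) := smul_ofReal_nonneg hP0 hκ
  have huM : (κ : ℂ) • (poisson T σ f : H →L[ℂ] H) ∈ M := smul_mem' (poisson T σ f).2 _
  have hsa : IsSelfAdjoint (timeIntegral T ψ f : H →L[ℂ] H) := by
    have := (sub_nonneg.2 h1).isSelfAdjoint
    have h3 := hu0.isSelfAdjoint.sub this
    rwa [sub_sub_cancel] at h3
  have hn := norm_le_of_neg_le_of_le h1 h2
  rw [norm_smul, Complex.norm_real, Real.norm_of_nonneg hκ, ← hN] at hn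
  have hm1 := moment_one_le (τ := τ) (timeIntegral T ψ f).2 huM h1 h2
  rw [tr_smul (poisson T σ f).2 hP0 hκ] at hm1
  have hm2 := moment_le_norm_rpow_mul (τ := τ) one_pos hp (timeIntegral T ψ f).2 hsa hn
  rw [lpNorm_ofReal hp0]
  have hm : moment τ p (timeIntegral T ψ f : H →L[ℂ] H)
      ≤ ENNReal.ofReal ((3 * κ) ^ p * (2 * N ^ (p - 1) * θ)) := by
    calc moment τ p (timeIntegral T ψ f : H →L[ℂ] H)
        ≤ ENNReal.ofReal ((3 * (κ * N)) ^ (p - 1)) * (2 * (ENNReal.ofReal κ * ENNReal.ofReal θ)) := by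
          refine hm2.trans ?_
          gcongr
          refine hm1.trans ?_
          gcongr
          rw [← hθ']
          exact tr_poisson_le T hσ hf
      _ = ENNReal.ofReal ((3 * (κ * N)) ^ (p - 1) * (2 * (κ * θ))) := by
          rw [ENNReal.ofReal_mul (by positivity), ENNReal.ofReal_mul (by norm_num : (0:ℝ) ≤ 2),
            ENNReal.ofReal_mul hκ, ENNReal.ofReal_ofNat]
      _ ≤ _ := by
          refine ENNReal.ofReal_le_ofReal ?_
          have e : (3 * κ) ^ p = (3 * κ) ^ (p - 1) * (3 * κ) := by
            rcases hκ.eq_or_lt with rfl | hκ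
            · rw [mul_zero, mul_zero, Real.zero_rpow hp0.ne']
            · rw [← Real.rpow_add_one (by positivity), sub_add_cancel]
          rw [e, ← mul_assoc 3, Real.mul_rpow (by positivity) hN0]
          have h0 : 0 ≤ (3 * κ) ^ (p - 1) * N ^ (p - 1) * (κ * θ) := by positivity
          nlinarith
  refine (ENNReal.rpow_le_rpow hm (by positivity)).trans (le_of_eq ?_)
  rw [ENNReal.ofReal_rpow_of_nonneg (by positivity) (by positivity),
    Real.mul_rpow (by positivity) (by positivity), ← Real.rpow_mul (by positivity),
    mul_one_div_cancel hp0.ne', Real.rpow_one]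

theorem diffQuot_poisson {s h : ℝ} (hs : 0 < s) (hh : 0 < h) (f : Elt M) :
    diffQuot (poisson T) h (poisson T s f)
      = timeIntegral T (fun v => -h⁻¹ * (subordinator (s + h) v - subordinator s v)) f := by
  have h1 := integrableOn_subordinator hs
  have h2 := integrableOn_subordinator (add_pos hs hh)
  have h21 : IntegrableOn (fun v => subordinator (s + h) v - subordinator s v) (Ioi 0) := h2.sub h1
  rw [timeIntegral_smul h21, timeIntegral_sub h2 h1, diffQuot, poisson_poisson T hh hs,
    add_comm h s, poisson_eq_timeIntegral T hs, poisson_eq_timeIntegral T (add_pos hs hh),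
    Complex.ofReal_neg, neg_smul, ← smul_neg, neg_sub]

theorem abs_slope_subordinator_le {s h : ℝ} (hs : 0 < s) (hh : 0 < h) (hhs : h ≤ s) {v : ℝ}
    (hv : 0 < v) : |-h⁻¹ * (subordinator (s + h) v - subordinator s v)|
      ≤ 22 / s * subordinator (s / 2) v := by
  have := abs_subordinator_sub_le hs (s := s) (σ := s + h) ⟨le_rfl, by linarith⟩
    ⟨by linarith, by linarith⟩ hv
  rw [abs_mul, abs_neg, abs_of_nonneg (by positivity : 0 ≤ h⁻¹), inv_mul_le_iff₀ hh]
  rw [add_sub_cancel_left, abs_of_pos hh] at this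
  linarith

theorem abs_slope_sub_slope_subordinator_le {s h k : ℝ} (hs : 0 < s) (hh : 0 < h) (hhs : h ≤ s)
    (hk : 0 < k) (hks : k ≤ s) {v : ℝ} (hv : 0 < v) :
    |-h⁻¹ * (subordinator (s + h) v - subordinator s v)
        - -k⁻¹ * (subordinator (s + k) v - subordinator s v)|
      ≤ 228 / s ^ 2 * (h + k) * subordinator (s / 2) v := by
  have key : ∀ h, 0 < h → h ≤ s →
      |h⁻¹ * (subordinator (s + h) v - subordinator s v - h * subordinatorDeriv s v)|
        ≤ 228 / s ^ 2 * h * subordinator (s / 2) v := by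
    intro h hh hhs
    have := abs_subordinator_taylor_le hs (s := s) (σ := s + h) ⟨le_rfl, by linarith⟩
      ⟨by linarith, by linarith⟩ hv
    rw [add_sub_cancel_left] at this
    rw [abs_mul, abs_of_nonneg (by positivity : 0 ≤ h⁻¹), inv_mul_le_iff₀ hh]
    linarith
  have e : -h⁻¹ * (subordinator (s + h) v - subordinator s v)
        - -k⁻¹ * (subordinator (s + k) v - subordinator s v)
      = k⁻¹ * (subordinator (s + k) v - subordinator s v - k * subordinatorDeriv s v)
        - h⁻¹ * (subordinator (s + h) v - subordinator s v - h * subordinatorDeriv s v) := by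
    field_simp
    ring
  rw [e]
  refine (abs_sub _ _).trans ?_
  have h1 := key h hh hhs
  have h2 := key k hk hks
  linarith

theorem integrableOn_slope_subordinator {s h : ℝ} (hs : 0 < s) (hh : 0 < h) :
    IntegrableOn (fun v => -h⁻¹ * (subordinator (s + h) v - subordinator s v)) (Ioi 0) :=
  ((integrableOn_subordinator (add_pos hs hh)).sub (integrableOn_subordinator hs)).const_mul _

theorem eventually_nhdsGT_zero_mem_Ioc {s : ℝ} (hs : 0 < s) :
    ∀ᶠ h in 𝓝[>] (0 : ℝ), 0 < h ∧ h ≤ s := by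
  filter_upwards [Ioc_mem_nhdsGT hs] with h hh using hh

/-- If `τ(f) < ∞`, then `P_s f` is in the `L_p`-domain of `A^{1/2}`. -/
theorem inLpDomain_poisson {p : ℝ} (hp : 1 ≤ p) {s : ℝ} (hs : 0 < s)
    {f : Elt M} (hf : 0 ≤ (f : H →L[ℂ] H)) (ht : tr τ (f : H →L[ℂ] H) < ∞) :
    InLpDomain τ (poisson T) (ENNReal.ofReal p) (poisson T s f) := by
  constructor
  · filter_upwards [eventually_nhdsGT_zero_mem_Ioc hs] with h hh
    rw [diffQuot_poisson hs hh.1]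
    exact (lpNorm_timeIntegral_le hp (integrableOn_slope_subordinator hs hh.1) (by positivity)
      (half_pos hs) (fun v hv => abs_slope_subordinator_le hs hh.1 hh.2 hv) hf ht).trans_lt
      ENNReal.ofReal_lt_top
  · obtain ⟨D, hD⟩ : ∃ D : ℝ, D = (2 * ‖(poisson T (s / 2) f : H →L[ℂ] H)‖ ^ (p - 1)
      * (tr τ (f : H →L[ℂ] H)).toReal) ^ (1 / p) := ⟨_, rfl⟩
    have hlim : Tendsto (fun q : ℝ × ℝ => ENNReal.ofReal (3 * (228 / s ^ 2 * (q.1 + q.2)) * D))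
        (𝓝[>] (0 : ℝ) ×ˢ 𝓝[>] (0 : ℝ)) (𝓝 0) := by
      have hc : Continuous fun q : ℝ × ℝ => ENNReal.ofReal (3 * (228 / s ^ 2 * (q.1 + q.2)) * D) :=
        ENNReal.continuous_ofReal.comp (by fun_prop)
      have h0 := hc.tendsto (0, 0)
      rw [nhds_prod_eq] at h0
      simp only [add_zero, mul_zero, zero_mul, ENNReal.ofReal_zero] at h0
      exact h0.mono_left (prod_mono nhdsWithin_le_nhds nhdsWithin_le_nhds)
    refine tendsto_of_tendsto_of_tendsto_of_le_of_le' tendsto_const_nhds hlim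
      (Eventually.of_forall fun _ => zero_le) ?_
    filter_upwards [(eventually_nhdsGT_zero_mem_Ioc hs).prod_mk
      (eventually_nhdsGT_zero_mem_Ioc hs)] with q hq
    obtain ⟨⟨h1, h2⟩, h3, h4⟩ := hq
    have i1 := integrableOn_slope_subordinator hs h1
    have i2 := integrableOn_slope_subordinator hs h3
    rw [diffQuot_poisson hs h1, diffQuot_poisson hs h3, ← timeIntegral_sub i1 i2, hD]
    exact lpNorm_timeIntegral_le hp (i1.sub i2) (by positivity) (half_pos hs)
      (fun v hv => abs_slope_sub_slope_subordinator_le hs h1 h2 h3 h4 hv) hf ht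

theorem genLpNorm_poisson_le {p : ℝ} (hp : 1 ≤ p) {s : ℝ} (hs : 0 < s)
    {f : Elt M} (hf : 0 ≤ (f : H →L[ℂ] H)) (ht : tr τ (f : H →L[ℂ] H) < ∞) :
    genLpNorm τ (poisson T) (ENNReal.ofReal p) (poisson T s f) ≤ ENNReal.ofReal (3 * (22 / s) *
      (2 * ‖(poisson T (s / 2) f : H →L[ℂ] H)‖ ^ (p - 1)
        * (tr τ (f : H →L[ℂ] H)).toReal) ^ (1 / p)) := by
  refine limsup_le_of_le ?_ ?_
  · isBoundedDefault
  filter_upwards [eventually_nhdsGT_zero_mem_Ioc hs] with h hh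
  rw [diffQuot_poisson hs hh.1]
  exact lpNorm_timeIntegral_le hp (integrableOn_slope_subordinator hs hh.1) (by positivity)
    (half_pos hs) (fun v hv => abs_slope_subordinator_le hs hh.1 hh.2 hv) hf ht

theorem deriv_poisson_poisson {r s : ℝ} (hr : 0 < r) (hs : 0 < s) (f : Elt M) :
    deriv (fun r => (poisson T r (poisson T s f) : H →L[ℂ] H)) r
      = deriv (fun r => (poisson T r f : H →L[ℂ] H)) (r + s) := by
  have e : (fun r => (poisson T r (poisson T s f) : H →L[ℂ] H))
      =ᶠ[𝓝 r] fun r => (poisson T (r + s) f : H →L[ℂ] H) := by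
    filter_upwards [lt_mem_nhds hr] with r hr
    rw [poisson_poisson T hr hs]
  rw [e.deriv_eq]
  exact deriv_comp_add_const (fun r => (poisson T r f : H →L[ℂ] H)) s r

/-- The Morrey inequality, applied to `P_{s/2} f`, bounds the derivative of `P_s f`. -/
theorem MorreyInequality.exists_norm_deriv_le {n p : ℝ} (hp : 1 ≤ p)
    (hT : MorreyInequality T n p) :
    ∃ C : ℝ, 0 ≤ C ∧ ∀ (s : ℝ) (f : Elt M), 0 < s → 0 ≤ (f : H →L[ℂ] H) →
      tr τ (f : H →L[ℂ] H) < ∞ →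
      ‖deriv (fun r => (poisson T r f : H →L[ℂ] H)) s‖ ≤ C * s ^ (-(n / p) - 1) *
        (‖(poisson T (s / 4) f : H →L[ℂ] H)‖ ^ (p - 1)
          * (tr τ (f : H →L[ℂ] H)).toReal) ^ (1 / p) := by
  obtain ⟨C, hC⟩ := hT
  refine ⟨C * (132 * 2 ^ (1 / p) * 2 ^ (n / p)), by positivity, fun s f hs hf ht => ?_⟩
  have hs2 := half_pos hs
  obtain ⟨X, hX⟩ : ∃ X, X = ‖(poisson T (s / 4) f : H →L[ℂ] H)‖ ^ (p - 1)
      * (tr τ (f : H →L[ℂ] H)).toReal := ⟨_, rfl⟩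
  have hX0 : 0 ≤ X := by rw [hX]; positivity
  have h1 := hC _ (inLpDomain_poisson hp hs2 hf ht)
  have h2 := (le_iSup₂ (f := fun (r : ℝ) (_ : 0 < r) => ENNReal.ofReal (r ^ (1 - (1 - n / p))) *
    ‖deriv (fun r : ℝ => (poisson T r (poisson T (s / 2) f) : H →L[ℂ] H)) r‖ₑ) _ hs2).trans
    (h1.trans (mul_le_mul_right (genLpNorm_poisson_le hp hs2 hf ht) _))
  rw [deriv_poisson_poisson hs2 hs2, add_halves, sub_sub_cancel, ← ofReal_norm,
    ← ENNReal.ofReal_mul (by positivity), ← ENNReal.ofReal_coe_nnreal,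
    ← ENNReal.ofReal_mul C.coe_nonneg, show s / 2 / 2 = s / 4 by ring, mul_assoc 2, ← hX,
    ENNReal.ofReal_le_ofReal_iff (by positivity)] at h2
  rw [← hX]
  have h3 : 0 < (s / 2) ^ (n / p) := by positivity
  rw [← le_div_iff₀' h3] at h2
  refine h2.trans (le_of_eq ?_)
  rw [Real.mul_rpow (by norm_num) hX0, Real.div_rpow hs.le (by norm_num), Real.rpow_sub hs,
    Real.rpow_neg hs.le, Real.rpow_one]
  field_simp
  ring

end Domain

/-! ### Limits at infinity -/

section Limits

theorem tendsto_max_rpow_neg {β a : ℝ} (hβ : 0 < β) (c : ℝ) :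
    Tendsto (fun s => c * max a s ^ (-β)) atTop (𝓝 0) := by
  have h1 : Tendsto (fun s => max a s) atTop atTop :=
    tendsto_atTop_mono (fun s => le_max_right a s) tendsto_id
  simpa using ((tendsto_rpow_neg_atTop hβ).comp h1).const_mul c

theorem norm_sub_le_of_norm_deriv_le {E : Type*} [NormedAddCommGroup E] [NormedSpace ℝ E]
    {F F' : ℝ → E} {K β a b : ℝ} (hβ : 0 < β) (ha : 0 < a) (hab : a ≤ b)
    (hF : ∀ s, a ≤ s → HasDerivAt F (F' s) s) (hle : ∀ s, a ≤ s → ‖F' s‖ ≤ K * s ^ (-β - 1)) :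
    ‖F b - F a‖ ≤ K / β * (a ^ (-β) - b ^ (-β)) := by
  have hB : ∀ s, a ≤ s →
      HasDerivAt (fun s => K / β * (a ^ (-β) - s ^ (-β))) (K * s ^ (-β - 1)) s := by
    intro s hs
    have h := ((Real.hasDerivAt_rpow_const (p := -β)
      (Or.inl (ha.trans_le hs).ne')).const_sub (a ^ (-β))).const_mul (K / β)
    have e : K / β * -(-β * s ^ (-β - 1)) = K * s ^ (-β - 1) := by field_simp
    rwa [e] at h
  exact image_norm_le_of_norm_deriv_right_le_deriv_boundary' (f := fun s => F s - F a) (a := a)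
    (fun s hs => ((hF s hs.1).continuousAt.sub continuousAt_const).continuousWithinAt)
    (fun s hs => ((hF s hs.1).sub_const _).hasDerivWithinAt) (by simp)
    (fun s hs => (hB s hs.1).continuousAt.continuousWithinAt)
    (fun s hs => (hB s hs.1).hasDerivWithinAt) (fun s hs => hle s hs.1) ⟨hab, le_rfl⟩

/-- A curve with speed `O(s^{-β-1})` converges at infinity, at the rate `O(s^{-β})`. -/
theorem exists_tendsto_of_norm_deriv_le {E : Type*} [NormedAddCommGroup E] [NormedSpace ℝ E]
    [CompleteSpace E] {F F' : ℝ → E} {K β a : ℝ} (hβ : 0 < β) (ha : 0 < a) (hK : 0 ≤ K)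
    (hF : ∀ s, a ≤ s → HasDerivAt F (F' s) s) (hle : ∀ s, a ≤ s → ‖F' s‖ ≤ K * s ^ (-β - 1)) :
    ∃ L, Tendsto F atTop (𝓝 L) ∧ ‖F a - L‖ ≤ K / β * a ^ (-β) := by
  have hinc : ∀ b c, a ≤ b → b ≤ c → ‖F c - F b‖ ≤ K / β * b ^ (-β) := by
    intro b c hab hbc
    have hb := ha.trans_le hab
    refine (norm_sub_le_of_norm_deriv_le hβ hb hbc (fun s hs => hF s (hab.trans hs))
      fun s hs => hle s (hab.trans hs)).trans ?_
    have h1 : 0 ≤ c ^ (-β) := Real.rpow_nonneg (hb.le.trans hbc) _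
    have h2 : 0 ≤ K / β := by positivity
    gcongr
    linarith
  have hcau : CauchySeq fun s => F (max a s) := by
    refine cauchySeq_of_le_tendsto_0' (fun s => K / β * max a s ^ (-β)) (fun s t hst => ?_)
      (tendsto_max_rpow_neg hβ _)
    rw [dist_comm, dist_eq_norm]
    exact hinc _ _ (le_max_left _ _) (max_le_max_left _ hst)
  obtain ⟨L, hL⟩ := cauchySeq_tendsto_of_complete hcau
  have hL' : Tendsto F atTop (𝓝 L) := by
    refine hL.congr' ?_
    filter_upwards [eventually_ge_atTop a] with s hs
    rw [max_eq_right hs]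
  refine ⟨L, hL', ?_⟩
  refine le_of_tendsto (tendsto_const_nhds.sub hL').norm ?_
  filter_upwards [eventually_ge_atTop a] with s hs
  rw [norm_sub_rev]
  exact hinc a s le_rfl hs

end Limits

/-! ### The semigroup on `M ∩ L₂(M)` -/

section Pairing

variable {M : VonNeumannAlgebra H} {τ : NSFTrace M}

/-- `w w*`, as an element of `M ∩ L₂(M)`. -/
def L2.mulStar (w : L2 τ) : L2 τ := L2.rmul (star_mem' w.mem) w

theorem L2.op_mulStar (w : L2 τ) : w.mulStar.op = w.op * star w.op := rfl

theorem L2.mulStar_nonneg (w : L2 τ) : 0 ≤ w.mulStar.op := mul_star_self_nonneg w.op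

theorem L2.tr_mulStar (w : L2 τ) : tr τ w.mulStar.op = ENNReal.ofReal (‖w‖ ^ 2) := by
  rw [L2.op_mulStar, tr_mul_star w.mem, L2.tr_eq_ofReal]

theorem L2.exists_mulStar_eq {c : H →L[ℂ] H} (hc : c ∈ M) (hc0 : 0 ≤ c) (hct : tr τ c < ∞) :
    ∃ w : L2 τ, w.mulStar.op = c := by
  refine ⟨L2.mk (CFC.sqrt c) (sqrt_mem hc hc0)
    (by rwa [star_sqrt, CFC.sqrt_mul_sqrt_self c hc0]), ?_⟩
  rw [L2.op_mulStar, L2.op_mk, star_sqrt, CFC.sqrt_mul_sqrt_self c hc0]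

/-- Traciality: `τ(w* y w) = τ(w w* y)`. -/
theorem L2.inner_lmul_eq (w y : L2 τ) : ⟪w, L2.lmul y.mem w⟫_ℂ = ⟪w.mulStar, y⟫_ℂ := by
  rw [L2.mulStar, L2.inner_rmul]
  congr 1
  apply L2.op_injective
  simp

variable {T : MarkovSemigroup τ}

theorem inner_lmul_at (w x : L2 τ) {v : ℝ} :
    ⟪w, L2.lmul (T.at v x.elt).2 w⟫_ℂ = ⟪w.mulStar, T.l2 v x⟫_ℂ :=
  L2.inner_lmul_eq w (T.l2 v x)

/-- Spectral subordination on `M ∩ L₂(M)`, written without the functional calculus of `A`. -/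
theorem inner_lmul_poisson {s : ℝ} (hs : 0 < s) (w : L2 τ) :
    IntegrableOn (fun v => subordinator s v * ‖T.l2 (v / 2) w.mulStar‖ ^ 2) (Ioi 0) ∧
    ⟪w, L2.lmul (poisson T s w.mulStar.elt).2 w⟫_ℂ
      = ((∫ v in Ioi (0 : ℝ), subordinator s v * ‖T.l2 (v / 2) w.mulStar‖ ^ 2 : ℝ) : ℂ) := by
  have hi := integrableOn_subordinator hs
  obtain ⟨hc, he⟩ := integral_inner_lmul (T := T) hi w.mulStar.elt w w
  simp only [← poisson_eq_timeIntegral T hs] at he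
  have e : ∀ v ∈ Ioi (0 : ℝ), (subordinator s v : ℂ) * ⟪w, L2.lmul (T.at v w.mulStar.elt).2 w⟫_ℂ
      = ((subordinator s v * ‖T.l2 (v / 2) w.mulStar‖ ^ 2 : ℝ) : ℂ) := by
    intro v hv
    rw [inner_lmul_at, T.inner_l2_self (le_of_lt hv), Complex.ofReal_mul]
  have hint : IntegrableOn (fun v => (subordinator s v : ℂ) *
      ⟪w, L2.lmul (T.at v w.mulStar.elt).2 w⟫_ℂ) (Ioi 0) :=
    Integrable.mul_bdd (c := ‖w.mulStar.op‖ * (‖w‖ * ‖w‖)) hi.ofReal hc.aestronglyMeasurable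
      (ae_of_all _ fun v => norm_inner_lmul_le _ (T.norm_at_le v _) _ _)
  refine ⟨?_, ?_⟩
  · have h1 := hint.re
    refine (integrable_congr ?_).1 h1
    refine (ae_restrict_iff' measurableSet_Ioi).2 (ae_of_all _ fun v hv => ?_)
    simp only
    rw [e v hv]
    exact Complex.ofReal_re _
  · rw [he, ← integral_complex_ofReal]
    exact setIntegral_congr_fun measurableSet_Ioi e

/-- Fixed points of the Poisson semigroup are fixed points of `T`: the weighted average of the
numbers `‖T_{v/2} f‖₂² ≤ ‖f‖₂²` is `‖f‖₂²`, so all of them are equal to `‖f‖₂²`. -/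
theorem at_eq_of_poisson_eq {f : Elt M} (hf : 0 ≤ (f : H →L[ℂ] H))
    (hft : tr τ (f : H →L[ℂ] H) < ∞) {s : ℝ} (hs : 0 < s) (h : poisson T s f = f) {t : ℝ}
    (ht : 0 < t) : T.at t f = f := by
  obtain ⟨w, hw⟩ := L2.exists_mulStar_eq f.2 hf hft
  obtain ⟨x, hx⟩ : ∃ x, x = w.mulStar := ⟨_, rfl⟩
  have hfx : x.elt = f := Subtype.ext (by rw [L2.coe_elt, hx, hw])
  obtain ⟨hint, he⟩ := inner_lmul_poisson (T := T) hs w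
  rw [← hx] at hint he
  have he2 : ⟪w, L2.lmul (poisson T s x.elt).2 w⟫_ℂ = ((‖x‖ ^ 2 : ℝ) : ℂ) := by
    have : ∀ (y : Elt M), y = x.elt → ⟪w, L2.lmul y.2 w⟫_ℂ = ⟪x, x⟫_ℂ := by
      rintro y rfl
      rw [hx]
      exact L2.inner_lmul_eq w w.mulStar
    rw [this _ (by rw [hfx, h]), inner_self_eq_norm_sq_to_K]
    push_cast
    rfl
  have hi := integrableOn_subordinator hs
  have hint2 : IntegrableOn
      (fun v => subordinator s v * (‖x‖ ^ 2 - ‖T.l2 (v / 2) x‖ ^ 2)) (Ioi 0) := by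
    simp only [mul_sub]
    exact (hi.mul_const _).sub hint
  have h0 : ∫ v in Ioi (0 : ℝ), subordinator s v * (‖x‖ ^ 2 - ‖T.l2 (v / 2) x‖ ^ 2) = 0 := by
    simp only [mul_sub]
    rw [integral_sub (hi.mul_const _) hint, integral_mul_const, integral_subordinator hs, one_mul,
      sub_eq_zero]
    exact_mod_cast he2.symm.trans he
  have hnn : ∀ v ∈ Ioi (0 : ℝ), 0 ≤ subordinator s v * (‖x‖ ^ 2 - ‖T.l2 (v / 2) x‖ ^ 2) := by
    intro v hv
    refine mul_nonneg (subordinator_nonneg hs.le (le_of_lt hv)) (sub_nonneg.2 ?_)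
    have := T.norm_l2_le (v / 2) x
    gcongr
  rw [setIntegral_eq_zero_iff_of_nonneg_ae
    ((ae_restrict_iff' measurableSet_Ioi).2 (ae_of_all _ hnn)) hint2] at h0
  -- the norms are antitone in time, so one time beyond `2 t` is enough
  have hex : ∃ v, 2 * t < v ∧ ‖T.l2 (v / 2) x‖ ^ 2 = ‖x‖ ^ 2 := by
    by_contra hne
    push Not at hne
    have h1 : ∀ᵐ v ∂(volume.restrict (Ioi (2 * t))), False := by
      have h2 := ae_restrict_of_ae_restrict_of_subset
        (Ioi_subset_Ioi (by positivity : (0 : ℝ) ≤ 2 * t)) h0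
      filter_upwards [h2, ae_restrict_mem measurableSet_Ioi] with v hv hv'
      have hv0 : 0 < v := (by positivity : (0 : ℝ) < 2 * t).trans hv'
      have hp : 0 < subordinator s v := by unfold subordinator; positivity
      rcases mul_eq_zero.1 hv with h3 | h3
      · exact hp.ne' h3
      · exact hne v hv' (by linarith)
    rw [ae_iff] at h1
    simp at h1
  obtain ⟨v, hv, hvx⟩ := hex
  have hn : ‖T.l2 (t / 2) x‖ ^ 2 = ‖x‖ ^ 2 := by
    refine le_antisymm ?_ (hvx ▸ ?_)
    · have := T.norm_l2_le (t / 2) x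
      gcongr
    · have := T.norm_l2_anti (s := t / 2) (t := v / 2) (by positivity) (by linarith) x
      gcongr
  have hin : ⟪x, T.l2 t x⟫_ℂ = ((‖x‖ ^ 2 : ℝ) : ℂ) := by rw [T.inner_l2_self ht.le, hn]
  have hz : ‖x - T.l2 t x‖ ^ 2 ≤ 0 := by
    rw [norm_sub_sq (𝕜 := ℂ), hin]
    have h1 := T.norm_l2_le t x
    have h2 : ‖T.l2 t x‖ ^ 2 ≤ ‖x‖ ^ 2 := by gcongr
    simp only [RCLike.re_to_complex, Complex.ofReal_re]
    linarith
  have hz' : x - T.l2 t x = 0 := by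
    rw [← norm_eq_zero]
    exact pow_eq_zero_iff (two_ne_zero) |>.1 (le_antisymm hz (sq_nonneg _))
  have := congrArg L2.elt (sub_eq_zero.1 hz').symm
  rw [← hfx]
  exact this

/-- Lower semicontinuity of the trace for the operator norm. -/
theorem tr_le_of_tendsto {a : ℝ → H →L[ℂ] H} {b : H →L[ℂ] H} {K : ℝ} (hK : 0 ≤ K)
    (hab : ∀ᶠ s in atTop, a s ∈ M ∧ 0 ≤ a s ∧ tr τ (a s) ≤ ENNReal.ofReal K)
    (hlim : Tendsto a atTop (𝓝 b)) (hb : b ∈ M) (hb0 : 0 ≤ b) : tr τ b ≤ ENNReal.ofReal K := by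
  refine tr_le_of_forall_inner_lmul hb hb0 fun w hw1 => ?_
  have hl : Tendsto (fun s => K + ‖b - a s‖ * (‖w‖ * ‖w‖)) atTop (𝓝 K) := by
    have h1 : Tendsto (fun s => ‖b - a s‖) atTop (𝓝 0) := by
      have := (tendsto_const_nhds (x := b)).sub hlim |>.norm
      simpa using this
    simpa using (h1.mul_const (‖w‖ * ‖w‖)).const_add K
  refine ge_of_tendsto hl ?_
  filter_upwards [hab] with s hs
  obtain ⟨hsM, hs0, hst⟩ := hs
  have hd : b - a s ∈ M := sub_mem hb hsM
  have e : L2.lmul hb w = L2.lmul hsM w + L2.lmul hd w := by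
    apply L2.op_injective
    rw [map_add L2.op]
    simp [sub_mul]
  rw [e, inner_add_right]
  refine (norm_add_le _ _).trans (add_le_add ?_ (norm_inner_lmul_le hd le_rfl w w))
  rw [(L2.inner_lmul_self hsM hs0 w).1, Complex.norm_real,
    Real.norm_of_nonneg ENNReal.toReal_nonneg]
  exact ENNReal.toReal_le_of_le_ofReal hK
    ((tr_star_mul_mul_le w.mem hw1 hsM hs0).trans hst)

/-- If `A` is injective, the only possible limit of `P_s f` as `s → ∞` is `0`. -/
theorem GeneratorInjective.eq_zero_of_tendsto (hT : GeneratorInjective T) {f : Elt M}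
    (hf : 0 ≤ (f : H →L[ℂ] H)) (hft : tr τ (f : H →L[ℂ] H) < ∞) {L : H →L[ℂ] H}
    (hL : Tendsto (fun s => (poisson T s f : H →L[ℂ] H)) atTop (𝓝 L)) : L = 0 := by
  have hLM : L ∈ M := isClosed_coe.mem_of_tendsto hL (Eventually.of_forall fun s => (poisson T s f).2)
  have hL0 : 0 ≤ L := by
    refine ge_of_tendsto hL ?_
    filter_upwards [eventually_gt_atTop 0] with s hs using poisson_nonneg T hs hf
  have hLt : tr τ L < ∞ := by
    refine (tr_le_of_tendsto (K := (tr τ (f : H →L[ℂ] H)).toReal) ENNReal.toReal_nonneg ?_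
      hL hLM hL0).trans_lt ENNReal.ofReal_lt_top
    filter_upwards [eventually_gt_atTop 0] with s hs
    rw [ENNReal.ofReal_toReal hft.ne]
    exact ⟨(poisson T s f).2, poisson_nonneg T hs hf, tr_poisson_le T hs hf⟩
  obtain ⟨g, hg⟩ : ∃ g : Elt M, (g : H →L[ℂ] H) = L := ⟨⟨L, hLM⟩, rfl⟩
  have hfix : poisson T 1 g = g := by
    have h1 : Tendsto (fun s => (poisson T (1 + s) f : H →L[ℂ] H)) atTop (𝓝 L) :=
      hL.comp (tendsto_atTop_add_const_left _ 1 tendsto_id)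
    have h2 : Tendsto (fun s => (poisson T (1 + s) f : H →L[ℂ] H)) atTop
        (𝓝 (poisson T 1 g : H →L[ℂ] H)) := by
      rw [tendsto_iff_norm_sub_tendsto_zero] at hL ⊢
      refine squeeze_zero' (Eventually.of_forall fun _ => norm_nonneg _) ?_ hL
      filter_upwards [eventually_gt_atTop 0] with s hs
      rw [← poisson_poisson T one_pos hs]
      have e : poisson T 1 (poisson T s f + (-1 : ℂ) • g)
          = poisson T 1 (poisson T s f) - poisson T 1 g := by
        rw [poisson_linear T one_pos, neg_one_smul, sub_eq_add_neg]
      have h3 := norm_poisson_le T one_pos (poisson T s f + (-1 : ℂ) • g)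
      rw [e, neg_one_smul, ← sub_eq_add_neg] at h3
      rw [← hg]
      exact h3
    exact Subtype.ext ((tendsto_nhds_unique h2 h1).trans hg.symm)
  have hg0 : 0 ≤ (g : H →L[ℂ] H) := by rwa [hg]
  have hgt : tr τ (g : H →L[ℂ] H) < ∞ := by rwa [hg]
  obtain ⟨w, hw⟩ := L2.exists_mulStar_eq g.2 hg0 hgt
  have hwg : w.mulStar.elt = g := Subtype.ext hw
  have hz : ∀ h, 0 < h → diffQuot T.at h g = 0 := fun h hh => by
    rw [diffQuot, at_eq_of_poisson_eq hg0 hgt one_pos hfix hh, sub_self, smul_zero]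
  have hl0 : lpNorm τ 2 (0 : Elt M) = 0 := by
    have := L2.lpNorm_elt (0 : L2 τ)
    rwa [map_zero, norm_zero, ENNReal.ofReal_zero] at this
  have hgz : g = 0 := by
    refine hT g ?_ ⟨?_, ?_⟩ ?_
    · rw [← hwg, L2.lpNorm_elt]
      exact ENNReal.ofReal_lt_top
    · filter_upwards [self_mem_nhdsWithin] with h hh
      rw [hz h hh, hl0]
      exact ENNReal.zero_lt_top
    · refine tendsto_const_nhds.congr' ?_
      have hev : ∀ᶠ h in 𝓝[>] (0 : ℝ), 0 < h := self_mem_nhdsWithin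
      filter_upwards [hev.prod_mk hev] with q hq
      rw [hz _ hq.1, hz _ hq.2, sub_self, hl0]
    · rw [genLpNorm]
      have : (fun s => lpNorm τ 2 (diffQuot T.at s g)) =ᶠ[𝓝[>] (0 : ℝ)] fun _ => 0 := by
        filter_upwards [self_mem_nhdsWithin] with h hh
        rw [hz h hh, hl0]
      rw [limsup_congr this, limsup_const]
  rw [← hg, hgz]
  rfl

end Pairing

/-! ### The Morrey inequality implies ultracontractivity -/

section Decay

/-- The iteration that turns a self-improving estimate for `N` into a decay estimate. In terms of
`u^n N(u)` and `D = (4^n B)^p θ` the hypothesis implies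
`(4u)^n N(4u) ≤ (D (u^n N(u))^{p-1})^{1/p} ≤ max D (u^n N(u))`, and `u^n N(u) → 0` as `u → 0`. -/
theorem le_of_forall_mul_four_le {N : ℝ → ℝ} {n p B θ N₀ : ℝ} (hn : 0 < n) (hp : 1 ≤ p)
    (hB : 0 ≤ B) (hθ : 0 ≤ θ) (hN0 : ∀ u, 0 < u → 0 ≤ N u) (hN₀ : ∀ u, 0 < u → N u ≤ N₀)
    (h : ∀ u, 0 < u → N (4 * u) ≤ B * u ^ (-(n / p)) * (N u ^ (p - 1) * θ) ^ (1 / p)) {s : ℝ}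
    (hs : 0 < s) : N s ≤ (4 ^ n * B) ^ p * s ^ (-n) * θ := by
  have hp0 : 0 < p := one_pos.trans_le hp
  obtain ⟨D, hD⟩ : ∃ D, D = (4 ^ n * B) ^ p * θ := ⟨_, rfl⟩
  have hD0 : 0 ≤ D := by rw [hD]; positivity
  have hstep : ∀ u, 0 < u → (4 * u) ^ n * N (4 * u) ≤ max D (u ^ n * N u) := by
    intro u hu
    obtain ⟨X, hX⟩ : ∃ X, X = max D (u ^ n * N u) := ⟨_, rfl⟩
    have hNu := hN0 u hu
    have hX0 : 0 ≤ X := hX ▸ hD0.trans (le_max_left _ _)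
    have hpow : u ^ n * u ^ (-(n / p)) = ((u ^ n) ^ (p - 1)) ^ (1 / p) := by
      rw [← Real.rpow_add hu, ← Real.rpow_mul hu.le, ← Real.rpow_mul hu.le]
      congr 1
      field_simp
      ring
    have hB' : 4 ^ n * B = ((4 ^ n * B) ^ p) ^ (1 / p) := by
      rw [← Real.rpow_mul (by positivity), mul_one_div_cancel hp0.ne', Real.rpow_one]
    calc (4 * u) ^ n * N (4 * u)
        ≤ (4 * u) ^ n * (B * u ^ (-(n / p)) * (N u ^ (p - 1) * θ) ^ (1 / p)) := by
          gcongr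
          exact h u hu
      _ = (4 ^ n * B) * (u ^ n * u ^ (-(n / p))) * (N u ^ (p - 1) * θ) ^ (1 / p) := by
          rw [Real.mul_rpow (by norm_num) hu.le]
          ring
      _ = (D * (u ^ n * N u) ^ (p - 1)) ^ (1 / p) := by
          rw [hpow, hB', ← Real.mul_rpow (by positivity) (by positivity),
            ← Real.mul_rpow (by positivity) (by positivity), Real.mul_rpow (by positivity) hNu, hD]
          congr 1
          ring
      _ ≤ (X * X ^ (p - 1)) ^ (1 / p) := by
          have h1 : D ≤ X := hX ▸ le_max_left _ _
          have h2 : u ^ n * N u ≤ X := hX ▸ le_max_right _ _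
          have h3 : 0 ≤ p - 1 := by linarith
          gcongr
      _ = X := by
          rcases hX0.eq_or_lt with h0 | h0
          · rw [← h0, zero_mul, Real.zero_rpow (by positivity)]
          · nth_rewrite 1 [← Real.rpow_one X]
            rw [← Real.rpow_add h0, add_sub_cancel, ← Real.rpow_mul hX0,
              mul_one_div_cancel hp0.ne', Real.rpow_one]
      _ = _ := hX
  have hiter : ∀ k : ℕ, s ^ n * N s ≤ max D ((s / 4 ^ k) ^ n * N (s / 4 ^ k)) := by
    intro k
    induction k with
    | zero => simp
    | succ k ih =>
      have h1 := hstep (s / 4 ^ (k + 1)) (by positivity)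
      have e : 4 * (s / 4 ^ (k + 1)) = s / 4 ^ k := by
        rw [pow_succ]
        field_simp
      rw [e] at h1
      exact ih.trans (max_le (le_max_left _ _) h1)
  have hlim : Tendsto (fun k : ℕ => max D ((s / 4 ^ k) ^ n * N₀)) atTop (𝓝 (max D (0 * N₀))) := by
    refine tendsto_const_nhds.max (Tendsto.mul_const _ ?_)
    have h1 : Tendsto (fun k : ℕ => s / (4 : ℝ) ^ k) atTop (𝓝 0) :=
      tendsto_const_nhds.div_atTop (tendsto_pow_atTop_atTop_of_one_lt (by norm_num))
    have h2 := h1.rpow_const (p := n) (Or.inr hn.le)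
    rwa [Real.zero_rpow hn.ne'] at h2
  have hfin : s ^ n * N s ≤ max D (0 * N₀) := by
    refine ge_of_tendsto hlim (Eventually.of_forall fun k => (hiter k).trans ?_)
    have := hN₀ (s / 4 ^ k) (by positivity)
    gcongr
  rw [zero_mul, max_eq_left hD0, hD] at hfin
  have hsn : 0 < s ^ n := by positivity
  rw [Real.rpow_neg hs.le]
  calc N s = (s ^ n)⁻¹ * (s ^ n * N s) := by field_simp
    _ ≤ (s ^ n)⁻¹ * ((4 ^ n * B) ^ p * θ) := by gcongr
    _ = _ := by ring

variable {M : VonNeumannAlgebra H} {τ : NSFTrace M} {T : MarkovSemigroup τ} {n p : ℝ}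

theorem norm_poisson_anti {r s : ℝ} (hr : 0 < r) (hrs : r ≤ s) (f : Elt M) :
    ‖(poisson T s f : H →L[ℂ] H)‖ ≤ ‖(poisson T r f : H →L[ℂ] H)‖ := by
  rcases hrs.eq_or_lt with rfl | hlt
  · exact le_rfl
  · have := poisson_poisson T (sub_pos.2 hlt) hr f
    rw [sub_add_cancel] at this
    rw [← this]
    exact norm_poisson_le T (sub_pos.2 hlt) _

/-- The `L₁ → L_∞` bound of the Poisson semigroup. -/
theorem MorreyInequality.exists_norm_poisson_le (hn : 0 < n) (hp : 1 ≤ p)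
    (hT : MorreyInequality T n p) (hinj : GeneratorInjective T) :
    ∃ C : ℝ, 0 ≤ C ∧ ∀ (s : ℝ) (f : Elt M), 0 < s → 0 ≤ (f : H →L[ℂ] H) →
      tr τ (f : H →L[ℂ] H) < ∞ →
      ‖(poisson T s f : H →L[ℂ] H)‖ ≤ C * s ^ (-n) * (tr τ (f : H →L[ℂ] H)).toReal := by
  obtain ⟨C, hC0, hC⟩ := hT.exists_norm_deriv_le hp
  have hp0 : 0 < p := one_pos.trans_le hp
  have hβ : 0 < n / p := by positivity
  refine ⟨(4 ^ n * (C / (n / p) * 4 ^ (-(n / p)))) ^ p, by positivity, fun s f hs hf hft => ?_⟩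
  obtain ⟨θ, hθ⟩ : ∃ θ, θ = (tr τ (f : H →L[ℂ] H)).toReal := ⟨_, rfl⟩
  have hθ0 : 0 ≤ θ := hθ ▸ ENNReal.toReal_nonneg
  rw [← hθ]
  refine le_of_forall_mul_four_le (N := fun s => ‖(poisson T s f : H →L[ℂ] H)‖) hn hp
    (by positivity) hθ0 (fun _ _ => norm_nonneg _) (fun u hu => norm_poisson_le T hu f) ?_ hs
  intro u hu
  obtain ⟨Y, hY⟩ : ∃ Y, Y = (‖(poisson T u f : H →L[ℂ] H)‖ ^ (p - 1) * θ) ^ (1 / p) := ⟨_, rfl⟩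
  have hY0 : 0 ≤ Y := by rw [hY]; positivity
  obtain ⟨L, hL, hle⟩ := exists_tendsto_of_norm_deriv_le
    (F := fun s => (poisson T s f : H →L[ℂ] H)) (K := C * Y) (β := n / p) (a := 4 * u) hβ
    (by positivity) (by positivity)
    (fun s hs => hasDerivAt_poisson T (lt_of_lt_of_le (by positivity) hs) f) (by
      intro s hs
      have hs0 : 0 < s := lt_of_lt_of_le (by positivity) hs
      rw [← deriv_poisson T hs0]
      refine (hC s f hs0 hf hft).trans ?_
      rw [← hθ]
      have h1 := norm_poisson_anti (T := T) hu (by linarith : u ≤ s / 4) f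
      have h2 : 0 ≤ p - 1 := by linarith
      have h3 : (‖(poisson T (s / 4) f : H →L[ℂ] H)‖ ^ (p - 1) * θ) ^ (1 / p) ≤ Y := by
        rw [hY]
        gcongr
      calc _ ≤ C * s ^ (-(n / p) - 1) * Y := by gcongr
        _ = _ := by ring)
  rw [hinj.eq_zero_of_tendsto hf hft hL, sub_zero] at hle
  rw [← hY]
  refine hle.trans (le_of_eq ?_)
  rw [Real.mul_rpow (by norm_num) hu.le]
  ring

/-- The `L₁ → L₂` bound of the semigroup, from the `L₁ → L_∞` bound of its Poisson semigroup. -/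
theorem exists_norm_l2_le {C : ℝ} (hC0 : 0 ≤ C)
    (hC : ∀ (s : ℝ) (f : Elt M), 0 < s → 0 ≤ (f : H →L[ℂ] H) → tr τ (f : H →L[ℂ] H) < ∞ →
      ‖(poisson T s f : H →L[ℂ] H)‖ ≤ C * s ^ (-n) * (tr τ (f : H →L[ℂ] H)).toReal) :
    ∃ D : ℝ, 0 ≤ D ∧ ∀ (t : ℝ) (w : L2 τ), 0 < t →
      ‖T.l2 t w.mulStar‖ ^ 2 ≤ D * t ^ (-(n / 2)) * (‖w‖ ^ 2) ^ 2 := by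
  obtain ⟨c, hc⟩ : ∃ c, c = Real.exp (-(1 / 2)) / (2 * √Real.pi) := ⟨_, rfl⟩
  have hc0 : 0 < c := by
    have := Real.sqrt_pos.2 Real.pi_pos
    rw [hc]
    positivity
  refine ⟨2 / c * C * 2 ^ (-(n / 2)), by positivity, fun t w ht => ?_⟩
  have ht2 : 0 < 2 * t := by positivity
  have hst : 0 < √(2 * t) := Real.sqrt_pos.2 ht2
  obtain ⟨hint, he⟩ := inner_lmul_poisson (T := T) hst w
  have h1 := congrArg norm he
  rw [Complex.norm_real] at h1
  have hft : tr τ (w.mulStar.elt : H →L[ℂ] H) = ENNReal.ofReal (‖w‖ ^ 2) := w.tr_mulStar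
  have h2 := hC (√(2 * t)) w.mulStar.elt hst w.mulStar_nonneg (hft ▸ ENNReal.ofReal_lt_top)
  rw [hft, ENNReal.toReal_ofReal (by positivity)] at h2
  have h3 := norm_inner_lmul_le (poisson T (√(2 * t)) w.mulStar.elt).2 h2 w w
  rw [h1] at h3
  have hpow : √(2 * t) ^ (-n) = 2 ^ (-(n / 2)) * t ^ (-(n / 2)) := by
    rw [← Real.mul_rpow (by norm_num) ht.le, Real.sqrt_eq_rpow, ← Real.rpow_mul ht2.le]
    congr 1
    ring
  have hX0 : 0 ≤ ‖T.l2 t w.mulStar‖ ^ 2 := by positivity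
  -- only the times between `t` and `2 t` are kept in the subordination formula
  have h4 : c / 2 * ‖T.l2 t w.mulStar‖ ^ 2
      ≤ ∫ v in Ioi (0 : ℝ), subordinator (√(2 * t)) v * ‖T.l2 (v / 2) w.mulStar‖ ^ 2 := by
    have hsub : Ioc t (2 * t) ⊆ Ioi 0 := fun v hv => ht.trans hv.1
    have hnn : ∀ v ∈ Ioi (0 : ℝ),
        0 ≤ subordinator (√(2 * t)) v * ‖T.l2 (v / 2) w.mulStar‖ ^ 2 := fun v hv =>
      mul_nonneg (subordinator_nonneg hst.le (le_of_lt hv)) (sq_nonneg _)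
    refine le_trans ?_ (setIntegral_mono_set hint
      ((ae_restrict_iff' measurableSet_Ioi).2 (ae_of_all _ hnn)) hsub.eventuallyLE)
    have e : c / 2 * ‖T.l2 t w.mulStar‖ ^ 2
        = ∫ v in Ioc t (2 * t), c / (2 * t) * ‖T.l2 t w.mulStar‖ ^ 2 := by
      rw [setIntegral_const, Measure.real, Real.volume_Ioc, ENNReal.toReal_ofReal (by linarith),
        smul_eq_mul]
      field_simp
      ring
    rw [e]
    refine setIntegral_mono_on continuous_const.integrableOn_Ioc (hint.mono_set hsub) measurableSet_Ioc fun v hv => ?_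
    have h5 := subordinator_sqrt_ge ht2 (by linarith [hv.1] : 2 * t / 2 ≤ v) hv.2
    rw [← hc] at h5
    have h6 := T.norm_l2_anti (s := v / 2) (t := t) (by linarith [hv.1]) (by linarith [hv.2])
      w.mulStar
    have h7 := subordinator_nonneg hst.le (ht.trans hv.1).le
    gcongr
  have h5 := h4.trans ((le_abs_self _).trans h3)
  rw [hpow] at h5
  calc ‖T.l2 t w.mulStar‖ ^ 2 = 2 / c * (c / 2 * ‖T.l2 t w.mulStar‖ ^ 2) := by field_simp
    _ ≤ 2 / c * (C * (2 ^ (-(n / 2)) * t ^ (-(n / 2))) * ‖w‖ ^ 2 * (‖w‖ * ‖w‖)) := by gcongr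
    _ = _ := by ring

/-- The operator norm of a positive `y ∈ M` is at most its norm as a form on `M ∩ L₂(M)`. Otherwise
`e = (y - K)₊` is not zero, and the hypothesis fails on `w = e √c`, where `0 ≠ c ≤ e` has finite
trace. -/
theorem norm_le_of_forall_inner_lmul {y : H →L[ℂ] H} (hy : y ∈ M) (hy0 : 0 ≤ y) {K : ℝ}
    (hK : 0 ≤ K) (h : ∀ w : L2 τ, ‖⟪w, L2.lmul hy w⟫_ℂ‖ ≤ K * ‖w‖ ^ 2) : ‖y‖ ≤ K := by
  refine norm_le_of_nonneg_of_le_smul hy0 hK ?_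
  have hysa := hy0.isSelfAdjoint
  have hle := sub_smul_one_le_excess hysa K
  obtain ⟨e, he⟩ : ∃ e, e = excess K y := ⟨_, rfl⟩
  have heM : e ∈ M := he ▸ excess_mem hy K
  have he0 : 0 ≤ e := he ▸ excess_nonneg K y
  have hes : star e = e := he0.isSelfAdjoint.star_eq
  have heye : e * y * e = (K : ℂ) • (e * e) + e * e * e := by
    obtain ⟨g, hg⟩ : ∃ g : ℝ → ℝ, g = fun t => max (t - K) 0 := ⟨_, rfl⟩
    have hc : Continuous g := by rw [hg]; fun_prop
    have h1 : e = cfc g y := by rw [he, excess, hg]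
    have h2 : e * y * e = cfc (fun t => g t * t * g t) y := by
      rw [cfc_mul (fun t => g t * t) g y (by fun_prop) (by fun_prop),
        cfc_mul g (fun t => t) y (by fun_prop) (by fun_prop), cfc_id' ℝ y, h1]
    have h3 : (K : ℂ) • (e * e) + e * e * e = cfc (fun t => K • (g t * g t) + g t * g t * g t) y := by
      rw [cfc_add y (fun t => K • (g t * g t)) (fun t => g t * g t * g t) (by fun_prop)
        (by fun_prop), cfc_smul K (fun t => g t * g t) y (by fun_prop),
        cfc_mul (fun t => g t * g t) g y (by fun_prop) (by fun_prop),
        cfc_mul g g y (by fun_prop) (by fun_prop), Complex.coe_smul, h1]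
    rw [h2, h3, hg]
    refine cfc_congr fun t _ => ?_
    simp only [smul_eq_mul]
    rcases le_total (t - K) 0 with h1 | h1
    · rw [max_eq_right h1]; ring
    · rw [max_eq_left h1]; ring
  suffices hz : e = 0 by
    rw [← he, hz, sub_nonpos] at hle
    exact hle
  by_contra hne
  obtain ⟨c, hc, hc0, hce, hcne, hct⟩ := exists_tr_lt_top_le τ heM he0 hne
  have hss := CFC.sqrt_mul_sqrt_self c hc0
  let w : L2 τ := L2.mk (CFC.sqrt c) (sqrt_mem hc hc0) (by rwa [star_sqrt, hss])
  let x : L2 τ := L2.lmul heM w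
  obtain ⟨r, hr⟩ : ∃ r, r = CFC.sqrt c := ⟨_, rfl⟩
  have hrM : r ∈ M := hr ▸ sqrt_mem hc hc0
  have hrs : star r = r := hr ▸ star_sqrt c
  rw [← hr] at hss
  have hxop : x.op = e * r := by rw [hr]; rfl
  have hx := h x
  rw [(L2.inner_lmul_self hy hy0 x).1, Complex.norm_real, Real.norm_of_nonneg
    ENNReal.toReal_nonneg, L2.norm_sq, hxop, star_mul, hrs, hes] at hx
  have hfin := (L2.inner_lmul_self hy hy0 x).2
  have hfin2 := x.tr_lt_top
  rw [hxop, star_mul, hrs, hes] at hfin hfin2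
  have e1 : r * e * y * (e * r) = (K : ℂ) • (r * e * (e * r)) + r * (e * e * e) * r := by
    rw [show r * e * y * (e * r) = r * (e * y * e) * r by simp only [mul_assoc], heye, mul_add,
      add_mul, mul_smul_comm, smul_mul_assoc]
    simp only [mul_assoc]
  have p1 : 0 ≤ r * e * (e * r) := by
    have := star_mul_self_nonneg (e * r)
    rwa [star_mul, hrs, hes] at this
  have p2 : 0 ≤ e * e * e := by
    have := star_mul_mul_nonneg he0 e
    rwa [hes] at this
  have p3 : 0 ≤ r * (e * e * e) * r := by
    have := star_mul_mul_nonneg p2 r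
    rwa [hrs] at this
  have m1 : r * e * (e * r) ∈ M := mul_mem (mul_mem hrM heM) (mul_mem heM hrM)
  have m3 : r * (e * e * e) * r ∈ M :=
    mul_mem (mul_mem hrM (mul_mem (mul_mem heM heM) heM)) hrM
  rw [e1, tr_add (smul_mem' m1 _) (smul_ofReal_nonneg p1 hK) m3 p3, tr_smul m1 p1 hK] at hx hfin
  have hfin3 := (ENNReal.add_lt_top.1 hfin).2
  rw [ENNReal.toReal_add (ENNReal.add_lt_top.1 hfin).1.ne hfin3.ne, ENNReal.toReal_mul,
    ENNReal.toReal_ofReal hK] at hx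
  have hz : tr τ (r * (e * e * e) * r) = 0 := by
    have h0 : (tr τ (r * (e * e * e) * r)).toReal = 0 :=
      le_antisymm (by linarith) ENNReal.toReal_nonneg
    rcases (ENNReal.toReal_eq_zero_iff _).1 h0 with h1 | h1
    · exact h1
    · exact absurd h1 hfin3.ne
  have hz1 := eq_zero_of_tr_eq_zero m3 p3 hz
  -- `√c e³ √c = 0` gives `e √c = 0`, and then `c = 0`
  have hs := CFC.sqrt_mul_sqrt_self e he0
  have hz2 : CFC.sqrt e * (e * r) = 0 := by
    rw [← CStarRing.star_mul_self_eq_zero_iff, star_mul, star_mul, hrs, hes, star_sqrt]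
    calc r * e * CFC.sqrt e * (CFC.sqrt e * (e * r))
        = r * (e * (CFC.sqrt e * CFC.sqrt e) * e) * r := by simp only [mul_assoc]
      _ = 0 := by rw [hs, hz1]
  have hz3 : e * r = 0 := by
    rw [← CStarRing.star_mul_self_eq_zero_iff, star_mul, hrs, hes]
    calc r * e * (e * r) = r * (CFC.sqrt e * CFC.sqrt e) * (e * r) := by rw [hs]
      _ = r * CFC.sqrt e * (CFC.sqrt e * (e * r)) := by simp only [mul_assoc]
      _ = 0 := by rw [hz2, mul_zero]
  have hec : e * c = 0 := by rw [← hss, ← mul_assoc, hz3, zero_mul]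
  have hcs : star c = c := hc0.isSelfAdjoint.star_eq
  have hccc : c * c * c = 0 := by
    refine le_antisymm ?_ ?_
    · have := star_mul_mul_mono hce c
      rwa [hcs, mul_assoc c e, hec, mul_zero] at this
    · have := star_mul_mul_nonneg hc0 c
      rwa [hcs] at this
  have hrc : r * c = 0 := by
    rw [← CStarRing.star_mul_self_eq_zero_iff, star_mul, hrs, hcs]
    calc c * r * (r * c) = c * (r * r) * c := by simp only [mul_assoc]
      _ = 0 := by rw [hss, hccc]
  refine hcne ((CStarRing.star_mul_self_eq_zero_iff c).1 ?_)
  rw [hcs]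
  nth_rewrite 1 [← hss]
  rw [mul_assoc, hrc, mul_zero]

/-- The `L₁ → L_∞` bound of the semigroup, by duality from the `L₁ → L₂` bound. -/
theorem exists_norm_at_le_tr {D : ℝ} (hD0 : 0 ≤ D)
    (hD : ∀ (t : ℝ) (w : L2 τ), 0 < t →
      ‖T.l2 t w.mulStar‖ ^ 2 ≤ D * t ^ (-(n / 2)) * (‖w‖ ^ 2) ^ 2) :
    ∃ C : ℝ, 0 ≤ C ∧ ∀ (t : ℝ) (f : Elt M), 0 < t → 0 ≤ (f : H →L[ℂ] H) →
      tr τ (f : H →L[ℂ] H) < ∞ →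
      ‖(T.at t f : H →L[ℂ] H)‖ ≤ C * t ^ (-(n / 2)) * (tr τ (f : H →L[ℂ] H)).toReal := by
  refine ⟨D * (1 / 2) ^ (-(n / 2)), by positivity, fun t f ht hf hft => ?_⟩
  obtain ⟨w, hw⟩ := L2.exists_mulStar_eq f.2 hf hft
  have hwf : w.mulStar.elt = f := Subtype.ext hw
  have htr : (tr τ (f : H →L[ℂ] H)).toReal = ‖w‖ ^ 2 := by
    rw [← hw, w.tr_mulStar, ENNReal.toReal_ofReal (by positivity)]
  have ht2 := half_pos ht
  rw [htr]
  refine norm_le_of_forall_inner_lmul (τ := τ) (T.at t f).2 ((T.markovian _).nonneg hf)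
    (by positivity) fun w' => ?_
  have hsq : ∀ w : L2 τ,
      ‖T.l2 (t / 2) w.mulStar‖ ≤ √(D * (t / 2) ^ (-(n / 2))) * ‖w‖ ^ 2 := by
    intro w
    have h1 : 0 ≤ D * (t / 2) ^ (-(n / 2)) := by positivity
    refine le_of_sq_le_sq ?_ (by positivity)
    rw [mul_pow, Real.sq_sqrt h1]
    exact hD _ w ht2
  have e : ⟪w', L2.lmul (T.at t f).2 w'⟫_ℂ
      = ⟪T.l2 (t / 2) w'.mulStar, T.l2 (t / 2) w.mulStar⟫_ℂ := by
    rw [← T.inner_l2_add ht2.le ht2.le, add_halves, ← inner_lmul_at]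
    congr 2
    simp only [hwf]
  rw [e]
  have h1 : 0 ≤ D * (t / 2) ^ (-(n / 2)) := by positivity
  calc _ ≤ ‖T.l2 (t / 2) w'.mulStar‖ * ‖T.l2 (t / 2) w.mulStar‖ := norm_inner_le_norm _ _
    _ ≤ (√(D * (t / 2) ^ (-(n / 2))) * ‖w'‖ ^ 2) * (√(D * (t / 2) ^ (-(n / 2))) * ‖w‖ ^ 2) := by
        have := hsq w
        have := hsq w'
        gcongr
    _ = √(D * (t / 2) ^ (-(n / 2))) * √(D * (t / 2) ^ (-(n / 2))) * (‖w'‖ ^ 2 * ‖w‖ ^ 2) := by ring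
    _ = D * (t / 2) ^ (-(n / 2)) * (‖w'‖ ^ 2 * ‖w‖ ^ 2) := by rw [Real.mul_self_sqrt h1]
    _ = _ := by
        rw [div_eq_mul_one_div t 2, Real.mul_rpow ht.le (by norm_num)]
        ring

end Decay

/-! ### Interpolation between `L₁` and `L_∞` -/

section Interpolation

variable {M : VonNeumannAlgebra H} {τ : NSFTrace M} {T : MarkovSemigroup τ} {n p q : ℝ}

/-- Young's inequality with non-optimal constants. -/
theorem le_smul_one_add_smul_pw (hp : 1 ≤ p) {f : H →L[ℂ] H} (hf : 0 ≤ f) {lam : ℝ}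
    (hl : 0 < lam) : f ≤ (lam : ℂ) • 1 + ((lam ^ (1 - p) : ℝ) : ℂ) • pw p f := by
  have hc0 := continuous_max_rpow (show 0 ≤ p by linarith)
  have hc : Continuous fun t : ℝ => lam ^ (1 - p) • (max t 0 ^ p) := continuous_const.mul hc0
  have hsa := hf.isSelfAdjoint
  have h1 : f = cfc (fun t : ℝ => t) f := (cfc_id' ℝ f).symm
  have h2 : (lam : ℂ) • 1 + ((lam ^ (1 - p) : ℝ) : ℂ) • pw p f
      = cfc (fun t : ℝ => lam + lam ^ (1 - p) • (max t 0 ^ p)) f := by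
    rw [cfc_const_add lam (fun t : ℝ => lam ^ (1 - p) • (max t 0 ^ p)) f hc.continuousOn hsa,
      cfc_smul _ _ f hc0.continuousOn, Complex.coe_smul, Complex.coe_smul,
      Algebra.algebraMap_eq_smul_one, pw]
  rw [h2]
  conv_lhs => rw [h1]
  refine cfc_mono (fun t ht => ?_) continuousOn_id (continuous_const.add hc).continuousOn
  have ht0 : 0 ≤ t := spectrum_nonneg hf ht
  rw [max_eq_left ht0, smul_eq_mul]
  rcases le_total t lam with h | h
  · have : 0 ≤ lam ^ (1 - p) * t ^ p := by positivity
    linarith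
  · have ht1 : 0 < t := hl.trans_le h
    have h3 : t ^ (1 - p) ≤ lam ^ (1 - p) := Real.rpow_le_rpow_of_nonpos hl h (by linarith)
    have h4 : t = t ^ (1 - p) * t ^ p := by
      rw [← Real.rpow_add ht1, sub_add_cancel, Real.rpow_one]
    have h5 : t ^ (1 - p) * t ^ p ≤ lam ^ (1 - p) * t ^ p := by gcongr
    linarith

/-- The `L_p → L_∞` bound on the positive cone, from the `L₁ → L_∞` bound. -/
theorem norm_at_le_of_tr_pw_le (hp : 1 ≤ p) {C : ℝ} (hC0 : 0 ≤ C)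
    (hC : ∀ (t : ℝ) (f : Elt M), 0 < t → 0 ≤ (f : H →L[ℂ] H) → tr τ (f : H →L[ℂ] H) < ∞ →
      ‖(T.at t f : H →L[ℂ] H)‖ ≤ C * t ^ (-(n / 2)) * (tr τ (f : H →L[ℂ] H)).toReal)
    {t : ℝ} (ht : 0 < t) {f : Elt M} (hf : 0 ≤ (f : H →L[ℂ] H)) {m : ℝ} (hm : 0 ≤ m)
    (hfm : tr τ (pw p (f : H →L[ℂ] H)) ≤ ENNReal.ofReal m) :
    ‖(T.at t f : H →L[ℂ] H)‖ ≤ 2 * (C * t ^ (-(n / 2)) * m) ^ (1 / p) := by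
  have hp0 : 0 < p := one_pos.trans_le hp
  obtain ⟨R, hR⟩ : ∃ R, R = C * t ^ (-(n / 2)) * m := ⟨_, rfl⟩
  have hR0 : 0 ≤ R := by rw [hR]; positivity
  obtain ⟨b, hb⟩ : ∃ b : Elt M, (b : H →L[ℂ] H) = pw p (f : H →L[ℂ] H) :=
    ⟨⟨_, pw_mem f.2 p⟩, rfl⟩
  have hb0 : 0 ≤ (b : H →L[ℂ] H) := hb ▸ pw_nonneg p _
  have hbt : ‖(T.at t b : H →L[ℂ] H)‖ ≤ R := by
    refine (hC t b ht hb0 (by rw [hb]; exact hfm.trans_lt ENNReal.ofReal_lt_top)).trans ?_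
    rw [hR, hb]
    have := ENNReal.toReal_le_of_le_ofReal hm hfm
    gcongr
  have key : ∀ lam, R ^ (1 / p) < lam → ‖(T.at t f : H →L[ℂ] H)‖ ≤ 2 * lam := by
    intro lam hlam
    have hl : 0 < lam := (by positivity : 0 ≤ R ^ (1 / p)).trans_lt hlam
    have h1 : (T.at t f : H →L[ℂ] H)
        ≤ (lam : ℂ) • 1 + ((lam ^ (1 - p) : ℝ) : ℂ) • (T.at t b : H →L[ℂ] H) := by
      have h2 := (T.markovian t.toNNReal).mono (f := f)
        (g := (lam : ℂ) • 1 + ((lam ^ (1 - p) : ℝ) : ℂ) • b) (by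
          have := le_smul_one_add_smul_pw hp hf hl
          rw [← hb] at this
          exact this)
      rw [map_add, map_smul, map_smul, (T.markovian t.toNNReal).map_one] at h2
      exact h2
    have h3 := CStarAlgebra.norm_le_norm_of_nonneg_of_le ((T.markovian t.toNNReal).nonneg hf) h1
    refine h3.trans ((norm_add_le _ _).trans ?_)
    rw [norm_smul, norm_smul, Complex.norm_real, Complex.norm_real, Real.norm_of_nonneg hl.le,
      Real.norm_of_nonneg (by positivity)]
    have h4 : ‖(1 : H →L[ℂ] H)‖ ≤ 1 := ContinuousLinearMap.norm_id_le
    have h5 : R ≤ lam ^ p := by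
      have h6 : (R ^ (1 / p)) ^ p ≤ lam ^ p := by gcongr
      rwa [← Real.rpow_mul hR0, one_div_mul_cancel hp0.ne', Real.rpow_one] at h6
    calc lam * ‖(1 : H →L[ℂ] H)‖ + lam ^ (1 - p) * ‖(T.at t b : H →L[ℂ] H)‖
        ≤ lam * 1 + lam ^ (1 - p) * lam ^ p := by
          have := hbt.trans h5
          gcongr
      _ = 2 * lam := by
          rw [← Real.rpow_add hl, sub_add_cancel, Real.rpow_one]
          ring
  rw [← hR]
  have hlim : Tendsto (fun c : ℝ => 2 * c) (𝓝[>] (R ^ (1 / p))) (𝓝 (2 * R ^ (1 / p))) :=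
    (tendsto_const_nhds.mul tendsto_id).mono_left nhdsWithin_le_nhds
  refine ge_of_tendsto hlim ?_
  filter_upwards [self_mem_nhdsWithin] with c hc using key c hc

theorem moment_sub_add_I_smul_sub_le {r : ℝ} (hr : 0 < r) {a : Fin 4 → H →L[ℂ] H}
    (ha : ∀ i, a i ∈ M) {G : ℝ≥0∞} (hG : ∀ i, moment τ r (a i) ≤ G) :
    moment τ r ((a 0 - a 1) + Complex.I • (a 2 - a 3)) ≤ 4 * momentConst r ^ 2 * G := by
  have hsub : ∀ i j, moment τ r (a i - a j) ≤ momentConst r * (G + G) := by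
    intro i j
    have h1 := moment_add_le (τ := τ) hr (ha i) (smul_mem' (ha j) (-1))
    rw [moment_smul hr _ (ha j), norm_neg, norm_one, Real.one_rpow, ENNReal.ofReal_one, one_mul,
      neg_one_smul, ← sub_eq_add_neg] at h1
    refine h1.trans ?_
    gcongr
    · exact hG i
    · exact hG j
  have hd : a 2 - a 3 ∈ M := sub_mem (ha 2) (ha 3)
  have h2 := moment_add_le (τ := τ) hr (sub_mem (ha 0) (ha 1)) (smul_mem' hd Complex.I)
  rw [moment_smul hr _ hd, Complex.norm_I, Real.one_rpow, ENNReal.ofReal_one, one_mul] at h2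
  calc _ ≤ (momentConst r : ℝ≥0∞) * (momentConst r * (G + G) + momentConst r * (G + G)) := by
        refine h2.trans ?_
        gcongr
        · exact hsub 0 1
        · exact hsub 2 3
    _ = _ := by ring

theorem norm_sub_add_I_smul_sub_le {a : Fin 4 → H →L[ℂ] H} {K : ℝ} (hK : ∀ i, ‖a i‖ ≤ K) :
    ‖(a 0 - a 1) + Complex.I • (a 2 - a 3)‖ ≤ 4 * K := by
  refine (norm_add_le _ _).trans ?_
  rw [norm_smul, Complex.norm_I, one_mul]
  have h1 := norm_sub_le (a 0) (a 1)
  have h2 := norm_sub_le (a 2) (a 3)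
  linarith [hK 0, hK 1, hK 2, hK 3]

/-- Reduction of bounds on `T_t` to the positive cone. -/
theorem exists_decomposition_at (hp : 1 ≤ p) {C : ℝ} (hC0 : 0 ≤ C)
    (hC : ∀ (t : ℝ) (f : Elt M), 0 < t → 0 ≤ (f : H →L[ℂ] H) → tr τ (f : H →L[ℂ] H) < ∞ →
      ‖(T.at t f : H →L[ℂ] H)‖ ≤ C * t ^ (-(n / 2)) * (tr τ (f : H →L[ℂ] H)).toReal) :
    ∃ K : ℝ, 0 ≤ K ∧ ∀ (t : ℝ) (x : Elt M), 0 < t → lpNorm τ (ENNReal.ofReal p) x ≤ 1 →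
      ∃ b : Fin 4 → H →L[ℂ] H, (∀ i, b i ∈ M) ∧ (∀ i, 0 ≤ b i) ∧
        (T.at t x : H →L[ℂ] H) = (b 0 - b 1) + Complex.I • (b 2 - b 3) ∧
        (∀ i, ‖b i‖ ≤ K * t ^ (-(n / (2 * p)))) ∧ ∀ i, moment τ p (b i) ≤ ENNReal.ofReal K := by
  have hp0 : 0 < p := one_pos.trans_le hp
  obtain ⟨m, hm⟩ : ∃ m : ℝ, m = 2 * momentConst p := ⟨_, rfl⟩
  have hm0 : 0 ≤ m := by rw [hm]; positivity
  have hm' : ENNReal.ofReal m = 2 * momentConst p := by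
    rw [hm, ENNReal.ofReal_mul (by norm_num), ENNReal.ofReal_ofNat, ENNReal.ofReal_coe_nnreal]
  obtain ⟨d, hd⟩ : ∃ d : ℝ≥0, (d : ℝ≥0∞) = (2 * dyadicConst p + 1) * ENNReal.ofReal m :=
    ⟨((2 * dyadicConst p + 1) * ENNReal.ofReal m).toNNReal, ENNReal.coe_toNNReal (by finiteness)⟩
  refine ⟨max (2 * (C * m) ^ (1 / p)) d, le_max_of_le_right d.2, fun t x ht hx => ?_⟩
  have hx1 : moment τ p (x : H →L[ℂ] H) ≤ 1 := by
    rw [lpNorm_ofReal hp0] at hx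
    have := ENNReal.rpow_le_rpow hx hp0.le
    rwa [← ENNReal.rpow_mul, one_div_mul_cancel hp0.ne', ENNReal.rpow_one, ENNReal.one_rpow] at this
  obtain ⟨a, haM, ha0, hxa, hat⟩ := exists_decomposition (τ := τ) hp0 x.2
  have hat' : ∀ i, tr τ (pw p (a i)) ≤ ENNReal.ofReal m := fun i => by
    refine (hat i).trans ?_
    rw [hm']
    exact mul_le_of_le_one_right' hx1
  let f : Fin 4 → Elt M := fun i => ⟨a i, haM i⟩
  have hxf : x = (f 0 - f 1) + Complex.I • (f 2 - f 3) := Subtype.ext hxa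
  refine ⟨fun i => (T.at t (f i) : H →L[ℂ] H), fun i => (T.at t (f i)).2,
    fun i => (T.markovian _).nonneg (ha0 i), ?_, fun i => ?_, fun i => ?_⟩
  · rw [hxf]
    simp only [MarkovSemigroup.at, map_add, map_sub, map_smul]
    rfl
  · refine (norm_at_le_of_tr_pw_le hp hC0 hC ht (ha0 i) hm0 (hat' i)).trans ?_
    have e : (C * t ^ (-(n / 2)) * m) ^ (1 / p) = (C * m) ^ (1 / p) * t ^ (-(n / (2 * p))) := by
      rw [show C * t ^ (-(n / 2)) * m = C * m * t ^ (-(n / 2)) by ring,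
        Real.mul_rpow (by positivity) (by positivity), ← Real.rpow_mul ht.le]
      congr 2
      field_simp
    rw [e, ← mul_assoc]
    gcongr
    exact le_max_left _ _
  · change moment τ p (T.at t (f i) : H →L[ℂ] H) ≤ _
    rw [T.at_eq, moment_of_nonneg ((T.markovian t.toNNReal).nonneg (f := f i) (ha0 i)) hp0]
    refine ((T.markovian t.toNNReal).tr_pw_le hp (ha0 i)).trans ?_
    calc _ ≤ (2 * dyadicConst p + 1) * ENNReal.ofReal m := by
          gcongr
          exact hat' i
      _ = ENNReal.ofReal d := by rw [← hd, ENNReal.ofReal_coe_nnreal]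
      _ ≤ _ := ENNReal.ofReal_le_ofReal (le_max_right _ _)

theorem ultracontractive_of_norm_at_le {C : ℝ} (hC0 : 0 ≤ C)
    (hC : ∀ (t : ℝ) (f : Elt M), 0 < t → 0 ≤ (f : H →L[ℂ] H) → tr τ (f : H →L[ℂ] H) < ∞ →
      ‖(T.at t f : H →L[ℂ] H)‖ ≤ C * t ^ (-(n / 2)) * (tr τ (f : H →L[ℂ] H)).toReal) :
    Ultracontractive T n := by
  intro P Q hP hPQ
  obtain ⟨p, hp0', rfl⟩ : ∃ p : ℝ, 0 ≤ p ∧ P = ENNReal.ofReal p :=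
    ⟨P.toReal, ENNReal.toReal_nonneg, (ENNReal.ofReal_toReal hPQ.ne_top).symm⟩
  have hp : 1 ≤ p := by
    rwa [ENNReal.one_le_ofReal] at hP
  have hp0 : 0 < p := one_pos.trans_le hp
  obtain ⟨K, hK0, hK⟩ := exists_decomposition_at hp hC0 hC
  have hpi : (ENNReal.ofReal p)⁻¹.toReal = 1 / p := by
    rw [ENNReal.toReal_inv, ENNReal.toReal_ofReal hp0', one_div]
  rcases eq_or_ne Q ∞ with rfl | hQ
  · refine ⟨Real.toNNReal (4 * K), fun t ht => iSup₂_le fun x hx => ?_⟩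
    obtain ⟨b, -, -, hxb, hbn, -⟩ := hK t x ht hx
    have h1 := norm_sub_add_I_smul_sub_le hbn
    rw [← hxb] at h1
    rw [lpNorm_top, ← ofReal_norm]
    change _ ≤ ENNReal.ofReal _ * _
    rw [← ENNReal.ofReal_mul (by positivity)]
    refine ENNReal.ofReal_le_ofReal (h1.trans (le_of_eq ?_))
    rw [hpi, ENNReal.inv_top, ENNReal.toReal_zero, sub_zero, ← mul_assoc,
      show n / 2 * (1 / p) = n / (2 * p) by field_simp]
  · obtain ⟨q, hq0', rfl⟩ : ∃ q : ℝ, 0 ≤ q ∧ Q = ENNReal.ofReal q :=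
      ⟨Q.toReal, ENNReal.toReal_nonneg, (ENNReal.ofReal_toReal hQ).symm⟩
    have hpq : p < q := (ENNReal.ofReal_lt_ofReal_iff_of_nonneg hp0').1 hPQ
    have hq0 : 0 < q := hp0.trans hpq
    have hqi : (ENNReal.ofReal q)⁻¹.toReal = 1 / q := by
      rw [ENNReal.toReal_inv, ENNReal.toReal_ofReal hq0', one_div]
    obtain ⟨c, hc⟩ : ∃ c : ℝ, c = 4 * momentConst q ^ 2 * (K ^ (q - p) * K) := ⟨_, rfl⟩
    have hc0 : 0 ≤ c := by rw [hc]; positivity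
    refine ⟨Real.toNNReal (c ^ (1 / q)), fun t ht => iSup₂_le fun x hx => ?_⟩
    obtain ⟨b, hbM, hb0, hxb, hbn, hbm⟩ := hK t x ht hx
    have hG : ∀ i, moment τ q (b i)
        ≤ ENNReal.ofReal ((K * t ^ (-(n / (2 * p)))) ^ (q - p) * K) := fun i => by
      refine (moment_le_norm_rpow_mul hp0 hpq.le (hbM i) (hb0 i).isSelfAdjoint (hbn i)).trans ?_
      rw [ENNReal.ofReal_mul (by positivity)]
      gcongr
      exact hbm i
    have h1 := moment_sub_add_I_smul_sub_le hq0 hbM hG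
    rw [← hxb] at h1
    have e1 : 4 * (momentConst q : ℝ≥0∞) ^ 2
        * ENNReal.ofReal ((K * t ^ (-(n / (2 * p)))) ^ (q - p) * K)
        = ENNReal.ofReal (c * (t ^ (-(n / (2 * p)))) ^ (q - p)) := by
      rw [Real.mul_rpow hK0 (by positivity), hc,
        show 4 * (momentConst q : ℝ) ^ 2 * (K ^ (q - p) * K) * (t ^ (-(n / (2 * p)))) ^ (q - p)
          = 4 * (momentConst q : ℝ) ^ 2 * (K ^ (q - p) * (t ^ (-(n / (2 * p)))) ^ (q - p) * K) by
            ring,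
        ENNReal.ofReal_mul (p := 4 * (momentConst q : ℝ) ^ 2) (by positivity),
        ENNReal.ofReal_mul (p := 4) (by norm_num), ENNReal.ofReal_pow (by positivity),
        ENNReal.ofReal_coe_nnreal, ENNReal.ofReal_ofNat]
    rw [e1] at h1
    rw [lpNorm_ofReal hq0]
    change _ ≤ ENNReal.ofReal _ * _
    rw [← ENNReal.ofReal_mul (by positivity)]
    refine (ENNReal.rpow_le_rpow h1 (by positivity)).trans (le_of_eq ?_)
    rw [ENNReal.ofReal_rpow_of_nonneg (by positivity) (by positivity),
      Real.mul_rpow hc0 (by positivity), ← Real.rpow_mul ht.le, ← Real.rpow_mul ht.le, hpi, hqi]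
    congr 3
    field_simp

theorem MorreyInequality.ultracontractive (hn : 0 < n) (hp : 1 ≤ p)
    (hT : MorreyInequality T n p) (hinj : GeneratorInjective T) : Ultracontractive T n := by
  obtain ⟨C, hC0, hC⟩ := hT.exists_norm_poisson_le hn hp hinj
  obtain ⟨D, hD0, hD⟩ := exists_norm_l2_le hC0 hC
  obtain ⟨B, hB0, hB⟩ := exists_norm_at_le_tr hD0 hD
  exact ultracontractive_of_norm_at_le hB0 hB

end Interpolation

end MarkovMorrey

end

theorem theoremB {H : Type*} [NormedAddCommGroup H] [InnerProductSpace ℂ H] [CompleteSpace H]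
    (M : VonNeumannAlgebra H) (τ : MarkovMorrey.NSFTrace M) (T : MarkovMorrey.MarkovSemigroup τ)
    (n : ℝ) (hn : 0 < n) :
    MarkovMorrey.Ultracontractive T n ↔
      MarkovMorrey.GeneratorInjective T ∧
        ∃ p : ℝ, 1 ≤ p ∧ n < p ∧ MarkovMorrey.MorreyInequality T n p := by
  refine ⟨fun h => ⟨h.generatorInjective hn, n + 1, by linarith, by linarith,
    h.morreyInequality hn (by linarith)⟩, ?_⟩
  rintro ⟨hinj, p, hp, -, hT⟩
  exact hT.ultracontractive hn hp hinj
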